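/- Let $(M^{n+1},g)$ be a complete oriented smooth Riemannian manifold, let $f\colon M\to\mathbb R$ be smooth, and let $\mathrm{Ric}_f=\mathrm{Ric}+\nabla^2 f$ be the Bakry–Émery Ricci curvature. Let $\Sigma^n$ be a connected, oriented, noncompact smooth hypersurface of $M$, (isometrically) immersed by $\varphi\colon\Sigma\to M$ and complete in the induced metric. For a smooth variation $\varphi_t\colon\Sigma\to M$, $|t|<\varepsilon$, with $\varphi_0=\varphi$ and $\varphi_t=\varphi$ outside a compact set $K$, consider the weighted area $A(t)=\int_K e^{-f\circ\varphi_t}\,d\mathrm{vol}_{\varphi_t^*g}$. Suppose that $\Sigma$ is stable $f$-minimal, that is, $A'(0)=0$ for every such variation, and $A''(0)\ge 0$ for every such variation whose variational vector field $\partial_t\varphi_t|_{t=0}$ is normal to $\Sigma$. Suppose moreover that $\mathrm{Ric}_f(v,v)\ge 0$ for every $x\in\Sigma$ and every $v\in T_{\varphi(x)}M$, and that there are a point $p\in\Sigma$ and constants $C,r_0$ such that $$V_{\Sigma,f}(B_p(r))=\int_{B_p(r)}e^{-f}\,d\mathrm{vol}_\Sigma\le C r^2\qquad\text{for all } r\ge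 r_0,$$ where $B_p(r)$ is the ball of radius $r$ about $p$ for the intrinsic distance of $\Sigma$. Then $\Sigma$ is totally geodesic (its second fundamental form vanishes identically), and $\mathrm{Ric}_f(\mathbf n,\mathbf n)=0$ for every unit normal vector $\mathbf n$ at every point of $\Sigma$. -/

import Mathlib

open Set Filter Topology MeasureTheory Bundle
open scoped Manifold ContDiff ENNReal Bundle

noncomputable section

namespace WeightedHypersurface

/-! ### Local coordinates on an `m`-dimensional manifold without boundary -/

section Coordinates

variable {m : ℕ} {M : Type*} [TopologicalSpace M] [ChartedSpace (EuclideanSpace ℝ (Fin m)) M]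

/-- The partial derivative `∂ᵢ u` of a function of `m` real variables. -/
def partialDeriv (i : Fin m) (u : EuclideanSpace ℝ (Fin m) → ℝ)
    (y : EuclideanSpace ℝ (Fin m)) : ℝ :=
  fderiv ℝ u y (EuclideanSpace.single i 1)

/-- The coordinate vector `∂/∂yⁱ` of the chart at `p`, at the point with coordinates `y`. -/
def coordVector (p : M) (y : EuclideanSpace ℝ (Fin m)) (i : Fin m) :
    TangentSpace (𝓡 m) ((chartAt (EuclideanSpace ℝ (Fin m)) p).symm y) :=
  mfderiv (𝓡 m) (𝓡 m) (chartAt (EuclideanSpace ℝ (Fin m)) p).symm y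
    (EuclideanSpace.single i (1 : ℝ) : EuclideanSpace ℝ (Fin m))

/-- The components of a tangent vector at `x` in the chart at `x`. -/
def tangentCoord (x : M) (v : TangentSpace (𝓡 m) x) : EuclideanSpace ℝ (Fin m) :=
  mfderiv (𝓡 m) (𝓡 m) (chartAt (EuclideanSpace ℝ (Fin m)) x) x v

/-- The components `hᵢⱼ(y) = h(∂/∂yⁱ, ∂/∂yʲ)` of a covariant 2-tensor in the chart at `p`. -/
def tensorCoeff (h : ∀ x : M, TangentSpace (𝓡 m) x → TangentSpace (𝓡 m) x → ℝ) (p : M)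
    (y : EuclideanSpace ℝ (Fin m)) : Matrix (Fin m) (Fin m) ℝ :=
  Matrix.of fun i j => h _ (coordVector p y i) (coordVector p y j)

/-- In the chart at `p`, the measure `√(det hᵢⱼ) dy¹ ⋯ dyᵐ`, as a measure on `M` carried by the
domain of this chart. -/
def chartVolume [MeasurableSpace M]
    (h : ∀ x : M, TangentSpace (𝓡 m) x → TangentSpace (𝓡 m) x → ℝ) (p : M) : Measure M :=
  (((volume : Measure (EuclideanSpace ℝ (Fin m))).restrict
      (chartAt (EuclideanSpace ℝ (Fin m)) p).target).withDensity
        fun y => ENNReal.ofReal (Real.sqrt (tensorCoeff h p y).det)).map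
    (chartAt (EuclideanSpace ℝ (Fin m)) p).symm

/-- The volume measure `dvol_h` of a smooth field `h` of positive semidefinite symmetric bilinear
forms on the tangent spaces. By the change of variables formula the measures `chartVolume h p`
agree on the overlaps of their chart domains, and `dvol_h` is the measure on `M` glued from
them; this is their least upper bound in the lattice of measures. -/
def tensorVolume [MeasurableSpace M]
    (h : ∀ x : M, TangentSpace (𝓡 m) x → TangentSpace (𝓡 m) x → ℝ) : Measure M :=
  ⨆ p : M, chartVolume h p

/-- Orientability: `M` has a smooth atlas all of whose coordinate changes have positive
Jacobian determinant. -/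
def IsOrientable (m : ℕ) (M : Type*) [TopologicalSpace M]
    [ChartedSpace (EuclideanSpace ℝ (Fin m)) M] : Prop :=
  ∃ A ⊆ IsManifold.maximalAtlas (𝓡 m) ∞ M,
    (∀ x : M, ∃ e ∈ A, x ∈ e.source) ∧
    ∀ e ∈ A, ∀ e' ∈ A, ∀ y ∈ (e.symm.trans e').source,
      0 < (fderiv ℝ (e.symm.trans e') y).det

end Coordinates

/-! ### Levi-Civita connection, Ricci curvature and Bakry-Émery Ricci curvature -/

section Riemannian

variable {m : ℕ} {M : Type*} [TopologicalSpace M] [ChartedSpace (EuclideanSpace ℝ (Fin m)) M]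
  [RiemannianBundle (fun x : M => TangentSpace (𝓡 m) x)]

/-- The Riemannian metric as a covariant 2-tensor. -/
def metricTensor (x : M) (v w : TangentSpace (𝓡 m) x) : ℝ := inner ℝ v w

/-- The metric coefficients `gᵢⱼ` in the chart at `p`. -/
def metricCoeff (p : M) (y : EuclideanSpace ℝ (Fin m)) : Matrix (Fin m) (Fin m) ℝ :=
  tensorCoeff metricTensor p y

/-- The Christoffel symbol `Γᵏᵢⱼ` of the Levi-Civita connection in the chart at `p`. -/
def christoffel (p : M) (k i j : Fin m) (y : EuclideanSpace ℝ (Fin m)) : ℝ :=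
  (1 / 2 : ℝ) * ∑ l, (metricCoeff p y)⁻¹ k l *
    (partialDeriv i (fun z => metricCoeff p z j l) y
      + partialDeriv j (fun z => metricCoeff p z i l) y
      - partialDeriv l (fun z => metricCoeff p z i j) y)

/-- The coefficients of the Ricci tensor,
`Ricⱼₖ = ∂ᵢ Γⁱⱼₖ - ∂ⱼ Γⁱᵢₖ + Γⁱᵢₗ Γˡⱼₖ - Γⁱⱼₗ Γˡᵢₖ`, in the chart at `p`. -/
def ricciCoeff (p : M) (j k : Fin m) (y : EuclideanSpace ℝ (Fin m)) : ℝ :=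
  ∑ i, (partialDeriv i (christoffel p i j k) y - partialDeriv j (christoffel p i i k) y
    + ∑ l, (christoffel p i i l y * christoffel p l j k y
      - christoffel p i j l y * christoffel p l i k y))

/-- The coefficients of the Hessian, `∂ᵢ ∂ⱼ f - Γᵏᵢⱼ ∂ₖ f`, in the chart at `p`. -/
def hessianCoeff (f : M → ℝ) (p : M) (i j : Fin m) (y : EuclideanSpace ℝ (Fin m)) : ℝ :=
  partialDeriv i
      (partialDeriv j (f ∘ (chartAt (EuclideanSpace ℝ (Fin m)) p).symm)) y
    - ∑ k, christoffel p k i j y *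
      partialDeriv k (f ∘ (chartAt (EuclideanSpace ℝ (Fin m)) p).symm) y

/-- The Ricci tensor. -/
def ricci (x : M) (v w : TangentSpace (𝓡 m) x) : ℝ :=
  ∑ i, ∑ j, ricciCoeff x i j (chartAt (EuclideanSpace ℝ (Fin m)) x x) *
    tangentCoord x v i * tangentCoord x w j

/-- The Hessian `∇²f` of a function. -/
def hessian (f : M → ℝ) (x : M) (v w : TangentSpace (𝓡 m) x) : ℝ :=
  ∑ i, ∑ j, hessianCoeff f x i j (chartAt (EuclideanSpace ℝ (Fin m)) x x) *
    tangentCoord x v i * tangentCoord x w j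

/-- The Bakry-Émery Ricci curvature `Ric_f = Ric + ∇²f`. -/
def bakryEmeryRicci (f : M → ℝ) (x : M) (v w : TangentSpace (𝓡 m) x) : ℝ :=
  ricci x v w + hessian f x v w

end Riemannian

/-! ### Immersed submanifolds and their weighted area -/

section Submanifold

variable {n m : ℕ}
  {S : Type*} [TopologicalSpace S] [ChartedSpace (EuclideanSpace ℝ (Fin n)) S]
  {M : Type*} [TopologicalSpace M] [ChartedSpace (EuclideanSpace ℝ (Fin m)) M]
  [RiemannianBundle (fun x : M => TangentSpace (𝓡 m) x)]

/-- The pull-back `φ^* g` of the Riemannian metric `g` of `M`. -/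
def pullbackMetric (φ : S → M) (x : S) (v w : TangentSpace (𝓡 n) x) : ℝ :=
  inner ℝ (mfderiv (𝓡 n) (𝓡 m) φ x v) (mfderiv (𝓡 n) (𝓡 m) φ x w)

/-- A smooth isometric immersion. -/
structure IsIsometricImmersion [RiemannianBundle (fun x : S => TangentSpace (𝓡 n) x)]
    (φ : S → M) : Prop where
  smooth : ContMDiff (𝓡 n) (𝓡 m) ∞ φ
  isometric : ∀ (x : S) (v w : TangentSpace (𝓡 n) x), pullbackMetric (m := m) φ x v w = metricTensor x v w

/-- `ν` is normal to the immersed submanifold `φ` at `x`. -/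
def IsNormal (φ : S → M) (x : S) (ν : TangentSpace (𝓡 m) (φ x)) : Prop :=
  ∀ v : TangentSpace (𝓡 n) x, inner ℝ (mfderiv (𝓡 n) (𝓡 m) φ x v) ν = 0

/-- The `a`-th component of `φ` in the charts at `x` and at `φ x`. -/
def localCoord (φ : S → M) (x : S) (a : Fin m) (y : EuclideanSpace ℝ (Fin n)) : ℝ :=
  chartAt (EuclideanSpace ℝ (Fin m)) (φ x)
    (φ ((chartAt (EuclideanSpace ℝ (Fin n)) x).symm y)) a

/-- The `a`-th component of the ambient covariant derivative `∇_{∂ᵢ} ∂ⱼ` along `φ` at `x`,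
where `∂ᵢ`, `∂ⱼ` are (the images under `dφ` of) the coordinate vector fields of the chart
at `x`. -/
def ambientDeriv (φ : S → M) (x : S) (i j : Fin n) (a : Fin m) : ℝ :=
  partialDeriv i (partialDeriv j (localCoord φ x a)) (chartAt (EuclideanSpace ℝ (Fin n)) x x)
    + ∑ b, ∑ c,
      christoffel (φ x) a b c (chartAt (EuclideanSpace ℝ (Fin m)) (φ x) (φ x)) *
        partialDeriv i (localCoord φ x b) (chartAt (EuclideanSpace ℝ (Fin n)) x x) *
        partialDeriv j (localCoord φ x c) (chartAt (EuclideanSpace ℝ (Fin n)) x x)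

/-- The second fundamental form `⟨∇_v w, ν⟩` of an immersed submanifold in the direction of a
normal vector `ν`. -/
def secondFundamentalForm (φ : S → M) (x : S) (ν : TangentSpace (𝓡 m) (φ x))
    (v w : TangentSpace (𝓡 n) x) : ℝ :=
  ∑ i, ∑ j, ∑ a, ∑ b,
    metricCoeff (φ x) (chartAt (EuclideanSpace ℝ (Fin m)) (φ x) (φ x)) a b *
      (ambientDeriv φ x i j a * tangentCoord x v i * tangentCoord x w j) *
      tangentCoord (φ x) ν b

/-- Totally geodesic: the second fundamental form vanishes. -/
def IsTotallyGeodesic (φ : S → M) : Prop :=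
  ∀ (x : S) (ν : TangentSpace (𝓡 m) (φ x)), IsNormal (n := n) φ x ν →
    ∀ v w : TangentSpace (𝓡 n) x, secondFundamentalForm φ x ν v w = 0

/-- The weighted area `∫_K e^{-f}` of the part `φ(K)` of the immersed submanifold `φ`, with respect
to the volume measure of the induced metric `φ^* g`. -/
def weightedArea [MeasurableSpace S] (f : M → ℝ) (K : Set S) (φ : S → M) : ℝ :=
  ∫ x in K, Real.exp (-f (φ x)) ∂(tensorVolume (pullbackMetric (n := n) (m := m) φ))

/-- `F` is a smooth variation `F t : S → M`, `|t| < ε`, of the immersion `φ` which is constant in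
`t` outside the compact set `K`. -/
structure IsVariation (φ : S → M) (K : Set S) (ε : ℝ) (F : ℝ → S → M) : Prop where
  pos : 0 < ε
  compact : IsCompact K
  smooth : ContMDiffOn (𝓘(ℝ, ℝ).prod (𝓡 n)) (𝓡 m) ∞ (fun q : ℝ × S => F q.1 q.2)
    (Ioo (-ε) ε ×ˢ univ)
  initial : F 0 = φ
  fixed : ∀ t ∈ Ioo (-ε) ε, ∀ x ∉ K, F t x = φ x

/-- The variational vector field `∂F/∂t` at `t = 0`. -/
def variationField (F : ℝ → S → M) (x : S) : TangentSpace (𝓡 m) (F 0 x) :=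
  mfderiv 𝓘(ℝ, ℝ) (𝓡 m) (fun t : ℝ => F t x) 0 (1 : ℝ)

/-- `f`-minimality: the first variation of the weighted area vanishes, for all compactly supported
variations. -/
def IsFMinimal [MeasurableSpace S] (f : M → ℝ) (φ : S → M) : Prop :=
  ∀ (K : Set S) (ε : ℝ) (F : ℝ → S → M), IsVariation (n := n) (m := m) φ K ε F →
    HasDerivAt (fun t => weightedArea (n := n) (m := m) f K (F t)) 0 0

/-- Stable `f`-minimality: in addition, the second variation of the weighted area is nonnegative
along every compactly supported normal variational vector field. -/
def IsStableFMinimal [MeasurableSpace S] (f : M → ℝ) (φ : S → M) : Prop :=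
  IsFMinimal (n := n) (m := m) f φ ∧
  ∀ (K : Set S) (ε : ℝ) (F : ℝ → S → M), IsVariation (n := n) (m := m) φ K ε F →
    (∀ x, IsNormal (n := n) (m := m) (F 0) x (variationField F x)) →
    0 ≤ iteratedDeriv 2 (fun t => weightedArea (n := n) (m := m) f K (F t)) 0

/-- The weighted volume `V_{Σ,f}(B) = ∫_B e^{-f}` of a subset of an immersed submanifold `S` that
carries its own (induced) Riemannian metric. -/
def weightedVolume [MeasurableSpace S] [RiemannianBundle (fun x : S => TangentSpace (𝓡 n) x)]
    (f : M → ℝ) (φ : S → M) (B : Set S) : ℝ≥0∞ :=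
  ∫⁻ x in B, ENNReal.ofReal (Real.exp (-f (φ x))) ∂(tensorVolume (metricTensor (m := n)))

end Submanifold

end WeightedHypersurface

end

open WeightedHypersurface

/-! The theorem rests on the stability inequality. The two orientations single out a smooth unit
normal `ν` along the hypersurface (`exists_unit_normal_field`). For a compactly supported function
`ψ`, the second variation of the weighted area in the direction `ψν` is the integral of `(|∇ψ|² - ψ²
(|A|² + Ric_f(ν,ν))) e^{-f}`, and stability makes it nonnegative (`stability_inequality`). The
potential `|A|² + Ric_f(ν,ν)` is a sum of two nonnegative terms. If there are cut-off functions
equal to `1` on larger and larger balls whose energy `∫ |∇ψ|² e^{-f}` tends to zero, then the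
potential vanishes identically, and with it both terms.

Quadratic volume growth is enough for logarithmic cut-offs to do this. Let `ψ` be a step function of
`log r / L`, falling from `1` to `0` for `r` between `e^L` and `e^{2L}`, so that its gradient is of
order `1 / (L r)`. A shell `e^k < r < e^{k+1}` has weighted volume of order `e^{2k}` and contributes
`O(1/L²)`. There are about `L` shells, so the energy is `O(1/L)` (`exists_log_cutoff`,
`exists_cutoff_energy_le`, `stabilityPotential_eq_zero`).

The second variation is computed pointwise in one chart of each manifold. The logarithm of the area
density is half the logarithm of a Gram determinant minus `f`, and its second derivative comes from
Jacobi's formula and covariant differentiation (`deriv_deriv_log_det`, `covD_variation`,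
`second_variation_density`). The variations used have vanishing covariant acceleration at time zero,
which removes the acceleration from the formula. They are built without an exponential map: a
partition of unity splits `ψ`, and each piece is added by an explicit quadratic polynomial in `t` in
a single chart (`IsNormalVariation.exists_add`, `exists_isNormalVariation`). The volume at time `t`
has a density with respect to the volume at time zero, so the weighted area is an integral against a
fixed measure and may be differentiated under the integral sign (`weightedArea_eq`,
`second_deriv_setIntegral`). The first variation shows that the weighted mean curvature vanishes,
which disposes of the square of the first derivative in the second one.

For the cut-offs, closed balls are compact by the Hopf-Rinow argument (`isCompact_closedEBall`). The
distance function is only Lipschitz, so it is replaced on a compact set by a smooth function at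
distance at most `1` from it, whose gradient is at most `5` (`exists_smooth_approx`). The constants
do not matter for the limit. -/

noncomputable section

namespace WeightedHypersurface

set_option linter.unusedSectionVars false

/-! ### The metric in a chart -/

/-- The model space `ℝᵐ`. -/
abbrev Euc (m : ℕ) := EuclideanSpace ℝ (Fin m)

/-! The instances of the scope `Bundle` make many instance searches diverge; these are shortcuts. -/

local instance clmSeminormedAddCommGroup {E F : Type*} [NormedAddCommGroup E] [NormedSpace ℝ E]
    [NormedAddCommGroup F] [NormedSpace ℝ F] : SeminormedAddCommGroup (E →L[ℝ] F) :=
  ContinuousLinearMap.toSeminormedAddCommGroup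

local instance clmNormedAddCommGroup {E F : Type*} [NormedAddCommGroup E] [NormedSpace ℝ E]
    [NormedAddCommGroup F] [NormedSpace ℝ F] : NormedAddCommGroup (E →L[ℝ] F) :=
  ContinuousLinearMap.toNormedAddCommGroup

local instance clmAddCommGroup {E F : Type*} [NormedAddCommGroup E] [NormedSpace ℝ E]
    [NormedAddCommGroup F] [NormedSpace ℝ F] : AddCommGroup (E →L[ℝ] F) :=
  ContinuousLinearMap.addCommGroup

local instance clmIsBoundedSMul {E F : Type*} [NormedAddCommGroup E] [NormedSpace ℝ E]
    [NormedAddCommGroup F] [NormedSpace ℝ F] : IsBoundedSMul ℝ (E →L[ℝ] F) :=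
  NormedSpace.toIsBoundedSMul

local instance clmNormedSpace {E F : Type*} [NormedAddCommGroup E] [NormedSpace ℝ E]
    [NormedAddCommGroup F] [NormedSpace ℝ F] : NormedSpace ℝ (E →L[ℝ] F) :=
  ContinuousLinearMap.toNormedSpace

local instance clmModule {E F : Type*} [NormedAddCommGroup E] [NormedSpace ℝ E]
    [NormedAddCommGroup F] [NormedSpace ℝ F] : Module ℝ (E →L[ℝ] F) := ContinuousLinearMap.module

local instance clmTopologicalSpace {E F : Type*} [NormedAddCommGroup E] [NormedSpace ℝ E]
    [NormedAddCommGroup F] [NormedSpace ℝ F] : TopologicalSpace (E →L[ℝ] F) :=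
  ContinuousLinearMap.topologicalSpace

local instance clmAddCommMonoid {E F : Type*} [NormedAddCommGroup E] [NormedSpace ℝ E]
    [NormedAddCommGroup F] [NormedSpace ℝ F] : AddCommMonoid (E →L[ℝ] F) :=
  ContinuousLinearMap.addCommMonoid

local instance eucNormedAddCommGroup {m : ℕ} : NormedAddCommGroup (Euc m) :=
  PiLp.normedAddCommGroup 2 _

local instance eucNormedSpace {m : ℕ} : NormedSpace ℝ (Euc m) := PiLp.normedSpace 2 ℝ _

local instance eucAddCommGroup {m : ℕ} : AddCommGroup (Euc m) := inferInstance

local instance eucAddCommMonoid {m : ℕ} : AddCommMonoid (Euc m) := inferInstance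

local instance eucTopologicalSpace {m : ℕ} : TopologicalSpace (Euc m) := PiLp.topologicalSpace 2 _

local instance eucModule {m : ℕ} : Module ℝ (Euc m) := inferInstance

local instance formNormedAddCommGroup {m : ℕ} : NormedAddCommGroup (Euc m →L[ℝ] Euc m →L[ℝ] ℝ) :=
  inferInstance

local instance formNormedSpace {m : ℕ} : NormedSpace ℝ (Euc m →L[ℝ] Euc m →L[ℝ] ℝ) := inferInstance

local instance formAddCommGroup {m : ℕ} : AddCommGroup (Euc m →L[ℝ] Euc m →L[ℝ] ℝ) := inferInstance

local instance bilinNormedAddCommGroup {m : ℕ} :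
    NormedAddCommGroup (Euc m →L[ℝ] Euc m →L[ℝ] Euc m) := inferInstance

local instance bilinNormedSpace {m : ℕ} : NormedSpace ℝ (Euc m →L[ℝ] Euc m →L[ℝ] Euc m) :=
  inferInstance

local instance bilinAddCommGroup {m : ℕ} : AddCommGroup (Euc m →L[ℝ] Euc m →L[ℝ] Euc m) :=
  inferInstance

/-! ### Calculus of bilinear maps -/

section BilinearCalculus

variable {X E F H : Type*} [NormedAddCommGroup X] [NormedSpace ℝ X] [NormedAddCommGroup E]
  [NormedSpace ℝ E] [NormedAddCommGroup F] [NormedSpace ℝ F] [NormedAddCommGroup H]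
  [NormedSpace ℝ H]

/-- The product rule for a varying bilinear map. -/
lemma fderiv_bilin {B : X → E →L[ℝ] F →L[ℝ] H} {a : X → E} {b : X → F} {x : X}
    (hB : DifferentiableAt ℝ B x) (ha : DifferentiableAt ℝ a x) (hb : DifferentiableAt ℝ b x)
    (v : X) : fderiv ℝ (fun z => B z (a z) (b z)) x v = fderiv ℝ B x v (a x) (b x)
      + B x (fderiv ℝ a x v) (b x) + B x (a x) (fderiv ℝ b x v) := by
  have h := (hB.hasFDerivAt.clm_apply ha.hasFDerivAt).clm_apply hb.hasFDerivAt
  rw [h.fderiv]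
  simp
  abel

lemma contDiffAt_bilin {N : WithTop ℕ∞} {B : X → E →L[ℝ] F →L[ℝ] H} {a : X → E} {b : X → F}
    {x : X} (hB : ContDiffAt ℝ N B x) (ha : ContDiffAt ℝ N a x) (hb : ContDiffAt ℝ N b x) :
    ContDiffAt ℝ N (fun z => B z (a z) (b z)) x :=
  (hB.clm_apply ha).clm_apply hb

lemma fderiv_comp_eval {Y : Type*} [NormedAddCommGroup Y] [NormedSpace ℝ Y]
    {B : Y → E →L[ℝ] F →L[ℝ] H} {u : X → Y} {x : X}
    (hB : DifferentiableAt ℝ B (u x)) (hu : DifferentiableAt ℝ u x) (v : X) :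
    fderiv ℝ (fun z => B (u z)) x v = fderiv ℝ B (u x) (fderiv ℝ u x v) := by
  have h := hB.hasFDerivAt.comp x hu.hasFDerivAt
  exact congrArg (fun L => L v) h.fderiv

lemma fderiv_const_eval (c : E) (x v : X) : fderiv ℝ (fun _ : X => c) x v = 0 := by
  simp

lemma fderiv_clm_eval {B : X → E →L[ℝ] H} {a : X → E} {x : X}
    (hB : DifferentiableAt ℝ B x) (ha : DifferentiableAt ℝ a x) (v : X) :
    fderiv ℝ (fun z => B z (a z)) x v = fderiv ℝ B x v (a x) + B x (fderiv ℝ a x v) := by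
  rw [(hB.hasFDerivAt.clm_apply ha.hasFDerivAt).fderiv]
  simp [add_comm]

end BilinearCalculus

/-! ### The differential of a chart and the metric in coordinates. -/

section ChartMetric

variable {m : ℕ} {M : Type*} [TopologicalSpace M] [ChartedSpace (Euc m) M]

/-- The differential of the inverse of the chart at `p`. -/
def chartFrame (p : M) (y : Euc m) : Euc m →L[ℝ] Euc m :=
  mfderiv (𝓡 m) (𝓡 m) (chartAt (Euc m) p).symm y

/-- The differential of the chart at `p`. -/
def chartCoframe (p x : M) : Euc m →L[ℝ] Euc m :=
  mfderiv (𝓡 m) (𝓡 m) (chartAt (Euc m) p) x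

lemma tangentCoord_eq (x : M) (v : Euc m) : tangentCoord x v = chartCoframe x x v := rfl

/-- The elementary bilinear form `v, w ↦ vₐ w_b`. -/
def elemForm {m : ℕ} (a b : Fin m) : Euc m →L[ℝ] Euc m →L[ℝ] ℝ :=
  (EuclideanSpace.proj a : Euc m →L[ℝ] ℝ).smulRight (EuclideanSpace.proj b : Euc m →L[ℝ] ℝ)

@[simp] lemma elemForm_apply {m : ℕ} (a b : Fin m) (v w : Euc m) :
    elemForm a b v w = v a * w b := by
  simp [elemForm]

lemma euc_sum {m : ℕ} (v : Euc m) :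
    v = ∑ a, v a • (EuclideanSpace.single a (1 : ℝ) : Euc m) := by
  ext i
  simp [Finset.sum_apply, Pi.single_apply]

/-- A linear function on the model space is determined by its values on the basis. -/
lemma euc_linear_ext {m : ℕ} {f g : Euc m → ℝ} (hf : IsLinearMap ℝ f) (hg : IsLinearMap ℝ g)
    (h : ∀ i, f (EuclideanSpace.single i (1 : ℝ)) = g (EuclideanSpace.single i (1 : ℝ)))
    (v : Euc m) : f v = g v := by
  change hf.mk' f v = hg.mk' g v
  rw [euc_sum v]
  simp only [map_sum, map_smul, IsLinearMap.mk'_apply, h]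

/-- A bilinear form on the model space is determined by its coefficients. -/
lemma bilin_eq_sum {m : ℕ} {F : Type*} [AddCommGroup F] [Module ℝ F]
    (B : Euc m →ₗ[ℝ] Euc m →ₗ[ℝ] F) (v w : Euc m) :
    B v w = ∑ a, ∑ b, (v a * w b) •
      B (EuclideanSpace.single a (1 : ℝ)) (EuclideanSpace.single b (1 : ℝ)) := by
  conv_lhs => rw [euc_sum v, euc_sum w]
  simp only [map_sum, LinearMap.sum_apply, Finset.smul_sum, smul_smul, map_smul,
    LinearMap.smul_apply]
  rw [Finset.sum_comm]
  exact Finset.sum_congr rfl fun a _ => Finset.sum_congr rfl fun b _ => by rw [mul_comm]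

lemma chartCoframe_chartFrame [IsManifold (𝓡 m) ∞ M] (p : M) {y : Euc m} (hy : y ∈ (chartAt (Euc m)
    p).target)
    (v : Euc m) : chartCoframe p ((chartAt (Euc m) p).symm y) (chartFrame p y v) = v := by
  have : IsManifold (𝓡 m) 1 M := IsManifold.of_le (n := ∞) (by simp)
  have h := (mdifferentiable_chart (I := 𝓡 m) p).comp_symm_deriv hy
  exact congrArg (fun L : Euc m →L[ℝ] Euc m => L v) h

lemma chartFrame_chartCoframe [IsManifold (𝓡 m) ∞ M] (p : M) {x : M} (hx : x ∈ (chartAt (Euc m)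
    p).source)
    (v : Euc m) : chartFrame p (chartAt (Euc m) p x) (chartCoframe p x v) = v := by
  have : IsManifold (𝓡 m) 1 M := IsManifold.of_le (n := ∞) (by simp)
  have h := (mdifferentiable_chart (I := 𝓡 m) p).symm_comp_deriv hx
  exact congrArg (fun L : Euc m →L[ℝ] Euc m => L v) h

variable [RiemannianBundle (fun x : M => TangentSpace (𝓡 m) x)]

/-- The metric of `M` in the chart at `p`, as a field of bilinear forms on the model space. -/
def chartMetric (p : M) (y : Euc m) : Euc m →L[ℝ] Euc m →L[ℝ] ℝ :=
  ∑ a, ∑ b, metricCoeff p y a b • elemForm a b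

/-- The form is assembled from its coefficients so that it is continuous and bilinear by
construction and its smoothness can be checked entry by entry. Bilinear expansion identifies it with
the inner product of frame vectors. -/
lemma chartMetric_apply (p : M) (y v w : Euc m) :
    chartMetric p y v w =
      metricTensor ((chartAt (Euc m) p).symm y) (chartFrame p y v) (chartFrame p y w) := by
  let B : Euc m →ₗ[ℝ] Euc m →ₗ[ℝ] ℝ :=
    LinearMap.mk₂ ℝ (fun v w => metricTensor ((chartAt (Euc m) p).symm y) (chartFrame p y v)
      (chartFrame p y w))
      (fun a b c => by rw [map_add]; exact inner_add_left _ _ _)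
      (fun a b c => by rw [map_smul]; exact real_inner_smul_left _ _ _)
      (fun a b c => by rw [map_add]; exact inner_add_right _ _ _)
      (fun a b c => by rw [map_smul]; exact real_inner_smul_right _ _ _)
  have h := bilin_eq_sum B v w
  change metricTensor _ _ _ = _ at h
  rw [h]
  simp only [chartMetric, sum_apply, smul_apply,
    elemForm_apply, smul_eq_mul]
  refine Finset.sum_congr rfl fun a _ => Finset.sum_congr rfl fun b _ => ?_
  rw [mul_comm]
  rfl

lemma metricCoeff_eq (p : M) (y : Euc m) (a b : Fin m) :
    metricCoeff p y a b = chartMetric p y (EuclideanSpace.single a (1 : ℝ))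
      (EuclideanSpace.single b (1 : ℝ)) := by
  rw [chartMetric_apply]; rfl

lemma chartMetric_symm (p : M) (y v w : Euc m) : chartMetric p y v w = chartMetric p y w v := by
  rw [chartMetric_apply, chartMetric_apply]
  exact real_inner_comm _ _

variable [IsManifold (𝓡 m) ∞ M]

lemma chartMetric_coframe (p : M) {x : M} (hx : x ∈ (chartAt (Euc m) p).source)
    (v w : Euc m) : chartMetric p (chartAt (Euc m) p x) (chartCoframe p x v) (chartCoframe p x w)
      = metricTensor x v w := by
  -- The type of the inner product depends on the base point, so the base point is exchanged through
  -- a general statement and not by rewriting.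
  have key : ∀ z : M, z = x → metricTensor z v w = metricTensor x v w := by
    rintro z rfl; rfl
  rw [chartMetric_apply, chartFrame_chartCoframe p hx, chartFrame_chartCoframe p hx]
  exact key _ ((chartAt (Euc m) p).left_inv hx)

lemma metricTensor_self_pos {x : M} {v : Euc m} (hv : v ≠ 0) :
    0 < metricTensor (m := m) (M := M) x v v := by
  have h : (v : TangentSpace (𝓡 m) x) ≠ 0 := hv
  exact real_inner_self_pos.2 h

lemma chartMetric_pos (p : M) {y : Euc m} (hy : y ∈ (chartAt (Euc m) p).target)
    {v : Euc m} (hv : v ≠ 0) : 0 < chartMetric p y v v := by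
  rw [chartMetric_apply]
  apply metricTensor_self_pos
  intro h
  apply hv
  rw [← chartCoframe_chartFrame p hy v, h, map_zero]

variable [IsContMDiffRiemannianBundle (𝓡 m) ∞ (Euc m) (fun x : M => TangentSpace (𝓡 m) x)]

/-- The frame vector is the tangent map of the inverse chart applied to a constant section. As a
smooth map into the tangent bundle it can be fed to the smoothness of the inner product. -/
lemma contMDiffOn_frame (p : M) (v : Euc m) :
    ContMDiffOn (𝓡 m) ((𝓡 m).prod 𝓘(ℝ, Euc m)) ∞
      (fun y : Euc m => (⟨(chartAt (Euc m) p).symm y, chartFrame p y v⟩ :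
        TotalSpace (Euc m) (fun x : M => TangentSpace (𝓡 m) x)))
      (chartAt (Euc m) p).target := by
  have hs : ContMDiffOn (𝓡 m) (𝓡 m) ∞ (chartAt (Euc m) p).symm (chartAt (Euc m) p).target :=
    contMDiffOn_chart_symm
  have : IsManifold (𝓡 m) 1 M := IsManifold.of_le (n := ∞) (by simp)
  have hu : UniqueMDiffOn (𝓡 m) (chartAt (Euc m) p).target :=
    (chartAt (Euc m) p).open_target.uniqueMDiffOn
  have ht := hs.contMDiffOn_tangentMapWithin (m := ∞) (by simp) hu
  have hv : ContMDiff (𝓡 m) ((𝓡 m).prod 𝓘(ℝ, Euc m)) ∞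
      (fun y : Euc m => (⟨y, v⟩ : TangentBundle (𝓡 m) (Euc m))) :=
    contMDiff_vectorSpace_iff_contDiff.2 contDiff_const
  refine (ht.comp hv.contMDiffOn fun y hy => hy).congr fun y hy => ?_
  have h2 : mfderivWithin (𝓡 m) (𝓡 m) (chartAt (Euc m) p).symm (chartAt (Euc m) p).target y
      = mfderiv (𝓡 m) (𝓡 m) (chartAt (Euc m) p).symm y :=
    mfderivWithin_of_isOpen (chartAt (Euc m) p).open_target hy
  simp only [Function.comp, tangentMapWithin, h2]
  rfl

lemma contDiffOn_chartMetric (p : M) :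
    ContDiffOn ℝ ∞ (chartMetric p) (chartAt (Euc m) p).target := by
  unfold chartMetric
  refine ContDiffOn.sum fun a _ => ContDiffOn.sum fun b _ => ?_
  suffices h : ContDiffOn ℝ ∞ (fun y => metricCoeff p y a b) (chartAt (Euc m) p).target from
    h.smul contDiffOn_const
  rw [← contMDiffOn_iff_contDiffOn]
  exact ContMDiffOn.inner_bundle (contMDiffOn_frame p (EuclideanSpace.single a (1 : ℝ)))
    (contMDiffOn_frame p (EuclideanSpace.single b (1 : ℝ)))

end ChartMetric

/-! ### Changes of coordinates. -/

section Transition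

variable {m : ℕ} {M : Type*} [TopologicalSpace M] [ChartedSpace (Euc m) M]

/-- The change of coordinates from the chart at `p` to the chart at `q`. -/
def transition (p q : M) : Euc m → Euc m :=
  fun y => chartAt (Euc m) q ((chartAt (Euc m) p).symm y)

/-- The domain of the change of coordinates. -/
def overlap (p q : M) : Set (Euc m) :=
  (chartAt (Euc m) p).target ∩ (chartAt (Euc m) p).symm ⁻¹' (chartAt (Euc m) q).source

lemma isOpen_overlap (p q : M) : IsOpen (overlap (m := m) p q) :=
  (chartAt (Euc m) p).symm.isOpen_inter_preimage (chartAt (Euc m) q).open_source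

lemma mem_overlap {p q x : M} (hp : x ∈ (chartAt (Euc m) p).source)
    (hq : x ∈ (chartAt (Euc m) q).source) : chartAt (Euc m) p x ∈ overlap (m := m) p q :=
  ⟨(chartAt (Euc m) p).map_source hp, by
    rwa [mem_preimage, (chartAt (Euc m) p).left_inv hp]⟩

lemma transition_chart {p q x : M} (hp : x ∈ (chartAt (Euc m) p).source) :
    transition p q (chartAt (Euc m) p x) = chartAt (Euc m) q x := by
  rw [transition, (chartAt (Euc m) p).left_inv hp]

lemma symm_transition {p q : M} {y : Euc m} (hy : y ∈ overlap p q) :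
    (chartAt (Euc m) q).symm (transition p q y) = (chartAt (Euc m) p).symm y :=
  (chartAt (Euc m) q).left_inv hy.2

lemma transition_mem_overlap {p q : M} {y : Euc m} (hy : y ∈ overlap p q) :
    transition p q y ∈ overlap q p :=
  ⟨(chartAt (Euc m) q).map_source hy.2, by
    rw [mem_preimage, symm_transition hy]
    exact (chartAt (Euc m) p).map_target hy.1⟩

lemma transition_transition {p q : M} {y : Euc m} (hy : y ∈ overlap p q) :
    transition q p (transition p q y) = y := by
  rw [transition, symm_transition hy, (chartAt (Euc m) p).right_inv hy.1]

variable [IsManifold (𝓡 m) ∞ M]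

lemma contDiffOn_transition (p q : M) :
    ContDiffOn ℝ ∞ (transition (m := m) p q) (overlap p q) := by
  rw [← contMDiffOn_iff_contDiffOn]
  exact contMDiffOn_chart.comp (contMDiffOn_chart_symm.mono inter_subset_left) fun y hy => hy.2

lemma contDiffAt_transition {p q : M} {y : Euc m} (hy : y ∈ overlap p q) :
    ContDiffAt ℝ ∞ (transition (m := m) p q) y :=
  (contDiffOn_transition p q y hy).contDiffAt ((isOpen_overlap p q).mem_nhds hy)

lemma differentiableAt_transition {p q : M} {y : Euc m} (hy : y ∈ overlap p q) :
    DifferentiableAt ℝ (transition (m := m) p q) y :=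
  (contDiffAt_transition hy).differentiableAt (by simp)

lemma chartCoframe_comp_chartFrame {p q : M} {y : Euc m} (hy : y ∈ overlap p q) (v : Euc m) :
    chartCoframe q ((chartAt (Euc m) p).symm y) (chartFrame p y v)
      = fderiv ℝ (transition p q) y v := by
  have : IsManifold (𝓡 m) 1 M := IsManifold.of_le (n := ∞) (by simp)
  have h1 := (mdifferentiable_chart (I := 𝓡 m) p).mdifferentiableAt_symm hy.1
  have h2 := (mdifferentiable_chart (I := 𝓡 m) q).mdifferentiableAt hy.2
  have h := mfderiv_comp y h2 h1
  have h3 : mfderiv (𝓡 m) (𝓡 m) (chartAt (Euc m) q ∘ (chartAt (Euc m) p).symm) y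
    = fderiv ℝ (transition p q) y := mfderiv_eq_fderiv
  rw [h3] at h
  exact (congrArg (fun L : Euc m →L[ℝ] Euc m => L v) h).symm

lemma chartFrame_transition {p q : M} {y : Euc m} (hy : y ∈ overlap p q) (v : Euc m) :
    chartFrame q (transition p q y) (fderiv ℝ (transition p q) y v) = chartFrame p y v := by
  rw [← chartCoframe_comp_chartFrame hy]
  exact chartFrame_chartCoframe q hy.2 _

lemma fderiv_transition_chartCoframe {p q x : M} (hp : x ∈ (chartAt (Euc m) p).source)
    (hq : x ∈ (chartAt (Euc m) q).source) (v : Euc m) :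
    fderiv ℝ (transition p q) (chartAt (Euc m) p x) (chartCoframe p x v)
      = chartCoframe q x v := by
  rw [← chartCoframe_comp_chartFrame (mem_overlap hp hq), chartFrame_chartCoframe p hp,
    (chartAt (Euc m) p).left_inv hp]

lemma fderiv_transition_comp {p q : M} {y : Euc m} (hy : y ∈ overlap p q) (v : Euc m) :
    fderiv ℝ (transition q p) (transition p q y) (fderiv ℝ (transition p q) y v) = v := by
  have h1 := differentiableAt_transition hy
  have h2 := differentiableAt_transition (transition_mem_overlap hy)
  have h : transition q p ∘ transition p q =ᶠ[𝓝 y] id :=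
    Filter.eventually_of_mem ((isOpen_overlap p q).mem_nhds hy) fun z hz =>
      transition_transition hz
  have h3 := fderiv_comp y h2 h1
  rw [h.fderiv_eq, fderiv_id] at h3
  exact (congrArg (fun L : Euc m →L[ℝ] Euc m => L v) h3).symm

variable [RiemannianBundle (fun x : M => TangentSpace (𝓡 m) x)]

lemma chartMetric_transition {p q : M} {y : Euc m} (hy : y ∈ overlap p q) (v w : Euc m) :
    chartMetric q (transition p q y) (fderiv ℝ (transition p q) y v)
      (fderiv ℝ (transition p q) y w) = chartMetric p y v w := by
  rw [chartMetric_apply, chartFrame_transition hy, chartFrame_transition hy, symm_transition hy,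
    chartMetric_apply]

end Transition

/-! ### Smooth families of matrices -/

section MatrixCalculus

variable {X : Type*} [NormedAddCommGroup X] [NormedSpace ℝ X] {ι : Type*} [Fintype ι]
  [DecidableEq ι] {N : WithTop ℕ∞}

lemma contDiffAt_det {A : X → Matrix ι ι ℝ} {x : X}
    (h : ∀ i j, ContDiffAt ℝ N (fun z => A z i j) x) : ContDiffAt ℝ N (fun z => (A z).det) x := by
  simp only [Matrix.det_apply]
  refine ContDiffAt.sum fun σ _ => ?_
  exact (contDiffAt_prod fun i _ => h (σ i) i).const_smul _

lemma contDiffAt_adjugate {A : X → Matrix ι ι ℝ} {x : X}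
    (h : ∀ i j, ContDiffAt ℝ N (fun z => A z i j) x) (i j : ι) :
    ContDiffAt ℝ N (fun z => (A z).adjugate i j) x := by
  simp only [Matrix.adjugate_apply]
  refine contDiffAt_det fun k l => ?_
  by_cases hk : k = j
  · subst hk
    simpa using contDiffAt_const
  · simpa [Matrix.updateRow_ne hk] using h k l

lemma contDiffAt_matrix_inv {A : X → Matrix ι ι ℝ} {x : X}
    (h : ∀ i j, ContDiffAt ℝ N (fun z => A z i j) x) (hx : (A x).det ≠ 0) (i j : ι) :
    ContDiffAt ℝ N (fun z => (A z)⁻¹ i j) x := by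
  simp only [Matrix.inv_def, Matrix.smul_apply, smul_eq_mul, Ring.inverse_eq_inv']
  exact ((contDiffAt_det h).inv hx).mul (contDiffAt_adjugate h i j)

/-- The matrix of a definite bilinear form is invertible. -/
lemma det_ne_zero_of_definite {A : Matrix ι ι ℝ}
    (h : ∀ v : ι → ℝ, v ≠ 0 → 0 < ∑ i, ∑ j, v i * A i j * v j) : A.det ≠ 0 := by
  intro h0
  obtain ⟨v, hv, hAv⟩ := Matrix.exists_mulVec_eq_zero_iff.2 h0
  have h1 := h v hv
  have h2 : ∑ i, ∑ j, v i * A i j * v j = ∑ i, v i * (A.mulVec v) i := by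
    simp only [Matrix.mulVec, dotProduct, Finset.mul_sum, mul_assoc]
  rw [h2, hAv] at h1
  simp at h1

end MatrixCalculus

/-! ### The Levi-Civita connection in a chart -/

/-- The elementary bilinear map `v, w ↦ vᵢ wⱼ eₖ`. -/
def elemBilin {m : ℕ} (k i j : Fin m) : Euc m →L[ℝ] Euc m →L[ℝ] Euc m :=
  (EuclideanSpace.proj i : Euc m →L[ℝ] ℝ).smulRight
    ((EuclideanSpace.proj j : Euc m →L[ℝ] ℝ).smulRight (EuclideanSpace.single k (1 : ℝ)))

@[simp] lemma elemBilin_apply {m : ℕ} (k i j : Fin m) (v w : Euc m) :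
    elemBilin k i j v w = (v i * w j) • (EuclideanSpace.single k (1 : ℝ) : Euc m) := by
  simp [elemBilin, smul_smul]

section Connection

variable {m : ℕ} {M : Type*} [TopologicalSpace M] [ChartedSpace (Euc m) M]
  [RiemannianBundle (fun x : M => TangentSpace (𝓡 m) x)]

/-- The Christoffel symbols in the chart at `p`, as a bilinear map. -/
def chartGamma (p : M) (y : Euc m) : Euc m →L[ℝ] Euc m →L[ℝ] Euc m :=
  ∑ k, ∑ i, ∑ j, christoffel p k i j y • elemBilin k i j

lemma chartGamma_apply (p : M) (y v w : Euc m) (k : Fin m) :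
    chartGamma p y v w k = ∑ i, ∑ j, christoffel p k i j y * (v i * w j) := by
  simp only [chartGamma, sum_apply, smul_apply, elemBilin_apply]
  simp [Finset.sum_apply, Pi.single_apply]

lemma chartGamma_single (p : M) (y : Euc m) (i j k : Fin m) :
    chartGamma p y (EuclideanSpace.single i (1 : ℝ)) (EuclideanSpace.single j (1 : ℝ)) k
      = christoffel p k i j y := by
  simp [chartGamma_apply]

lemma metricCoeff_symm (p : M) (y : Euc m) (a b : Fin m) :
    metricCoeff p y a b = metricCoeff p y b a := by
  rw [metricCoeff_eq, metricCoeff_eq, chartMetric_symm]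

lemma christoffel_symm (p : M) (k i j : Fin m) (y : Euc m) :
    christoffel p k i j y = christoffel p k j i y := by
  unfold christoffel
  congr 1
  refine Finset.sum_congr rfl fun l _ => ?_
  have h : (fun z => metricCoeff p z i j) = fun z => metricCoeff p z j i :=
    funext fun z => metricCoeff_symm p z i j
  rw [h]
  ring

lemma chartGamma_symm (p : M) (y v w : Euc m) : chartGamma p y v w = chartGamma p y w v := by
  ext k
  rw [chartGamma_apply, chartGamma_apply, Finset.sum_comm]
  refine Finset.sum_congr rfl fun i _ => Finset.sum_congr rfl fun j _ => ?_
  rw [christoffel_symm, mul_comm (v j)]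

variable [IsManifold (𝓡 m) ∞ M]
  [IsContMDiffRiemannianBundle (𝓡 m) ∞ (Euc m) (fun x : M => TangentSpace (𝓡 m) x)]

lemma chartMetric_eq_sum (p : M) (y v w : Euc m) :
    chartMetric p y v w = ∑ a, ∑ b, v a * metricCoeff p y a b * w b := by
  simp only [chartMetric, sum_apply, smul_apply, elemForm_apply, smul_eq_mul]
  exact Finset.sum_congr rfl fun a _ => Finset.sum_congr rfl fun b _ => by ring

lemma metricCoeff_det_ne_zero (p : M) {y : Euc m} (hy : y ∈ (chartAt (Euc m) p).target) :
    (metricCoeff p y).det ≠ 0 := by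
  refine det_ne_zero_of_definite fun v hv => ?_
  have h := chartMetric_pos p hy (v := WithLp.toLp 2 v) (by
    intro h; apply hv; ext i; simpa using congrArg (fun u : Euc m => u i) h)
  rwa [chartMetric_eq_sum] at h

lemma contDiffAt_chartMetric (p : M) {y : Euc m} (hy : y ∈ (chartAt (Euc m) p).target) :
    ContDiffAt ℝ ∞ (chartMetric p) y :=
  (contDiffOn_chartMetric p y hy).contDiffAt ((chartAt (Euc m) p).open_target.mem_nhds hy)

lemma contDiffAt_metricCoeff (p : M) {y : Euc m} (hy : y ∈ (chartAt (Euc m) p).target)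
    (a b : Fin m) : ContDiffAt ℝ ∞ (fun z => metricCoeff p z a b) y := by
  simp only [metricCoeff_eq]
  have h := contDiffAt_chartMetric p hy
  fun_prop

lemma contDiffAt_partialDeriv {u : Euc m → ℝ} {y : Euc m} (h : ContDiffAt ℝ ∞ u y) (i : Fin m) :
    ContDiffAt ℝ ∞ (partialDeriv i u) y := by
  unfold partialDeriv
  have h1 : ContDiffAt ℝ ∞ (fderiv ℝ u) y := h.fderiv_right (by simp)
  fun_prop

lemma contDiffAt_christoffel (p : M) (k i j : Fin m) {y : Euc m}
    (hy : y ∈ (chartAt (Euc m) p).target) : ContDiffAt ℝ ∞ (christoffel p k i j) y := by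
  unfold christoffel
  refine contDiffAt_const.mul (ContDiffAt.sum fun l _ => ?_)
  have hg := fun a b => contDiffAt_metricCoeff p hy a b
  exact (contDiffAt_matrix_inv hg (metricCoeff_det_ne_zero p hy) k l).mul
    (((contDiffAt_partialDeriv (hg j l) i).add (contDiffAt_partialDeriv (hg i l) j)).sub
      (contDiffAt_partialDeriv (hg i j) l))

lemma contDiffAt_chartGamma (p : M) {y : Euc m} (hy : y ∈ (chartAt (Euc m) p).target) :
    ContDiffAt ℝ ∞ (chartGamma p) y := by
  unfold chartGamma
  refine ContDiffAt.sum fun k _ => ContDiffAt.sum fun i _ => ContDiffAt.sum fun j _ => ?_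
  have h := contDiffAt_christoffel p k i j hy
  exact h.smul contDiffAt_const

lemma differentiableAt_chartMetric (p : M) {y : Euc m} (hy : y ∈ (chartAt (Euc m) p).target) :
    DifferentiableAt ℝ (chartMetric (m := m) p) y :=
  (contDiffAt_chartMetric p hy).differentiableAt (by simp)

lemma fderiv_chartMetric_apply (p : M) {y : Euc m} (hy : y ∈ (chartAt (Euc m) p).target)
    (v a b : Euc m) : fderiv ℝ (fun z => chartMetric p z a b) y v
      = fderiv ℝ (chartMetric p) y v a b := by
  rw [fderiv_bilin (differentiableAt_chartMetric p hy) (differentiableAt_const a)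
    (differentiableAt_const b), fderiv_const_eval, fderiv_const_eval]
  simp only [map_zero, zero_apply, add_zero]

lemma partialDeriv_metricCoeff (p : M) {y : Euc m} (hy : y ∈ (chartAt (Euc m) p).target)
    (i a b : Fin m) : partialDeriv i (fun z => metricCoeff p z a b) y
      = fderiv ℝ (chartMetric p) y (EuclideanSpace.single i (1 : ℝ))
        (EuclideanSpace.single a (1 : ℝ)) (EuclideanSpace.single b (1 : ℝ)) := by
  simp only [metricCoeff_eq, partialDeriv]
  exact fderiv_chartMetric_apply p hy _ _ _

/-- The Koszul formula. -/
lemma koszul (p : M) {y : Euc m} (hy : y ∈ (chartAt (Euc m) p).target) (v w u : Euc m) :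
    2 * chartMetric p y (chartGamma p y v w) u =
      fderiv ℝ (chartMetric p) y v w u + fderiv ℝ (chartMetric p) y w v u
        - fderiv ℝ (chartMetric p) y u v w := by
  -- On basis vectors this is the definition of the Christoffel symbols multiplied by the metric
  -- matrix, which cancels its inverse. Both sides are linear in each of the three vectors, so the
  -- basis suffices.
  have key : ∀ i j l : Fin m,
      2 * chartMetric p y (chartGamma p y (EuclideanSpace.single i (1 : ℝ))
        (EuclideanSpace.single j (1 : ℝ))) (EuclideanSpace.single l (1 : ℝ)) =
      partialDeriv i (fun z => metricCoeff p z j l) y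
      + partialDeriv j (fun z => metricCoeff p z i l) y
      - partialDeriv l (fun z => metricCoeff p z i j) y := by
    intro i j l
    have hu : IsUnit (metricCoeff p y).det := (metricCoeff_det_ne_zero p hy).isUnit
    set c : Fin m → ℝ := fun l => partialDeriv i (fun z => metricCoeff p z j l) y
      + partialDeriv j (fun z => metricCoeff p z i l) y
      - partialDeriv l (fun z => metricCoeff p z i j) y with hc
    have h1 : ∀ k, christoffel p k i j y = (1 / 2) * ((metricCoeff p y)⁻¹.mulVec c) k := by
      intro k
      rw [christoffel, Matrix.mulVec, dotProduct]
    have h2 : (metricCoeff p y).mulVec ((metricCoeff p y)⁻¹.mulVec c) = c := by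
      rw [Matrix.mulVec_mulVec, Matrix.mul_nonsing_inv _ hu, Matrix.one_mulVec]
    have h3 := congrFun h2 l
    rw [chartMetric_eq_sum]
    simp only [chartGamma_single, h1]
    change _ = c l
    rw [← h3, Matrix.mulVec, dotProduct, Finset.mul_sum]
    refine Finset.sum_congr rfl fun k _ => ?_
    rw [Finset.sum_eq_single l]
    · rw [metricCoeff_symm p y l k]; simp; ring
    · intro b _ hb; simp [hb]
    · simp
  simp only [partialDeriv_metricCoeff p hy] at key
  refine euc_linear_ext (f := fun v => 2 * chartMetric p y (chartGamma p y v w) u)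
    (g := fun v => fderiv ℝ (chartMetric p) y v w u + fderiv ℝ (chartMetric p) y w v u
        - fderiv ℝ (chartMetric p) y u v w) ⟨?_, ?_⟩ ⟨?_, ?_⟩ (fun i => ?_) v
  iterate 4 (intros; simp; try ring)
  refine euc_linear_ext (f := fun w => 2 * chartMetric p y (chartGamma p y (EuclideanSpace.single i
      (1 : ℝ)) w) u)
    (g := fun w => fderiv ℝ (chartMetric p) y (EuclideanSpace.single i (1 : ℝ)) w u + fderiv ℝ
        (chartMetric p) y w (EuclideanSpace.single i (1 : ℝ)) u
        - fderiv ℝ (chartMetric p) y u (EuclideanSpace.single i (1 : ℝ)) w) ⟨?_, ?_⟩ ⟨?_, ?_⟩ (fun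
            j => ?_) w
  iterate 4 (intros; simp; try ring)
  refine euc_linear_ext (f := fun u => 2 * chartMetric p y (chartGamma p y (EuclideanSpace.single i
      (1 : ℝ)) (EuclideanSpace.single j (1 : ℝ))) u)
    (g := fun u => fderiv ℝ (chartMetric p) y (EuclideanSpace.single i (1 : ℝ))
        (EuclideanSpace.single j (1 : ℝ)) u + fderiv ℝ (chartMetric p) y (EuclideanSpace.single j
            (1 : ℝ)) (EuclideanSpace.single i (1 : ℝ)) u
        - fderiv ℝ (chartMetric p) y u (EuclideanSpace.single i (1 : ℝ)) (EuclideanSpace.single j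
            (1 : ℝ))) ⟨?_, ?_⟩ ⟨?_, ?_⟩ (fun l => ?_) u
  iterate 4 (intros; simp; try ring)
  exact key i j l

/-- The Levi-Civita connection is metric. -/
lemma fderiv_chartMetric (p : M) {y : Euc m} (hy : y ∈ (chartAt (Euc m) p).target)
    (v w u : Euc m) : fderiv ℝ (chartMetric p) y v w u =
      chartMetric p y (chartGamma p y v w) u + chartMetric p y w (chartGamma p y v u) := by
  have hs : ∀ a b c, fderiv ℝ (chartMetric p) y a b c = fderiv ℝ (chartMetric p) y a c b := by
    intro a b c
    rw [← fderiv_chartMetric_apply p hy, ← fderiv_chartMetric_apply p hy]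
    simp only [chartMetric_symm p _ b c]
  -- In the sum of the Koszul formulas for `(v, w, u)` and `(v, u, w)` the derivatives along `w` and
  -- `u` cancel, and twice the derivative along `v` remains.
  have h1 := koszul p hy v w u
  have h2 := koszul p hy v u w
  rw [chartMetric_symm p y w]
  linarith [hs w u v, hs u w v, hs v u w]

/-- Transformation law of the Christoffel symbols. -/
lemma chartGamma_transition {p q : M} {y : Euc m} (hy : y ∈ overlap p q) (v w : Euc m) :
    chartGamma q (transition p q y) (fderiv ℝ (transition p q) y v)
        (fderiv ℝ (transition p q) y w)
      = fderiv ℝ (transition p q) y (chartGamma p y v w)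
        - fderiv ℝ (fderiv ℝ (transition p q)) y v w := by
  set τ := transition (m := m) p q with hτ
  have hp : y ∈ (chartAt (Euc m) p).target := hy.1
  have hq : τ y ∈ (chartAt (Euc m) q).target := (transition_mem_overlap hy).1
  have hτ1 : DifferentiableAt ℝ τ y := differentiableAt_transition hy
  have hτ2 : DifferentiableAt ℝ (fderiv ℝ τ) y :=
    ((contDiffAt_transition hy).fderiv_right (m := ∞) (by simp)).differentiableAt (by simp)
  have hsym : ∀ a b, fderiv ℝ (fderiv ℝ τ) y a b = fderiv ℝ (fderiv ℝ τ) y b a := fun a b =>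
    ((contDiffAt_transition hy).isSymmSndFDerivAt (by simpa using ENat.LEInfty.out)).eq a b
  have hG := differentiableAt_chartMetric q hq
  -- Obtained by differentiating the transformation law of the metric, which holds on a whole
  -- neighbourhood of `y`.
  have hD : ∀ a b c : Euc m, fderiv ℝ (chartMetric p) y a b c =
      fderiv ℝ (chartMetric q) (τ y) (fderiv ℝ τ y a) (fderiv ℝ τ y b) (fderiv ℝ τ y c)
      + chartMetric q (τ y) (fderiv ℝ (fderiv ℝ τ) y a b) (fderiv ℝ τ y c)
      + chartMetric q (τ y) (fderiv ℝ τ y b) (fderiv ℝ (fderiv ℝ τ) y a c) := by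
    intro a b c
    have h3 : (fun z => chartMetric p z b c) =ᶠ[𝓝 y]
        fun z => chartMetric q (τ z) (fderiv ℝ τ z b) (fderiv ℝ τ z c) :=
      Filter.eventually_of_mem ((isOpen_overlap p q).mem_nhds hy) fun z hz =>
        (chartMetric_transition hz b c).symm
    have hc : ∀ e : Euc m, DifferentiableAt ℝ (fun z => fderiv ℝ τ z e) y := fun e =>
      hτ2.clm_apply (differentiableAt_const e)
    have hc' : ∀ e : Euc m, fderiv ℝ (fun z => fderiv ℝ τ z e) y a
        = fderiv ℝ (fderiv ℝ τ) y a e := fun e => by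
      rw [fderiv_clm_eval hτ2 (differentiableAt_const e), fderiv_const_eval, map_zero, add_zero]
    rw [← fderiv_chartMetric_apply p hp, h3.fderiv_eq,
      fderiv_bilin (B := fun z => chartMetric q (τ z)) (hG.comp y hτ1) (hc b) (hc c),
      fderiv_comp_eval hG hτ1, hc', hc']
  rw [← sub_eq_zero]
  by_contra hne
  -- The Koszul formulas in the two charts make the difference `d` of the two sides orthogonal to
  -- the image of any vector under the differential of the transition. That differential is onto, so
  -- `d` is orthogonal to itself.
  set d := chartGamma q (τ y) (fderiv ℝ τ y v) (fderiv ℝ τ y w)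
        - (fderiv ℝ τ y (chartGamma p y v w) - fderiv ℝ (fderiv ℝ τ) y v w) with hd
  have hd' : ∃ u, fderiv ℝ τ y u = d := by
    refine ⟨fderiv ℝ (transition q p) (τ y) d, ?_⟩
    have h := fderiv_transition_comp (transition_mem_overlap hy) d
    rwa [transition_transition hy] at h
  obtain ⟨u, hu⟩ := hd'
  have hpos := chartMetric_pos q hq hne
  have h1 := koszul p hp v w u
  have h2 := koszul q hq (fderiv ℝ τ y v) (fderiv ℝ τ y w) (fderiv ℝ τ y u)
  rw [hD v w u, hD w v u, hD u v w, ← chartMetric_transition hy, ← hτ] at h1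
  have h3 : chartMetric q (τ y) d (fderiv ℝ τ y u) = 0 := by
    rw [hd]
    simp only [map_sub, sub_apply]
    rw [hsym w v, hsym u v, hsym u w] at h1
    have h4 := chartMetric_symm q (τ y) (fderiv ℝ (fderiv ℝ τ) y v u) (fderiv ℝ τ y w)
    linarith
  rw [hu] at h3
  exact hpos.ne' h3

end Connection

/-! ### Gluing measures -/

/-- Measures carried by the sets of an open cover which agree on overlaps glue to their
supremum. -/
lemma iSup_measure_restrict {S : Type*} [TopologicalSpace S] [SecondCountableTopology S]
    [MeasurableSpace S] [OpensMeasurableSpace S] {U : S → Set S} (hU : ∀ p, IsOpen (U p))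
    (hmem : ∀ p, p ∈ U p) {μ : S → Measure S} (hμ : ∀ p, μ p (U p)ᶜ = 0)
    (hagree : ∀ p q A, MeasurableSet A → A ⊆ U p → A ⊆ U q → μ p A = μ q A) (p : S) :
    (⨆ q, μ q).restrict (U p) = μ p := by
  obtain ⟨T, hTc, hT⟩ := TopologicalSpace.isOpen_iUnion_countable U hU
  have hTu : ⋃ i ∈ T, U i = univ := by
    rw [hT]; exact eq_univ_of_forall fun x => mem_iUnion.2 ⟨x, hmem x⟩
  have hTne : T.Nonempty := by
    by_contra h
    rw [not_nonempty_iff_eq_empty] at h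
    have : p ∈ (univ : Set S) := mem_univ p
    rw [← hTu, h] at this
    simp at this
  obtain ⟨s, hs⟩ := hTc.exists_eq_range hTne
  -- A countable subcover made disjoint cuts the space into measurable pieces, each inside one
  -- chart. Summing the chart measures over the pieces gives a measure `ν`, which is then shown to
  -- be the supremum.
  set D : ℕ → Set S := disjointed fun k => U (s k) with hD
  have hDm : ∀ k, MeasurableSet (D k) := fun k =>
    MeasurableSet.disjointed (fun j => (hU (s j)).measurableSet) k
  have hDU : ∀ k, D k ⊆ U (s k) := fun k => disjointed_subset _ k
  have hDd : Pairwise (Function.onFun Disjoint D) := disjoint_disjointed _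
  have hDu : ⋃ k, D k = univ := by
    rw [hD, iUnion_disjointed, ← hTu, hs, biUnion_range]
  have hsplit : ∀ (m : Measure S) (A : Set S), MeasurableSet A → m A = ∑' k, m (A ∩ D k) := by
    intro m A hA
    rw [← measure_iUnion (fun i j hij => (hDd hij).mono inter_subset_right inter_subset_right)
      (fun k => hA.inter (hDm k)), ← inter_iUnion, hDu, inter_univ]
  have hpart : ∀ (q : S) (A : Set S), μ q A = μ q (A ∩ U q) := by
    intro q A
    exact (measure_inter_conull (hμ q)).symm
  set ν : Measure S := Measure.sum fun k => (μ (s k)).restrict (D k) with hν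
  have hνA : ∀ A, MeasurableSet A → ν A = ∑' k, μ (s k) (A ∩ D k) := by
    intro A hA
    rw [hν, Measure.sum_apply _ hA]
    exact tsum_congr fun k => Measure.restrict_apply hA
  have hsub : ∀ q A, MeasurableSet A → A ⊆ U q → ν A = μ q A := by
    intro q A hA hAq
    rw [hνA A hA, hsplit (μ q) A hA]
    exact tsum_congr fun k => hagree _ _ _ (hA.inter (hDm k))
      (inter_subset_right.trans (hDU k)) (inter_subset_left.trans hAq)
  have hsup : (⨆ q, μ q) = ν := by
    apply le_antisymm
    · refine iSup_le fun q => Measure.le_iff.2 fun A hA => ?_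
      rw [hpart q A, ← hsub q _ (hA.inter (hU q).measurableSet) inter_subset_right]
      exact measure_mono inter_subset_left
    · refine Measure.le_iff.2 fun A hA => ?_
      rw [hνA A hA, hsplit _ A hA]
      exact ENNReal.tsum_le_tsum fun k => (le_iSup μ (s k)) _
  ext A hA
  rw [hsup, Measure.restrict_apply hA, hsub p _ (hA.inter (hU p).measurableSet) inter_subset_right,
    ← hpart]

lemma measurableSet_inter_preimage_of_continuousOn {X Y : Type*} [TopologicalSpace X]
    [MeasurableSpace X] [OpensMeasurableSpace X] [TopologicalSpace Y] [MeasurableSpace Y]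
    [BorelSpace Y] {f : X → Y} {s : Set X} (hf : ContinuousOn f s) (hs : MeasurableSet s)
    {A : Set Y} (hA : MeasurableSet A) : MeasurableSet (f ⁻¹' A ∩ s) := by
  have h1 : Measurable (s.domRestrict f) := (continuousOn_iff_continuous_domRestrict.1
      hf).measurable
  have h2 := hs.subtype_image (h1 hA)
  convert h2 using 1
  ext x
  constructor
  · rintro ⟨hA, hx⟩
    exact ⟨⟨x, hx⟩, hA, rfl⟩
  · rintro ⟨⟨z, hz⟩, hA, rfl⟩
    exact ⟨hA, hz⟩

/-! ### The volume measure of a field of bilinear forms -/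

section Volume

variable {n : ℕ} {S : Type*} [TopologicalSpace S] [ChartedSpace (Euc n) S]
  [IsManifold (𝓡 n) ∞ S]

/-- A field of bilinear forms on the tangent spaces whose coefficients in charts are smooth. -/
structure IsFormField (h : ∀ x : S, TangentSpace (𝓡 n) x → TangentSpace (𝓡 n) x → ℝ) :
    Prop where
  bilin : ∀ x, ∃ B : Euc n →ₗ[ℝ] Euc n →ₗ[ℝ] ℝ, ∀ v w : Euc n, h x v w = B v w
  continuousOn : ∀ p i j, ContinuousOn (fun y => tensorCoeff h p y i j)
    (chartAt (Euc n) p).target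

variable {h h' : ∀ x : S, TangentSpace (𝓡 n) x → TangentSpace (𝓡 n) x → ℝ}

/-- The two coefficient matrices are congruent through the Jacobian matrix `J`, as in `Jᵀ H J`, so
its determinant enters squared. -/
lemma tensorCoeff_transition (hb : IsFormField h) {p q : S} {y : Euc n} (hy : y ∈ overlap p q) :
    (tensorCoeff h p y).det =
      (tensorCoeff h q (transition p q y)).det * (fderiv ℝ (transition p q) y).det ^ 2 := by
  set J : Matrix (Fin n) (Fin n) ℝ :=
    Matrix.of fun k i => fderiv ℝ (transition p q) y (EuclideanSpace.single i (1 : ℝ)) k with hJ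
  have hJdet : J.det = (fderiv ℝ (transition p q) y).det := by
    rw [ContinuousLinearMap.det,
      ← LinearMap.det_toMatrix (EuclideanSpace.basisFun (Fin n) ℝ).toBasis]
    congr 1
  obtain ⟨B, hB⟩ := hb.bilin ((chartAt (Euc n) q).symm (transition p q y))
  have key : ∀ z : S, z = (chartAt (Euc n) q).symm (transition p q y) →
      ∀ v w : Euc n, h z v w = B v w := by
    rintro z rfl v w; exact hB v w
  have hmat : tensorCoeff h p y = J.transpose * tensorCoeff h q (transition p q y) * J := by
    ext i j
    have e1 : tensorCoeff h p y i j = B (chartFrame p y (EuclideanSpace.single i (1 : ℝ)))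
        (chartFrame p y (EuclideanSpace.single j (1 : ℝ))) :=
      key _ (symm_transition hy).symm _ _
    have e2 : ∀ k l, tensorCoeff h q (transition p q y) k l =
        B (chartFrame q (transition p q y) (EuclideanSpace.single k (1 : ℝ)))
        (chartFrame q (transition p q y) (EuclideanSpace.single l (1 : ℝ))) :=
      fun k l => hB _ _
    rw [e1, ← chartFrame_transition hy, ← chartFrame_transition hy]
    have e3 := bilin_eq_sum (B.compl₁₂
      (chartFrame q (transition p q y)).toLinearMap (chartFrame q (transition p q y)).toLinearMap)
      (fderiv ℝ (transition p q) y (EuclideanSpace.single i (1 : ℝ)))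
      (fderiv ℝ (transition p q) y (EuclideanSpace.single j (1 : ℝ)))
    simp only [LinearMap.compl₁₂_apply, ContinuousLinearMap.coe_coe] at e3
    rw [e3]
    simp only [Matrix.mul_apply, Matrix.transpose_apply, hJ, Matrix.of_apply, e2, smul_eq_mul,
      Finset.sum_mul]
    rw [Finset.sum_comm]
    exact Finset.sum_congr rfl fun a _ => Finset.sum_congr rfl fun b _ => by ring
  rw [hmat, Matrix.det_mul, Matrix.det_mul, Matrix.det_transpose, hJdet]
  ring

variable [MeasurableSpace S] [BorelSpace S]

/-- The density of the volume in the chart at `p`. -/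
def volDensity (h : ∀ x : S, TangentSpace (𝓡 n) x → TangentSpace (𝓡 n) x → ℝ) (p : S)
    (y : Euc n) : ℝ≥0∞ := ENNReal.ofReal (Real.sqrt (tensorCoeff h p y).det)

lemma volDensity_continuousOn (hb : IsFormField h) (p : S) :
    ContinuousOn (volDensity h p) (chartAt (Euc n) p).target := by
  refine ENNReal.continuous_ofReal.comp_continuousOn
    (Real.continuous_sqrt.comp_continuousOn ?_)
  simp only [Matrix.det_apply]
  refine continuousOn_finsetSum _ fun σ _ => ContinuousOn.const_smul ?_ _
  exact continuousOn_finsetProd _ fun i _ => hb.continuousOn p _ _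

lemma volDensity_transition (hb : IsFormField h) {p q : S} {y : Euc n} (hy : y ∈ overlap p q) :
    volDensity h p y = ENNReal.ofReal |(fderiv ℝ (transition p q) y).det| *
      volDensity h q (transition p q y) := by
  rw [volDensity, tensorCoeff_transition hb hy, mul_comm, Real.sqrt_mul (sq_nonneg _),
    Real.sqrt_sq_eq_abs, ENNReal.ofReal_mul (abs_nonneg _)]
  rfl

lemma aemeasurable_chart_symm (p : S) (g : Euc n → ℝ≥0∞) :
    AEMeasurable (chartAt (Euc n) p).symm
      (((volume : Measure (Euc n)).restrict (chartAt (Euc n) p).target).withDensity g) :=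
  ((chartAt (Euc n) p).continuousOn_symm.aemeasurable
    (chartAt (Euc n) p).open_target.measurableSet).mono_ac (withDensity_absolutelyContinuous _ _)

lemma lintegral_chartVolume (hb : IsFormField h) (p : S) {g : S → ℝ≥0∞} (hg : Measurable g) :
    ∫⁻ x, g x ∂(chartVolume h p) = ∫⁻ y in (chartAt (Euc n) p).target,
      volDensity h p y * g ((chartAt (Euc n) p).symm y) := by
  have hm : AEMeasurable (chartAt (Euc n) p).symm
      ((volume : Measure (Euc n)).restrict (chartAt (Euc n) p).target) :=
    (chartAt (Euc n) p).continuousOn_symm.aemeasurable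
      (chartAt (Euc n) p).open_target.measurableSet
  rw [chartVolume, lintegral_map' hg.aemeasurable (aemeasurable_chart_symm p _)]
  have hd : AEMeasurable (volDensity h p)
      ((volume : Measure (Euc n)).restrict (chartAt (Euc n) p).target) :=
    (volDensity_continuousOn hb p).aemeasurable (chartAt (Euc n) p).open_target.measurableSet
  exact lintegral_withDensity_eq_lintegral_mul₀ hd (hg.comp_aemeasurable hm)

lemma chartVolume_apply (p : S) {A : Set S} (hA : MeasurableSet A) :
    chartVolume h p A = ∫⁻ y in (chartAt (Euc n) p).symm ⁻¹' A ∩ (chartAt (Euc n) p).target,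
      volDensity h p y := by
  rw [chartVolume, Measure.map_apply_of_aemeasurable (aemeasurable_chart_symm p _) hA,
    withDensity_apply', Measure.restrict_restrict' (chartAt (Euc n) p).open_target.measurableSet]
  rfl

lemma chartVolume_compl (p : S) : chartVolume h p (chartAt (Euc n) p).sourceᶜ = 0 := by
  rw [chartVolume_apply p (chartAt (Euc n) p).open_source.measurableSet.compl]
  have : (chartAt (Euc n) p).symm ⁻¹' (chartAt (Euc n) p).sourceᶜ ∩ (chartAt (Euc n) p).target
      = ∅ := by
    ext y
    simp only [mem_inter_iff, mem_preimage, mem_compl_iff, mem_empty_iff_false, iff_false, not_and]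
    exact fun h1 h2 => h1 ((chartAt (Euc n) p).map_target h2)
  rw [this]
  simp

/-- Change of variables along the transition map: the square root of the squared Jacobian
determinant is exactly the factor in the substitution formula. -/
lemma chartVolume_agree (hb : IsFormField h) (p q : S) {A : Set S} (hA : MeasurableSet A)
    (hp : A ⊆ (chartAt (Euc n) p).source) (hq : A ⊆ (chartAt (Euc n) q).source) :
    chartVolume h p A = chartVolume h q A := by
  rw [chartVolume_apply p hA, chartVolume_apply q hA]
  set Bp := (chartAt (Euc n) p).symm ⁻¹' A ∩ (chartAt (Euc n) p).target
  set Bq := (chartAt (Euc n) q).symm ⁻¹' A ∩ (chartAt (Euc n) q).target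
  have hBp : ∀ y ∈ Bp, y ∈ overlap (m := n) p q := fun y hy => ⟨hy.2, hq hy.1⟩
  have hBm : MeasurableSet Bp := measurableSet_inter_preimage_of_continuousOn
    (chartAt (Euc n) p).continuousOn_symm (chartAt (Euc n) p).open_target.measurableSet hA
  have himg : transition p q '' Bp = Bq := by
    ext z
    constructor
    · rintro ⟨y, hy, rfl⟩
      refine ⟨?_, (transition_mem_overlap (hBp y hy)).1⟩
      rw [mem_preimage, symm_transition (hBp y hy)]
      exact hy.1
    · intro hz
      have hz' : z ∈ overlap (m := n) q p := ⟨hz.2, hp hz.1⟩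
      refine ⟨transition q p z, ⟨?_, (transition_mem_overlap hz').1⟩, transition_transition hz'⟩
      rw [mem_preimage, symm_transition hz']
      exact hz.1
  rw [← himg, lintegral_image_eq_lintegral_abs_det_fderiv_mul volume hBm
    (fun y hy => (differentiableAt_transition (hBp y hy)).hasFDerivAt.hasFDerivWithinAt)]
  · exact setLIntegral_congr_fun hBm fun y hy => volDensity_transition hb (hBp y hy)
  · intro y hy z hz hyz
    rw [← transition_transition (hBp y hy), ← transition_transition (hBp z hz), hyz]

variable [SecondCountableTopology S]

/-- This makes the supremum of measures computable, since every later statement about the volume is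
checked inside chart domains. -/
lemma tensorVolume_restrict (hb : IsFormField h) (p : S) :
    (tensorVolume h).restrict (chartAt (Euc n) p).source = chartVolume h p :=
  iSup_measure_restrict (fun p => (chartAt (Euc n) p).open_source) (fun p => mem_chart_source _ p)
    (fun p => chartVolume_compl p) (fun p q _ hA hp hq => chartVolume_agree hb p q hA hp hq) p

/-- Comparison of the volume measures of two fields of bilinear forms. -/
lemma tensorVolume_eq_withDensity (hb : IsFormField h) (hb' : IsFormField h') {J : S → ℝ≥0∞}
    (hJ : Measurable J) (hJ' : ∀ p : S, ∀ y ∈ (chartAt (Euc n) p).target,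
      volDensity h' p y = volDensity h p y * J ((chartAt (Euc n) p).symm y)) :
    tensorVolume h' = (tensorVolume h).withDensity J := by
  have hU : ∀ p : S, IsOpen (chartAt (Euc n) p).source := fun p => (chartAt (Euc n) p).open_source
  obtain ⟨T, hTc, hT⟩ := TopologicalSpace.isOpen_iUnion_countable
    (fun p : S => (chartAt (Euc n) p).source) hU
  have hTu : ⋃ i : T, (chartAt (Euc n) (i : S)).source = univ := by
    rw [iUnion_coe_set, hT]
    exact eq_univ_of_forall fun x => mem_iUnion.2 ⟨x, mem_chart_source _ x⟩
  have : Countable T := hTc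
  refine Measure.ext_of_iUnion_eq_univ hTu fun p => ?_
  rw [tensorVolume_restrict hb', restrict_withDensity (hU p).measurableSet,
    tensorVolume_restrict hb]
  ext A hA
  rw [withDensity_apply _ hA, ← lintegral_indicator hA,
    lintegral_chartVolume hb _ (hJ.indicator hA), chartVolume_apply _ hA]
  have hm := measurableSet_inter_preimage_of_continuousOn
    (chartAt (Euc n) (p : S)).continuousOn_symm
    (chartAt (Euc n) (p : S)).open_target.measurableSet hA
  have ht := (chartAt (Euc n) (p : S)).open_target.measurableSet
  rw [← lintegral_indicator hm, ← lintegral_indicator ht]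
  congr 1
  ext y
  by_cases hy : y ∈ (chartAt (Euc n) (p : S)).target
  · by_cases hyA : (chartAt (Euc n) (p : S)).symm y ∈ A
    · rw [indicator_of_mem (show y ∈ _ ∩ _ from ⟨hyA, hy⟩), indicator_of_mem hy, indicator_of_mem
        hyA, hJ' _ _ hy]
    · rw [indicator_of_notMem (fun h => hyA h.1), indicator_of_mem hy, indicator_of_notMem hyA,
        mul_zero]
  · rw [indicator_of_notMem (fun h => hy h.2), indicator_of_notMem hy]

/-- The volume measure is finite on a neighbourhood of every point. -/
lemma tensorVolume_isLocallyFinite (hb : IsFormField h) :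
    IsLocallyFiniteMeasure (tensorVolume h) := by
  refine ⟨fun x => ?_⟩
  set e := chartAt (Euc n) x
  have hx : e x ∈ e.target := mem_chart_target _ x
  obtain ⟨r, hr, hsub⟩ := Metric.isOpen_iff.1 e.open_target (e x) hx
  set V := e.source ∩ e ⁻¹' Metric.ball (e x) (r / 2)
  have hV : IsOpen V := e.isOpen_inter_preimage Metric.isOpen_ball
  have hxV : x ∈ V := ⟨mem_chart_source _ x, Metric.mem_ball_self (by positivity)⟩
  refine ⟨V, hV.mem_nhds hxV, ?_⟩
  have h1 : tensorVolume h V = chartVolume h x V := by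
    rw [← tensorVolume_restrict hb x, Measure.restrict_apply hV.measurableSet,
      inter_eq_left.2 inter_subset_left]
  have hcb : Metric.closedBall (e x) (r / 2) ⊆ e.target := fun y hy =>
    hsub (Metric.closedBall_subset_ball (by linarith) hy)
  have hcomp : IsCompact (Metric.closedBall (e x) (r / 2)) := isCompact_closedBall _ _
  rw [h1, chartVolume_apply _ hV.measurableSet]
  have hsub2 : e.symm ⁻¹' V ∩ e.target ⊆ Metric.closedBall (e x) (r / 2) := by
    rintro y ⟨⟨h2, h3⟩, h4⟩
    rw [mem_preimage, e.right_inv h4] at h3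
    exact Metric.ball_subset_closedBall h3
  obtain ⟨c, hc⟩ := (hcomp.image_of_continuousOn (f := fun y => (tensorCoeff h x y).det.sqrt) (by
    refine (Real.continuous_sqrt.comp_continuousOn ?_)
    simp only [Matrix.det_apply]
    refine continuousOn_finsetSum _ fun σ _ => ContinuousOn.const_smul ?_ _
    exact continuousOn_finsetProd _ fun i _ => (hb.continuousOn x _ _).mono hcb)).bddAbove
  calc ∫⁻ y in e.symm ⁻¹' V ∩ e.target, volDensity h x y
      ≤ ∫⁻ y in Metric.closedBall (e x) (r / 2), volDensity h x y := lintegral_mono_set hsub2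
    _ ≤ ∫⁻ y in Metric.closedBall (e x) (r / 2), ENNReal.ofReal c :=
        setLIntegral_mono' hcomp.measurableSet fun y hy =>
          ENNReal.ofReal_le_ofReal (hc (mem_image_of_mem _ hy))
    _ < ⊤ := by
        rw [setLIntegral_const]
        exact ENNReal.mul_lt_top ENNReal.ofReal_lt_top hcomp.measure_lt_top

/-- The volume measure of a positive definite metric charges every nonempty open set. -/
lemma tensorVolume_pos (hb : IsFormField h)
    (hpos : ∀ p : S, ∀ y ∈ (chartAt (Euc n) p).target, 0 < (tensorCoeff h p y).det)
    {O : Set S} (hO : IsOpen O) {x : S} (hx : x ∈ O) : 0 < tensorVolume h O := by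
  set e := chartAt (Euc n) x
  have hV : IsOpen (O ∩ e.source) := hO.inter e.open_source
  have h1 : tensorVolume h (O ∩ e.source) = chartVolume h x (O ∩ e.source) := by
    rw [← tensorVolume_restrict hb x, Measure.restrict_apply hV.measurableSet,
      inter_eq_left.2 inter_subset_right]
  refine lt_of_lt_of_le ?_ (measure_mono (inter_subset_left : O ∩ e.source ⊆ O))
  rw [h1, chartVolume_apply _ hV.measurableSet]
  have hW : IsOpen (e.symm ⁻¹' (O ∩ e.source) ∩ e.target) := by
    rw [inter_comm]; exact e.symm.isOpen_inter_preimage hV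
  have hxW : e x ∈ e.symm ⁻¹' (O ∩ e.source) ∩ e.target := by
    refine ⟨?_, mem_chart_target _ x⟩
    rw [mem_preimage, e.left_inv (mem_chart_source _ x)]
    exact ⟨hx, mem_chart_source _ x⟩
  rw [pos_iff_ne_zero]
  intro h0
  rw [setLIntegral_eq_zero_iff' hW.measurableSet
    (((volDensity_continuousOn hb x).mono inter_subset_right).aemeasurable hW.measurableSet)] at h0
  have h2 : volume (e.symm ⁻¹' (O ∩ e.source) ∩ e.target) = 0 := by
    rw [ae_iff] at h0
    refine measure_mono_null ?_ h0
    intro y hy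
    rw [mem_ofPred_eq]
    intro hy0
    exact (ENNReal.ofReal_pos.2 (Real.sqrt_pos.2 (hpos x y hy.2))).ne' (hy0 hy)
  exact (hW.measure_pos volume ⟨_, hxW⟩).ne' h2

end Volume

/-! ### Derivatives of determinants -/

lemma contDiffAt_deriv {F : Type*} [NormedAddCommGroup F] [NormedSpace ℝ F] {u : ℝ → F} {t : ℝ}
    (h : ContDiffAt ℝ ∞ u t) : ContDiffAt ℝ ∞ (deriv u) t := by
  have h1 : ContDiffAt ℝ ∞ (fderiv ℝ u) t := h.fderiv_right (by simp)
  exact h1.clm_apply contDiffAt_const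

section DetDerivative

variable {ι : Type*} [Fintype ι] [DecidableEq ι]

/-- The differential of the determinant at the identity is the trace. The determinant is smooth, so
its differential can be found along lines, where `det (1 + X B)` is a polynomial in `X` whose
derivative at `0` is the trace of `B`. The chain rule then covers arbitrary curves. -/
lemma hasDerivAt_det_one_add {M : ℝ → Matrix ι ι ℝ} {M' : Matrix ι ι ℝ} {t : ℝ}
    (hM : ∀ i j, HasDerivAt (fun s => M s i j) (M' i j) t) (h0 : M t = 0) :
    HasDerivAt (fun s => (1 + M s).det) M'.trace t := by
  set g : (ι → ι → ℝ) → ℝ := fun B => (1 + Matrix.of B : Matrix ι ι ℝ).det with hg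
  have hgd : DifferentiableAt ℝ g 0 := by
    have : ContDiffAt ℝ 1 g 0 := by
      refine contDiffAt_det fun i j => ?_
      simp only [Matrix.add_apply, Matrix.of_apply]
      have h1 : ContDiff ℝ 1 (fun B : ι → ι → ℝ => B i j) := contDiff_apply_apply ℝ ℝ i j
      exact contDiffAt_const.add h1.contDiffAt
    exact this.differentiableAt one_ne_zero
  have hdir : ∀ B : Matrix ι ι ℝ, fderiv ℝ g 0 (Matrix.of.symm B) = B.trace := by
    intro B
    have h1 : HasDerivAt (fun s : ℝ => s • (Matrix.of.symm B : ι → ι → ℝ))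
        (Matrix.of.symm B) 0 := by
      simpa using (hasDerivAt_id (0 : ℝ)).smul_const (Matrix.of.symm B : ι → ι → ℝ)
    have h2 : HasDerivAt (g ∘ fun s : ℝ => s • (Matrix.of.symm B : ι → ι → ℝ))
        (fderiv ℝ g 0 (Matrix.of.symm B)) 0 := by
      refine HasFDerivAt.comp_hasDerivAt (l := g) (l' := fderiv ℝ g 0) 0 ?_ h1
      simpa using hgd.hasFDerivAt
    have h3 : (g ∘ fun s : ℝ => s • (Matrix.of.symm B : ι → ι → ℝ)) =
        fun s : ℝ => (1 + (Polynomial.X : Polynomial ℝ) •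
          B.map Polynomial.C).det.eval s := by
      funext s
      simp only [Function.comp, hg]
      rw [← Polynomial.coe_evalRingHom, RingHom.map_det]
      congr 1
      ext i j
      simp [Matrix.one_apply]
      split_ifs <;> simp [mul_comm]
    rw [h3] at h2
    have h4 := Polynomial.hasDerivAt (1 + (Polynomial.X : Polynomial ℝ) •
          B.map Polynomial.C).det 0
    rw [Matrix.derivative_det_one_add_X_smul] at h4
    exact h2.unique h4
  have hM2 : HasDerivAt (fun s => (Matrix.of.symm (M s) : ι → ι → ℝ)) (Matrix.of.symm M') t :=
    hasDerivAt_pi.2 fun i => hasDerivAt_pi.2 fun j => hM i j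
  have h5 : HasDerivAt (g ∘ fun s => (Matrix.of.symm (M s) : ι → ι → ℝ))
      (fderiv ℝ g 0 (Matrix.of.symm M')) t := by
    refine HasFDerivAt.comp_hasDerivAt (l := g) (l' := fderiv ℝ g 0) t ?_ hM2
    rw [h0]
    exact hgd.hasFDerivAt
  rw [hdir] at h5
  exact h5

/-- Jacobi's formula. -/
lemma hasDerivAt_det {A : ℝ → Matrix ι ι ℝ} {A' : Matrix ι ι ℝ} {t : ℝ}
    (hA : ∀ i j, HasDerivAt (fun s => A s i j) (A' i j) t) (hdet : (A t).det ≠ 0) :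
    HasDerivAt (fun s => (A s).det) ((A t).det * ((A t)⁻¹ * A').trace) t := by
  have hu : IsUnit (A t).det := hdet.isUnit
  -- Factoring out `A t` reduces the claim to a curve through the identity.
  have h1 : ∀ s, (A s).det = (A t).det * (1 + (A t)⁻¹ * (A s - A t)).det := by
    intro s
    rw [← Matrix.det_mul, Matrix.mul_add, ← Matrix.mul_assoc, Matrix.mul_nonsing_inv _ hu]
    simp
  have h2 : (fun s => (A s).det) = fun s => (A t).det * (1 + (A t)⁻¹ * (A s - A t)).det :=
    funext h1
  rw [h2]
  refine HasDerivAt.const_mul _ (hasDerivAt_det_one_add (M' := (A t)⁻¹ * A') (fun i j => ?_)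
    (by simp))
  simp only [Matrix.mul_apply, Matrix.sub_apply]
  exact HasDerivAt.fun_sum fun k _ => ((hA k j).sub_const _).const_mul _

/-- The inverse is differentiable by Cramer's rule. Its derivative is then found by differentiating
`A A⁻¹ = 1`, which holds near `t`. -/
lemma hasDerivAt_matrix_inv {A : ℝ → Matrix ι ι ℝ} {A' : Matrix ι ι ℝ} {t : ℝ}
    (hc : ∀ i j, ContDiffAt ℝ 1 (fun s => A s i j) t)
    (hA : ∀ i j, HasDerivAt (fun s => A s i j) (A' i j) t) (hdet : (A t).det ≠ 0) (i j : ι) :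
    HasDerivAt (fun s => (A s)⁻¹ i j) ((-((A t)⁻¹ * A' * (A t)⁻¹)) i j) t := by
  have hu : IsUnit (A t).det := hdet.isUnit
  have hd : ∀ i j, DifferentiableAt ℝ (fun s => (A s)⁻¹ i j) t := fun i j =>
    (contDiffAt_matrix_inv hc hdet i j).differentiableAt one_ne_zero
  set P : Matrix ι ι ℝ := Matrix.of fun i j => deriv (fun s => (A s)⁻¹ i j) t with hP
  have h1 : ∀ᶠ s in 𝓝 t, A s * (A s)⁻¹ = 1 := by
    have hcont : ContinuousAt (fun s => (A s).det) t := (contDiffAt_det hc).continuousAt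
    filter_upwards [hcont.eventually_ne hdet] with s hs
    exact Matrix.mul_nonsing_inv _ hs.isUnit
  have h2 : A' * (A t)⁻¹ + A t * P = 0 := by
    ext i j
    have h3 : HasDerivAt (fun s => ∑ k, A s i k * (A s)⁻¹ k j)
        (∑ k, (A' i k * (A t)⁻¹ k j + A t i k * P k j)) t :=
      HasDerivAt.fun_sum fun k _ => (hA i k).mul (hd k j).hasDerivAt
    have h4 : (fun s => ∑ k, A s i k * (A s)⁻¹ k j) =ᶠ[𝓝 t] fun _ => (1 : Matrix ι ι ℝ) i j := by
      filter_upwards [h1] with s hs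
      rw [← hs, Matrix.mul_apply]
    have h5 := h3.unique ((hasDerivAt_const t _).congr_of_eventuallyEq h4)
    rw [Finset.sum_add_distrib] at h5
    simpa [Matrix.mul_apply] using h5
  have h6 : P = -((A t)⁻¹ * A' * (A t)⁻¹) := by
    have h7 : (A t)⁻¹ * (A t * P) = P := by
      rw [← Matrix.mul_assoc, Matrix.nonsing_inv_mul _ hu, Matrix.one_mul]
    rw [← h7, eq_neg_of_add_eq_zero_right h2, Matrix.mul_neg, Matrix.mul_assoc]
  rw [← h6]
  exact (hd i j).hasDerivAt

/-- The second derivative of the logarithm of a determinant. -/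
lemma deriv_deriv_log_det {A : ℝ → Matrix ι ι ℝ} {A₁ A₂ : Matrix ι ι ℝ} {t : ℝ}
    (hc : ∀ i j, ContDiffAt ℝ ∞ (fun s => A s i j) t)
    (h1 : ∀ i j, deriv (fun s => A s i j) t = A₁ i j)
    (h2 : ∀ i j, deriv (deriv fun s => A s i j) t = A₂ i j) (hdet : 0 < (A t).det) :
    deriv (fun s => Real.log (A s).det) t = ((A t)⁻¹ * A₁).trace ∧
    deriv (deriv fun s => Real.log (A s).det) t =
      ((A t)⁻¹ * A₂).trace - ((A t)⁻¹ * A₁ * (A t)⁻¹ * A₁).trace := by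
  have hcont : ContinuousAt (fun s => (A s).det) t := (contDiffAt_det hc).continuousAt
  have hev : ∀ᶠ s in 𝓝 t, ∀ i j, ContDiffAt ℝ 1 (fun s => A s i j) s := by
    rw [Filter.eventually_all]; intro i
    rw [Filter.eventually_all]; intro j
    exact ((hc i j).of_le (by simp)).eventually (by simp)
  have hlog : (deriv fun s => Real.log (A s).det) =ᶠ[𝓝 t]
      fun s => ((A s)⁻¹ * Matrix.of fun i j => deriv (fun s => A s i j) s).trace := by
    filter_upwards [hcont.eventually (lt_mem_nhds hdet), hev] with s hs hd
    have h3 := (hasDerivAt_det (A' := Matrix.of fun i j => deriv (fun s => A s i j) s)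
      (fun i j => ((hd i j).differentiableAt one_ne_zero).hasDerivAt) hs.ne').log hs.ne'
    rw [h3.deriv, mul_div_cancel_left₀ _ hs.ne']
  have hA1 : (Matrix.of fun i j => deriv (fun s => A s i j) t) = A₁ := by
    ext i j; exact h1 i j
  refine ⟨by rw [hlog.eq_of_nhds, hA1], ?_⟩
  rw [hlog.deriv_eq]
  have hinv := fun i j => hasDerivAt_matrix_inv (A' := A₁) (fun i j => (hc i j).of_le (by simp))
    (fun i j => by
      rw [← h1 i j]; exact ((hc i j).differentiableAt (by simp)).hasDerivAt) hdet.ne' i j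
  have hd2 : ∀ i j, HasDerivAt (deriv fun s => A s i j) (A₂ i j) t := by
    intro i j
    rw [← h2 i j]
    refine DifferentiableAt.hasDerivAt ?_
    have : ContDiffAt ℝ ∞ (deriv fun s => A s i j) t := contDiffAt_deriv (hc i j)
    exact this.differentiableAt (by simp)
  set Q := -((A t)⁻¹ * A₁ * (A t)⁻¹) with hQ
  have h5 : HasDerivAt (fun s => ((A s)⁻¹ * Matrix.of fun i j => deriv (fun s => A s i j) s).trace)
      ((Q * A₁).trace + ((A t)⁻¹ * A₂).trace) t := by
    simp only [Matrix.trace, Matrix.diag, Matrix.mul_apply, Matrix.of_apply,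
      ← Finset.sum_add_distrib]
    refine HasDerivAt.fun_sum fun i _ => HasDerivAt.fun_sum fun k _ => ?_
    have := (hinv i k).mul (hd2 k i)
    rw [h1] at this
    exact this
  rw [h5.deriv, hQ, Matrix.neg_mul, Matrix.trace_neg]
  ring

end DetDerivative

/-! ### Covariant derivatives along curves -/

section Covariant

variable {E : Type*} [NormedAddCommGroup E] [NormedSpace ℝ E]

/-- A metric on an open set with its Levi-Civita connection. -/
structure IsMetricConnection (Ω : Set E) (G : E → E →L[ℝ] E →L[ℝ] ℝ)
    (Γ : E → E →L[ℝ] E →L[ℝ] E) : Prop where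
  isOpen : IsOpen Ω
  metric_smooth : ∀ z ∈ Ω, ContDiffAt ℝ ∞ G z
  conn_smooth : ∀ z ∈ Ω, ContDiffAt ℝ ∞ Γ z
  metric_symm : ∀ z v w, G z v w = G z w v
  conn_symm : ∀ z v w, Γ z v w = Γ z w v
  compat : ∀ z ∈ Ω, ∀ v w u, fderiv ℝ G z v w u = G z (Γ z v w) u + G z w (Γ z v u)
  pos : ∀ z ∈ Ω, ∀ v, v ≠ 0 → 0 < G z v v

/-- The covariant derivative of a vector field along a curve. -/
def covD (Γ : E → E →L[ℝ] E →L[ℝ] E) (c W : ℝ → E) (t : ℝ) : E :=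
  deriv W t + Γ (c t) (deriv c t) (W t)

/-- The curvature of a connection. -/
def curv (Γ : E → E →L[ℝ] E →L[ℝ] E) (z X Y W : E) : E :=
  fderiv ℝ Γ z X Y W - fderiv ℝ Γ z Y X W + Γ z X (Γ z Y W) - Γ z Y (Γ z X W)

variable {Ω : Set E} {G : E → E →L[ℝ] E →L[ℝ] ℝ} {Γ : E → E →L[ℝ] E →L[ℝ] E}

lemma hasDerivAt_bilin_curve {H : Type*} [NormedAddCommGroup H] [NormedSpace ℝ H]
    {B : E → E →L[ℝ] E →L[ℝ] H} {c W W' : ℝ → E} {t : ℝ} (hB : DifferentiableAt ℝ B (c t))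
    (hc : DifferentiableAt ℝ c t) (hW : DifferentiableAt ℝ W t) (hW' : DifferentiableAt ℝ W' t) :
    HasDerivAt (fun s => B (c s) (W s) (W' s))
      (fderiv ℝ B (c t) (deriv c t) (W t) (W' t) + B (c t) (deriv W t) (W' t)
        + B (c t) (W t) (deriv W' t)) t := by
  have h := ((hB.hasFDerivAt.comp_hasDerivAt t hc.hasDerivAt).clm_apply
    hW.hasDerivAt).clm_apply hW'.hasDerivAt
  simpa using h

lemma contDiffAt_covD {c W : ℝ → E} {t : ℝ} (hΓ : ContDiffAt ℝ ∞ Γ (c t))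
    (hc : ContDiffAt ℝ ∞ c t) (hW : ContDiffAt ℝ ∞ W t) : ContDiffAt ℝ ∞ (covD Γ c W) t :=
  (contDiffAt_deriv hW).add
    (contDiffAt_bilin (B := fun s => Γ (c s)) (hΓ.comp t hc) (contDiffAt_deriv hc) hW)

lemma deriv_metric_curve (hG : IsMetricConnection Ω G Γ) {c W W' : ℝ → E} {t : ℝ} (ht : c t ∈ Ω)
    (hc : DifferentiableAt ℝ c t) (hW : DifferentiableAt ℝ W t) (hW' : DifferentiableAt ℝ W' t) :
    deriv (fun s => G (c s) (W s) (W' s)) t =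
      G (c t) (covD Γ c W t) (W' t) + G (c t) (W t) (covD Γ c W' t) := by
  rw [(hasDerivAt_bilin_curve ((hG.metric_smooth _ ht).differentiableAt (by simp)) hc hW hW').deriv,
    hG.compat _ ht]
  simp only [covD, map_add, add_apply]
  ring

lemma deriv_deriv_metric_curve (hG : IsMetricConnection Ω G Γ) {c W W' : ℝ → E} {t : ℝ}
    (ht : c t ∈ Ω) (hc : ContDiffAt ℝ ∞ c t) (hW : ContDiffAt ℝ ∞ W t)
    (hW' : ContDiffAt ℝ ∞ W' t) :
    deriv (deriv fun s => G (c s) (W s) (W' s)) t =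
      G (c t) (covD Γ c (covD Γ c W) t) (W' t) + 2 * G (c t) (covD Γ c W t) (covD Γ c W' t)
        + G (c t) (W t) (covD Γ c (covD Γ c W') t) := by
  have hev : ∀ u : ℝ → E, ContDiffAt ℝ ∞ u t → ∀ᶠ s in 𝓝 t, DifferentiableAt ℝ u s := by
    intro u hu
    filter_upwards [(hu.of_le (m := 1) (by simp)).eventually (by simp)] with s hs
    exact hs.differentiableAt one_ne_zero
  have h1 : (deriv fun s => G (c s) (W s) (W' s)) =ᶠ[𝓝 t] fun s =>
      G (c s) (covD Γ c W s) (W' s) + G (c s) (W s) (covD Γ c W' s) := by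
    filter_upwards [hc.continuousAt (hG.isOpen.mem_nhds ht), hev c hc, hev W hW, hev W' hW']
      with s h1 h2 h3 h4
    exact deriv_metric_curve hG h1 h2 h3 h4
  have hΓ := hG.conn_smooth _ ht
  have hD := (contDiffAt_covD hΓ hc hW).differentiableAt (by simp)
  have hD' := (contDiffAt_covD hΓ hc hW').differentiableAt (by simp)
  have dc := hc.differentiableAt (by simp)
  have dW := hW.differentiableAt (by simp)
  have dW' := hW'.differentiableAt (by simp)
  have dG := (hG.metric_smooth _ ht).differentiableAt (by simp)
  have e1 := (hasDerivAt_bilin_curve dG dc hD dW').differentiableAt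
  have e2 := (hasDerivAt_bilin_curve dG dc dW hD').differentiableAt
  rw [h1.deriv_eq, deriv_fun_add e1 e2, deriv_metric_curve hG ht dc hD dW',
    deriv_metric_curve hG ht dc dW hD']
  ring

/-! ### Two-parameter maps -/

variable {Y : Type*} [NormedAddCommGroup Y] [NormedSpace ℝ Y]

lemma hasDerivAt_slice {H : ℝ × Y → E} {t : ℝ} {y : Y} (h : DifferentiableAt ℝ H (t, y)) :
    HasDerivAt (fun s => H (s, y)) (fderiv ℝ H (t, y) (1, 0)) t := by
  have h1 : HasDerivAt (fun s : ℝ => (s, y)) ((1 : ℝ), (0 : Y)) t :=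
    (hasDerivAt_id t).prodMk (hasDerivAt_const t y)
  exact h.hasFDerivAt.comp_hasDerivAt t h1

lemma fderiv_slice {H : ℝ × Y → E} {t : ℝ} {y : Y} (h : DifferentiableAt ℝ H (t, y)) (w : Y) :
    fderiv ℝ (fun z => H (t, z)) y w = fderiv ℝ H (t, y) (0, w) := by
  have h1 : HasFDerivAt (fun z : Y => (t, z)) (ContinuousLinearMap.inr ℝ ℝ Y) y :=
    hasFDerivAt_prodMk_right t y
  have h2 := h.hasFDerivAt.comp y h1
  have h3 : fderiv ℝ (fun z => H (t, z)) y = _ := h2.fderiv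
  rw [h3]
  simp

lemma contDiffAt_partial {H : ℝ × Y → E} {q : ℝ × Y} (h : ContDiffAt ℝ ∞ H q) (v : ℝ × Y) :
    ContDiffAt ℝ ∞ (fun r => fderiv ℝ H r v) q := by
  have h1 : ContDiffAt ℝ ∞ (fderiv ℝ H) q := h.fderiv_right (by simp)
  exact h1.clm_apply contDiffAt_const

/-- Symmetry of mixed partial derivatives. -/
lemma fderiv_partial_comm {H : ℝ × Y → E} {q : ℝ × Y} (h : ContDiffAt ℝ ∞ H q) (v w : ℝ × Y) :
    fderiv ℝ (fun r => fderiv ℝ H r v) q w = fderiv ℝ (fun r => fderiv ℝ H r w) q v := by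
  have h1 : DifferentiableAt ℝ (fderiv ℝ H) q :=
    ContDiffAt.differentiableAt (n := ∞) (h.fderiv_right (by simp)) (by simp)
  rw [fderiv_clm_eval h1 (differentiableAt_const v), fderiv_clm_eval h1 (differentiableAt_const w)]
  simp only [fderiv_const_eval, map_zero, add_zero]
  exact (h.isSymmSndFDerivAt (by simpa using ENat.LEInfty.out)).eq w v

lemma eventually_contDiffAt {X F : Type*} [NormedAddCommGroup X] [NormedSpace ℝ X]
    [NormedAddCommGroup F] [NormedSpace ℝ F] {H : X → F} {q : X} (h : ContDiffAt ℝ ∞ H q)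
    (k : ℕ) : ∀ᶠ r in 𝓝 q, ContDiffAt ℝ k H r :=
  (h.of_le (by exact_mod_cast le_top)).eventually (by simp)

lemma deriv_slice_eventuallyEq {H : ℝ × Y → E} {t : ℝ} {y : Y}
    (h : ∀ᶠ q in 𝓝 (t, y), ContDiffAt ℝ ∞ H q) :
    (deriv fun s => H (s, y)) =ᶠ[𝓝 t] fun s => fderiv ℝ H (s, y) (1, 0) := by
  have h1 : ContinuousAt (fun s : ℝ => (s, y)) t := by fun_prop
  filter_upwards [h1.eventually h] with s hs
  exact (hasDerivAt_slice (hs.differentiableAt (by simp))).deriv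

lemma contDiffAt_slice {H : ℝ × Y → E} {t : ℝ} {y : Y} (h : ContDiffAt ℝ ∞ H (t, y)) :
    ContDiffAt ℝ ∞ (fun s => H (s, y)) t :=
  h.comp t (contDiffAt_id.prodMk contDiffAt_const)

lemma contDiffAt_slice_right {H : ℝ × Y → E} {t : ℝ} {y : Y} (h : ContDiffAt ℝ ∞ H (t, y)) :
    ContDiffAt ℝ ∞ (fun z => H (t, z)) y :=
  h.comp y (contDiffAt_const.prodMk contDiffAt_id)

lemma eventually_partial {H : ℝ × Y → E} {q : ℝ × Y} (h : ∀ᶠ r in 𝓝 q, ContDiffAt ℝ ∞ H r)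
    (v : ℝ × Y) : ∀ᶠ r in 𝓝 q, ContDiffAt ℝ ∞ (fun r => fderiv ℝ H r v) r :=
  h.mono fun _ hr => contDiffAt_partial hr v

/-- The second derivative of a slice. -/
lemma deriv_deriv_slice {H : ℝ × Y → E} {t : ℝ} {y : Y}
    (h : ∀ᶠ q in 𝓝 (t, y), ContDiffAt ℝ ∞ H q) :
    deriv (deriv fun s => H (s, y)) t =
      fderiv ℝ (fun r => fderiv ℝ H r (1, 0)) (t, y) (1, 0) := by
  rw [(deriv_slice_eventuallyEq h).deriv_eq]
  exact (hasDerivAt_slice (H := fun r => fderiv ℝ H r (1, 0))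
    ((contDiffAt_partial h.self_of_nhds _).differentiableAt (by simp))).deriv

/-- The derivatives along a variation of the image of a tangent vector, when the covariant
acceleration of the variation vanishes at time zero. -/
lemma covD_variation (hG : IsMetricConnection Ω G Γ) {F : ℝ × Y → E} {y₀ : Y} {V : Y → E}
    (hF : ∀ᶠ q in 𝓝 ((0 : ℝ), y₀), ContDiffAt ℝ ∞ F q) (h0 : F (0, y₀) ∈ Ω)
    (hV : ∀ᶠ y in 𝓝 y₀, deriv (fun t => F (t, y)) 0 = V y)
    (hA : ∀ᶠ y in 𝓝 y₀, deriv (deriv fun t => F (t, y)) 0 = -Γ (F (0, y)) (V y) (V y))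
    (w : Y) :
    let c : ℝ → E := fun t => F (t, y₀)
    let W : ℝ → E := fun t => fderiv ℝ F (t, y₀) (0, w)
    let u_w : E := fderiv ℝ (fun y => F (0, y)) y₀ w
    W 0 = u_w ∧ covD Γ c W 0 = fderiv ℝ V y₀ w + Γ (F (0, y₀)) (V y₀) u_w ∧
      covD Γ c (covD Γ c W) 0 = -curv Γ (F (0, y₀)) u_w (V y₀) (V y₀) := by
  intro c W u_w
  have hF0 := hF.self_of_nhds
  have hd0 : DifferentiableAt ℝ F (0, y₀) := hF0.differentiableAt (by simp)
  have hinr : ContinuousAt (fun y : Y => ((0 : ℝ), y)) y₀ := by fun_prop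
  have hinl : ContinuousAt (fun s : ℝ => (s, y₀)) 0 := by fun_prop
  set D₁ : ℝ × Y → E := fun q => fderiv ℝ F q (1, 0) with hD₁
  have hD₁s := eventually_partial hF (1, 0)
  have hV' : (fun y => D₁ (0, y)) =ᶠ[𝓝 y₀] V := by
    filter_upwards [hinr.eventually hF, hV] with y hy hVy
    rw [← hVy]
    exact (hasDerivAt_slice (hy.differentiableAt (by simp))).deriv.symm
  have hVd : ContDiffAt ℝ ∞ V y₀ :=
    (contDiffAt_slice_right hD₁s.self_of_nhds).congr_of_eventuallyEq hV'.symm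
  have hud : ContDiffAt ℝ ∞ (fun y => F (0, y)) y₀ := contDiffAt_slice_right hF0
  have hΓd : DifferentiableAt ℝ Γ (F (0, y₀)) :=
    (hG.conn_smooth _ h0).differentiableAt (by simp)
  have hW0 : W 0 = u_w := (fderiv_slice hd0 w).symm
  have hc1 : deriv c 0 = V y₀ := hV.self_of_nhds
  have hc2 : deriv (deriv c) 0 = -Γ (F (0, y₀)) (V y₀) (V y₀) := hA.self_of_nhds
  have hcd : ContDiffAt ℝ ∞ c 0 := contDiffAt_slice hF0
  have hWd : ContDiffAt ℝ ∞ W 0 := contDiffAt_slice (contDiffAt_partial hF0 (0, w))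
  have hW1ev : deriv W =ᶠ[𝓝 0] fun s => fderiv ℝ D₁ (s, y₀) (0, w) := by
    filter_upwards [deriv_slice_eventuallyEq (eventually_partial hF (0, w)), hinl.eventually hF]
      with s hs hFs
    rw [hs]
    exact fderiv_partial_comm hFs _ _
  have hW1 : deriv W 0 = fderiv ℝ V y₀ w := by
    rw [hW1ev.eq_of_nhds, ← hV'.fderiv_eq]
    exact (fderiv_slice (hD₁s.self_of_nhds.differentiableAt (by simp)) w).symm
  -- Partial derivatives commute, so the second time derivative of `W` is the derivative along `w`
  -- of the acceleration of the variation, and the acceleration is prescribed at all points near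
  -- `y₀`.
  have hW2 : deriv (deriv W) 0 =
      fderiv ℝ (fun y => -Γ (F (0, y)) (V y) (V y)) y₀ w := by
    have e1 : deriv (deriv W) 0 = fderiv ℝ (fun q => fderiv ℝ D₁ q (0, w)) (0, y₀) (1, 0) := by
      rw [hW1ev.deriv_eq]
      exact (hasDerivAt_slice (H := fun q => fderiv ℝ D₁ q (0, w))
        ((contDiffAt_partial hD₁s.self_of_nhds _).differentiableAt (by simp))).deriv
    have e2 : (fun y => fderiv ℝ D₁ (0, y) (1, 0)) =ᶠ[𝓝 y₀]
        fun y => -Γ (F (0, y)) (V y) (V y) := by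
      filter_upwards [hA, hinr.eventually hF.eventually_nhds] with y hy hFy
      rw [← hy, deriv_deriv_slice hFy]
    rw [e1, fderiv_partial_comm hD₁s.self_of_nhds, ← e2.fderiv_eq]
    exact (fderiv_slice (H := fun q => fderiv ℝ D₁ q (1, 0))
      ((contDiffAt_partial hD₁s.self_of_nhds _).differentiableAt (by simp)) w).symm
  have hVdd := hVd.differentiableAt (by simp)
  have hudd := hud.differentiableAt (by simp)
  have hW2' : deriv (deriv W) 0 = -(fderiv ℝ Γ (F (0, y₀)) u_w (V y₀) (V y₀)
      + Γ (F (0, y₀)) (fderiv ℝ V y₀ w) (V y₀) + Γ (F (0, y₀)) (V y₀) (fderiv ℝ V y₀ w)) := by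
    rw [hW2, fderiv_fun_neg]
    change -fderiv ℝ (fun y => Γ (F (0, y)) (V y) (V y)) y₀ w = _
    rw [fderiv_bilin (B := fun y => Γ (F (0, y))) (hΓd.comp y₀ hudd) hVdd hVdd,
      fderiv_comp_eval (u := fun y => F (0, y)) hΓd hudd]
  have hDW : covD Γ c W 0 = fderiv ℝ V y₀ w + Γ (F (0, y₀)) (V y₀) u_w := by
    rw [covD, hW1, hc1, hW0]
  refine ⟨hW0, hDW, ?_⟩
  have e3 : deriv (covD Γ c W) 0 = deriv (deriv W) 0
      + (fderiv ℝ Γ (F (0, y₀)) (V y₀) (V y₀) u_w + Γ (F (0, y₀)) (deriv (deriv c) 0) u_w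
        + Γ (F (0, y₀)) (V y₀) (deriv W 0)) := by
    have e4 := hasDerivAt_bilin_curve (B := Γ) (c := c) (W := deriv c) (W' := W) (t := 0) hΓd
      (hcd.differentiableAt (by simp)) ((contDiffAt_deriv hcd).differentiableAt (by simp))
      (hWd.differentiableAt (by simp))
    rw [hc1, hW0] at e4
    exact ((((contDiffAt_deriv hWd).differentiableAt (by simp)).hasDerivAt).add e4).deriv
  have hsymD : ∀ a b e, fderiv ℝ Γ (F (0, y₀)) a b e = fderiv ℝ Γ (F (0, y₀)) a e b := by
    intro a b e
    have k1 : ∀ b e : E, fderiv ℝ (fun z => Γ z b e) (F (0, y₀)) a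
        = fderiv ℝ Γ (F (0, y₀)) a b e := fun b e => by
      rw [fderiv_bilin hΓd (differentiableAt_const b) (differentiableAt_const e),
        fderiv_const_eval, fderiv_const_eval]
      simp
    rw [← k1, ← k1]
    simp only [hG.conn_symm _ b e]
  -- This is the Jacobi equation at time zero. The terms containing the derivative of `V` cancel,
  -- and the derivatives and products of `Γ` that remain are those of the curvature.
  rw [covD, e3, hc1, hDW, hW2', hc2, hW1, curv, hsymD (V y₀) (V y₀) u_w]
  change _ + Γ (F (0, y₀)) _ _ = _
  simp only [map_add, map_neg, neg_apply]
  rw [hG.conn_symm _ (fderiv ℝ V y₀ w) (V y₀), hG.conn_symm _ (V y₀) u_w,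
    hG.conn_symm _ (Γ (F (0, y₀)) (V y₀) (V y₀)) u_w]
  abel

end Covariant

lemma differentiableAt_bilin_comp {X Y E F H : Type*} [NormedAddCommGroup X] [NormedSpace ℝ X]
    [NormedAddCommGroup Y] [NormedSpace ℝ Y] [NormedAddCommGroup E] [NormedSpace ℝ E]
    [NormedAddCommGroup F] [NormedSpace ℝ F] [NormedAddCommGroup H] [NormedSpace ℝ H]
    {B : Y → E →L[ℝ] F →L[ℝ] H} {u : X → Y} {x : X} (hB : DifferentiableAt ℝ B (u x))
    (hu : DifferentiableAt ℝ u x) : DifferentiableAt ℝ (fun z => B (u z)) x :=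
  DifferentiableAt.comp x hB hu

lemma contDiffAt_bilin_comp {X Y E F H : Type*} [NormedAddCommGroup X] [NormedSpace ℝ X]
    [NormedAddCommGroup Y] [NormedSpace ℝ Y] [NormedAddCommGroup E] [NormedSpace ℝ E]
    [NormedAddCommGroup F] [NormedSpace ℝ F] [NormedAddCommGroup H] [NormedSpace ℝ H]
    {B : Y → E →L[ℝ] F →L[ℝ] H} {u : X → Y} {x : X} {N : WithTop ℕ∞}
    (hB : ContDiffAt ℝ N B (u x)) (hu : ContDiffAt ℝ N u x) :
    ContDiffAt ℝ N (fun z => B (u z)) x :=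
  ContDiffAt.comp x hB hu

/-! ### Frames adapted to a hyperplane -/

section Frame

variable {E : Type*} [NormedAddCommGroup E] [NormedSpace ℝ E] [FiniteDimensional ℝ E] {n : ℕ}

/-- The vectors `u i` have an invertible Gram matrix and `N` is a unit vector orthogonal to them, so
these `n + 1` vectors are independent and form a basis. Pairing with the basis and inverting the
Gram matrix recovers the coordinates. -/
lemma frame_expansion (hE : Module.finrank ℝ E = n + 1) (g : E →L[ℝ] E →L[ℝ] ℝ)
    (hg : ∀ v w, g v w = g w v) {u : Fin n → E} {N : E} {h : Matrix (Fin n) (Fin n) ℝ}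
    (hh : ∀ i j, h i j = g (u i) (u j)) (hdet : h.det ≠ 0) (hN : ∀ i, g (u i) N = 0)
    (hNN : g N N = 1) (v : E) :
    v = ∑ i, (∑ j, h⁻¹ i j * g v (u j)) • u i + g v N • N := by
  let Φ : (Fin n → ℝ) × ℝ →ₗ[ℝ] E :=
    (Fintype.linearCombination ℝ u).coprod (LinearMap.toSpanSingleton ℝ E N)
  have hΦ : ∀ a s, Φ (a, s) = ∑ i, a i • u i + s • N := fun a s => by
    simp [Φ, Fintype.linearCombination_apply]
  have h1 : ∀ a s j, g (Φ (a, s)) (u j) = (Matrix.vecMul a h) j := by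
    intro a s j
    rw [hΦ]
    simp only [map_add, map_sum, map_smul, add_apply, sum_apply, smul_apply, smul_eq_mul,
      hg N (u j), hN, mul_zero, add_zero, Matrix.vecMul, dotProduct, hh]
  have h2 : ∀ a s, g (Φ (a, s)) N = s := by
    intro a s
    rw [hΦ]
    simp [hN, hNN]
  have hinj : Function.Injective Φ := by
    rw [← LinearMap.ker_eq_bot, LinearMap.ker_eq_bot']
    rintro ⟨a, s⟩ h0
    have hs : s = 0 := by rw [← h2 a s, h0]; simp
    have ha : a = 0 := by
      refine Matrix.eq_zero_of_vecMul_eq_zero hdet ?_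
      ext j
      rw [← h1 a s j, h0]; simp
    rw [hs, ha]; rfl
  have hsurj : Function.Surjective Φ := by
    refine (LinearMap.injective_iff_surjective_of_finrank_eq_finrank ?_).1 hinj
    rw [hE]; simp
  obtain ⟨⟨a, s⟩, rfl⟩ := hsurj v
  rw [h2, hΦ]
  congr 1
  refine Finset.sum_congr rfl fun i _ => ?_
  congr 1
  have h3 : (Matrix.mulVec h⁻¹ (Matrix.mulVec h a)) i = a i := by
    rw [Matrix.mulVec_mulVec, Matrix.nonsing_inv_mul _ hdet.isUnit, Matrix.one_mulVec]
  rw [← h3]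
  have h4 : Matrix.mulVec h a = Matrix.vecMul a h := by
    ext j
    simp only [Matrix.mulVec, Matrix.vecMul, dotProduct]
    exact Finset.sum_congr rfl fun k _ => by rw [hh, hh, hg, mul_comm]
  rw [h4, Matrix.mulVec, dotProduct]
  exact Finset.sum_congr rfl fun j _ => by rw [← hΦ, h1]

/-- The trace of an endomorphism in an adapted frame. -/
lemma trace_frame (hE : Module.finrank ℝ E = n + 1) (g : E →L[ℝ] E →L[ℝ] ℝ)
    (hg : ∀ v w, g v w = g w v) {u : Fin n → E} {N : E} {h : Matrix (Fin n) (Fin n) ℝ}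
    (hh : ∀ i j, h i j = g (u i) (u j)) (hdet : h.det ≠ 0) (hN : ∀ i, g (u i) N = 0)
    (hNN : g N N = 1) (L : E →ₗ[ℝ] E) :
    LinearMap.trace ℝ E L = ∑ i, ∑ j, h⁻¹ i j * g (L (u i)) (u j) + g (L N) N := by
  have h1 : L = ∑ i, ∑ j, h⁻¹ i j • ((g.flip (u j)).toLinearMap.smulRight (L (u i)))
      + (g.flip N).toLinearMap.smulRight (L N) := by
    ext v
    conv_lhs => rw [frame_expansion hE g hg hh hdet hN hNN v]
    simp only [map_add, map_sum, map_smul, LinearMap.add_apply, LinearMap.sum_apply,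
      LinearMap.smul_apply, LinearMap.smulRight_apply, ContinuousLinearMap.coe_coe,
      ContinuousLinearMap.flip_apply, Finset.sum_smul, smul_smul]
  conv_lhs => rw [h1]
  simp only [map_add, map_sum, map_smul, LinearMap.trace_smulRight, ContinuousLinearMap.coe_coe,
    ContinuousLinearMap.flip_apply, smul_eq_mul]

end Frame

/-! ### The second variation of the area density -/

section SecondVariation

variable {n : ℕ} {E : Type*} [NormedAddCommGroup E] [NormedSpace ℝ E] [FiniteDimensional ℝ E]
  {Ω : Set E} {G : E → E →L[ℝ] E →L[ℝ] ℝ} {Γ : E → E →L[ℝ] E →L[ℝ] E}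

/-- The Gram matrix of the partial derivatives of a map at a point. -/
def gramMatrix (G : E → E →L[ℝ] E →L[ℝ] ℝ) (F : ℝ × Euc n → E) (y : Euc n) (t : ℝ) :
    Matrix (Fin n) (Fin n) ℝ :=
  Matrix.of fun i j => G (F (t, y)) (fderiv ℝ F (t, y) (0, EuclideanSpace.single i (1 : ℝ)))
    (fderiv ℝ F (t, y) (0, EuclideanSpace.single j (1 : ℝ)))

/-- The curvature endomorphism `X ↦ R(X, N) N`. -/
def curvEnd (Γ : E → E →L[ℝ] E →L[ℝ] E) (z N : E) : E →ₗ[ℝ] E where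
  toFun X := curv Γ z X N N
  map_add' X Y := by simp only [curv, map_add, add_apply]; abel
  map_smul' a X := by
    simp only [curv, map_smul, smul_apply, RingHom.id_apply, smul_sub, smul_add]

lemma curv_self (z N : E) : curv Γ z N N N = 0 := by simp [curv]

lemma curv_smul (z X N : E) (a : ℝ) : curv Γ z X (a • N) (a • N) = a ^ 2 • curv Γ z X N N := by
  simp only [curv, map_smul, smul_apply, smul_sub, smul_add, smul_smul, pow_two]

-- The second variation formula at a point, in coordinates. Here `B` is the matrix of the second
-- fundamental form, `η` the weighted mean curvature, and `k` the weighted area density relative to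
-- time zero.
--
-- The covariant derivative of the frame vector `u i` along the variation is `∂ᵢψ N + ψ D i`, where
-- `D i` is the covariant derivative of `N`. Hence the Gram matrix has first derivative `2ψB` and
-- second derivative `2(∂ψ ∂ψᵀ + ψ² B h⁻¹ B) - ψ² (R + Rᵀ)`, the last term coming from the Jacobi
-- equation. In half the second derivative of the logarithm of the determinant, `B h⁻¹ B` enters
-- once with a plus sign and twice with a minus sign. This leaves `|∇ψ|² - ψ²|A|² - ψ² Ric(N,N)`,
-- and the weight supplies the Hessian of `f`. Passing from the logarithm back to `k` adds the
-- square of the first derivative `ψη`, which is assumed to vanish.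
set_option synthInstance.maxHeartbeats 200000 in
theorem second_variation_density (hE : Module.finrank ℝ E = n + 1)
    (hG : IsMetricConnection Ω G Γ) {F : ℝ × Euc n → E} {y₀ : Euc n} {ψ : Euc n → ℝ}
    {N : Euc n → E} {f : E → ℝ}
    (hF : ∀ᶠ q in 𝓝 ((0 : ℝ), y₀), ContDiffAt ℝ ∞ F q) (h0 : F (0, y₀) ∈ Ω)
    (hV : ∀ᶠ y in 𝓝 y₀, deriv (fun t => F (t, y)) 0 = ψ y • N y)
    (hA : ∀ᶠ y in 𝓝 y₀, deriv (deriv fun t => F (t, y)) 0 =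
      -Γ (F (0, y)) (ψ y • N y) (ψ y • N y))
    (hψ : DifferentiableAt ℝ ψ y₀) (hNd : DifferentiableAt ℝ N y₀)
    (hf : ContDiffAt ℝ ∞ f (F (0, y₀)))
    (hN : ∀ᶠ y in 𝓝 y₀, ∀ w, G (F (0, y)) (fderiv ℝ (fun y => F (0, y)) y w) (N y) = 0)
    (hNN : ∀ᶠ y in 𝓝 y₀, G (F (0, y)) (N y) (N y) = 1)
    {h : Matrix (Fin n) (Fin n) ℝ} (hh : h = gramMatrix G F y₀ 0) (hdet : 0 < h.det)
    {B : Matrix (Fin n) (Fin n) ℝ}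
    (hB : ∀ i j, B i j = -G (F (0, y₀)) (N y₀)
      (fderiv ℝ (fun y => fderiv ℝ (fun y => F (0, y)) y (EuclideanSpace.single j (1 : ℝ))) y₀
        (EuclideanSpace.single i (1 : ℝ)) + Γ (F (0, y₀))
        (fderiv ℝ (fun y => F (0, y)) y₀ (EuclideanSpace.single i (1 : ℝ)))
        (fderiv ℝ (fun y => F (0, y)) y₀ (EuclideanSpace.single j (1 : ℝ)))))
    {k : ℝ → ℝ} (hk : k = fun t => Real.exp (-f (F (t, y₀))) *
      Real.sqrt ((gramMatrix G F y₀ t).det / (gramMatrix G F y₀ 0).det))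
    {η : ℝ} (hη : η = -fderiv ℝ f (F (0, y₀)) (N y₀) + (h⁻¹ * B).trace) :
    deriv k 0 = Real.exp (-f (F (0, y₀))) * (ψ y₀ * η) ∧
    (ψ y₀ * η = 0 → deriv (deriv k) 0 = Real.exp (-f (F (0, y₀))) *
      (∑ i, ∑ j, h⁻¹ i j * (fderiv ℝ ψ y₀ (EuclideanSpace.single i (1 : ℝ)) *
          fderiv ℝ ψ y₀ (EuclideanSpace.single j (1 : ℝ)))
        - ψ y₀ ^ 2 * ((h⁻¹ * B * h⁻¹ * B).trace
          + LinearMap.trace ℝ E (curvEnd Γ (F (0, y₀)) (N y₀))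
          + (fderiv ℝ (fderiv ℝ f) (F (0, y₀)) (N y₀) (N y₀)
            - fderiv ℝ f (F (0, y₀)) (Γ (F (0, y₀)) (N y₀) (N y₀)))))) := by
  set z := F (0, y₀) with hz
  set e : Fin n → Euc n := fun i => EuclideanSpace.single i (1 : ℝ) with he
  set u : Fin n → E := fun i => fderiv ℝ (fun y => F (0, y)) y₀ (e i) with hu
  set D : Fin n → E := fun i => fderiv ℝ N y₀ (e i) + Γ z (N y₀) (u i) with hD
  set c : ℝ → E := fun t => F (t, y₀) with hc
  set W : Fin n → ℝ → E := fun i t => fderiv ℝ F (t, y₀) (0, e i) with hW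
  have hF0 := hF.self_of_nhds
  have hcd : ContDiffAt ℝ ∞ c 0 := contDiffAt_slice hF0
  have hWd : ∀ i, ContDiffAt ℝ ∞ (W i) 0 := fun i => contDiffAt_slice (contDiffAt_partial hF0 _)
  have hc1 : deriv c 0 = ψ y₀ • N y₀ := hV.self_of_nhds
  have hc2 : deriv (deriv c) 0 = -Γ z (ψ y₀ • N y₀) (ψ y₀ • N y₀) := hA.self_of_nhds
  have hN0 : ∀ i, G z (u i) (N y₀) = 0 := fun i => hN.self_of_nhds (e i)
  have hNN0 : G z (N y₀) (N y₀) = 1 := hNN.self_of_nhds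
  have hud : ContDiffAt ℝ ∞ (fun y => F (0, y)) y₀ := contDiffAt_slice_right hF0
  have hudd : DifferentiableAt ℝ (fun y => F (0, y)) y₀ := hud.differentiableAt (by simp)
  have hGd : DifferentiableAt ℝ G z := (hG.metric_smooth _ h0).differentiableAt (by simp)
  have hGu : DifferentiableAt ℝ (fun y => G (F (0, y))) y₀ :=
    differentiableAt_bilin_comp (u := fun y => F (0, y)) hGd hudd
  have hu2 : ∀ j, DifferentiableAt ℝ (fun y => fderiv ℝ (fun y => F (0, y)) y (e j)) y₀ := by
    intro j
    have h1 : DifferentiableAt ℝ (fderiv ℝ fun y => F (0, y)) y₀ :=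
      ContDiffAt.differentiableAt (n := ∞) (hud.fderiv_right (by simp)) (by simp)
    exact h1.clm_apply (differentiableAt_const _)
  have hhu : ∀ i j, h i j = G z (u i) (u j) := by
    intro i j
    rw [hh]
    change G z (fderiv ℝ F (0, y₀) (0, e i)) (fderiv ℝ F (0, y₀) (0, e j)) = _
    rw [← fderiv_slice (hF0.differentiableAt (by simp)),
      ← fderiv_slice (hF0.differentiableAt (by simp))]
  -- differentiating the two conditions on the unit normal field
  have hDN : ∀ i, G z (D i) (N y₀) = 0 := by
    intro i
    have h1 : fderiv ℝ (fun y => G (F (0, y)) (N y) (N y)) y₀ (e i) = 0 := by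
      have : (fun y => G (F (0, y)) (N y) (N y)) =ᶠ[𝓝 y₀] fun _ => (1 : ℝ) := hNN
      rw [this.fderiv_eq, fderiv_const_eval]
    rw [fderiv_bilin (B := fun y => G (F (0, y))) hGu hNd hNd,
      fderiv_comp_eval (u := fun y => F (0, y)) hGd hudd, hG.compat _ h0] at h1
    change G z (Γ z (u i) (N y₀)) (N y₀) + G z (N y₀) (Γ z (u i) (N y₀))
      + G z (fderiv ℝ N y₀ (e i)) (N y₀) + G z (N y₀) (fderiv ℝ N y₀ (e i)) = 0 at h1
    rw [hG.metric_symm _ (N y₀), hG.metric_symm _ (N y₀) (fderiv ℝ N y₀ (e i)),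
      hG.conn_symm _ (u i)] at h1
    simp only [hD, map_add, add_apply]
    linarith
  have hDB : ∀ i j, G z (D i) (u j) = B i j := by
    intro i j
    have h1 : fderiv ℝ (fun y => G (F (0, y)) (fderiv ℝ (fun y => F (0, y)) y (e j)) (N y)) y₀
        (e i) = 0 := by
      have : (fun y => G (F (0, y)) (fderiv ℝ (fun y => F (0, y)) y (e j)) (N y)) =ᶠ[𝓝 y₀]
          fun _ => (0 : ℝ) := hN.mono fun y hy => hy (e j)
      rw [this.fderiv_eq, fderiv_const_eval]
    rw [fderiv_bilin (B := fun y => G (F (0, y))) hGu (hu2 j) hNd,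
      fderiv_comp_eval (u := fun y => F (0, y)) hGd hudd, hG.compat _ h0] at h1
    change G z (Γ z (u i) (u j)) (N y₀) + G z (u j) (Γ z (u i) (N y₀))
      + G z (fderiv ℝ (fun y => fderiv ℝ (fun y => F (0, y)) y (e j)) y₀ (e i)) (N y₀)
      + G z (u j) (fderiv ℝ N y₀ (e i)) = 0 at h1
    rw [hB]
    change _ = -G z (N y₀) (fderiv ℝ (fun y => fderiv ℝ (fun y => F (0, y)) y (e j)) y₀ (e i)
      + Γ z (u i) (u j))
    rw [hG.metric_symm _ (N y₀), hG.metric_symm _ (D i)]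
    rw [hG.conn_symm _ (u i) (N y₀)] at h1
    simp only [hD, map_add, add_apply]
    linarith
  have hBsymm : ∀ i j, B i j = B j i := by
    intro i j
    have h1 : DifferentiableAt ℝ (fderiv ℝ fun y => F (0, y)) y₀ :=
      ContDiffAt.differentiableAt (n := ∞) (hud.fderiv_right (by simp)) (by simp)
    have h2 : ∀ a b : Euc n, fderiv ℝ (fun y => fderiv ℝ (fun y => F (0, y)) y b) y₀ a
        = fderiv ℝ (fderiv ℝ fun y => F (0, y)) y₀ a b := fun a b => by
      rw [fderiv_clm_eval h1 (differentiableAt_const _), fderiv_const_eval, map_zero, add_zero]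
    rw [hB, hB, h2, h2, hG.conn_symm]
    congr 3
    exact (hud.isSymmSndFDerivAt (by simpa using ENat.LEInfty.out)).eq _ _
  -- covariant derivatives of the frame along the variation
  have hvar := fun i => covD_variation hG hF h0 hV hA (e i)
  have hW0 : ∀ i, W i 0 = u i := fun i => (hvar i).1
  have hVd : ∀ i, fderiv ℝ (fun y => ψ y • N y) y₀ (e i) =
      fderiv ℝ ψ y₀ (e i) • N y₀ + ψ y₀ • fderiv ℝ N y₀ (e i) := fun i => by
    have h1 := hψ.hasFDerivAt.smul hNd.hasFDerivAt
    change fderiv ℝ (ψ • N) y₀ (e i) = _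
    rw [h1.fderiv]
    simp [add_comm]
  have hW1 : ∀ i, covD Γ c (W i) 0 = fderiv ℝ ψ y₀ (e i) • N y₀ + ψ y₀ • D i := fun i => by
    rw [(hvar i).2.1, hVd]
    simp only [hD, map_smul, smul_apply, smul_add, add_assoc]
    rfl
  have hW2 : ∀ i, covD Γ c (covD Γ c (W i)) 0 = -(ψ y₀ ^ 2 • curv Γ z (u i) (N y₀) (N y₀)) :=
    fun i => by rw [(hvar i).2.2, curv_smul]
  have hinvT : h⁻¹.transpose = h⁻¹ := by
    rw [Matrix.transpose_nonsing_inv]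
    congr 1
    ext i j
    rw [Matrix.transpose_apply, hhu, hhu, hG.metric_symm]
  have hinvsymm : ∀ i j, h⁻¹ i j = h⁻¹ j i := fun i j => congrFun (congrFun hinvT j) i
  -- `D i` has no normal component, so its expansion in the adapted frame involves only the products
  -- `G z (D i) (u j)`, which are the entries of `B`.
  have hDD : ∀ i j, G z (D i) (D j) = (B * h⁻¹ * B) i j := by
    intro i j
    conv_lhs => rw [frame_expansion hE (G z) (hG.metric_symm z) hhu hdet.ne' hN0 hNN0 (D i)]
    simp only [hDN, zero_smul, add_zero, map_sum, map_smul, sum_apply, smul_apply, smul_eq_mul,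
      hDB, hG.metric_symm z (u _) (D j), Matrix.mul_apply, Finset.sum_mul]
    refine Finset.sum_congr rfl fun a _ => Finset.sum_congr rfl fun b _ => ?_
    rw [hinvsymm a b, hBsymm j a]
    ring
  have hgij : ∀ t i j, gramMatrix G F y₀ t i j = G (c t) (W i t) (W j t) := fun t i j => rfl
  set ψ' : Fin n → ℝ := fun i => fderiv ℝ ψ y₀ (e i) with hψ'
  set R : Matrix (Fin n) (Fin n) ℝ := Matrix.of fun i j => G z (curv Γ z (u i) (N y₀) (N y₀)) (u j)
    with hR
  have hA1 : ∀ i j, deriv (fun t => gramMatrix G F y₀ t i j) 0 = ((2 * ψ y₀) • B) i j := by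
    intro i j
    simp only [hgij]
    rw [deriv_metric_curve hG h0 (hcd.differentiableAt (by simp))
      ((hWd i).differentiableAt (by simp)) ((hWd j).differentiableAt (by simp)), hW1, hW1, hW0, hW0]
    change G z _ _ + G z _ _ = _
    rw [hG.metric_symm z (u i)]
    simp only [map_add, map_smul, add_apply, smul_apply, hG.metric_symm z (N y₀), hN0, hDB,
      hBsymm j i, Matrix.smul_apply, smul_eq_mul]
    ring
  -- The mixed terms between the normal part `∂ψ N` and the tangential part `ψ D` drop out by
  -- orthogonality.
  have hA2 : ∀ i j, deriv (deriv fun t => gramMatrix G F y₀ t i j) 0 =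
      ((2 : ℝ) • (Matrix.vecMulVec ψ' ψ' + ψ y₀ ^ 2 • (B * h⁻¹ * B))
        - ψ y₀ ^ 2 • (R + R.transpose)) i j := by
    intro i j
    simp only [hgij]
    rw [deriv_deriv_metric_curve hG h0 hcd (hWd i) (hWd j), hW1, hW1, hW2, hW2, hW0, hW0]
    change G z _ _ + 2 * G z _ _ + G z _ _ = _
    rw [hG.metric_symm z (u i)]
    have hND : ∀ i, G z (N y₀) (D i) = 0 := fun i => by rw [hG.metric_symm, hDN]
    simp only [map_add, map_smul, map_neg, neg_apply, add_apply, smul_apply, hDN, hND, hNN0, hDD,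
      Matrix.smul_apply, Matrix.add_apply, Matrix.sub_apply, Matrix.transpose_apply, hR,
      Matrix.of_apply, Matrix.vecMulVec_apply, smul_eq_mul]
    ring
  -- the logarithm of the density
  have hgs : ∀ i j, ContDiffAt ℝ ∞ (fun t => gramMatrix G F y₀ t i j) 0 := fun i j =>
    contDiffAt_bilin (B := fun t => G (c t)) (contDiffAt_bilin_comp (hG.metric_smooth _ h0) hcd)
        (hWd i) (hWd j)
  have hdet0 : 0 < (gramMatrix G F y₀ 0).det := hh ▸ hdet
  have hdets : ContDiffAt ℝ ∞ (fun t => (gramMatrix G F y₀ t).det) 0 := contDiffAt_det hgs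
  obtain ⟨hlog1, hlog2⟩ := deriv_deriv_log_det hgs hA1 hA2 hdet0
  rw [← hh] at hlog1 hlog2
  set ℓ : ℝ → ℝ := fun t => Real.log (gramMatrix G F y₀ t).det with hℓ
  set φ : ℝ → ℝ := fun t => f (c t) with hφ
  have hℓs : ContDiffAt ℝ ∞ ℓ 0 := hdets.log hdet0.ne'
  have hφs : ContDiffAt ℝ ∞ φ 0 := hf.comp 0 hcd
  have hfev : ∀ᶠ w in 𝓝 z, DifferentiableAt ℝ f w := by
    filter_upwards [eventually_contDiffAt hf 1] with w hw
    exact hw.differentiableAt (by simp)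
  have hcev : ∀ᶠ t in 𝓝 0, DifferentiableAt ℝ c t := by
    filter_upwards [eventually_contDiffAt hcd 1] with w hw
    exact hw.differentiableAt (by simp)
  have hφ1ev : deriv φ =ᶠ[𝓝 0] fun t => fderiv ℝ f (c t) (deriv c t) := by
    filter_upwards [hcd.continuousAt.eventually hfev, hcev] with t h1 h2
    exact (h1.hasFDerivAt.comp_hasDerivAt t h2.hasDerivAt).deriv
  have hφ1 : deriv φ 0 = ψ y₀ * fderiv ℝ f z (N y₀) := by
    rw [hφ1ev.eq_of_nhds, hc1, map_smul, smul_eq_mul]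
  have hφ2 : deriv (deriv φ) 0 = ψ y₀ ^ 2 * (fderiv ℝ (fderiv ℝ f) z (N y₀) (N y₀)
      - fderiv ℝ f z (Γ z (N y₀) (N y₀))) := by
    have hfd : DifferentiableAt ℝ (fderiv ℝ f) z :=
      ContDiffAt.differentiableAt (n := ∞) (hf.fderiv_right (by simp)) (by simp)
    have h1 : HasDerivAt (fun t => fderiv ℝ f (c t) (deriv c t))
        (fderiv ℝ (fderiv ℝ f) z (deriv c 0) (deriv c 0) + fderiv ℝ f z (deriv (deriv c) 0)) 0 :=
      (hfd.hasFDerivAt.comp_hasDerivAt (x := (0 : ℝ)) (f := c)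
        (hcd.differentiableAt (by simp)).hasDerivAt).clm_apply
        ((contDiffAt_deriv hcd).differentiableAt (by simp)).hasDerivAt
    rw [hφ1ev.deriv_eq, h1.deriv, hc1, hc2]
    simp only [map_smul, map_neg, smul_apply, smul_eq_mul]
    ring
  -- The logarithm of the density `k`; subtracting `ℓ 0` accounts for the normalization by the area
  -- at time zero.
  set L : ℝ → ℝ := fun t => -φ t + (1 / 2) * (ℓ t - ℓ 0) with hL
  have hLs : ContDiffAt ℝ ∞ L 0 := hφs.neg.add (contDiffAt_const.mul (hℓs.sub contDiffAt_const))
  have hkL : k =ᶠ[𝓝 0] fun t => Real.exp (L t) := by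
    filter_upwards [hdets.continuousAt.eventually (lt_mem_nhds hdet0)] with t ht
    rw [hk]
    change _ * _ = Real.exp (-φ t + (1 / 2) * (ℓ t - ℓ 0))
    rw [Real.exp_add]
    congr 1
    rw [hℓ]
    dsimp only
    rw [← Real.log_div ht.ne' hdet0.ne', Real.sqrt_eq_rpow, Real.rpow_def_of_pos (div_pos ht hdet0),
      mul_comm]
  have hL0 : L 0 = -f z := by simp [hL, hφ, hc, hz]
  have hdiff : ∀ g : ℝ → ℝ, ContDiffAt ℝ ∞ g 0 → ∀ᶠ t in 𝓝 0, DifferentiableAt ℝ g t := by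
    intro g hg
    filter_upwards [eventually_contDiffAt hg 1] with w hw
    exact hw.differentiableAt (by simp)
  have hL1ev : deriv L =ᶠ[𝓝 0] fun t => -deriv φ t + (1 / 2) * deriv ℓ t := by
    filter_upwards [hdiff φ hφs, hdiff ℓ hℓs] with t h1 h2
    exact (h1.hasDerivAt.neg.add ((h2.hasDerivAt.sub_const _).const_mul _)).deriv
  have hL1 : deriv L 0 = ψ y₀ * η := by
    rw [hL1ev.eq_of_nhds, hφ1, hlog1, hη, Matrix.mul_smul, Matrix.trace_smul, smul_eq_mul]
    ring
  have hL2 : deriv (deriv L) 0 = -deriv (deriv φ) 0 + (1 / 2) * deriv (deriv ℓ) 0 := by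
    rw [hL1ev.deriv_eq]
    exact (((contDiffAt_deriv hφs).differentiableAt (by simp)).hasDerivAt.neg.add
      (((contDiffAt_deriv hℓs).differentiableAt (by simp)).hasDerivAt.const_mul _)).deriv
  have hk1ev : deriv k =ᶠ[𝓝 0] fun t => Real.exp (L t) * deriv L t := by
    filter_upwards [hkL.deriv, hdiff L hLs] with t h1 h2
    rw [h1]
    exact h2.hasDerivAt.exp.deriv
  refine ⟨by rw [hk1ev.eq_of_nhds, hL0, hL1], fun hη0 => ?_⟩
  have hk2 : deriv (deriv k) 0 = Real.exp (L 0) * deriv L 0 * deriv L 0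
      + Real.exp (L 0) * deriv (deriv L) 0 := by
    rw [hk1ev.deriv_eq]
    exact ((hLs.differentiableAt (by simp)).hasDerivAt.exp.mul
      ((contDiffAt_deriv hLs).differentiableAt (by simp)).hasDerivAt).deriv
  rw [hk2, hL1, hη0, hL0, hL2, hφ2, hlog2]
  -- In the adapted frame the trace has only tangential terms, because the curvature is
  -- antisymmetric in its first two arguments and kills the pair `(N, N)`.
  have htr : LinearMap.trace ℝ E (curvEnd Γ z (N y₀)) = (h⁻¹ * R).trace := by
    rw [trace_frame hE (G z) (hG.metric_symm z) hhu hdet.ne' hN0 hNN0]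
    change _ + G z (curv Γ z (N y₀) (N y₀) (N y₀)) (N y₀) = _
    rw [curv_self, map_zero, zero_apply, add_zero, Matrix.trace]
    simp only [Matrix.diag, Matrix.mul_apply]
    rw [Finset.sum_comm]
    exact Finset.sum_congr rfl fun i _ => Finset.sum_congr rfl fun j _ => by rw [hinvsymm]; rfl
  have htrT : (h⁻¹ * R.transpose).trace = (h⁻¹ * R).trace := by
    rw [← Matrix.trace_transpose, Matrix.transpose_mul, Matrix.transpose_transpose, hinvT,
      Matrix.trace_mul_comm]
  have hψψ : (h⁻¹ * Matrix.vecMulVec ψ' ψ').trace = ∑ i, ∑ j, h⁻¹ i j * (ψ' i * ψ' j) := by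
    simp only [Matrix.trace, Matrix.diag, Matrix.mul_apply, Matrix.vecMulVec_apply]
    exact Finset.sum_congr rfl fun i _ => Finset.sum_congr rfl fun j _ => by ring
  have hBB : (h⁻¹ * (B * h⁻¹ * B)).trace = (h⁻¹ * B * h⁻¹ * B).trace := by
    simp only [Matrix.mul_assoc]
  simp only [Matrix.mul_sub, Matrix.mul_add, Matrix.mul_smul, Matrix.smul_mul, Matrix.trace_sub,
    Matrix.trace_add, Matrix.trace_smul, smul_eq_mul, htr, htrT, hψψ, hBB]
  ring

end SecondVariation

/-! ### Quadratic forms attached to a positive definite matrix -/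

section PosDef

open scoped MatrixOrder Matrix.Norms.L2Operator

variable {n : ℕ}

/-- The inverse `h⁻¹` is `Cᵀ C` for some `C`, and the trace becomes the sum of squares of the
entries of `C B Cᵀ`. This is the squared norm of the second fundamental form; if it vanishes, so
does `h⁻¹ B h⁻¹`, hence `B`. -/
lemma trace_conj_square_nonneg {h B : Matrix (Fin n) (Fin n) ℝ} (hh : h.PosDef)
    (hB : B.transpose = B) :
    0 ≤ (h⁻¹ * B * h⁻¹ * B).trace ∧ ((h⁻¹ * B * h⁻¹ * B).trace = 0 → B = 0) := by
  obtain ⟨C, hC⟩ := CStarAlgebra.nonneg_iff_eq_star_mul_self.1 hh.inv.posSemidef.nonneg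
  rw [Matrix.star_eq_conjTranspose, Matrix.conjTranspose_eq_transpose_of_trivial] at hC
  have hX : (h⁻¹ * B * h⁻¹ * B).trace =
      ((C * B * C.transpose).transpose * (C * B * C.transpose)).trace := by
    rw [hC]
    simp only [Matrix.transpose_mul, Matrix.transpose_transpose, hB, Matrix.mul_assoc]
    rw [Matrix.trace_mul_comm]
    simp only [Matrix.mul_assoc]
  have hsum : ((C * B * C.transpose).transpose * (C * B * C.transpose)).trace =
      ∑ i, ∑ j, (C * B * C.transpose) j i ^ 2 := by
    simp only [Matrix.trace, Matrix.diag, Matrix.mul_apply (M := (C * B * C.transpose).transpose),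
      Matrix.transpose_apply, pow_two]
  rw [hX, hsum]
  refine ⟨by positivity, fun h0 => ?_⟩
  have h1 : C * B * C.transpose = 0 := by
    ext j i
    have h2 := (Finset.sum_eq_zero_iff_of_nonneg fun i _ => by positivity).1 h0 i
      (Finset.mem_univ _)
    have h3 := (Finset.sum_eq_zero_iff_of_nonneg fun i _ => by positivity).1 h2 j
      (Finset.mem_univ _)
    exact pow_eq_zero_iff (two_ne_zero) |>.1 h3
  have h2 : h⁻¹ * B * h⁻¹ = 0 := by
    have : h⁻¹ * B * h⁻¹ = C.transpose * (C * B * C.transpose) * C := by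
      rw [hC]; simp only [Matrix.mul_assoc]
    rw [this, h1, Matrix.mul_zero, Matrix.zero_mul]
  have hu : IsUnit h.det := hh.det_pos.ne'.isUnit
  calc B = h * (h⁻¹ * B * h⁻¹) * h := by
        rw [Matrix.mul_assoc h⁻¹, Matrix.mul_nonsing_inv_cancel_left _ _ hu,
          Matrix.nonsing_inv_mul_cancel_right _ _ hu]
    _ = 0 := by rw [h2, Matrix.mul_zero, Matrix.zero_mul]

/-- The extremal vector for the dual norm is `w = h⁻¹ ψ`. Tested on it, the hypothesis reads `s² ≤
c² s`, where `s` is the sum to be bounded. -/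
lemma dual_form_le {h : Matrix (Fin n) (Fin n) ℝ} (hh : h.PosDef) {ψ : Fin n → ℝ} {c : ℝ}
    (hψ : ∀ w : Fin n → ℝ, (∑ i, ψ i * w i) ^ 2 ≤ c ^ 2 * ∑ i, ∑ j, h i j * (w i * w j)) :
    ∑ i, ∑ j, h⁻¹ i j * (ψ i * ψ j) ≤ c ^ 2 := by
  have hu : IsUnit h.det := hh.det_pos.ne'.isUnit
  set w : Fin n → ℝ := h⁻¹.mulVec ψ with hw
  have h1 : h.mulVec w = ψ := by
    rw [hw, Matrix.mulVec_mulVec, Matrix.mul_nonsing_inv _ hu, Matrix.one_mulVec]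
  have h2 : ∑ i, ψ i * w i = ∑ i, ∑ j, h⁻¹ i j * (ψ i * ψ j) := by
    simp only [hw, Matrix.mulVec, dotProduct, Finset.mul_sum]
    exact Finset.sum_congr rfl fun i _ => Finset.sum_congr rfl fun j _ => by ring
  have h3 : ∑ i, ∑ j, h i j * (w i * w j) = ∑ i, ψ i * w i := by
    conv_rhs => rw [← h1]
    simp only [Matrix.mulVec, dotProduct, Finset.sum_mul]
    exact Finset.sum_congr rfl fun i _ => Finset.sum_congr rfl fun j _ => by ring
  have h4 := hψ w
  rw [h3] at h4
  rw [← h2]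
  set s := ∑ i, ψ i * w i
  by_contra hs
  push Not at hs
  nlinarith [sq_nonneg c]

lemma posDef_of_form {h : Matrix (Fin n) (Fin n) ℝ} (hs : ∀ i j, h i j = h j i)
    (hp : ∀ w : Fin n → ℝ, w ≠ 0 → 0 < ∑ i, ∑ j, h i j * (w i * w j)) : h.PosDef := by
  refine Matrix.PosDef.of_dotProduct_mulVec_pos (Matrix.IsHermitian.ext fun i j => hs j i)
    fun w hw => ?_
  have h1 : star w ⬝ᵥ h.mulVec w = ∑ i, ∑ j, h i j * (w i * w j) := by
    simp only [dotProduct, Matrix.mulVec, Finset.mul_sum, star_trivial]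
    exact Finset.sum_congr rfl fun i _ => Finset.sum_congr rfl fun j _ => by ring
  rw [h1]
  exact hp w hw

end PosDef

/-! ### The curvature tensors in a chart -/

section Curvature

section Multilinear

variable {E : Type*} [NormedAddCommGroup E] [NormedSpace ℝ E] (Γ : E → E →L[ℝ] E →L[ℝ] E)
  (z X Y Y' W W' : E) (a : ℝ)

lemma curv_add_mid : curv Γ z X (Y + Y') W = curv Γ z X Y W + curv Γ z X Y' W := by
  simp only [curv, map_add, add_apply]; abel

lemma curv_smul_mid : curv Γ z X (a • Y) W = a • curv Γ z X Y W := by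
  simp only [curv, map_smul, smul_apply, smul_sub, smul_add]

lemma curv_add_right : curv Γ z X Y (W + W') = curv Γ z X Y W + curv Γ z X Y W' := by
  simp only [curv, map_add]; abel

lemma curv_smul_right : curv Γ z X Y (a • W) = a • curv Γ z X Y W := by
  simp only [curv, map_smul, smul_sub, smul_add]

end Multilinear

variable {m : ℕ} {M : Type*} [TopologicalSpace M] [ChartedSpace (Euc m) M]
  [RiemannianBundle (fun x : M => TangentSpace (𝓡 m) x)] [IsManifold (𝓡 m) ∞ M]
  [IsContMDiffRiemannianBundle (𝓡 m) ∞ (Euc m) (fun x : M => TangentSpace (𝓡 m) x)]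

lemma isMetricConnection_chart (p : M) :
    IsMetricConnection (chartAt (Euc m) p).target (chartMetric (m := m) p) (chartGamma p) where
  isOpen := (chartAt (Euc m) p).open_target
  metric_smooth _ hz := contDiffAt_chartMetric p hz
  conn_smooth _ hz := contDiffAt_chartGamma p hz
  metric_symm z v w := chartMetric_symm p z v w
  conn_symm z v w := chartGamma_symm p z v w
  compat _ hz v w u := fderiv_chartMetric p hz v w u
  pos _ hz _ hv := chartMetric_pos p hz hv

lemma fderiv_chartGamma_apply (p : M) {y : Euc m} (hy : y ∈ (chartAt (Euc m) p).target)
    (v : Euc m) (i j k : Fin m) :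
    (fderiv ℝ (chartGamma p) y v (EuclideanSpace.single i (1 : ℝ))
      (EuclideanSpace.single j (1 : ℝ))) k = fderiv ℝ (christoffel p k i j) y v := by
  have h1 : DifferentiableAt ℝ (chartGamma (m := m) p) y :=
    (contDiffAt_chartGamma p hy).differentiableAt (by simp)
  have h2 : christoffel p k i j = fun z => (EuclideanSpace.proj k : Euc m →L[ℝ] ℝ)
      (chartGamma p z (EuclideanSpace.single i (1 : ℝ)) (EuclideanSpace.single j (1 : ℝ))) := by
    ext z
    exact (chartGamma_single p z i j k).symm
  have h3 := ((h1.hasFDerivAt.clm_apply (hasFDerivAt_const (EuclideanSpace.single i (1 : ℝ)) y)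
    ).clm_apply (hasFDerivAt_const (EuclideanSpace.single j (1 : ℝ)) y))
  have h4 := (EuclideanSpace.proj k : Euc m →L[ℝ] ℝ).hasFDerivAt.comp y h3
  rw [h2]
  have h5 := congrArg (fun L => L v) h4.fderiv
  refine Eq.trans ?_ h5.symm
  simp

/-- The coordinate formula for the Ricci tensor is a contraction of the curvature. Written as the
trace of an endomorphism it no longer depends on a basis and can be evaluated in the frame adapted
to the hypersurface. -/
lemma ricci_eq_trace (x : M) (v : Euc m) :
    ricci x v v = LinearMap.trace ℝ (Euc m)
      (curvEnd (chartGamma x) (chartAt (Euc m) x x) (chartCoframe x x v)) := by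
  set z := chartAt (Euc m) x x
  have hz : z ∈ (chartAt (Euc m) x).target := mem_chart_target _ x
  set N := chartCoframe x x v
  -- The trace is polarized to a bilinear form, so that it can be compared with the coefficients on
  -- basis vectors.
  let T : Euc m →ₗ[ℝ] Euc m →ₗ[ℝ] ℝ := LinearMap.mk₂ ℝ
    (fun a b => ∑ i, (curv (chartGamma x) z (EuclideanSpace.single i (1 : ℝ)) a b) i)
    (fun a a' b => by
      simp only [curv_add_mid, PiLp.add_apply, Finset.sum_add_distrib])
    (fun c a b => by
      simp only [curv_smul_mid, PiLp.smul_apply, Finset.smul_sum])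
    (fun a b b' => by
      simp only [curv_add_right, PiLp.add_apply, Finset.sum_add_distrib])
    (fun c a b => by
      simp only [curv_smul_right, PiLp.smul_apply, Finset.smul_sum])
  have hT : LinearMap.trace ℝ (Euc m) (curvEnd (chartGamma x) z N) = T N N := by
    rw [LinearMap.trace_eq_sum_inner _ (EuclideanSpace.basisFun (Fin m) ℝ)]
    refine Finset.sum_congr rfl fun i _ => ?_
    rw [EuclideanSpace.basisFun_apply, EuclideanSpace.inner_single_left]
    simp [curvEnd]
  rw [hT, bilin_eq_sum T N N]
  change ∑ j : Fin m, ∑ k : Fin m, ricciCoeff x j k z * N j * N k = _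
  refine Finset.sum_congr rfl fun j _ => Finset.sum_congr rfl fun k _ => ?_
  have hc : T (EuclideanSpace.single j (1 : ℝ)) (EuclideanSpace.single k (1 : ℝ)) =
      ricciCoeff x j k z := by
    change ∑ i : Fin m, _ = ∑ i : Fin m, _
    refine Finset.sum_congr rfl fun i _ => ?_
    simp only [curv, PiLp.add_apply, PiLp.sub_apply, fderiv_chartGamma_apply x hz]
    have h1 : ∀ a b c : Fin m, (chartGamma x z (EuclideanSpace.single a (1 : ℝ))
        (chartGamma x z (EuclideanSpace.single b (1 : ℝ)) (EuclideanSpace.single c (1 : ℝ)))) i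
        = ∑ l, christoffel x i a l z * christoffel x l b c z := by
      intro a b c
      conv_lhs => rw [euc_sum (chartGamma x z (EuclideanSpace.single b (1 : ℝ))
        (EuclideanSpace.single c (1 : ℝ)))]
      simp only [map_sum, map_smul, chartGamma_single, WithLp.ofLp_sum, Finset.sum_apply,
        PiLp.smul_apply, smul_eq_mul]
      exact Finset.sum_congr rfl fun l _ => mul_comm _ _
    rw [h1, h1, Finset.sum_sub_distrib]
    simp only [partialDeriv]
    ring
  rw [hc, smul_eq_mul]
  ring

lemma hessian_eq {f : M → ℝ} (hf : ContMDiff (𝓡 m) 𝓘(ℝ, ℝ) ∞ f) (x : M) (v : Euc m) :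
    hessian f x v v =
      fderiv ℝ (fderiv ℝ (f ∘ (chartAt (Euc m) x).symm)) (chartAt (Euc m) x x)
        (chartCoframe x x v) (chartCoframe x x v)
      - fderiv ℝ (f ∘ (chartAt (Euc m) x).symm) (chartAt (Euc m) x x)
        (chartGamma x (chartAt (Euc m) x x) (chartCoframe x x v) (chartCoframe x x v)) := by
  set z := chartAt (Euc m) x x
  set N := chartCoframe x x v
  set g := f ∘ (chartAt (Euc m) x).symm
  have hg : ContDiffAt ℝ ∞ g z := by
    have h1 : ContMDiffOn (𝓡 m) 𝓘(ℝ, ℝ) ∞ g (chartAt (Euc m) x).target :=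
      hf.comp_contMDiffOn contMDiffOn_chart_symm
    exact (contMDiffOn_iff_contDiffOn.1 h1).contDiffAt
      ((chartAt (Euc m) x).open_target.mem_nhds (mem_chart_target _ x))
  have hg1 : DifferentiableAt ℝ (fderiv ℝ g) z :=
    ContDiffAt.differentiableAt (n := ∞) (hg.fderiv_right (by simp)) (by simp)
  let T : Euc m →ₗ[ℝ] Euc m →ₗ[ℝ] ℝ := LinearMap.mk₂ ℝ
    (fun a b => fderiv ℝ (fderiv ℝ g) z a b - fderiv ℝ g z (chartGamma x z a b))
    (fun a a' b => by simp only [map_add, add_apply]; ring)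
    (fun c a b => by simp only [map_smul, smul_apply, smul_eq_mul]; ring)
    (fun a b b' => by simp only [map_add]; ring)
    (fun c a b => by simp only [map_smul, smul_eq_mul]; ring)
  change _ = T N N
  rw [bilin_eq_sum T N N]
  change ∑ i : Fin m, ∑ j : Fin m, hessianCoeff f x i j z * N i * N j = _
  refine Finset.sum_congr rfl fun i _ => Finset.sum_congr rfl fun j _ => ?_
  have hc : T (EuclideanSpace.single i (1 : ℝ)) (EuclideanSpace.single j (1 : ℝ)) =
      hessianCoeff f x i j z := by
    change fderiv ℝ (fderiv ℝ g) z _ _ - fderiv ℝ g z _ = _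
    rw [hessianCoeff]
    congr 1
    · change _ = fderiv ℝ (fun y => fderiv ℝ g y (EuclideanSpace.single j (1 : ℝ))) z _
      rw [fderiv_clm_eval hg1 (differentiableAt_const _), fderiv_const_eval, map_zero, add_zero]
    · conv_lhs => rw [euc_sum (chartGamma x z (EuclideanSpace.single i (1 : ℝ))
        (EuclideanSpace.single j (1 : ℝ)))]
      simp only [map_sum, map_smul, chartGamma_single, smul_eq_mul]
      rfl
  rw [hc, smul_eq_mul]
  ring

end Curvature

/-! ### Maps between manifolds in charts -/

section LocalMaps

variable {n m : ℕ} {S : Type*} [TopologicalSpace S] [ChartedSpace (Euc n) S]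
  {M : Type*} [TopologicalSpace M] [ChartedSpace (Euc m) M]

/-- The coordinate expression of a map in the charts at `p` and `q`. -/
def localMap (p : S) (q : M) (φ : S → M) (y : Euc n) : Euc m :=
  chartAt (Euc m) q (φ ((chartAt (Euc n) p).symm y))

/-- The coordinate expression of a family of maps in the charts at `p` and `q`. -/
def localVariation (p : S) (q : M) (F : ℝ → S → M) (z : ℝ × Euc n) : Euc m :=
  chartAt (Euc m) q (F z.1 ((chartAt (Euc n) p).symm z.2))

lemma localMap_chart {p : S} {q : M} {φ : S → M} {x : S} (hx : x ∈ (chartAt (Euc n) p).source) :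
    localMap p q φ (chartAt (Euc n) p x) = chartAt (Euc m) q (φ x) := by
  rw [localMap, (chartAt (Euc n) p).left_inv hx]

/-- The differential of a map, between the model spaces. -/
def tangentOf (n m : ℕ) [ChartedSpace (Euc n) S] [ChartedSpace (Euc m) M] (φ : S → M) (x : S) :
    Euc n →L[ℝ] Euc m :=
  mfderiv (𝓡 n) (𝓡 m) φ x

variable [IsManifold (𝓡 n) ∞ S] [IsManifold (𝓡 m) ∞ M]

lemma contDiffAt_localMap {p : S} {q : M} {φ : S → M} {y : Euc n}
    (hy : y ∈ (chartAt (Euc n) p).target)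
    (hφ : ContMDiffAt (𝓡 n) (𝓡 m) ∞ φ ((chartAt (Euc n) p).symm y))
    (hq : φ ((chartAt (Euc n) p).symm y) ∈ (chartAt (Euc m) q).source) :
    ContDiffAt ℝ ∞ (localMap (n := n) (m := m) p q φ) y := by
  have h1 : ContMDiffAt (𝓡 n) (𝓡 n) ∞ (chartAt (Euc n) p).symm y :=
    contMDiffOn_chart_symm.contMDiffAt ((chartAt (Euc n) p).open_target.mem_nhds hy)
  have h2 : ContMDiffAt (𝓡 m) (𝓡 m) ∞ (chartAt (Euc m) q) (φ ((chartAt (Euc n) p).symm y)) :=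
    contMDiffOn_chart.contMDiffAt ((chartAt (Euc m) q).open_source.mem_nhds hq)
  exact (h2.comp y (hφ.comp y h1)).contDiffAt

lemma fderiv_localMap {p : S} {q : M} {φ : S → M} {y : Euc n}
    (hy : y ∈ (chartAt (Euc n) p).target)
    (hφ : MDifferentiableAt (𝓡 n) (𝓡 m) φ ((chartAt (Euc n) p).symm y))
    (hq : φ ((chartAt (Euc n) p).symm y) ∈ (chartAt (Euc m) q).source) (v : Euc n) :
    fderiv ℝ (localMap (n := n) (m := m) p q φ) y v =
      chartCoframe q (φ ((chartAt (Euc n) p).symm y))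
        (tangentOf n m φ ((chartAt (Euc n) p).symm y) (chartFrame p y v)) := by
  have : IsManifold (𝓡 n) 1 S := IsManifold.of_le (n := ∞) (by simp)
  have : IsManifold (𝓡 m) 1 M := IsManifold.of_le (n := ∞) (by simp)
  have h1 := (mdifferentiable_chart (I := 𝓡 n) p).mdifferentiableAt_symm hy
  have h2 := (mdifferentiable_chart (I := 𝓡 m) q).mdifferentiableAt hq
  have h3 := mfderiv_comp y hφ h1
  have h4 := mfderiv_comp y h2 (hφ.comp y h1)
  have h5 : mfderiv (𝓡 n) (𝓡 m) (chartAt (Euc m) q ∘ φ ∘ (chartAt (Euc n) p).symm) y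
    = fderiv ℝ (localMap (n := n) (m := m) p q φ) y := mfderiv_eq_fderiv
  rw [h5, h3] at h4
  exact congrArg (fun L : Euc n →L[ℝ] Euc m => L v) h4

lemma contDiffAt_localVariation {p : S} {q : M} {F : ℝ → S → M} {t : ℝ} {y : Euc n}
    (hy : y ∈ (chartAt (Euc n) p).target)
    (hF : ContMDiffAt (𝓘(ℝ, ℝ).prod (𝓡 n)) (𝓡 m) ∞ (fun z : ℝ × S => F z.1 z.2)
      (t, (chartAt (Euc n) p).symm y))
    (hq : F t ((chartAt (Euc n) p).symm y) ∈ (chartAt (Euc m) q).source) :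
    ContDiffAt ℝ ∞ (localVariation (n := n) (m := m) p q F) (t, y) := by
  have h1 : ContMDiffAt (𝓡 n) (𝓡 n) ∞ (chartAt (Euc n) p).symm y :=
    contMDiffOn_chart_symm.contMDiffAt ((chartAt (Euc n) p).open_target.mem_nhds hy)
  have h2 : ContMDiffAt (𝓡 m) (𝓡 m) ∞ (chartAt (Euc m) q)
      (F t ((chartAt (Euc n) p).symm y)) :=
    contMDiffOn_chart.contMDiffAt ((chartAt (Euc m) q).open_source.mem_nhds hq)
  have h3 : ContMDiffAt (𝓘(ℝ, ℝ).prod (𝓡 n)) (𝓘(ℝ, ℝ).prod (𝓡 n)) ∞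
      (fun z : ℝ × Euc n => (z.1, (chartAt (Euc n) p).symm z.2)) (t, y) :=
    contMDiffAt_fst.prodMk (ContMDiffAt.comp (t, y) h1 contMDiffAt_snd)
  have h4 : ContMDiffAt (𝓘(ℝ, ℝ).prod (𝓡 n)) (𝓡 m) ∞
      (localVariation (n := n) (m := m) p q F) (t, y) :=
    ContMDiffAt.comp (t, y) (g := chartAt (Euc m) q)
      (f := fun z : ℝ × Euc n => F z.1 ((chartAt (Euc n) p).symm z.2)) h2
      (ContMDiffAt.comp (t, y) (g := fun z : ℝ × S => F z.1 z.2) hF h3)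
  rw [← modelWithCornersSelf_prod, chartedSpaceSelf_prod] at h4
  exact h4.contDiffAt

variable [RiemannianBundle (fun x : M => TangentSpace (𝓡 m) x)]

lemma pullbackMetric_eq (q : M) {φ : S → M} {x : S} (hq : φ x ∈ (chartAt (Euc m) q).source)
    (v w : Euc n) : pullbackMetric (n := n) (m := m) φ x v w =
      chartMetric q (chartAt (Euc m) q (φ x)) (chartCoframe q (φ x) (tangentOf n m φ x v))
        (chartCoframe q (φ x) (tangentOf n m φ x w)) := by
  rw [chartMetric_coframe q hq]
  rfl

lemma tensorCoeff_pullback {p : S} {q : M} {φ : S → M} {y : Euc n}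
    (hy : y ∈ (chartAt (Euc n) p).target)
    (hφ : MDifferentiableAt (𝓡 n) (𝓡 m) φ ((chartAt (Euc n) p).symm y))
    (hq : φ ((chartAt (Euc n) p).symm y) ∈ (chartAt (Euc m) q).source) (i j : Fin n) :
    tensorCoeff (pullbackMetric (n := n) (m := m) φ) p y i j =
      chartMetric q (localMap p q φ y)
        (fderiv ℝ (localMap (n := n) (m := m) p q φ) y (EuclideanSpace.single i (1 : ℝ)))
        (fderiv ℝ (localMap (n := n) (m := m) p q φ) y (EuclideanSpace.single j (1 : ℝ))) := by
  rw [fderiv_localMap hy hφ hq, fderiv_localMap hy hφ hq]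
  exact pullbackMetric_eq q hq _ _

lemma pullbackMetric_bilin (φ : S → M) (x : S) : ∃ B : Euc n →ₗ[ℝ] Euc n →ₗ[ℝ] ℝ,
    ∀ v w : Euc n, pullbackMetric (n := n) (m := m) φ x v w = B v w := by
  refine ⟨LinearMap.mk₂ ℝ (fun v w => chartMetric (φ x) (chartAt (Euc m) (φ x) (φ x))
    (chartCoframe (φ x) (φ x) (tangentOf n m φ x v))
    (chartCoframe (φ x) (φ x) (tangentOf n m φ x w))) ?_ ?_ ?_ ?_, fun v w =>
      pullbackMetric_eq (φ x) (mem_chart_source _ _) v w⟩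
  · intro a b c; simp only [map_add, add_apply]
  · intro a b c; simp only [map_smul, smul_apply]
  · intro a b c; simp only [map_add]
  · intro a b c; simp only [map_smul]

lemma gramMatrix_localVariation {p : S} {q : M} {F : ℝ → S → M} {t : ℝ} {y : Euc n}
    (hy : y ∈ (chartAt (Euc n) p).target)
    (hF : ContMDiffAt (𝓘(ℝ, ℝ).prod (𝓡 n)) (𝓡 m) ∞ (fun z : ℝ × S => F z.1 z.2)
      (t, (chartAt (Euc n) p).symm y))
    (hq : F t ((chartAt (Euc n) p).symm y) ∈ (chartAt (Euc m) q).source) :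
    tensorCoeff (pullbackMetric (n := n) (m := m) (F t)) p y =
      gramMatrix (chartMetric q) (localVariation (n := n) (m := m) p q F) y t := by
  have h1 := contDiffAt_localVariation hy hF hq
  have h2 : MDifferentiableAt (𝓡 n) (𝓡 m) (F t) ((chartAt (Euc n) p).symm y) := by
    have h3 : ContMDiffAt (𝓡 n) (𝓡 m) ∞ (fun x => F t x) ((chartAt (Euc n) p).symm y) :=
      ContMDiffAt.comp (g := fun z : ℝ × S => F z.1 z.2) (f := fun x : S => (t, x)) _ hF
        (contMDiffAt_const.prodMk contMDiffAt_id)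
    exact h3.mdifferentiableAt (by simp)
  ext i j
  rw [tensorCoeff_pullback hy h2 hq, gramMatrix, Matrix.of_apply,
    ← fderiv_slice (h1.differentiableAt (by simp)), ← fderiv_slice (h1.differentiableAt (by simp))]
  rfl

variable [IsContMDiffRiemannianBundle (𝓡 m) ∞ (Euc m) (fun x : M => TangentSpace (𝓡 m) x)]

lemma contDiffAt_tensorCoeff_pullback {p : S} {φ : S → M} {y : Euc n}
    (hy : y ∈ (chartAt (Euc n) p).target) (hφ : ContMDiff (𝓡 n) (𝓡 m) ∞ φ) (i j : Fin n) :
    ContDiffAt ℝ ∞ (fun z => tensorCoeff (pullbackMetric (n := n) (m := m) φ) p z i j) y := by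
  set q := φ ((chartAt (Euc n) p).symm y) with hq
  have hqs : φ ((chartAt (Euc n) p).symm y) ∈ (chartAt (Euc m) q).source := mem_chart_source _ _
  have h1 := contDiffAt_localMap (q := q) hy hφ.contMDiffAt hqs
  have hG : ContDiffAt ℝ ∞ (fun z => chartMetric q (localMap p q φ z)) y :=
    contDiffAt_bilin_comp (contDiffAt_chartMetric q ((chartAt (Euc m) q).map_source hqs)) h1
  have hd : ∀ v : Euc n, ContDiffAt ℝ ∞ (fun z => fderiv ℝ (localMap p q φ) z v) y := fun v =>
    (h1.fderiv_right (by simp)).clm_apply contDiffAt_const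
  refine (contDiffAt_bilin hG (hd (EuclideanSpace.single i (1 : ℝ)))
    (hd (EuclideanSpace.single j (1 : ℝ)))).congr_of_eventuallyEq ?_
  have h2 : ∀ᶠ z in 𝓝 y, φ ((chartAt (Euc n) p).symm z) ∈ (chartAt (Euc m) q).source :=
    (hφ.continuous.continuousAt.comp ((chartAt (Euc n) p).continuousAt_symm hy)).eventually
      ((chartAt (Euc m) q).open_source.mem_nhds hqs)
  filter_upwards [h2, (chartAt (Euc n) p).open_target.mem_nhds hy] with z h3 h4
  exact tensorCoeff_pullback h4 (hφ.contMDiffAt.mdifferentiableAt (by simp)) h3 i j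

lemma isFormField_pullback {φ : S → M} (hφ : ContMDiff (𝓡 n) (𝓡 m) ∞ φ) :
    IsFormField (pullbackMetric (n := n) (m := m) φ) where
  bilin := pullbackMetric_bilin φ
  continuousOn _ i j _ hy :=
    (contDiffAt_tensorCoeff_pullback hy hφ i j).continuousAt.continuousWithinAt

end LocalMaps

/-! ### The second fundamental form in charts -/

section SecondForm

variable {n m : ℕ} {S : Type*} [TopologicalSpace S] [ChartedSpace (Euc n) S]
  {M : Type*} [TopologicalSpace M] [ChartedSpace (Euc m) M]
  [IsManifold (𝓡 n) ∞ S] [IsManifold (𝓡 m) ∞ M]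
  [RiemannianBundle (fun x : M => TangentSpace (𝓡 m) x)]
  [IsContMDiffRiemannianBundle (𝓡 m) ∞ (Euc m) (fun x : M => TangentSpace (𝓡 m) x)]

/-- The ambient covariant derivative `∇_{∂ᵢ} ∂ⱼ` along a map, in the charts at `x` and `φ x`. -/
def covHessian (φ : S → M) (x : S) (i j : Fin n) : Euc m :=
  fderiv ℝ (fun y => fderiv ℝ (localMap (n := n) (m := m) x (φ x) φ) y
      (EuclideanSpace.single j (1 : ℝ))) (chartAt (Euc n) x x) (EuclideanSpace.single i (1 : ℝ))
    + chartGamma (φ x) (chartAt (Euc m) (φ x) (φ x))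
      (fderiv ℝ (localMap (n := n) (m := m) x (φ x) φ) (chartAt (Euc n) x x)
        (EuclideanSpace.single i (1 : ℝ)))
      (fderiv ℝ (localMap (n := n) (m := m) x (φ x) φ) (chartAt (Euc n) x x)
        (EuclideanSpace.single j (1 : ℝ)))

lemma fderiv_component {X : Type*} [NormedAddCommGroup X] [NormedSpace ℝ X] {u : X → Euc m}
    {y : X} (hu : DifferentiableAt ℝ u y) (a : Fin m) (v : X) :
    fderiv ℝ (fun z => u z a) y v = fderiv ℝ u y v a := by
  have h := (EuclideanSpace.proj a : Euc m →L[ℝ] ℝ).hasFDerivAt.comp y hu.hasFDerivAt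
  exact congrArg (fun L => L v) h.fderiv

lemma ambientDeriv_eq {φ : S → M} (hφ : ContMDiff (𝓡 n) (𝓡 m) ∞ φ) (x : S) (i j : Fin n)
    (a : Fin m) : ambientDeriv φ x i j a = covHessian φ x i j a := by
  set y := chartAt (Euc n) x x with hy
  have hyt : y ∈ (chartAt (Euc n) x).target := mem_chart_target _ x
  have hx : (chartAt (Euc n) x).symm y = x := (chartAt (Euc n) x).left_inv (mem_chart_source _ x)
  set u := localMap (n := n) (m := m) x (φ x) φ with hu
  have h1 : ContDiffAt ℝ ∞ u y :=
    contDiffAt_localMap hyt hφ.contMDiffAt (by rw [hx]; exact mem_chart_source _ _)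
  have h2 : ∀ᶠ z in 𝓝 y, DifferentiableAt ℝ u z := by
    filter_upwards [eventually_contDiffAt h1 1] with z hz
    exact hz.differentiableAt (by simp)
  have hl : ∀ b, localCoord φ x b = fun z => u z b := fun b => rfl
  have h3 : ∀ b k, partialDeriv k (localCoord φ x b) =ᶠ[𝓝 y] fun z =>
      (fderiv ℝ u z (EuclideanSpace.single k (1 : ℝ))) b := by
    intro b k
    filter_upwards [h2] with z hz
    rw [hl, partialDeriv, fderiv_component hz]
  have h4 : DifferentiableAt ℝ (fun z => fderiv ℝ u z (EuclideanSpace.single j (1 : ℝ))) y := by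
    have : DifferentiableAt ℝ (fderiv ℝ u) y :=
      ContDiffAt.differentiableAt (n := ∞) (h1.fderiv_right (by simp)) (by simp)
    exact this.clm_apply (differentiableAt_const _)
  have h5 : partialDeriv i (partialDeriv j (localCoord φ x a)) y =
      fderiv ℝ (fun z => fderiv ℝ u z (EuclideanSpace.single j (1 : ℝ))) y
        (EuclideanSpace.single i (1 : ℝ)) a := by
    rw [partialDeriv, (h3 a j).fderiv_eq, fderiv_component h4]
  rw [ambientDeriv, covHessian, h5, PiLp.add_apply, chartGamma_apply]
  congr 1
  refine Finset.sum_congr rfl fun b _ => Finset.sum_congr rfl fun c _ => ?_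
  rw [(h3 b i).eq_of_nhds, (h3 c j).eq_of_nhds, mul_assoc]

lemma secondFundamentalForm_eq {φ : S → M} (hφ : ContMDiff (𝓡 n) (𝓡 m) ∞ φ) (x : S)
    (ν : Euc m) (v w : Euc n) : secondFundamentalForm (n := n) (m := m) φ x ν v w =
      ∑ i, ∑ j, chartCoframe x x v i * chartCoframe x x w j *
        chartMetric (φ x) (chartAt (Euc m) (φ x) (φ x)) (covHessian φ x i j)
          (chartCoframe (φ x) (φ x) ν) := by
  refine Finset.sum_congr rfl fun i _ => Finset.sum_congr rfl fun j _ => ?_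
  rw [chartMetric_eq_sum, Finset.mul_sum]
  refine Finset.sum_congr rfl fun a _ => ?_
  rw [Finset.mul_sum]
  refine Finset.sum_congr rfl fun b _ => ?_
  rw [ambientDeriv_eq hφ, tangentCoord_eq, tangentCoord_eq, tangentCoord_eq]
  ring

end SecondForm

/-! ### Orientations -/

section Orientation

variable {m : ℕ} {M : Type*} [TopologicalSpace M] [ChartedSpace (Euc m) M] [IsManifold (𝓡 m) ∞ M]

lemma eventually_pos_or_neg {X : Type*} [TopologicalSpace X] {u : X → ℝ} {x : X}
    (hu : ContinuousAt u x) (h0 : u x ≠ 0) :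
    (∀ᶠ y in 𝓝 x, 0 < u y) ∨ ∀ᶠ y in 𝓝 x, u y < 0 := by
  rcases lt_or_gt_of_ne h0 with h | h
  · exact Or.inr (hu.eventually (gt_mem_nhds h))
  · exact Or.inl (hu.eventually (lt_mem_nhds h))

lemma det_chartCoframe_ne_zero (p : M) {x : M} (hx : x ∈ (chartAt (Euc m) p).source) :
    (chartCoframe (m := m) p x).det ≠ 0 := by
  have h : (chartFrame p (chartAt (Euc m) p x)).comp (chartCoframe p x) =
      ContinuousLinearMap.id ℝ (Euc m) := by
    ext1 v
    exact chartFrame_chartCoframe p hx v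
  have h2 := congrArg ContinuousLinearMap.det h
  intro h0
  have h3 : (chartFrame p (chartAt (Euc m) p x)).det * (chartCoframe (m := m) p x).det = 1 := by
    rw [← LinearMap.det_id (A := ℝ) (M := Euc m)]
    refine Eq.trans ?_ h2
    exact (LinearMap.det_comp _ _).symm
  rw [h0, mul_zero] at h3
  exact zero_ne_one h3

/-- An orientation gives a choice of sign in each tangent space which is locally constant with
respect to the charts. -/
lemma exists_orientation_sign (hM : IsOrientable m M) : ∃ σ : M → ℝ, ∀ q x₀ : M,
    x₀ ∈ (chartAt (Euc m) q).source →
      (∀ᶠ x in 𝓝 x₀, 0 < σ x * (chartCoframe (m := m) q x).det) ∨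
      ∀ᶠ x in 𝓝 x₀, σ x * (chartCoframe (m := m) q x).det < 0 := by
  have : IsManifold (𝓡 m) 1 M := IsManifold.of_le (n := ∞) (by simp)
  obtain ⟨A, hA, hcov, hpos⟩ := hM
  have hmd : ∀ e ∈ A, e.MDifferentiable (𝓡 m) (𝓡 m) := fun e he =>
    ⟨(contMDiffOn_of_mem_maximalAtlas (hA he)).mdifferentiableOn (by simp),
      (contMDiffOn_symm_of_mem_maximalAtlas (hA he)).mdifferentiableOn (by simp)⟩
  let d : OpenPartialHomeomorph M (Euc m) → M → Euc m →L[ℝ] Euc m :=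
    fun e x => mfderiv (𝓡 m) (𝓡 m) e x
  have hd : ∀ (e e' : OpenPartialHomeomorph M (Euc m)), e.MDifferentiable (𝓡 m) (𝓡 m) →
      e'.MDifferentiable (𝓡 m) (𝓡 m) → ∀ x ∈ e.source, x ∈ e'.source →
      (d e' x).det = (fderiv ℝ (e.symm.trans e') (e x)).det * (d e x).det := by
    intro e e' he he' x hx hx'
    have hx2 : e.symm (e x) = x := e.left_inv hx
    have h1 := he.mdifferentiableAt_symm (e.map_source hx)
    have h2 := he'.mdifferentiableAt hx'
    have h3 := he.mdifferentiableAt hx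
    have h4 : MDifferentiableAt (𝓡 m) (𝓡 m) (e' ∘ e.symm) (e x) :=
      MDifferentiableAt.comp (e x) (by rw [hx2]; exact h2) h1
    have h5 := mfderiv_comp x h4 h3
    have h6 : mfderiv (𝓡 m) (𝓡 m) (e' ∘ e.symm) (e x) = fderiv ℝ (e.symm.trans e') (e x) :=
      mfderiv_eq_fderiv
    have h7 : (e' ∘ e.symm) ∘ e =ᶠ[𝓝 x] e' := by
      filter_upwards [e.open_source.mem_nhds hx] with z hz
      simp [e.left_inv hz]
    rw [h7.mfderiv_eq, h6] at h5
    have h8 : d e' x = (fderiv ℝ (e.symm.trans e') (e x)).comp (d e x) := h5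
    rw [h8]
    exact LinearMap.det_comp _ _
  choose e heA hes using hcov
  -- The sign at `x` is that of the differential at `x` of an oriented chart chosen there. The
  -- choice is arbitrary from point to point, but oriented charts differ by positive Jacobians, so
  -- near `x₀` the chart `e₀` can take its place.
  refine ⟨fun x => (d (e x) x).det, fun q x₀ hq => ?_⟩
  set e₀ := e x₀ with he₀
  set c := chartAt (Euc m) q with hc
  have hcm : c.MDifferentiable (𝓡 m) (𝓡 m) := mdifferentiable_chart q
  have he₀s : x₀ ∈ e₀.source := hes x₀
  have hcont : ContinuousAt (fun x => (fderiv ℝ (c.symm.trans e₀) (c x)).det) x₀ := by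
    have h1 : ContMDiffOn (𝓡 m) (𝓡 m) ∞ (c.symm.trans e₀) (c.symm.trans e₀).source :=
      (contMDiffOn_of_mem_maximalAtlas (hA (heA x₀))).comp
        (contMDiffOn_chart_symm.mono fun z hz => hz.1)
        (fun z hz => hz.2)
    have h2 : ContDiffAt ℝ ∞ (c.symm.trans e₀) (c x₀) := by
      refine (contMDiffOn_iff_contDiffOn.1 h1).contDiffAt
        ((c.symm.trans e₀).open_source.mem_nhds ?_)
      refine ⟨c.map_source hq, ?_⟩
      show c.symm (c x₀) ∈ e₀.source
      rwa [c.left_inv hq]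
    have h3 : ContinuousAt (fderiv ℝ (c.symm.trans e₀)) (c x₀) :=
      (h2.fderiv_right (m := ∞) (by simp)).continuousAt
    exact (ContinuousLinearMap.continuous_det.continuousAt).comp
      (h3.comp (c.continuousAt hq))
  -- Both determinants refer to the preferred coordinates of the tangent space at `x`, which may
  -- jump as `x` moves. The jump enters as a square, and what is left is the Jacobian of a fixed
  -- coordinate change, continuous in `x`.
  have hkey : ∀ᶠ x in 𝓝 x₀, ∃ b : ℝ, 0 < b ∧ (d (e x) x).det * (chartCoframe (m := m) q x).det =
      b * (fderiv ℝ (c.symm.trans e₀) (c x)).det := by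
    filter_upwards [e₀.open_source.mem_nhds he₀s, c.open_source.mem_nhds hq] with x hx hx'
    have h1 := hd e₀ (e x) (hmd _ (heA x₀)) (hmd _ (heA x)) x hx (hes x)
    have h2 := hd c e₀ hcm (hmd _ (heA x₀)) x hx' hx
    have h3 : 0 < (fderiv ℝ (e₀.symm.trans (e x)) (e₀ x)).det := by
      refine hpos _ (heA x₀) _ (heA x) _ ⟨e₀.map_source hx, ?_⟩
      show e₀.symm (e₀ x) ∈ (e x).source
      rw [e₀.left_inv hx]; exact hes x
    have h4 : (chartCoframe (m := m) q x).det ≠ 0 := det_chartCoframe_ne_zero q hx'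
    refine ⟨(fderiv ℝ (e₀.symm.trans (e x)) (e₀ x)).det * (chartCoframe (m := m) q x).det ^ 2,
      by positivity, ?_⟩
    rw [h1, h2]
    change _ * (_ * (chartCoframe (m := m) q x).det) * _ = _
    ring
  have hne : (fderiv ℝ (c.symm.trans e₀) (c x₀)).det ≠ 0 := by
    have h2 := hd e₀ c (hmd _ (heA x₀)) hcm x₀ he₀s hq
    have h3 := hd c e₀ hcm (hmd _ (heA x₀)) x₀ hq he₀s
    have h4 : (d c x₀).det ≠ 0 := det_chartCoframe_ne_zero q hq
    intro h0
    rw [h0, zero_mul] at h3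
    rw [h3, mul_zero] at h2
    exact h4 h2
  rcases eventually_pos_or_neg hcont hne with h | h
  · left
    filter_upwards [hkey, h] with x ⟨b, hb, h1⟩ h2
    rw [h1]; positivity
  · right
    filter_upwards [hkey, h] with x ⟨b, hb, h1⟩ h2
    rw [h1]; exact mul_neg_of_pos_of_neg hb h2

end Orientation

/-! ### The unit normal field of a hypersurface -/

section Normal

/-- The map `(v, s) ↦ L v + s w`. -/
def pairMap {E F : Type*} [NormedAddCommGroup E] [NormedSpace ℝ E] [NormedAddCommGroup F]
    [NormedSpace ℝ F] (L : E →L[ℝ] F) (w : F) : E × ℝ →L[ℝ] F :=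
  L.comp (ContinuousLinearMap.fst ℝ E ℝ) + (ContinuousLinearMap.snd ℝ E ℝ).smulRight w

@[simp] lemma pairMap_apply {E F : Type*} [NormedAddCommGroup E] [NormedSpace ℝ E]
    [NormedAddCommGroup F] [NormedSpace ℝ F] (L : E →L[ℝ] F) (w : F) (z : E × ℝ) :
    pairMap L w z = L z.1 + z.2 • w := by
  simp [pairMap]

lemma continuous_pairMap {E F : Type*} [NormedAddCommGroup E] [NormedSpace ℝ E]
    [NormedAddCommGroup F] [NormedSpace ℝ F] :
    Continuous fun z : (E →L[ℝ] F) × F => pairMap z.1 z.2 := by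
  unfold pairMap
  have h1 : Continuous fun z : (E →L[ℝ] F) × F =>
      (ContinuousLinearMap.snd ℝ E ℝ).smulRight z.2 :=
    (ContinuousLinearMap.smulRightL ℝ (E × ℝ) F (ContinuousLinearMap.snd ℝ E ℝ)).continuous.comp
      continuous_snd
  exact (continuous_fst.clm_comp continuous_const).add h1

variable {n : ℕ}

/-- A fixed identification of `ℝⁿ⁺¹` with `ℝⁿ × ℝ`. -/
def splitEquiv (n : ℕ) : Euc (n + 1) ≃L[ℝ] Euc n × ℝ :=
  ContinuousLinearEquiv.ofFinrankEq (by simp)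

/-- The determinant of the frame consisting of a hyperplane and a transversal vector. -/
def frameDet (L : Euc n →L[ℝ] Euc (n + 1)) (w : Euc (n + 1)) : ℝ :=
  ((splitEquiv n : Euc (n + 1) →L[ℝ] Euc n × ℝ).comp (pairMap L w)).det

lemma continuous_frameDet :
    Continuous fun z : (Euc n →L[ℝ] Euc (n + 1)) × Euc (n + 1) => frameDet z.1 z.2 :=
  ContinuousLinearMap.continuous_det.comp (continuous_const.clm_comp continuous_pairMap)

/-- The identification with `ℝⁿ × ℝ` only turns the frame into an endomorphism; conjugating `T` by
it does not change its determinant. -/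
lemma frameDet_comp_left (T : Euc (n + 1) →L[ℝ] Euc (n + 1)) (L : Euc n →L[ℝ] Euc (n + 1))
    (w : Euc (n + 1)) : frameDet (T.comp L) (T w) = T.det * frameDet L w := by
  have h : ((splitEquiv n : Euc (n + 1) →L[ℝ] Euc n × ℝ).comp (pairMap (T.comp L) (T w)) :
      Euc n × ℝ →ₗ[ℝ] Euc n × ℝ) =
      (((splitEquiv n).toLinearEquiv : Euc (n + 1) →ₗ[ℝ] Euc n × ℝ) ∘ₗ (T : Euc (n + 1) →ₗ[ℝ] _) ∘ₗ
        ((splitEquiv n).toLinearEquiv.symm : Euc n × ℝ →ₗ[ℝ] Euc (n + 1))) ∘ₗ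
      ((splitEquiv n : Euc (n + 1) →L[ℝ] Euc n × ℝ).comp (pairMap L w) :
        Euc n × ℝ →ₗ[ℝ] Euc n × ℝ) := by
    refine LinearMap.ext fun z => ?_
    simp
  have h2 := congrArg LinearMap.det h
  rw [LinearMap.det_comp, LinearMap.det_conj] at h2
  exact h2

lemma frameDet_comp_right (L : Euc n →L[ℝ] Euc (n + 1)) (T : Euc n →L[ℝ] Euc n)
    (w : Euc (n + 1)) : frameDet (L.comp T) w = frameDet L w * T.det := by
  have h : ((splitEquiv n : Euc (n + 1) →L[ℝ] Euc n × ℝ).comp (pairMap (L.comp T) w) :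
      Euc n × ℝ →ₗ[ℝ] Euc n × ℝ) =
      ((splitEquiv n : Euc (n + 1) →L[ℝ] Euc n × ℝ).comp (pairMap L w) :
        Euc n × ℝ →ₗ[ℝ] Euc n × ℝ) ∘ₗ ((T : Euc n →ₗ[ℝ] Euc n).prodMap LinearMap.id) := by
    refine LinearMap.ext fun z => ?_
    simp
  have h2 := congrArg LinearMap.det h
  rw [LinearMap.det_comp, LinearMap.det_prodMap, LinearMap.det_id, mul_one] at h2
  exact h2

lemma frameDet_smul (L : Euc n →L[ℝ] Euc (n + 1)) (w : Euc (n + 1)) (c : ℝ) :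
    frameDet L (c • w) = c * frameDet L w := by
  have h : ((splitEquiv n : Euc (n + 1) →L[ℝ] Euc n × ℝ).comp (pairMap L (c • w)) :
      Euc n × ℝ →ₗ[ℝ] Euc n × ℝ) =
      ((splitEquiv n : Euc (n + 1) →L[ℝ] Euc n × ℝ).comp (pairMap L w) :
        Euc n × ℝ →ₗ[ℝ] Euc n × ℝ) ∘ₗ
        ((LinearMap.id : Euc n →ₗ[ℝ] Euc n).prodMap (c • (LinearMap.id : ℝ →ₗ[ℝ] ℝ))) := by
    refine LinearMap.ext fun z => ?_
    simp [smul_smul, mul_comm]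
  have h2 := congrArg LinearMap.det h
  rw [LinearMap.det_comp, LinearMap.det_prodMap, LinearMap.det_id, LinearMap.det_smul,
    LinearMap.det_id, one_mul] at h2
  simp only [Module.finrank_self, pow_one, mul_one] at h2
  rw [mul_comm]
  exact h2

/-- Pairing `L v + s w = 0` with `w` gives `s = 0`, and injectivity of `L` gives `v = 0`, so the
frame map has trivial kernel. -/
lemma frameDet_ne_zero {G : Euc (n + 1) →L[ℝ] Euc (n + 1) →L[ℝ] ℝ}
    {L : Euc n →L[ℝ] Euc (n + 1)} {w : Euc (n + 1)} (hL : Function.Injective L)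
    (hw : ∀ v, G (L v) w = 0) (hww : G w w ≠ 0) : frameDet L w ≠ 0 := by
  intro h0
  have h1 := LinearMap.bot_lt_ker_of_det_eq_zero h0
  refine h1.ne' ?_
  rw [LinearMap.ker_eq_bot']
  rintro ⟨v, s⟩ hz
  have h2 : splitEquiv n (pairMap L w (v, s)) = 0 := hz
  rw [map_eq_zero_iff _ (splitEquiv n).injective, pairMap_apply] at h2
  have h3 := congrArg (fun u => G u w) h2
  simp only [map_add, map_smul, add_apply, smul_apply, hw, map_zero, zero_apply, zero_add,
    smul_eq_mul, mul_eq_zero, hww, or_false] at h3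
  rw [h3, zero_smul, add_zero, map_eq_zero_iff _ hL] at h2
  simp only at h2
  rw [h2, h3]
  rfl

end Normal

/-! ### Existence of a smooth unit normal field -/

section LocalNormal

variable {n : ℕ}

/-- A unit normal field along a parametrized hypersurface of `ℝⁿ⁺¹` with a metric. -/
lemma exists_local_normal {G : Euc n → Euc (n + 1) →L[ℝ] Euc (n + 1) →L[ℝ] ℝ}
    {u : Euc n → Euc (n + 1)} {y₀ : Euc n} (hG : ContDiffAt ℝ ∞ G y₀) (hu : ContDiffAt ℝ ∞ u y₀)
    (hsymm : ∀ y v w, G y v w = G y w v) (hpos : ∀ᶠ y in 𝓝 y₀, ∀ v, v ≠ 0 → 0 < G y v v)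
    (hinj : ∀ᶠ y in 𝓝 y₀, Function.Injective (fderiv ℝ u y)) :
    ∃ N : Euc n → Euc (n + 1), ContDiffAt ℝ ∞ N y₀ ∧ ∀ᶠ y in 𝓝 y₀,
      (∀ v, G y (fderiv ℝ u y v) (N y) = 0) ∧ G y (N y) (N y) = 1 := by
  have hns : ¬ Function.Surjective (fderiv ℝ u y₀) := by
    intro hs
    have h2 : (fderiv ℝ u y₀ : Euc n →ₗ[ℝ] Euc (n + 1)).range = ⊤ := LinearMap.range_eq_top.2 hs
    have h3 := LinearMap.finrank_range_le (fderiv ℝ u y₀ : Euc n →ₗ[ℝ] Euc (n + 1))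
    rw [h2, finrank_top] at h3
    simp at h3
  -- For reasons of dimension some vector lies outside the tangent hyperplane at `y₀`. Taken as a
  -- constant field, it is projected off the tangent hyperplanes and normalized.
  obtain ⟨w₀, hw₀⟩ := not_forall.1 hns
  let e : Fin n → Euc n := fun i => EuclideanSpace.single i (1 : ℝ)
  let U : Fin n → Euc n → Euc (n + 1) := fun i y => fderiv ℝ u y (e i)
  let h : Euc n → Matrix (Fin n) (Fin n) ℝ := fun y => Matrix.of fun i j => G y (U i y) (U j y)
  let N₁ : Euc n → Euc (n + 1) := fun y => w₀ - ∑ i, (∑ j, (h y)⁻¹ i j * G y w₀ (U j y)) • U i y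
  have hU : ∀ i, ContDiffAt ℝ ∞ (U i) y₀ := fun i =>
    (hu.fderiv_right (by simp)).clm_apply contDiffAt_const
  have hdet : ∀ y, (∀ v, v ≠ 0 → 0 < G y v v) → Function.Injective (fderiv ℝ u y) →
      (h y).det ≠ 0 := by
    intro y hp hi
    refine det_ne_zero_of_definite fun a ha => ?_
    have hsum : ∑ i, ∑ j, a i * h y i j * a j =
        G y (fderiv ℝ u y (WithLp.toLp 2 a)) (fderiv ℝ u y (WithLp.toLp 2 a)) := by
      conv_rhs => rw [euc_sum (WithLp.toLp 2 a : Euc n)]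
      simp only [map_sum, map_smul, sum_apply, smul_apply, smul_eq_mul, Finset.mul_sum]
      rw [Finset.sum_comm]
      refine Finset.sum_congr rfl fun i _ => Finset.sum_congr rfl fun j _ => ?_
      change a j * G y (U j y) (U i y) * a i = _
      ring
    rw [hsum]
    refine hp _ fun h0 => ha ?_
    have h1 : (WithLp.toLp 2 a : Euc n) = 0 := by
      apply hi; rw [h0, map_zero]
    exact (WithLp.toLp_eq_zero 2).1 h1
  have hhs : ∀ i j, ContDiffAt ℝ ∞ (fun y => h y i j) y₀ := fun i j =>
    contDiffAt_bilin hG (hU i) (hU j)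
  have hN₁ : ContDiffAt ℝ ∞ N₁ y₀ := by
    refine contDiffAt_const.sub (ContDiffAt.sum fun i _ => ContDiffAt.smul
      (f := fun y => ∑ j, (h y)⁻¹ i j * G y w₀ (U j y)) (g := U i) ?_ (hU i))
    exact ContDiffAt.sum fun j _ =>
      (contDiffAt_matrix_inv hhs (hdet y₀ hpos.self_of_nhds hinj.self_of_nhds) i j).mul
        (contDiffAt_bilin hG contDiffAt_const (hU j))
  have hN₁0 : N₁ y₀ ≠ 0 := by
    intro h0
    apply hw₀
    refine ⟨∑ i, (∑ j, (h y₀)⁻¹ i j * G y₀ w₀ (U j y₀)) • e i, ?_⟩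
    simp only [map_sum, map_smul]
    exact (sub_eq_zero.1 h0).symm
  have hnorm : ∀ y, (h y).det ≠ 0 → ∀ v, G y (fderiv ℝ u y v) (N₁ y) = 0 := by
    intro y hy v
    have hk : ∀ k, G y (U k y) (N₁ y) = 0 := by
      intro k
      simp only [N₁, map_sub, map_sum, map_smul, smul_eq_mul, Finset.sum_mul]
      rw [Finset.sum_comm, sub_eq_zero]
      have h1 : ∀ j, ∑ i, (h y)⁻¹ i j * G y w₀ (U j y) * G y (U k y) (U i y) =
          G y w₀ (U j y) * ((h y) * (h y)⁻¹) k j := by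
        intro j
        rw [Matrix.mul_apply, Finset.mul_sum]
        refine Finset.sum_congr rfl fun i _ => ?_
        change _ = _ * (G y (U k y) (U i y) * _)
        ring
      simp only [h1, Matrix.mul_nonsing_inv _ hy.isUnit, Matrix.one_apply, mul_ite, mul_one,
        mul_zero, Finset.sum_ite_eq, Finset.mem_univ, if_true]
      exact hsymm _ _ _
    rw [euc_sum v]
    simp only [map_sum, map_smul, sum_apply, smul_apply]
    exact Finset.sum_eq_zero fun k _ => by rw [show G y (fderiv ℝ u y (EuclideanSpace.single k 1))
        (N₁ y) = 0 from hk k, smul_zero]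
  have hsq : 0 < G y₀ (N₁ y₀) (N₁ y₀) := hpos.self_of_nhds _ hN₁0
  have hsqs : ContDiffAt ℝ ∞ (fun y => G y (N₁ y) (N₁ y)) y₀ := contDiffAt_bilin hG hN₁ hN₁
  refine ⟨fun y => (Real.sqrt (G y (N₁ y) (N₁ y)))⁻¹ • N₁ y,
    ((hsqs.sqrt hsq.ne').inv (Real.sqrt_ne_zero'.2 hsq)).smul hN₁, ?_⟩
  filter_upwards [hpos, hinj, hsqs.continuousAt.eventually (lt_mem_nhds hsq)] with y h1 h2 h3
  have h4 := hnorm y (hdet y h1 h2)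
  refine ⟨fun v => by rw [map_smul, h4, smul_zero], ?_⟩
  simp only [map_smul, smul_apply, smul_eq_mul]
  rw [← mul_assoc, ← mul_inv, Real.mul_self_sqrt h3.le, inv_mul_cancel₀ h3.ne']

end LocalNormal

/-! ### The global unit normal of an oriented hypersurface. -/

section GlobalNormal

variable {n : ℕ} {S : Type*} [TopologicalSpace S] [ChartedSpace (Euc n) S]
  {M : Type*} [TopologicalSpace M] [ChartedSpace (Euc (n + 1)) M]
  [IsManifold (𝓡 n) ∞ S] [IsManifold (𝓡 (n + 1)) ∞ M]
  [RiemannianBundle (fun x : M => TangentSpace (𝓡 (n + 1)) x)]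

/-- `w` is a unit normal vector of `φ` at `x`. -/
def IsUnitNormal (n : ℕ) [ChartedSpace (Euc n) S] [ChartedSpace (Euc (n + 1)) M]
    [RiemannianBundle (fun x : M => TangentSpace (𝓡 (n + 1)) x)]
    (φ : S → M) (x : S) (w : Euc (n + 1)) : Prop :=
  IsNormal (n := n) (m := n + 1) φ x w ∧ metricTensor (m := n + 1) (φ x) w w = 1

lemma fderiv_localMap_chart {m : ℕ} {M : Type*} [TopologicalSpace M] [ChartedSpace (Euc m) M]
    [IsManifold (𝓡 m) ∞ M] {p : S} {q : M} {φ : S → M} {x : S}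
    (hx : x ∈ (chartAt (Euc n) p).source)
    (hφ : MDifferentiableAt (𝓡 n) (𝓡 m) φ x)
    (hq : φ x ∈ (chartAt (Euc m) q).source) (v : Euc n) :
    fderiv ℝ (localMap (n := n) (m := m) p q φ) (chartAt (Euc n) p x) v =
      chartCoframe q (φ x) (tangentOf n m φ x (chartFrame p (chartAt (Euc n) p x) v)) := by
  have h := fderiv_localMap (p := p) (q := q) (φ := φ) ((chartAt (Euc n) p).map_source hx)
    (by rw [(chartAt (Euc n) p).left_inv hx]; exact hφ)
    (by rw [(chartAt (Euc n) p).left_inv hx]; exact hq) v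
  rw [(chartAt (Euc n) p).left_inv hx] at h
  exact h

lemma isUnitNormal_iff {p : S} {q : M} {φ : S → M} {x : S}
    (hx : x ∈ (chartAt (Euc n) p).source)
    (hφ : MDifferentiableAt (𝓡 n) (𝓡 (n + 1)) φ x)
    (hq : φ x ∈ (chartAt (Euc (n + 1)) q).source) (w : Euc (n + 1)) :
    IsUnitNormal n φ x w ↔
      (∀ v, chartMetric q (chartAt (Euc (n + 1)) q (φ x))
        (fderiv ℝ (localMap (n := n) (m := n + 1) p q φ) (chartAt (Euc n) p x) v)
        (chartCoframe q (φ x) w) = 0) ∧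
      chartMetric q (chartAt (Euc (n + 1)) q (φ x)) (chartCoframe q (φ x) w)
        (chartCoframe q (φ x) w) = 1 := by
  rw [chartMetric_coframe q hq]
  refine and_congr ⟨fun h v => ?_, fun h (v : Euc n) => ?_⟩ Iff.rfl
  · rw [fderiv_localMap_chart hx hφ hq, chartMetric_coframe q hq]
    exact h _
  · have h1 := h (chartCoframe p x v)
    rw [fderiv_localMap_chart hx hφ hq, chartMetric_coframe q hq, chartFrame_chartCoframe p hx]
      at h1
    exact h1

lemma finrank_euc (k : ℕ) : Module.finrank ℝ (Euc k) = k := by simp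

/-- The unit normal vectors of a hyperplane are unique up to sign. -/
lemma unit_normal_unique {g : Euc (n + 1) →L[ℝ] Euc (n + 1) →L[ℝ] ℝ}
    (hg : ∀ v w, g v w = g w v) (hpos : ∀ v, v ≠ 0 → 0 < g v v)
    {L : Euc n →L[ℝ] Euc (n + 1)} (hL : Function.Injective L) {N w : Euc (n + 1)}
    (hN : ∀ v, g (L v) N = 0) (hNN : g N N = 1) (hw : ∀ v, g (L v) w = 0) : w = g w N • N := by
  set u : Fin n → Euc (n + 1) := fun i => L (EuclideanSpace.single i (1 : ℝ)) with hu
  set h : Matrix (Fin n) (Fin n) ℝ := Matrix.of fun i j => g (u i) (u j) with hh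
  have hdet : h.det ≠ 0 := by
    refine det_ne_zero_of_definite fun a ha => ?_
    have hsum : ∑ i, ∑ j, a i * h i j * a j =
        g (L (WithLp.toLp 2 a)) (L (WithLp.toLp 2 a)) := by
      conv_rhs => rw [euc_sum (WithLp.toLp 2 a : Euc n)]
      simp only [map_sum, map_smul, sum_apply, smul_apply, smul_eq_mul, Finset.mul_sum]
      rw [Finset.sum_comm]
      refine Finset.sum_congr rfl fun i _ => Finset.sum_congr rfl fun j _ => ?_
      change a j * g (u j) (u i) * a i = _
      ring
    rw [hsum]
    refine hpos _ fun h0 => ha ?_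
    have h1 : (WithLp.toLp 2 a : Euc n) = 0 := by
      apply hL; rw [h0, map_zero]
    exact (WithLp.toLp_eq_zero 2).1 h1
  have h1 := frame_expansion (finrank_euc (n + 1)) g hg (h := h) (fun i j => rfl) hdet
    (fun i => hN _) hNN w
  rw [Finset.sum_eq_zero, zero_add] at h1
  · exact h1
  · intro i _
    rw [Finset.sum_eq_zero, zero_smul]
    intro j _
    rw [hg, hw, mul_zero]

variable [IsContMDiffRiemannianBundle (𝓡 (n + 1)) ∞ (Euc (n + 1))
  (fun x : M => TangentSpace (𝓡 (n + 1)) x)]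

lemma fderiv_localMap_comp_coframe {p : S} {q : M} {φ : S → M} {x : S}
    (hx : x ∈ (chartAt (Euc n) p).source)
    (hφ : MDifferentiableAt (𝓡 n) (𝓡 (n + 1)) φ x)
    (hq : φ x ∈ (chartAt (Euc (n + 1)) q).source) :
    (fderiv ℝ (localMap (n := n) (m := n + 1) p q φ) (chartAt (Euc n) p x)).comp
      (chartCoframe p x) = (chartCoframe q (φ x)).comp (tangentOf n (n + 1) φ x) := by
  ext1 v
  change fderiv ℝ _ _ (chartCoframe p x v) = _
  rw [fderiv_localMap_chart hx hφ hq, chartFrame_chartCoframe p hx]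
  rfl

lemma injective_fderiv_localMap {p : S} {q : M} {φ : S → M} {x : S}
    (hx : x ∈ (chartAt (Euc n) p).source)
    (hφ : MDifferentiableAt (𝓡 n) (𝓡 (n + 1)) φ x)
    (hq : φ x ∈ (chartAt (Euc (n + 1)) q).source)
    (hinj : Function.Injective (tangentOf n (n + 1) φ x)) :
    Function.Injective (fderiv ℝ (localMap (n := n) (m := n + 1) p q φ) (chartAt (Euc n) p x)) := by
  refine (injective_iff_map_eq_zero _).2 fun v hv => ?_
  rw [fderiv_localMap_chart hx hφ hq] at hv
  have h1 := congrArg (chartFrame q (chartAt (Euc (n + 1)) q (φ x))) hv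
  rw [chartFrame_chartCoframe q hq, map_zero] at h1
  have h2 := hinj (h1.trans (map_zero _).symm)
  have h3 := congrArg (chartCoframe p x) h2
  have h4 := chartCoframe_chartFrame p ((chartAt (Euc n) p).map_source hx) v
  rw [(chartAt (Euc n) p).left_inv hx] at h4
  rw [h4, map_zero] at h3
  exact h3

lemma exists_local_normal_chart {φ : S → M} (hφ : ContMDiff (𝓡 n) (𝓡 (n + 1)) ∞ φ)
    (hinj : ∀ x, Function.Injective (tangentOf n (n + 1) φ x)) (p : S) (q : M) {y₀ : Euc n}
    (hy : y₀ ∈ (chartAt (Euc n) p).target)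
    (hq : φ ((chartAt (Euc n) p).symm y₀) ∈ (chartAt (Euc (n + 1)) q).source) :
    ∃ N : Euc n → Euc (n + 1), ContDiffAt ℝ ∞ N y₀ ∧ ∀ᶠ y in 𝓝 y₀,
      (∀ v, chartMetric q (localMap p q φ y)
        (fderiv ℝ (localMap (n := n) (m := n + 1) p q φ) y v) (N y) = 0) ∧
      chartMetric q (localMap p q φ y) (N y) (N y) = 1 := by
  have hu := contDiffAt_localMap hy hφ.contMDiffAt hq
  have hev : ∀ᶠ y in 𝓝 y₀, y ∈ (chartAt (Euc n) p).target ∧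
      φ ((chartAt (Euc n) p).symm y) ∈ (chartAt (Euc (n + 1)) q).source :=
    ((chartAt (Euc n) p).open_target.eventually_mem hy).and
      ((hφ.continuous.continuousAt.comp ((chartAt (Euc n) p).continuousAt_symm hy)).eventually
        ((chartAt (Euc (n + 1)) q).open_source.mem_nhds hq))
  refine exists_local_normal (G := fun y => chartMetric q (localMap p q φ y))
    (contDiffAt_bilin_comp (contDiffAt_chartMetric q ((chartAt (Euc (n + 1)) q).map_source hq)) hu)
    hu (fun y => chartMetric_symm q _) ?_ ?_
  · filter_upwards [hev] with y h v hv
    exact chartMetric_pos q ((chartAt (Euc (n + 1)) q).map_source h.2) hv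
  · filter_upwards [hev] with y h
    have h1 := injective_fderiv_localMap (p := p) (q := q)
      ((chartAt (Euc n) p).map_target h.1) (hφ.mdifferentiable (by simp) _) h.2 (hinj _)
    rwa [(chartAt (Euc n) p).right_inv h.1] at h1

/-- The frame determinant is nonzero on a unit normal and changes sign with it, so one of the two
unit normals has the required sign. -/
lemma exists_signed_unit_normal {φ : S → M} (hφ : ContMDiff (𝓡 n) (𝓡 (n + 1)) ∞ φ)
    (hinj : ∀ x, Function.Injective (tangentOf n (n + 1) φ x)) (x : S) {a : ℝ} (ha : a ≠ 0) :
    ∃ w, IsUnitNormal n φ x w ∧ 0 < a * frameDet (tangentOf n (n + 1) φ x) w := by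
  have hmd : ∀ x, MDifferentiableAt (𝓡 n) (𝓡 (n + 1)) φ x := hφ.mdifferentiable (by simp)
  have hxs : x ∈ (chartAt (Euc n) x).source := mem_chart_source _ x
  have hqs : φ x ∈ (chartAt (Euc (n + 1)) (φ x)).source := mem_chart_source _ _
  obtain ⟨N, -, hN⟩ := exists_local_normal_chart hφ hinj x (φ x)
    ((chartAt (Euc n) x).map_source hxs) (by rw [(chartAt (Euc n) x).left_inv hxs]; exact hqs)
  have hN0 := hN.self_of_nhds
  rw [localMap_chart hxs] at hN0
  set w := chartFrame (φ x) (chartAt (Euc (n + 1)) (φ x) (φ x)) (N (chartAt (Euc n) x x)) with hw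
  have hcw : chartCoframe (φ x) (φ x) w = N (chartAt (Euc n) x x) := by
    have := chartCoframe_chartFrame (φ x) ((chartAt (Euc (n + 1)) (φ x)).map_source hqs)
      (N (chartAt (Euc n) x x))
    rwa [(chartAt (Euc (n + 1)) (φ x)).left_inv hqs] at this
  have hw1 : IsUnitNormal n φ x w := by
    rw [isUnitNormal_iff hxs (hmd x) hqs, hcw]
    exact hN0
  have hne : frameDet (tangentOf n (n + 1) φ x) w ≠ 0 := by
    -- The nonvanishing is seen in coordinates, where the metric is a bilinear form on the model
    -- space; the differentials of the charts only contribute factors.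
    have h1 : frameDet ((chartCoframe (φ x) (φ x)).comp (tangentOf n (n + 1) φ x))
        (chartCoframe (φ x) (φ x) w) ≠ 0 := by
      rw [← fderiv_localMap_comp_coframe hxs (hmd x) hqs, frameDet_comp_right]
      refine mul_ne_zero (frameDet_ne_zero (G := chartMetric (φ x)
        (chartAt (Euc (n + 1)) (φ x) (φ x)))
        (injective_fderiv_localMap hxs (hmd x) hqs (hinj x)) ?_ ?_)
        (det_chartCoframe_ne_zero x hxs)
      · rw [hcw]; exact hN0.1
      · rw [hcw, hN0.2]; exact one_ne_zero
    rw [frameDet_comp_left] at h1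
    exact right_ne_zero_of_mul h1
  have hne2 : a * frameDet (tangentOf n (n + 1) φ x) w ≠ 0 :=
    mul_ne_zero ha hne
  rcases lt_or_gt_of_ne hne2 with h | h
  · refine ⟨(-1 : ℝ) • w, ?_, ?_⟩
    · rw [isUnitNormal_iff hxs (hmd x) hqs, map_smul, hcw]
      refine ⟨fun v => by rw [map_smul, hN0.1 v, smul_zero], ?_⟩
      simp only [map_smul, smul_apply, hN0.2, smul_eq_mul]
      norm_num
    · rw [frameDet_smul]
      linarith
  · exact ⟨w, hw1, h⟩

lemma continuousAt_frameDet {X : Type*} [TopologicalSpace X]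
    {L : X → Euc n →L[ℝ] Euc (n + 1)} {w : X → Euc (n + 1)} {x : X} (hL : ContinuousAt L x)
    (hw : ContinuousAt w x) : ContinuousAt (fun z => frameDet (L z) (w z)) x :=
  ContinuousAt.comp (g := fun z : (Euc n →L[ℝ] Euc (n + 1)) × Euc (n + 1) => frameDet z.1 z.2)
    (f := fun z => (L z, w z)) continuous_frameDet.continuousAt (hL.prodMk hw)

lemma eventually_sign_mul {X : Type*} {l : Filter X} {a b : X → ℝ}
    (ha : (∀ᶠ z in l, 0 < a z) ∨ ∀ᶠ z in l, a z < 0)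
    (hb : (∀ᶠ z in l, 0 < b z) ∨ ∀ᶠ z in l, b z < 0) :
    (∀ᶠ z in l, 0 < a z * b z) ∨ ∀ᶠ z in l, a z * b z < 0 := by
  rcases ha with ha | ha <;> rcases hb with hb | hb
  · exact Or.inl (by filter_upwards [ha, hb] with z h1 h2 using mul_pos h1 h2)
  · exact Or.inr (by filter_upwards [ha, hb] with z h1 h2 using mul_neg_of_pos_of_neg h1 h2)
  · exact Or.inr (by filter_upwards [ha, hb] with z h1 h2 using mul_neg_of_neg_of_pos h1 h2)
  · exact Or.inl (by filter_upwards [ha, hb] with z h1 h2 using mul_pos_of_neg_of_neg h1 h2)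

/-- At each point `c` is `1` or `-1`, and positivity of `c k` forces it to share the sign of `k`,
which is eventually constant. -/
lemma exists_constant_sign {X V : Type*} [AddCommGroup V] [Module ℝ V] {l : Filter X} {k : X → ℝ}
    {v w : X → V} (hk : (∀ᶠ z in l, 0 < k z) ∨ ∀ᶠ z in l, k z < 0)
    (h : ∀ᶠ z in l, ∃ c : ℝ, c * c = 1 ∧ v z = c • w z ∧ 0 < c * k z) :
    ∃ s : ℝ, ∀ᶠ z in l, v z = s • w z := by
  rcases hk with hk | hk
  · refine ⟨1, ?_⟩
    filter_upwards [h, hk] with z ⟨c, h1, h2, h3⟩ h4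
    have h5 : 0 < c := (pos_iff_pos_of_mul_pos h3).2 h4
    rw [h2, show c = 1 by nlinarith]
  · refine ⟨-1, ?_⟩
    filter_upwards [h, hk] with z ⟨c, h1, h2, h3⟩ h4
    have h5 : c < 0 := by
      by_contra h
      push Not at h
      nlinarith
    rw [h2, show c = -1 by nlinarith]

/-- An oriented immersed hypersurface of an oriented manifold has a smooth unit normal field. -/
theorem exists_unit_normal_field (hS : IsOrientable n S) (hM : IsOrientable (n + 1) M) {φ : S → M}
    (hφ : ContMDiff (𝓡 n) (𝓡 (n + 1)) ∞ φ)
    (hinj : ∀ x, Function.Injective (tangentOf n (n + 1) φ x)) :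
    ∃ ν : S → Euc (n + 1), (∀ x, IsUnitNormal n φ x (ν x)) ∧
      ∀ (p : S) (q : M) (y : Euc n), y ∈ (chartAt (Euc n) p).target →
        φ ((chartAt (Euc n) p).symm y) ∈ (chartAt (Euc (n + 1)) q).source →
        ContDiffAt ℝ ∞ (fun z => chartCoframe q (φ ((chartAt (Euc n) p).symm z))
          (ν ((chartAt (Euc n) p).symm z))) y := by
  obtain ⟨σ, hσ⟩ := exists_orientation_sign hS
  obtain ⟨τ, hτ⟩ := exists_orientation_sign hM
  have hmd : ∀ x, MDifferentiableAt (𝓡 n) (𝓡 (n + 1)) φ x := hφ.mdifferentiable (by simp)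
  have hσ0 : ∀ x, σ x ≠ 0 := by
    intro x h0
    rcases hσ x x (mem_chart_source _ x) with h | h <;> simpa [h0] using h.self_of_nhds
  have hτ0 : ∀ x, τ x ≠ 0 := by
    intro x h0
    rcases hτ x x (mem_chart_source _ x) with h | h <;> simpa [h0] using h.self_of_nhds
  -- Of the two unit normals, `ν` is the one for which the frame formed by the tangent space and the
  -- normal agrees with the two orientations, compared through `σ` and `τ`.
  have hex := fun x => exists_signed_unit_normal hφ hinj x (mul_ne_zero (hσ0 x) (hτ0 (φ x)))
  choose ν hν hνpos using hex
  refine ⟨ν, hν, fun p q y hy hq => ?_⟩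
  obtain ⟨N, hNs, hN⟩ := exists_local_normal_chart hφ hinj p q hy hq
  have hps : ContinuousAt (chartAt (Euc n) p).symm y := (chartAt (Euc n) p).continuousAt_symm hy
  have hφps : ContinuousAt (fun z => φ ((chartAt (Euc n) p).symm z)) y :=
    hφ.continuous.continuousAt.comp hps
  have hev : ∀ᶠ z in 𝓝 y, z ∈ (chartAt (Euc n) p).target ∧
      φ ((chartAt (Euc n) p).symm z) ∈ (chartAt (Euc (n + 1)) q).source :=
    ((chartAt (Euc n) p).open_target.eventually_mem hy).and
      (hφps.eventually ((chartAt (Euc (n + 1)) q).open_source.mem_nhds hq))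
  set u := localMap (n := n) (m := n + 1) p q φ with hu
  have hus : ContDiffAt ℝ ∞ u y := contDiffAt_localMap hy hφ.contMDiffAt hq
  have hinju : ∀ᶠ z in 𝓝 y, Function.Injective (fderiv ℝ u z) := by
    filter_upwards [hev] with z hz
    have h1 := injective_fderiv_localMap (p := p) (q := q)
      ((chartAt (Euc n) p).map_target hz.1) (hmd _) hz.2 (hinj _)
    rwa [(chartAt (Euc n) p).right_inv hz.1] at h1
  have hD : (∀ᶠ z in 𝓝 y, 0 < frameDet (fderiv ℝ u z) (N z)) ∨
      ∀ᶠ z in 𝓝 y, frameDet (fderiv ℝ u z) (N z) < 0 := by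
    refine eventually_pos_or_neg ?_ ?_
    · exact continuousAt_frameDet (hus.fderiv_right (m := ∞) (by simp)).continuousAt
        hNs.continuousAt
    · refine frameDet_ne_zero (G := chartMetric q (u y)) hinju.self_of_nhds hN.self_of_nhds.1 ?_
      rw [hN.self_of_nhds.2]; exact one_ne_zero
  obtain ⟨a, hadef⟩ : ∃ a : Euc n → ℝ, a = fun z => σ ((chartAt (Euc n) p).symm z) *
      (chartCoframe (m := n) p ((chartAt (Euc n) p).symm z)).det := ⟨_, rfl⟩
  obtain ⟨b, hbdef⟩ : ∃ b : Euc n → ℝ, b = fun z => τ (φ ((chartAt (Euc n) p).symm z)) *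
      (chartCoframe (m := n + 1) q (φ ((chartAt (Euc n) p).symm z))).det := ⟨_, rfl⟩
  have ha : (∀ᶠ z in 𝓝 y, 0 < a z) ∨ ∀ᶠ z in 𝓝 y, a z < 0 := by
    rw [hadef]
    exact (hσ p _ ((chartAt (Euc n) p).map_target hy)).imp (fun h => hps.eventually h)
      fun h => hps.eventually h
  have hb : (∀ᶠ z in 𝓝 y, 0 < b z) ∨ ∀ᶠ z in 𝓝 y, b z < 0 := by
    rw [hbdef]
    exact (hτ q _ hq).imp (fun h => hφps.eventually h) fun h => hφps.eventually h
  -- `ν` differs from the smooth local normal `N` by a sign `c`. The product of `c` with three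
  -- quantities, each of locally constant sign, is positive, so `c` is locally constant and `ν` is
  -- as smooth as `N`.
  have hrel : ∀ᶠ z in 𝓝 y, ∃ c : ℝ, c * c = 1 ∧
      chartCoframe q (φ ((chartAt (Euc n) p).symm z)) (ν ((chartAt (Euc n) p).symm z)) = c • N z ∧
      0 < c * (a z * b z * frameDet (fderiv ℝ u z) (N z)) := by
    filter_upwards [hev, hN, hinju] with z hz hNz hiz
    set x := (chartAt (Euc n) p).symm z with hx
    have hxs : x ∈ (chartAt (Euc n) p).source := (chartAt (Euc n) p).map_target hz.1
    have hpx : chartAt (Euc n) p x = z := (chartAt (Euc n) p).right_inv hz.1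
    have hνx := (isUnitNormal_iff hxs (hmd x) hz.2 (ν x)).1 (hν x)
    rw [hpx] at hνx
    have h1 := unit_normal_unique (chartMetric_symm q (u z))
      (fun v hv => chartMetric_pos q ((chartAt (Euc (n + 1)) q).map_source hz.2) hv)
      hiz hNz.1 hNz.2 hνx.1
    set c := chartMetric q (u z) (chartCoframe q (φ x) (ν x)) (N z) with hc
    refine ⟨c, ?_, h1, ?_⟩
    · have h2 := hνx.2
      rw [h1] at h2
      simp only [map_smul, smul_apply, smul_eq_mul] at h2
      change c * (c * chartMetric q (u z) (N z) (N z)) = 1 at h2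
      rw [hNz.2, mul_one] at h2
      exact h2
    · rw [hadef, hbdef]
      have h2 := fderiv_localMap_comp_coframe hxs (hmd x) hz.2
      rw [hpx] at h2
      have h3 := frameDet_comp_right (fderiv ℝ u z) (chartCoframe p x)
        (chartCoframe q (φ x) (ν x))
      rw [h2, frameDet_comp_left, h1, frameDet_smul] at h3
      have h4 := hνpos x
      have h5 : (chartCoframe (m := n + 1) q (φ x)).det ≠ 0 := det_chartCoframe_ne_zero q hz.2
      calc 0 < (σ x * τ (φ x) * frameDet (tangentOf n (n + 1) φ x) (ν x)) *
            (chartCoframe (m := n + 1) q (φ x)).det ^ 2 := by positivity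
        _ = σ x * τ (φ x) * (chartCoframe (m := n + 1) q (φ x)).det *
            ((chartCoframe (m := n + 1) q (φ x)).det *
              frameDet (tangentOf n (n + 1) φ x) (ν x)) := by ring
        _ = _ := by
          rw [h3]
          change _ = c * ((σ x * (chartCoframe (m := n) p x).det) *
            (τ (φ x) * (chartCoframe (m := n + 1) q (φ x)).det) * _)
          ring
  obtain ⟨s, hs⟩ := exists_constant_sign (eventually_sign_mul (eventually_sign_mul ha hb) hD) hrel
  exact ContDiffAt.congr_of_eventuallyEq (f := s • N) (hNs.const_smul s) hs

end GlobalNormal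

/-! ### Normal variations -/

section Jets

variable {m : ℕ} {M : Type*} [TopologicalSpace M] [ChartedSpace (Euc m) M] [IsManifold (𝓡 m) ∞ M]
  [RiemannianBundle (fun x : M => TangentSpace (𝓡 m) x)]
  [IsContMDiffRiemannianBundle (𝓡 m) ∞ (Euc m) (fun x : M => TangentSpace (𝓡 m) x)]

lemma deriv_deriv_comp {E F : Type*} [NormedAddCommGroup E] [NormedSpace ℝ E]
    [NormedAddCommGroup F] [NormedSpace ℝ F] {τ : E → F} {a : ℝ → E} {t : ℝ}
    (hτ : ContDiffAt ℝ ∞ τ (a t)) (ha : ContDiffAt ℝ ∞ a t) :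
    deriv (fun s => τ (a s)) t = fderiv ℝ τ (a t) (deriv a t) ∧
    deriv (deriv fun s => τ (a s)) t =
      fderiv ℝ (fderiv ℝ τ) (a t) (deriv a t) (deriv a t) + fderiv ℝ τ (a t) (deriv (deriv a) t) :=
          by
  have hev : deriv (fun s => τ (a s)) =ᶠ[𝓝 t] fun s => fderiv ℝ τ (a s) (deriv a s) := by
    filter_upwards [ha.continuousAt.eventually (eventually_contDiffAt hτ 1),
      eventually_contDiffAt ha 1] with s h1 h2
    exact ((h1.differentiableAt (by simp)).hasFDerivAt.comp_hasDerivAt s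
      (h2.differentiableAt (by simp)).hasDerivAt).deriv
  have hfd : DifferentiableAt ℝ (fderiv ℝ τ) (a t) :=
    ContDiffAt.differentiableAt (n := ∞) (hτ.fderiv_right (by simp)) (by simp)
  have h1 : HasDerivAt (fun s => fderiv ℝ τ (a s) (deriv a s))
      (fderiv ℝ (fderiv ℝ τ) (a t) (deriv a t) (deriv a t) +
        fderiv ℝ τ (a t) (deriv (deriv a) t)) t :=
    (hfd.hasFDerivAt.comp_hasDerivAt t (ha.differentiableAt (by simp)).hasDerivAt).clm_apply
      ((contDiffAt_deriv ha).differentiableAt (by simp)).hasDerivAt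
  exact ⟨hev.eq_of_nhds, by rw [hev.deriv_eq, h1.deriv]⟩

/-- A curve whose velocity is `V` and whose covariant acceleration vanishes has these properties
in all charts. -/
lemma geodesic_jet_transition {c : ℝ → M} {q q' : M} {V : Euc m}
    (hc : ContinuousAt c 0) (hq : c 0 ∈ (chartAt (Euc m) q).source)
    (hq' : c 0 ∈ (chartAt (Euc m) q').source)
    (ha : ContDiffAt ℝ ∞ (fun t => chartAt (Euc m) q (c t)) 0)
    (h1 : deriv (fun t => chartAt (Euc m) q (c t)) 0 = chartCoframe q (c 0) V)
    (h2 : deriv (deriv fun t => chartAt (Euc m) q (c t)) 0 =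
      -chartGamma q (chartAt (Euc m) q (c 0)) (chartCoframe q (c 0) V) (chartCoframe q (c 0) V)) :
    deriv (fun t => chartAt (Euc m) q' (c t)) 0 = chartCoframe q' (c 0) V ∧
    deriv (deriv fun t => chartAt (Euc m) q' (c t)) 0 =
      -chartGamma q' (chartAt (Euc m) q' (c 0)) (chartCoframe q' (c 0) V)
        (chartCoframe q' (c 0) V) := by
  set a : ℝ → Euc m := fun t => chartAt (Euc m) q (c t) with hadef
  have hov : a 0 ∈ overlap q q' := mem_overlap hq hq'
  have hev : (fun t => chartAt (Euc m) q' (c t)) =ᶠ[𝓝 0] fun t => transition q q' (a t) := by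
    filter_upwards [hc.eventually ((chartAt (Euc m) q).open_source.mem_nhds hq)] with t ht
    exact (transition_chart ht).symm
  have h3 := deriv_deriv_comp (τ := transition (m := m) q q') (contDiffAt_transition hov) ha
  have hD : fderiv ℝ (transition (m := m) q q') (a 0) (chartCoframe q (c 0) V) =
      chartCoframe q' (c 0) V := fderiv_transition_chartCoframe hq hq' V
  refine ⟨by rw [hev.deriv_eq, h3.1, h1, hD], ?_⟩
  -- The second derivative of the transition map is exactly the inhomogeneous term in the
  -- transformation law of the Christoffel symbols, so the two cancel.
  rw [hev.deriv.deriv_eq, h3.2, h1, h2, ← transition_chart (q := q') hq, ← hD,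
    chartGamma_transition hov, map_neg]
  abel

end Jets

/-! ### Construction of variations with a prescribed normal velocity. -/

section Variations

variable {n m : ℕ} {S : Type*} [TopologicalSpace S] [ChartedSpace (Euc n) S]
  {M : Type*} [TopologicalSpace M] [ChartedSpace (Euc m) M]
  [IsManifold (𝓡 n) ∞ S] [IsManifold (𝓡 m) ∞ M]
  [RiemannianBundle (fun x : M => TangentSpace (𝓡 m) x)]
  [IsContMDiffRiemannianBundle (𝓡 m) ∞ (Euc m) (fun x : M => TangentSpace (𝓡 m) x)]

/-- A vector field along `φ` is smooth. -/
def IsSmoothField (n m : ℕ) [ChartedSpace (Euc n) S] [ChartedSpace (Euc m) M] (φ : S → M)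
    (ν : S → Euc m) : Prop :=
  ∀ (p : S) (q : M) (y : Euc n), y ∈ (chartAt (Euc n) p).target →
    φ ((chartAt (Euc n) p).symm y) ∈ (chartAt (Euc m) q).source →
    ContDiffAt ℝ ∞ (fun z => chartCoframe q (φ ((chartAt (Euc n) p).symm z))
      (ν ((chartAt (Euc n) p).symm z))) y

lemma IsSmoothField.contMDiffAt {φ : S → M} {ν : S → Euc m} (hν : IsSmoothField n m φ ν)
    {q : M} {x : S} (hx : φ x ∈ (chartAt (Euc m) q).source) :
    ContMDiffAt (𝓡 n) 𝓘(ℝ, Euc m) ∞ (fun z => chartCoframe q (φ z) (ν z)) x := by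
  have hxs : x ∈ (chartAt (Euc n) x).source := mem_chart_source _ x
  have h1 := hν x q _ ((chartAt (Euc n) x).map_source hxs)
    (by rw [(chartAt (Euc n) x).left_inv hxs]; exact hx)
  have h2 : ContMDiffAt (𝓡 n) (𝓡 n) ∞ (chartAt (Euc n) x) x :=
    contMDiffOn_chart.contMDiffAt ((chartAt (Euc n) x).open_source.mem_nhds hxs)
  refine (h1.comp_contMDiffAt h2).congr_of_eventuallyEq ?_
  filter_upwards [(chartAt (Euc n) x).open_source.mem_nhds hxs] with z hz
  simp only [Function.comp, (chartAt (Euc n) x).left_inv hz]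

/-- A smooth variation with velocity `σ ν` and with vanishing covariant acceleration at `t = 0`. -/
structure IsNormalVariation (φ : S → M) (ν : S → Euc m) (K : Set S) (σ : S → ℝ) (ε : ℝ)
    (F : ℝ → S → M) : Prop where
  pos : 0 < ε
  smooth : ∀ t ∈ Ioo (-ε) ε, ∀ x, ContMDiffAt (𝓘(ℝ, ℝ).prod (𝓡 n)) (𝓡 m) ∞
    (fun z : ℝ × S => F z.1 z.2) (t, x)
  initial : F 0 = φ
  fixed : ∀ t ∈ Ioo (-ε) ε, ∀ x ∉ K, F t x = φ x
  jet : ∀ (x : S) (q : M), φ x ∈ (chartAt (Euc m) q).source →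
    deriv (fun t => chartAt (Euc m) q (F t x)) 0 = chartCoframe q (φ x) (σ x • ν x) ∧
    deriv (deriv fun t => chartAt (Euc m) q (F t x)) 0 =
      -chartGamma q (chartAt (Euc m) q (φ x)) (chartCoframe q (φ x) (σ x • ν x))
        (chartCoframe q (φ x) (σ x • ν x))

lemma isNormalVariation_const {φ : S → M} (hφ : ContMDiff (𝓡 n) (𝓡 m) ∞ φ) (ν : S → Euc m)
    (K : Set S) : IsNormalVariation (n := n) φ ν K 0 1 fun _ => φ where
  pos := one_pos
  smooth t _ x := ContMDiffAt.comp (t, x) (g := φ) hφ.contMDiffAt contMDiffAt_snd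
  initial := rfl
  fixed _ _ _ _ := rfl
  jet x q _ := by simp

/-- This replaces the exponential map. Since the support of `ψ` is mapped into one chart, the
variation is corrected there by `t ψ N - (t²/2) B A`, where `N` is the normal in coordinates and `A
= Γ(N, N)`. Only the 2-jet in `t` at time zero matters, and a quadratic polynomial suffices to
adjust it. -/
lemma IsNormalVariation.exists_add {φ : S → M} (hφ : ContMDiff (𝓡 n) (𝓡 m) ∞ φ) {ν : S → Euc m}
    (hν : IsSmoothField n m φ ν) {K : Set S} {σ ψ : S → ℝ} {ε : ℝ} {F : ℝ → S → M}
    (hF : IsNormalVariation (n := n) φ ν K σ ε F) (hσ : ContMDiff (𝓡 n) 𝓘(ℝ, ℝ) ∞ σ)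
    (hψ : ContMDiff (𝓡 n) 𝓘(ℝ, ℝ) ∞ ψ) (hc : HasCompactSupport ψ) (hK : tsupport ψ ⊆ K) (q : M)
    (hq : tsupport ψ ⊆ φ ⁻¹' (chartAt (Euc m) q).source) :
    ∃ ε' F', IsNormalVariation (n := n) φ ν K (σ + ψ) ε' F' := by
  classical
  set c := chartAt (Euc m) q with hcdef
  let N : S → Euc m := fun x => chartCoframe q (φ x) (ν x)
  let A : S → Euc m := fun x => chartGamma q (c (φ x)) (N x) (N x)
  -- The acceleration must become `-(σ + ψ)² Γ(N, N)`, and the given variation already contributes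
  -- `-σ² Γ(N, N)`; this is the difference.
  let B : S → ℝ := fun x => (σ x + ψ x) ^ 2 - σ x ^ 2
  let Φ : ℝ × S → Euc m := fun z =>
    c (F z.1 z.2) + (z.1 * ψ z.2) • N z.2 - ((z.1 ^ 2 / 2) * B z.2) • A z.2
  have hNs : ∀ x, φ x ∈ c.source → ContMDiffAt (𝓡 n) 𝓘(ℝ, Euc m) ∞ N x := fun x hx =>
    hν.contMDiffAt hx
  have hcs : ∀ x ∈ c.source, ContMDiffAt (𝓡 m) 𝓘(ℝ, Euc m) ∞ c x := fun x hx =>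
    contMDiffOn_chart.contMDiffAt (c.open_source.mem_nhds hx)
  have hAs : ∀ x, φ x ∈ c.source → ContMDiffAt (𝓡 n) 𝓘(ℝ, Euc m) ∞ A x := by
    intro x hx
    have h1 : ContMDiffAt (𝓡 n) 𝓘(ℝ, Euc m × Euc m) ∞ (fun z => (c (φ z), N z)) x :=
      (ContMDiffAt.comp x (hcs _ hx) hφ.contMDiffAt).prodMk_space (hNs x hx)
    have h2 : ContDiffAt ℝ ∞ (fun w : Euc m × Euc m => chartGamma q w.1 w.2 w.2)
        (c (φ x), N x) :=
      contDiffAt_bilin (B := fun w : Euc m × Euc m => chartGamma q w.1)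
        (contDiffAt_bilin_comp (contDiffAt_chartGamma q (c.map_source hx)) contDiffAt_fst)
        contDiffAt_snd contDiffAt_snd
    exact ContDiffAt.comp_contMDiffAt (g := fun w : Euc m × Euc m => chartGamma q w.1 w.2 w.2)
      (f := fun z => (c (φ z), N z)) h2 h1
  have hfst : ContMDiff (𝓘(ℝ, ℝ).prod (𝓡 n)) 𝓘(ℝ, ℝ) ∞ (fun z : ℝ × S => z.1) := contMDiff_fst
  have hBs : ContMDiff (𝓡 n) 𝓘(ℝ, ℝ) ∞ B := ((hσ.add hψ).pow 2).sub (hσ.pow 2)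
  have hΦs : ∀ z : ℝ × S, z.1 ∈ Ioo (-ε) ε → φ z.2 ∈ c.source → F z.1 z.2 ∈ c.source →
      ContMDiffAt (𝓘(ℝ, ℝ).prod (𝓡 n)) 𝓘(ℝ, Euc m) ∞ Φ z := by
    intro z hz h1 h2
    have hsnd : ContMDiffAt (𝓘(ℝ, ℝ).prod (𝓡 n)) (𝓡 n) ∞ (fun z : ℝ × S => z.2) z :=
      contMDiffAt_snd
    have h3 := ContMDiffAt.comp z (g := c) (f := fun z : ℝ × S => F z.1 z.2) (hcs _ h2)
      (hF.smooth z.1 hz z.2)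
    have h4 := ContMDiffAt.comp z (g := N) (hNs _ h1) hsnd
    have h5 := ContMDiffAt.comp z (g := A) (hAs _ h1) hsnd
    have h6 := ContMDiffAt.comp z (g := ψ) hψ.contMDiffAt hsnd
    have h7 := ContMDiffAt.comp z (g := B) hBs.contMDiffAt hsnd
    exact (h3.add ((hfst.contMDiffAt.mul h6).smul h4)).sub
      ((((hfst.pow 2).contMDiffAt.div_const 2).mul h7).smul h5)
  -- The open set where the formula makes sense. It contains time zero over the compact support of
  -- `ψ`, so the tube lemma gives a time interval that works over a whole neighbourhood `U` of the
  -- support.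
  let W : Set (ℝ × S) := {z | z.1 ∈ Ioo (-ε) ε ∧ φ z.2 ∈ c.source ∧ F z.1 z.2 ∈ c.source ∧
    Φ z ∈ c.target}
  have hW : IsOpen W := by
    rw [isOpen_iff_mem_nhds]
    rintro z ⟨h1, h2, h3, h4⟩
    filter_upwards [continuousAt_fst.eventually (isOpen_Ioo.mem_nhds h1),
      (hφ.continuous.comp continuous_snd).continuousAt.eventually (c.open_source.mem_nhds h2),
      (hF.smooth z.1 h1 z.2).continuousAt.eventually (c.open_source.mem_nhds h3),
      (hΦs z h1 h2 h3).continuousAt.eventually (c.open_target.mem_nhds h4)] with w w1 w2 w3 w4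
    exact ⟨w1, w2, w3, w4⟩
  have hF0 : ∀ x, F 0 x = φ x := fun x => congrFun hF.initial x
  have h0W : ({0} : Set ℝ) ×ˢ tsupport ψ ⊆ W := by
    rintro ⟨t, x⟩ ⟨ht, hx⟩
    obtain rfl : t = 0 := ht
    have h1 : φ x ∈ c.source := hq hx
    refine ⟨by simpa using hF.pos, h1, by simpa only [hF0] using h1, ?_⟩
    have : Φ (0, x) = c (φ x) := by simp [Φ, hF0]
    rw [this]
    exact c.map_source h1
  obtain ⟨u, U, huo, hUo, h0u, hTU, huU⟩ :=
    generalized_tube_lemma isCompact_singleton hc.isCompact hW h0W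
  obtain ⟨δ, hδ, hδu⟩ := Metric.isOpen_iff.1 huo 0 (h0u rfl)
  set ε' := min ε δ with hε'
  have hε'pos : 0 < ε' := lt_min hF.pos hδ
  have hsub : ∀ t ∈ Ioo (-ε') ε', t ∈ Ioo (-ε) ε ∧ t ∈ u := by
    intro t ht
    have h1 := min_le_left ε δ
    have h2 := min_le_right ε δ
    refine ⟨⟨by linarith [ht.1], by linarith [ht.2]⟩, hδu ?_⟩
    rw [Metric.mem_ball, dist_zero_right, Real.norm_eq_abs, abs_lt]
    exact ⟨by linarith [ht.1], by linarith [ht.2]⟩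
  have hzero : ∀ x ∉ tsupport ψ, ψ x = 0 := fun x hx => image_eq_zero_of_notMem_tsupport hx
  -- On `U` outside the support of `ψ` the correction is zero and the two branches agree, so
  -- smoothness can be checked separately on `U` and off the support.
  let F' : ℝ → S → M := fun t x => if x ∈ tsupport ψ then c.symm (Φ (t, x)) else F t x
  have hF'U : ∀ t ∈ Ioo (-ε') ε', ∀ x ∈ U, F' t x = c.symm (Φ (t, x)) := by
    intro t ht x hx
    by_cases hxT : x ∈ tsupport ψ
    · exact if_pos hxT
    · have h1 : F' t x = F t x := if_neg hxT
      have h2 : (t, x) ∈ W := huU ⟨(hsub t ht).2, hx⟩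
      have h3 : Φ (t, x) = c (F t x) := by simp [Φ, B, hzero x hxT]
      rw [h1, h3, c.left_inv h2.2.2.1]
  have hF'T : ∀ t, ∀ x ∉ tsupport ψ, F' t x = F t x := fun t x hx => if_neg hx
  refine ⟨ε', F', hε'pos, fun t ht x => ?_, ?_, fun t ht x hx => ?_, fun x q' hq' => ?_⟩
  · by_cases hx : x ∈ U
    · have h2 : (t, x) ∈ W := huU ⟨(hsub t ht).2, hx⟩
      have h3 : ContMDiffAt (𝓡 m) (𝓡 m) ∞ c.symm (Φ (t, x)) :=
        contMDiffOn_chart_symm.contMDiffAt (c.open_target.mem_nhds h2.2.2.2)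
      have h4 := ContMDiffAt.comp (t, x) h3 (hΦs (t, x) h2.1 h2.2.1 h2.2.2.1)
      refine h4.congr_of_eventuallyEq ?_
      filter_upwards [(isOpen_Ioo.prod hUo).mem_nhds (⟨ht, hx⟩ : (t, x) ∈ Ioo (-ε') ε' ×ˢ U)]
        with z hz
      exact hF'U z.1 hz.1 z.2 hz.2
    · have hxT : x ∉ tsupport ψ := fun h => hx (hTU h)
      refine (hF.smooth t (hsub t ht).1 x).congr_of_eventuallyEq ?_
      have h1 : ∀ᶠ z : ℝ × S in 𝓝 (t, x), z.2 ∈ (tsupport ψ)ᶜ :=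
        continuousAt_snd.eventually ((isClosed_tsupport ψ).isOpen_compl.mem_nhds hxT)
      filter_upwards [h1] with z hz
      exact hF'T z.1 z.2 hz
  · ext x
    by_cases hxT : x ∈ tsupport ψ
    · have h1 : F' 0 x = c.symm (Φ (0, x)) := if_pos hxT
      have h2 : Φ (0, x) = c (φ x) := by simp [Φ, hF0]
      rw [h1, h2, c.left_inv (hq hxT)]
    · rw [hF'T 0 x hxT, hF0]
  · rw [hF'T t x fun h => hx (hK h), hF.fixed t (hsub t ht).1 x hx]
  · by_cases hxT : x ∈ tsupport ψ
    · have hxs : φ x ∈ c.source := hq hxT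
      have hIoo : Ioo (-ε') ε' ∈ 𝓝 (0 : ℝ) := Ioo_mem_nhds (by linarith) hε'pos
      have h0I : (0 : ℝ) ∈ Ioo (-ε') ε' := ⟨by linarith, hε'pos⟩
      have hF'0 : F' 0 x = φ x := by
        have h2 : Φ (0, x) = c (φ x) := by simp [Φ, hF0]
        rw [hF'U 0 h0I x (hTU hxT), h2, c.left_inv hxs]
      have hcF' : (fun t => c (F' t x)) =ᶠ[𝓝 0] fun t => Φ (t, x) := by
        filter_upwards [hIoo] with t ht
        have h2 : (t, x) ∈ W := huU ⟨(hsub t ht).2, hTU hxT⟩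
        rw [hF'U t ht x (hTU hxT), c.right_inv h2.2.2.2]
      have hmk : ContMDiffAt 𝓘(ℝ, ℝ) (𝓘(ℝ, ℝ).prod (𝓡 n)) ∞ (fun t : ℝ => (t, x)) 0 :=
        contMDiffAt_id.prodMk contMDiffAt_const
      have hFx : ContMDiffAt 𝓘(ℝ, ℝ) (𝓡 m) ∞ (fun t => F t x) 0 :=
        ContMDiffAt.comp (0 : ℝ) (g := fun z : ℝ × S => F z.1 z.2)
          (hF.smooth 0 (hsub 0 h0I).1 x) hmk
      have hcFx : ContDiffAt ℝ ∞ (fun t => c (F t x)) 0 :=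
        (ContMDiffAt.comp (0 : ℝ) (g := c) (hcs _ (by simpa only [hF0] using hxs)) hFx).contDiffAt
      have hΦx : ContDiffAt ℝ ∞ (fun t => Φ (t, x)) 0 :=
        (ContMDiffAt.comp (0 : ℝ) (g := Φ) (hΦs (0, x) (hsub 0 h0I).1 hxs
          (by simpa only [hF0] using hxs)) hmk).contDiffAt
      have hev : ∀ᶠ t in 𝓝 0, DifferentiableAt ℝ (fun t => c (F t x)) t := by
        filter_upwards [eventually_contDiffAt hcFx 1] with t ht
        exact ht.differentiableAt (by simp)
      have hd1 : deriv (fun t => Φ (t, x)) =ᶠ[𝓝 0] fun t =>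
          deriv (fun t => c (F t x)) t + ψ x • N x - (t * B x) • A x := by
        filter_upwards [hev] with t ht
        have h1 : HasDerivAt (fun t : ℝ => (t * ψ x) • N x) (ψ x • N x) t := by
          have := ((hasDerivAt_id t).mul_const (ψ x)).smul_const (N x)
          rwa [one_mul] at this
        have h2 : HasDerivAt (fun t : ℝ => ((t ^ 2 / 2) * B x) • A x) ((t * B x) • A x) t := by
          have h := (((hasDerivAt_pow 2 t).div_const 2).mul_const (B x)).smul_const (A x)
          refine h.congr_deriv ?_
          congr 1
          norm_num
        exact ((ht.hasDerivAt.add h1).sub h2).deriv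
      have hd2 : deriv (deriv fun t => Φ (t, x)) 0 =
          deriv (deriv fun t => c (F t x)) 0 - B x • A x := by
        rw [hd1.deriv_eq]
        have h1 : HasDerivAt (fun t : ℝ => (t * B x) • A x) (B x • A x) 0 := by
          have := ((hasDerivAt_id (0 : ℝ)).mul_const (B x)).smul_const (A x)
          rwa [one_mul] at this
        exact (((((contDiffAt_deriv hcFx).differentiableAt (by simp)).hasDerivAt).add_const
          _).sub h1).deriv
      obtain ⟨j1, j2⟩ := hF.jet x q hxs
      have hjet := geodesic_jet_transition (c := fun t => F' t x) (q := q) (q' := q')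
        (V := (σ + ψ) x • ν x) ?_ (by rw [hF'0]; exact hxs) (by rw [hF'0]; exact hq')
        (hΦx.congr_of_eventuallyEq hcF') ?_ ?_
      · rwa [hF'0] at hjet
      · have h3 : ContinuousAt c.symm (Φ (0, x)) := by
          refine c.continuousAt_symm ?_
          have h2 : (0, x) ∈ W := huU ⟨(hsub 0 h0I).2, hTU hxT⟩
          exact h2.2.2.2
        have h4 : ContinuousAt (fun t => c.symm (Φ (t, x))) 0 :=
          ContinuousAt.comp (g := c.symm) (f := fun t => Φ (t, x)) h3 hΦx.continuousAt
        refine h4.congr ?_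
        filter_upwards [hIoo] with t ht
        exact (hF'U t ht x (hTU hxT)).symm
      · rw [hcF'.deriv_eq, hd1.eq_of_nhds, j1, hF'0]
        simp only [map_smul, map_add, zero_mul, zero_smul, sub_zero, Pi.add_apply, add_smul]
        rfl
      · rw [hcF'.deriv.deriv_eq, hd2, j2, hF'0]
        simp only [map_smul, smul_apply, smul_smul, Pi.add_apply]
        change -((σ x * σ x) • A x) - ((σ x + ψ x) ^ 2 - σ x ^ 2) • A x =
          -(((σ x + ψ x) * (σ x + ψ x)) • A x)
        rw [← neg_smul, ← neg_smul, ← sub_smul]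
        congr 1
        ring
    · have h1 : (fun t => chartAt (Euc m) q' (F' t x)) = fun t => chartAt (Euc m) q' (F t x) := by
        ext1 t
        rw [hF'T t x hxT]
      rw [h1, Pi.add_apply, hzero x hxT, add_zero]
      exact hF.jet x q' hq'

variable [T2Space S] [SigmaCompactSpace S]

/-- Every compactly supported normal velocity is realized by a variation. -/
theorem exists_isNormalVariation {φ : S → M} (hφ : ContMDiff (𝓡 n) (𝓡 m) ∞ φ) {ν : S → Euc m}
    (hν : IsSmoothField n m φ ν) {ψ : S → ℝ} (hψ : ContMDiff (𝓡 n) 𝓘(ℝ, ℝ) ∞ ψ)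
    (hc : HasCompactSupport ψ) :
    ∃ ε F, IsNormalVariation (n := n) φ ν (tsupport ψ) ψ ε F := by
  classical
  obtain ⟨ρ, hρ⟩ := SmoothPartitionOfUnity.exists_isSubordinate (𝓡 n) (s := univ) isClosed_univ
    (fun x : S => φ ⁻¹' (chartAt (Euc m) (φ x)).source)
    (fun x => (chartAt (Euc m) (φ x)).open_source.preimage hφ.continuous)
    (fun x _ => mem_iUnion_of_mem x (mem_chart_source (Euc m) (φ x)))
  -- Only finitely many functions of the partition meet the support of `ψ`, so the velocity `ψ` is
  -- reached by adding finitely many pieces, one at a time.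
  have hfin := ρ.locallyFinite.finite_nonempty_inter_compact hc.isCompact
  have hstep : ∀ s : Finset S, ∃ ε F,
      IsNormalVariation (n := n) φ ν (tsupport ψ) (∑ i ∈ s, fun x => ρ i x * ψ x) ε F := by
    intro s
    induction s using Finset.induction_on with
    | empty => exact ⟨1, _, by simpa using isNormalVariation_const hφ ν _⟩
    | insert i s hi ih =>
      obtain ⟨ε, F, hF⟩ := ih
      rw [Finset.sum_insert hi, add_comm]
      have hts : tsupport (fun x => ρ i x * ψ x) ⊆ tsupport ψ :=
        closure_mono fun x hx => right_ne_zero_of_mul hx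
      refine hF.exists_add hφ hν ?_ ((ρ i).contMDiff.mul hψ)
        (hc.isCompact.of_isClosed_subset (isClosed_tsupport _) hts) hts (φ i) ?_
      · have : (∑ i ∈ s, fun x => ρ i x * ψ x) = fun x => ∑ i ∈ s, ρ i x * ψ x := by
          ext x; simp
        rw [this]
        exact contMDiff_finsetSum fun i _ => (ρ i).contMDiff.mul hψ
      · exact (closure_mono fun x hx => left_ne_zero_of_mul hx : tsupport _ ⊆ tsupport (ρ i)).trans
          (hρ i)
  have hsum : (∑ i ∈ hfin.toFinset, fun x => ρ i x * ψ x) = ψ := by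
    ext x
    rw [Finset.sum_apply, ← Finset.sum_mul]
    by_cases hx : ψ x = 0
    · rw [hx, mul_zero]
    · have h1 : ∑ i ∈ hfin.toFinset, ρ i x = 1 := by
        rw [← ρ.sum_eq_one (mem_univ x)]
        refine (finsum_eq_sum_of_support_subset _ fun i hi => ?_).symm
        rw [Finite.coe_toFinset]
        exact ⟨x, hi, subset_tsupport ψ hx⟩
      rw [h1, one_mul]
  rw [← hsum]
  have := hstep hfin.toFinset
  rw [hsum] at this ⊢
  exact this

end Variations

/-! ### Differentiation under the integral over a compact set -/

section FiberSmooth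

variable {X : Type*} [TopologicalSpace X] {n : ℕ}

/-- `k` is, near `z`, a smooth function of the time and of `n` continuous coordinates. -/
def IsFiberSmoothAt (n : ℕ) (k : ℝ × X → ℝ) (z : ℝ × X) : Prop :=
  ∃ (y : X → Euc n) (κ : ℝ × Euc n → ℝ), ContinuousAt y z.2 ∧
    ContDiffAt ℝ ∞ κ (z.1, y z.2) ∧ k =ᶠ[𝓝 z] fun w => κ (w.1, y w.2)

lemma IsFiberSmoothAt.continuousAt {k : ℝ × X → ℝ} {z : ℝ × X} (h : IsFiberSmoothAt n k z) :
    ContinuousAt k z := by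
  obtain ⟨y, κ, hy, hκ, hk⟩ := h
  have h1 : ContinuousAt (fun w : ℝ × X => (w.1, y w.2)) z :=
    continuousAt_fst.prodMk (ContinuousAt.comp (g := y) hy continuousAt_snd)
  exact (ContinuousAt.comp (g := κ) (f := fun w : ℝ × X => (w.1, y w.2)) hκ.continuousAt h1).congr
    hk.symm

lemma IsFiberSmoothAt.slice {k : ℝ × X → ℝ} {z : ℝ × X} (h : IsFiberSmoothAt n k z) :
    ContDiffAt ℝ ∞ (fun t => k (t, z.2)) z.1 := by
  obtain ⟨y, κ, hy, hκ, hk⟩ := h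
  have h1 : ContinuousAt (fun t : ℝ => (t, z.2)) z.1 := by fun_prop
  exact (contDiffAt_slice hκ).congr_of_eventuallyEq (h1.eventually hk)

lemma IsFiberSmoothAt.deriv {k : ℝ × X → ℝ} {z : ℝ × X} (h : IsFiberSmoothAt n k z) :
    IsFiberSmoothAt n (fun w => deriv (fun t => k (t, w.2)) w.1) z := by
  obtain ⟨y, κ, hy, hκ, hk⟩ := h
  refine ⟨y, fun r => fderiv ℝ κ r (1, 0), hy, contDiffAt_partial hκ _, ?_⟩
  have h1 : ContinuousAt (fun w : ℝ × X => (w.1, y w.2)) z :=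
    continuousAt_fst.prodMk (ContinuousAt.comp (g := y) hy continuousAt_snd)
  filter_upwards [hk.eventually_nhds, h1.eventually (eventually_contDiffAt hκ 1)] with w h2 h3
  have h4 : ContinuousAt (fun t : ℝ => (t, w.2)) w.1 := by fun_prop
  have h5 : (fun t => k (t, w.2)) =ᶠ[𝓝 w.1] fun t => κ (t, y w.2) := h4.eventually h2
  rw [h5.deriv_eq]
  exact (hasDerivAt_slice (h3.differentiableAt (by simp))).deriv

variable [MeasurableSpace X] [BorelSpace X] {μ : Measure X}

/-- The time derivative is jointly continuous, hence bounded by a constant on a compact time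
interval times `K`, and this constant is integrable because `K` has finite measure. -/
lemma hasDerivAt_setIntegral {k : ℝ × X → ℝ} {K : Set X} (hK : IsCompact K)
    (hKm : MeasurableSet K) (hμ : μ K ≠ ⊤) {δ : ℝ}
    (hk : ∀ t ∈ Ioo (-δ) δ, ∀ x ∈ K, IsFiberSmoothAt n k (t, x)) {t : ℝ} (ht : t ∈ Ioo (-δ) δ) :
    Integrable (fun x => deriv (fun s => k (s, x)) t) (μ.restrict K) ∧
    HasDerivAt (fun s => ∫ x in K, k (s, x) ∂μ) (∫ x in K, deriv (fun s => k (s, x)) t ∂μ) t := by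
  have hfin : IsFiniteMeasure (μ.restrict K) := ⟨by
    rw [Measure.restrict_apply_univ]; exact hμ.lt_top⟩
  obtain ⟨r, hr, hrs⟩ := Metric.nhds_basis_closedBall.mem_iff.1 (isOpen_Ioo.mem_nhds ht)
  have hcont : ∀ s ∈ Ioo (-δ) δ, ContinuousOn (fun x => k (s, x)) K := fun s hs x hx =>
    (ContinuousAt.comp (g := k) (hk s hs x hx).continuousAt
      (by fun_prop : ContinuousAt (fun x : X => (s, x)) x)).continuousWithinAt
  have hcont' : ContinuousOn (fun z : ℝ × X => deriv (fun s => k (s, z.2)) z.1)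
      (Metric.closedBall t r ×ˢ K) := fun z hz =>
    (hk z.1 (hrs hz.1) z.2 hz.2).deriv.continuousAt.continuousWithinAt
  obtain ⟨C, hC⟩ := ((isCompact_closedBall t r).prod hK).exists_bound_of_continuousOn hcont'
  have hm1 : AEStronglyMeasurable (fun x => deriv (fun s => k (s, x)) t) (μ.restrict K) := by
    refine ContinuousOn.aestronglyMeasurable_of_isCompact (fun x hx => ?_) hK hKm
    exact (ContinuousAt.comp (g := fun z : ℝ × X => deriv (fun s => k (s, z.2)) z.1)
      (hk t ht x hx).deriv.continuousAt
      (by fun_prop : ContinuousAt (fun x : X => (t, x)) x)).continuousWithinAt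
  refine hasDerivAt_integral_of_dominated_loc_of_deriv_le
    (F := fun s x => k (s, x)) (F' := fun s x => deriv (fun s => k (s, x)) s)
    (bound := fun _ => C) (Metric.closedBall_mem_nhds t hr) ?_ ?_ hm1 ?_ (integrable_const C) ?_
  · filter_upwards [isOpen_Ioo.mem_nhds ht] with s hs
    exact (hcont s hs).aestronglyMeasurable_of_isCompact hK hKm
  · exact ContinuousOn.integrableOn_of_subset_isCompact (hcont t ht) hK hKm Subset.rfl hμ
  · filter_upwards [ae_restrict_mem hKm] with x hx s hs
    exact hC (s, x) ⟨hs, hx⟩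
  · filter_upwards [ae_restrict_mem hKm] with x hx s hs
    exact ((hk s (hrs hs) x hx).slice.differentiableAt (by simp)).hasDerivAt

/-- Differentiation under the integral is applied to `k` and then to its time derivative, which is
again fibrewise smooth. The tube lemma turns the neighbourhood `W` of time zero into a uniform time
interval over `K`. -/
lemma second_deriv_setIntegral {k : ℝ × X → ℝ} {K : Set X} (hK : IsCompact K)
    (hKm : MeasurableSet K) (hμ : μ K ≠ ⊤) {W : Set (ℝ × X)} (hW : IsOpen W)
    (hKW : ({0} : Set ℝ) ×ˢ K ⊆ W) (hk : ∀ z ∈ W, IsFiberSmoothAt n k z) {A : ℝ → ℝ}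
    (hA : ∃ δ > 0, ∀ t ∈ Ioo (-δ) δ, A t = ∫ x in K, k (t, x) ∂μ) :
    deriv A 0 = ∫ x in K, deriv (fun s => k (s, x)) 0 ∂μ ∧
    iteratedDeriv 2 A 0 = ∫ x in K, deriv (deriv fun s => k (s, x)) 0 ∂μ := by
  obtain ⟨u, U, huo, -, h0u, hKU, huU⟩ := generalized_tube_lemma isCompact_singleton hK hW hKW
  obtain ⟨δ₁, hδ₁, hδu⟩ := Metric.isOpen_iff.1 huo 0 (h0u rfl)
  obtain ⟨δ₂, hδ₂, hA⟩ := hA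
  set δ := min δ₁ δ₂ with hδ
  have hδpos : 0 < δ := lt_min hδ₁ hδ₂
  have hkδ : ∀ t ∈ Ioo (-δ) δ, ∀ x ∈ K, IsFiberSmoothAt n k (t, x) := by
    intro t ht x hx
    refine hk _ (huU ⟨hδu ?_, hKU hx⟩)
    rw [Metric.mem_ball, dist_zero_right, Real.norm_eq_abs, abs_lt]
    have := min_le_left δ₁ δ₂
    exact ⟨by linarith [ht.1], by linarith [ht.2]⟩
  have hev : ∀ t ∈ Ioo (-δ) δ, A =ᶠ[𝓝 t] fun t => ∫ x in K, k (t, x) ∂μ := by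
    intro t ht
    filter_upwards [isOpen_Ioo.mem_nhds ht] with s hs
    have := min_le_right δ₁ δ₂
    exact hA s ⟨by linarith [hs.1], by linarith [hs.2]⟩
  have h0 : (0 : ℝ) ∈ Ioo (-δ) δ := ⟨by linarith, hδpos⟩
  have h1 : ∀ t ∈ Ioo (-δ) δ, deriv A t = ∫ x in K, deriv (fun s => k (s, x)) t ∂μ :=
    fun t ht => by
      rw [(hev t ht).deriv_eq]
      exact (hasDerivAt_setIntegral hK hKm hμ hkδ ht).2.deriv
  refine ⟨h1 0 h0, ?_⟩
  rw [iteratedDeriv_succ, iteratedDeriv_one]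
  have h2 : deriv A =ᶠ[𝓝 0] fun t => ∫ x in K, deriv (fun s => k (s, x)) t ∂μ := by
    filter_upwards [isOpen_Ioo.mem_nhds h0] with t ht using h1 t ht
  rw [h2.deriv_eq]
  exact (hasDerivAt_setIntegral (k := fun z : ℝ × X => deriv (fun s => k (s, z.2)) z.1) hK hKm hμ
    (fun t ht x hx => (hkδ t ht x hx).deriv) h0).2.deriv

end FiberSmooth

/-! ### The weighted area of a variation -/

section AreaDensity

variable {n m : ℕ} {S : Type*} [TopologicalSpace S] [ChartedSpace (Euc n) S]
  {M : Type*} [TopologicalSpace M] [ChartedSpace (Euc m) M]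
  [IsManifold (𝓡 n) ∞ S] [IsManifold (𝓡 m) ∞ M]
  [RiemannianBundle (fun x : M => TangentSpace (𝓡 m) x)]

/-- The determinant of the metric induced by `φ`, in the chart at `p`. -/
def inducedDet (n m : ℕ) [ChartedSpace (Euc n) S] [ChartedSpace (Euc m) M]
    [RiemannianBundle (fun x : M => TangentSpace (𝓡 m) x)] (φ : S → M) (p : S) (y : Euc n) : ℝ :=
  (tensorCoeff (pullbackMetric (n := n) (m := m) φ) p y).det

/-- The density of the weighted area at time `t` with respect to the area at time `0`. -/
def areaDensity (n m : ℕ) [ChartedSpace (Euc n) S] [ChartedSpace (Euc m) M]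
    [RiemannianBundle (fun x : M => TangentSpace (𝓡 m) x)] (f : M → ℝ) (F : ℝ → S → M)
    (z : ℝ × S) : ℝ :=
  Real.exp (-f (F z.1 z.2)) * Real.sqrt (inducedDet n m (F z.1) z.2 (chartAt (Euc n) z.2 z.2) /
    inducedDet n m (F 0) z.2 (chartAt (Euc n) z.2 z.2))

variable [IsContMDiffRiemannianBundle (𝓡 m) ∞ (Euc m) (fun x : M => TangentSpace (𝓡 m) x)]

/-- The squared Jacobian determinants cancel in the quotient. Thus `areaDensity`, which uses at each
point the chart at that very point, can be read in a single chart near any point. -/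
lemma inducedDet_ratio {φ φ' : S → M} (hφ : ContMDiff (𝓡 n) (𝓡 m) ∞ φ)
    (hφ' : ContMDiff (𝓡 n) (𝓡 m) ∞ φ') {p q x : S} (hp : x ∈ (chartAt (Euc n) p).source)
    (hq : x ∈ (chartAt (Euc n) q).source) :
    inducedDet n m φ p (chartAt (Euc n) p x) / inducedDet n m φ' p (chartAt (Euc n) p x) =
      inducedDet n m φ q (chartAt (Euc n) q x) / inducedDet n m φ' q (chartAt (Euc n) q x) := by
  have hov : chartAt (Euc n) p x ∈ overlap p q := mem_overlap hp hq
  have h1 := tensorCoeff_transition (isFormField_pullback (n := n) (m := m) hφ) hov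
  have h2 := tensorCoeff_transition (isFormField_pullback (n := n) (m := m) hφ') hov
  rw [transition_chart hp] at h1 h2
  have hJ : (fderiv ℝ (transition (m := n) p q) (chartAt (Euc n) p x)).det ≠ 0 := by
    have h3 : (fderiv ℝ (transition (m := n) q p) (transition p q (chartAt (Euc n) p x))).comp
        (fderiv ℝ (transition (m := n) p q) (chartAt (Euc n) p x)) =
        ContinuousLinearMap.id ℝ (Euc n) := by
      ext1 v
      exact fderiv_transition_comp hov v
    intro h0
    have h4 := congrArg ContinuousLinearMap.det h3
    have h5 : (fderiv ℝ (transition (m := n) q p) (transition p q (chartAt (Euc n) p x))).det *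
        (fderiv ℝ (transition (m := n) p q) (chartAt (Euc n) p x)).det = 1 := by
      rw [← LinearMap.det_id (A := ℝ) (M := Euc n)]
      exact (LinearMap.det_comp _ _).symm.trans h4
    rw [h0, mul_zero] at h5
    exact zero_ne_one h5
  rw [inducedDet, inducedDet, h1, h2]
  exact mul_div_mul_right _ _ (pow_ne_zero 2 hJ)

lemma contMDiffAt_slice_right {F : ℝ → S → M} {t : ℝ} {x : S}
    (hF : ContMDiffAt (𝓘(ℝ, ℝ).prod (𝓡 n)) (𝓡 m) ∞ (fun z : ℝ × S => F z.1 z.2) (t, x)) :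
    ContMDiffAt (𝓡 n) (𝓡 m) ∞ (F t) x :=
  ContMDiffAt.comp (g := fun z : ℝ × S => F z.1 z.2) (f := fun x : S => (t, x)) _ hF
    (contMDiffAt_const.prodMk contMDiffAt_id)

/-- The area ratio and the weight of a variation in local coordinates. -/
lemma exists_local_density {f : M → ℝ} (hf : ContMDiff (𝓡 m) 𝓘(ℝ, ℝ) ∞ f) {F : ℝ → S → M} {ε : ℝ}
    (hF : ∀ t ∈ Ioo (-ε) ε, ∀ x, ContMDiffAt (𝓘(ℝ, ℝ).prod (𝓡 n)) (𝓡 m) ∞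
      (fun z : ℝ × S => F z.1 z.2) (t, x))
    (hpos : ∀ x, ∀ y ∈ (chartAt (Euc n) x).target, 0 < inducedDet n m (F 0) x y)
    {z : ℝ × S} (hz : z.1 ∈ Ioo (-ε) ε) :
    ∃ κ κ' : ℝ × Euc n → ℝ, ContDiffAt ℝ ∞ κ (z.1, chartAt (Euc n) z.2 z.2) ∧
      ContDiffAt ℝ ∞ κ' (z.1, chartAt (Euc n) z.2 z.2) ∧
      ∀ᶠ w in 𝓝 z, f (F w.1 w.2) = κ (w.1, chartAt (Euc n) z.2 w.2) ∧
        inducedDet n m (F w.1) w.2 (chartAt (Euc n) w.2 w.2) /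
          inducedDet n m (F 0) w.2 (chartAt (Euc n) w.2 w.2) =
        κ' (w.1, chartAt (Euc n) z.2 w.2) := by
  obtain ⟨t₀, x₀⟩ := z
  dsimp only at hz ⊢
  set c := chartAt (Euc n) x₀ with hc
  set q := F t₀ x₀ with hq
  have hx₀ : x₀ ∈ c.source := mem_chart_source _ _
  have hy₀ : c x₀ ∈ c.target := c.map_source hx₀
  have hcx : c.symm (c x₀) = x₀ := c.left_inv hx₀
  have hqs : F t₀ (c.symm (c x₀)) ∈ (chartAt (Euc m) q).source := by
    rw [hcx]; exact mem_chart_source _ _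
  set V := localVariation (n := n) (m := m) x₀ q F with hV
  have hVs : ContDiffAt ℝ ∞ V (t₀, c x₀) :=
    contDiffAt_localVariation hy₀ (by rw [← hc, hcx]; exact hF t₀ hz x₀) hqs
  have hVt : V (t₀, c x₀) ∈ (chartAt (Euc m) q).target := (chartAt (Euc m) q).map_source hqs
  have h0 : (0 : ℝ) ∈ Ioo (-ε) ε := ⟨by linarith [hz.1, hz.2], by linarith [hz.1, hz.2]⟩
  have hsm : ∀ t ∈ Ioo (-ε) ε, ContMDiff (𝓡 n) (𝓡 m) ∞ (F t) := fun t ht x =>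
    contMDiffAt_slice_right (hF t ht x)
  have hfq : ContDiffAt ℝ ∞ (f ∘ (chartAt (Euc m) q).symm) (V (t₀, c x₀)) := by
    have h1 : ContMDiffOn (𝓡 m) 𝓘(ℝ, ℝ) ∞ (f ∘ (chartAt (Euc m) q).symm)
      (chartAt (Euc m) q).target := hf.comp_contMDiffOn contMDiffOn_chart_symm
    exact (contMDiffOn_iff_contDiffOn.1 h1).contDiffAt
      ((chartAt (Euc m) q).open_target.mem_nhds hVt)
  have hgram : ContDiffAt ℝ ∞ (fun r : ℝ × Euc n => (gramMatrix (chartMetric q) V r.2 r.1).det)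
      (t₀, c x₀) := by
    refine contDiffAt_det fun i j => ?_
    exact contDiffAt_bilin (B := fun r : ℝ × Euc n => chartMetric q (V r))
      (contDiffAt_bilin_comp (contDiffAt_chartMetric q hVt) hVs)
      (contDiffAt_partial hVs _) (contDiffAt_partial hVs _)
  have hdet0 : ContDiffAt ℝ ∞ (fun r : ℝ × Euc n => inducedDet n m (F 0) x₀ r.2) (t₀, c x₀) := by
    have h1 : ContDiffAt ℝ ∞ (inducedDet n m (F 0) x₀) (c x₀) :=
      contDiffAt_det fun i j => contDiffAt_tensorCoeff_pullback hy₀ (hsm 0 h0) i j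
    exact ContDiffAt.comp (t₀, c x₀) (g := inducedDet n m (F 0) x₀) (f := Prod.snd) h1
      contDiffAt_snd
  refine ⟨fun r => (f ∘ (chartAt (Euc m) q).symm) (V r), fun r =>
    (gramMatrix (chartMetric q) V r.2 r.1).det / inducedDet n m (F 0) x₀ r.2,
    ContDiffAt.comp (t₀, c x₀) (g := f ∘ (chartAt (Euc m) q).symm) (f := V) hfq hVs, hgram.div
        hdet0 (hpos x₀ _ hy₀).ne', ?_⟩
  have h1 : ∀ᶠ w : ℝ × S in 𝓝 (t₀, x₀), F w.1 w.2 ∈ (chartAt (Euc m) q).source :=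
    (hF t₀ hz x₀).continuousAt.eventually
      ((chartAt (Euc m) q).open_source.mem_nhds (mem_chart_source _ _))
  have h2 : ∀ᶠ w : ℝ × S in 𝓝 (t₀, x₀), w.1 ∈ Ioo (-ε) ε :=
    continuousAt_fst.eventually (isOpen_Ioo.mem_nhds hz)
  have h3 : ∀ᶠ w : ℝ × S in 𝓝 (t₀, x₀), w.2 ∈ c.source :=
    continuousAt_snd.eventually (c.open_source.mem_nhds hx₀)
  filter_upwards [h1, h2, h3] with w w1 w2 w3
  have hw : c.symm (c w.2) = w.2 := c.left_inv w3
  constructor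
  · simp only [Function.comp, hV, localVariation, ← hc, hw, (chartAt (Euc m) q).left_inv w1]
  · rw [inducedDet_ratio (hsm _ w2) (hsm 0 h0) (mem_chart_source _ _) w3]
    congr 1
    rw [inducedDet, gramMatrix_localVariation (q := q) (c.map_source w3)
      (by rw [← hc, hw]; exact hF _ w2 _) (by rw [← hc, hw]; exact w1)]

/-- Away from time zero the maps need not stay immersions, and the square root is smooth only where
the ratio of determinants is positive. This is an open condition, and at time zero the ratio is `1`.
-/
lemma isFiberSmoothAt_areaDensity {f : M → ℝ} (hf : ContMDiff (𝓡 m) 𝓘(ℝ, ℝ) ∞ f) {F : ℝ → S → M}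
    {ε : ℝ} (hF : ∀ t ∈ Ioo (-ε) ε, ∀ x, ContMDiffAt (𝓘(ℝ, ℝ).prod (𝓡 n)) (𝓡 m) ∞
      (fun z : ℝ × S => F z.1 z.2) (t, x))
    (hpos : ∀ x, ∀ y ∈ (chartAt (Euc n) x).target, 0 < inducedDet n m (F 0) x y) :
    ∃ W : Set (ℝ × S), IsOpen W ∧ (∀ x, 0 < ε → ((0 : ℝ), x) ∈ W) ∧
      ∀ z ∈ W, IsFiberSmoothAt n (areaDensity n m f F) z := by
  let R : ℝ × S → ℝ := fun w => inducedDet n m (F w.1) w.2 (chartAt (Euc n) w.2 w.2) /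
    inducedDet n m (F 0) w.2 (chartAt (Euc n) w.2 w.2)
  have hcont : ∀ z : ℝ × S, ContinuousAt (fun w : ℝ × S => (w.1, chartAt (Euc n) z.2 w.2)) z :=
    fun z => continuousAt_fst.prodMk
      (ContinuousAt.comp (g := chartAt (Euc n) z.2)
        ((chartAt (Euc n) z.2).continuousAt (mem_chart_source _ _)) continuousAt_snd)
  refine ⟨{z | z.1 ∈ Ioo (-ε) ε ∧ 0 < R z}, ?_, ?_, ?_⟩
  · rw [isOpen_iff_mem_nhds]
    rintro z ⟨h1, h2⟩
    obtain ⟨κ, κ', -, hκ', hev⟩ := exists_local_density hf hF hpos h1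
    have h3 : ContinuousAt R z := by
      refine (ContinuousAt.comp (g := κ') (f := fun w : ℝ × S => (w.1, chartAt (Euc n) z.2 w.2))
        hκ'.continuousAt (hcont z)).congr ?_
      filter_upwards [hev] with w hw using hw.2.symm
    filter_upwards [h3.eventually (lt_mem_nhds h2),
      continuousAt_fst.eventually (isOpen_Ioo.mem_nhds h1)] with w h4 h5
    exact ⟨h5, h4⟩
  · intro x hε
    refine ⟨⟨by simpa using hε, hε⟩, ?_⟩
    have := hpos x _ (mem_chart_target (Euc n) x)
    exact div_pos this this
  · rintro z ⟨h1, h2⟩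
    obtain ⟨κ, κ', hκ, hκ', hev⟩ := exists_local_density hf hF hpos h1
    refine ⟨chartAt (Euc n) z.2, fun r => Real.exp (-κ r) * Real.sqrt (κ' r),
      (chartAt (Euc n) z.2).continuousAt (mem_chart_source _ _),
      hκ.neg.exp.mul (hκ'.sqrt ?_), ?_⟩
    · have h3 : κ' (z.1, chartAt (Euc n) z.2 z.2) = R z := hev.self_of_nhds.2.symm
      rw [h3]
      exact h2.ne'
    · filter_upwards [hev] with w hw
      rw [areaDensity, hw.1, hw.2]

variable [T2Space S] [SecondCountableTopology S] [MeasurableSpace S] [BorelSpace S]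

/-- The volume at time `t` is the volume at time zero multiplied by the square root of the ratio of
the determinants. The time dependence moves from the measure to the integrand, and only the metric
at time zero has to be nondegenerate. -/
lemma weightedArea_eq {f : M → ℝ} {F : ℝ → S → M}
    {ε : ℝ} (hF : ∀ t ∈ Ioo (-ε) ε, ∀ x, ContMDiffAt (𝓘(ℝ, ℝ).prod (𝓡 n)) (𝓡 m) ∞
      (fun z : ℝ × S => F z.1 z.2) (t, x)) (hf : ContMDiff (𝓡 m) 𝓘(ℝ, ℝ) ∞ f)
    (hpos : ∀ x, ∀ y ∈ (chartAt (Euc n) x).target, 0 < inducedDet n m (F 0) x y) {t : ℝ}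
    (ht : t ∈ Ioo (-ε) ε) {K : Set S} (hK : IsCompact K) :
    weightedArea (n := n) (m := m) f K (F t) = ∫ x in K, areaDensity n m f F (t, x)
      ∂(tensorVolume (pullbackMetric (n := n) (m := m) (F 0))) := by
  have h0 : (0 : ℝ) ∈ Ioo (-ε) ε := ⟨by linarith [ht.1, ht.2], by linarith [ht.1, ht.2]⟩
  have hsm : ∀ t ∈ Ioo (-ε) ε, ContMDiff (𝓡 n) (𝓡 m) ∞ (F t) := fun t ht x =>
    contMDiffAt_slice_right (hF t ht x)
  let R : S → ℝ := fun x => Real.sqrt (inducedDet n m (F t) x (chartAt (Euc n) x x) /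
    inducedDet n m (F 0) x (chartAt (Euc n) x x))
  have hR : Continuous R := by
    rw [continuous_iff_continuousAt]
    intro x
    obtain ⟨κ, κ', -, hκ', hev⟩ := exists_local_density hf hF hpos (z := (t, x)) ht
    have h1 : ContinuousAt (fun w : S => (t, chartAt (Euc n) x w)) x :=
      continuousAt_const.prodMk ((chartAt (Euc n) x).continuousAt (mem_chart_source _ _))
    have h2 := ContinuousAt.comp (g := κ') (f := fun w : S => (t, chartAt (Euc n) x w))
      hκ'.continuousAt h1
    have h3 : ContinuousAt (fun w : S => (t, w)) x := by fun_prop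
    refine (Real.continuous_sqrt.continuousAt.comp h2).congr ?_
    filter_upwards [h3.eventually hev] with w hw
    simp only [Function.comp, R, hw.2]
  have hvol : tensorVolume (pullbackMetric (n := n) (m := m) (F t)) =
      (tensorVolume (pullbackMetric (n := n) (m := m) (F 0))).withDensity
        fun x => ENNReal.ofReal (R x) := by
    refine tensorVolume_eq_withDensity (isFormField_pullback (hsm 0 h0))
      (isFormField_pullback (hsm t ht)) (by fun_prop) fun p y hy => ?_
    have hx : (chartAt (Euc n) p).symm y ∈ (chartAt (Euc n) p).source :=
      (chartAt (Euc n) p).map_target hy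
    have h1 : R ((chartAt (Euc n) p).symm y) = Real.sqrt (inducedDet n m (F t) p y /
        inducedDet n m (F 0) p y) := by
      simp only [R]
      rw [inducedDet_ratio (hsm t ht) (hsm 0 h0) (mem_chart_source _ _) hx,
        (chartAt (Euc n) p).right_inv hy]
    have h2 := hpos p y hy
    rw [h1, volDensity, volDensity, ← ENNReal.ofReal_mul (Real.sqrt_nonneg _)]
    congr 1
    change Real.sqrt (inducedDet n m (F t) p y) = Real.sqrt (inducedDet n m (F 0) p y) * _
    rw [← Real.sqrt_mul h2.le, mul_div_cancel₀ _ h2.ne']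
  rw [weightedArea, hvol, setIntegral_withDensity_eq_setIntegral_toReal_smul₀ (by fun_prop)
    (by simp) _ hK.measurableSet]
  refine setIntegral_congr_fun hK.measurableSet fun x _ => ?_
  simp only [areaDensity, smul_eq_mul]
  rw [ENNReal.toReal_ofReal (Real.sqrt_nonneg _), mul_comm]

end AreaDensity

/-! ### The stability inequality -/

section MetricMatrix

variable {m : ℕ} {M : Type*} [TopologicalSpace M] [ChartedSpace (Euc m) M]
  [RiemannianBundle (fun x : M => TangentSpace (𝓡 m) x)] [IsManifold (𝓡 m) ∞ M]
  [IsContMDiffRiemannianBundle (𝓡 m) ∞ (Euc m) (fun x : M => TangentSpace (𝓡 m) x)]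

lemma metricCoeff_sum (p : M) (y : Euc m) (w : Fin m → ℝ) :
    ∑ i, ∑ j, metricCoeff p y i j * (w i * w j) =
      chartMetric p y (WithLp.toLp 2 w) (WithLp.toLp 2 w) := by
  rw [chartMetric_eq_sum]
  exact Finset.sum_congr rfl fun i _ => Finset.sum_congr rfl fun j _ => by
    change _ = w i * _ * w j
    ring

lemma metricCoeff_posDef (p : M) {y : Euc m} (hy : y ∈ (chartAt (Euc m) p).target) :
    (metricCoeff p y).PosDef := by
  refine posDef_of_form (metricCoeff_symm p y) fun w hw => ?_
  rw [metricCoeff_sum]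
  exact chartMetric_pos p hy fun h => hw ((WithLp.toLp_eq_zero 2).1 h)

lemma isFormField_metricTensor : IsFormField (metricTensor (m := m) (M := M)) where
  bilin x := by
    refine ⟨LinearMap.mk₂ ℝ (fun v w => chartMetric x (chartAt (Euc m) x x)
      (chartCoframe x x v) (chartCoframe x x w)) ?_ ?_ ?_ ?_, fun v w =>
        (chartMetric_coframe x (mem_chart_source _ _) v w).symm⟩
    · intro a b c; simp only [map_add, add_apply]
    · intro a b c; simp only [map_smul, smul_apply]
    · intro a b c; simp only [map_add]
    · intro a b c; simp only [map_smul]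
  continuousOn p i j y hy := (contDiffAt_metricCoeff p hy i j).continuousAt.continuousWithinAt

end MetricMatrix

section Stability

variable {n : ℕ} {S : Type*} [TopologicalSpace S] [ChartedSpace (Euc n) S]
  {M : Type*} [TopologicalSpace M] [ChartedSpace (Euc (n + 1)) M]
  [IsManifold (𝓡 n) ∞ S] [IsManifold (𝓡 (n + 1)) ∞ M]
  [RiemannianBundle (fun x : M => TangentSpace (𝓡 (n + 1)) x)]

/-- The induced metric in the chart at `x`, at the point `x`. -/
def inducedMatrix (n : ℕ) [ChartedSpace (Euc n) S] [ChartedSpace (Euc (n + 1)) M]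
    [RiemannianBundle (fun x : M => TangentSpace (𝓡 (n + 1)) x)] (φ : S → M) (x : S) :
    Matrix (Fin n) (Fin n) ℝ :=
  tensorCoeff (pullbackMetric (n := n) (m := n + 1) φ) x (chartAt (Euc n) x x)

/-- The matrix of the second fundamental form with respect to the unit normal `ν`. -/
def shapeMatrix (n : ℕ) [ChartedSpace (Euc n) S] [ChartedSpace (Euc (n + 1)) M]
    [RiemannianBundle (fun x : M => TangentSpace (𝓡 (n + 1)) x)] (φ : S → M)
    (ν : S → Euc (n + 1)) (x : S) : Matrix (Fin n) (Fin n) ℝ :=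
  Matrix.of fun i j => -chartMetric (φ x) (chartAt (Euc (n + 1)) (φ x) (φ x))
    (chartCoframe (φ x) (φ x) (ν x)) (covHessian φ x i j)

/-- The potential `|A|² + Ric_f(ν, ν)` of the stability operator. -/
def stabilityPotential (n : ℕ) [ChartedSpace (Euc n) S] [ChartedSpace (Euc (n + 1)) M]
    [RiemannianBundle (fun x : M => TangentSpace (𝓡 (n + 1)) x)] (f : M → ℝ) (φ : S → M)
    (ν : S → Euc (n + 1)) (x : S) : ℝ :=
  ((inducedMatrix n φ x)⁻¹ * shapeMatrix n φ ν x * (inducedMatrix n φ x)⁻¹ *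
    shapeMatrix n φ ν x).trace + bakryEmeryRicci (m := n + 1) f (φ x) (ν x) (ν x)

/-- The weighted mean curvature. -/
def weightedMeanCurvature (n : ℕ) [ChartedSpace (Euc n) S] [ChartedSpace (Euc (n + 1)) M]
    [RiemannianBundle (fun x : M => TangentSpace (𝓡 (n + 1)) x)] (f : M → ℝ) (φ : S → M)
    (ν : S → Euc (n + 1)) (x : S) : ℝ :=
  -fderiv ℝ (f ∘ (chartAt (Euc (n + 1)) (φ x)).symm) (chartAt (Euc (n + 1)) (φ x) (φ x))
      (chartCoframe (φ x) (φ x) (ν x))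
    + ((inducedMatrix n φ x)⁻¹ * shapeMatrix n φ ν x).trace

/-- The squared norm of the gradient of a function with respect to the induced metric. -/
def gradSq (n : ℕ) [ChartedSpace (Euc n) S] [ChartedSpace (Euc (n + 1)) M]
    [RiemannianBundle (fun x : M => TangentSpace (𝓡 (n + 1)) x)] (φ : S → M) (ψ : S → ℝ)
    (x : S) : ℝ :=
  ∑ i, ∑ j, (inducedMatrix n φ x)⁻¹ i j *
    (fderiv ℝ (ψ ∘ (chartAt (Euc n) x).symm) (chartAt (Euc n) x x)
        (EuclideanSpace.single i (1 : ℝ)) *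
      fderiv ℝ (ψ ∘ (chartAt (Euc n) x).symm) (chartAt (Euc n) x x)
        (EuclideanSpace.single j (1 : ℝ)))

variable [IsContMDiffRiemannianBundle (𝓡 (n + 1)) ∞ (Euc (n + 1))
  (fun x : M => TangentSpace (𝓡 (n + 1)) x)]

lemma contDiffAt_comp_chart_symm {k : ℕ} {P : Type*} [TopologicalSpace P] [ChartedSpace (Euc k) P]
    [IsManifold (𝓡 k) ∞ P] {f : P → ℝ} (hf : ContMDiff (𝓡 k) 𝓘(ℝ, ℝ) ∞ f) (p : P) {y : Euc k}
    (hy : y ∈ (chartAt (Euc k) p).target) :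
    ContDiffAt ℝ ∞ (f ∘ (chartAt (Euc k) p).symm) y := by
  have h1 : ContMDiffOn (𝓡 k) 𝓘(ℝ, ℝ) ∞ (f ∘ (chartAt (Euc k) p).symm)
    (chartAt (Euc k) p).target := hf.comp_contMDiffOn contMDiffOn_chart_symm
  exact (contMDiffOn_iff_contDiffOn.1 h1).contDiffAt
    ((chartAt (Euc k) p).open_target.mem_nhds hy)

lemma bakryEmeryRicci_eq {f : M → ℝ} (hf : ContMDiff (𝓡 (n + 1)) 𝓘(ℝ, ℝ) ∞ f) (x : M)
    (v : Euc (n + 1)) : bakryEmeryRicci f x v v =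
      LinearMap.trace ℝ (Euc (n + 1)) (curvEnd (chartGamma x) (chartAt (Euc (n + 1)) x x)
        (chartCoframe x x v)) +
      (fderiv ℝ (fderiv ℝ (f ∘ (chartAt (Euc (n + 1)) x).symm)) (chartAt (Euc (n + 1)) x x)
        (chartCoframe x x v) (chartCoframe x x v)
      - fderiv ℝ (f ∘ (chartAt (Euc (n + 1)) x).symm) (chartAt (Euc (n + 1)) x x)
        (chartGamma x (chartAt (Euc (n + 1)) x x) (chartCoframe x x v) (chartCoframe x x v))) := by
  rw [← ricci_eq_trace, ← hessian_eq hf]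
  rfl

/-- The first and second derivatives of the area density along a normal variation. -/
lemma deriv_areaDensity {f : M → ℝ} (hf : ContMDiff (𝓡 (n + 1)) 𝓘(ℝ, ℝ) ∞ f) {φ : S → M}
    (hφ : ContMDiff (𝓡 n) (𝓡 (n + 1)) ∞ φ) {ν : S → Euc (n + 1)}
    (hν : ∀ x, IsUnitNormal n φ x (ν x)) (hνs : IsSmoothField n (n + 1) φ ν) {K : Set S} {ψ : S → ℝ}
    (hψ : ContMDiff (𝓡 n) 𝓘(ℝ, ℝ) ∞ ψ) {ε : ℝ} {F : ℝ → S → M}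
    (hF : IsNormalVariation (n := n) φ ν K ψ ε F) (x : S)
    (hpos : 0 < (inducedMatrix n φ x).det) :
    deriv (fun t => areaDensity n (n + 1) f F (t, x)) 0 =
      Real.exp (-f (φ x)) * (ψ x * weightedMeanCurvature n f φ ν x) ∧
    (ψ x * weightedMeanCurvature n f φ ν x = 0 →
      deriv (deriv fun t => areaDensity n (n + 1) f F (t, x)) 0 =
        Real.exp (-f (φ x)) * (gradSq n φ ψ x - ψ x ^ 2 * stabilityPotential n f φ ν x)) := by
  have hφ0 := hF.initial
  have hF0 : ∀ x, F 0 x = φ x := fun x => congrFun hφ0 x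
  have hmd : ∀ x, MDifferentiableAt (𝓡 n) (𝓡 (n + 1)) φ x := hφ.mdifferentiable (by simp)
  set c := chartAt (Euc n) x with hc
  set q := φ x with hq
  have hx : x ∈ c.source := mem_chart_source _ x
  have hy : c x ∈ c.target := c.map_source hx
  have hcx : c.symm (c x) = x := c.left_inv hx
  have hqs : φ x ∈ (chartAt (Euc (n + 1)) q).source := mem_chart_source _ _
  set V := localVariation (n := n) (m := n + 1) x q F with hV
  have h0I : (0 : ℝ) ∈ Ioo (-ε) ε := ⟨by linarith [hF.pos], hF.pos⟩
  have hVloc : (fun y => V (0, y)) = localMap (n := n) (m := n + 1) x q φ := by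
    ext1 y
    simp only [hV, localVariation, localMap, hF0]
  have hV0 : V (0, c x) = chartAt (Euc (n + 1)) q (φ x) := by
    simp only [hV, localVariation, ← hc, hcx, hF0]
  have hev : ∀ᶠ y in 𝓝 (c x), y ∈ c.target ∧ φ (c.symm y) ∈ (chartAt (Euc (n + 1)) q).source :=
    (c.open_target.eventually_mem hy).and
      ((hφ.continuous.continuousAt.comp (c.continuousAt_symm hy)).eventually
        ((chartAt (Euc (n + 1)) q).open_source.mem_nhds
          (by simp only [Function.comp, hcx]; exact hqs)))
  have hFs : ∀ᶠ r in 𝓝 ((0 : ℝ), c x), ContDiffAt ℝ ∞ V r := by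
    have h1 : ContinuousAt (fun r : ℝ × Euc n => F r.1 (c.symm r.2)) (0, c x) := by
      have h2 : ContinuousAt (fun r : ℝ × Euc n => (r.1, c.symm r.2)) (0, c x) :=
        continuousAt_fst.prodMk (ContinuousAt.comp (g := c.symm) (c.continuousAt_symm hy)
          continuousAt_snd)
      refine ContinuousAt.comp (g := fun z : ℝ × S => F z.1 z.2) ?_ h2
      simp only [hcx]
      exact (hF.smooth 0 h0I x).continuousAt
    have h2 : ∀ᶠ r : ℝ × Euc n in 𝓝 (0, c x),
        F r.1 (c.symm r.2) ∈ (chartAt (Euc (n + 1)) q).source :=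
      h1.eventually ((chartAt (Euc (n + 1)) q).open_source.mem_nhds
        (by simp only [hcx, hF0]; exact hqs))
    have h3 : ∀ᶠ r : ℝ × Euc n in 𝓝 (0, c x), r.1 ∈ Ioo (-ε) ε :=
      continuousAt_fst.eventually (isOpen_Ioo.mem_nhds h0I)
    have h4 : ∀ᶠ r : ℝ × Euc n in 𝓝 (0, c x), r.2 ∈ c.target :=
      continuousAt_snd.eventually (c.open_target.mem_nhds hy)
    filter_upwards [h2, h3, h4] with r h2 h3 h4
    exact contDiffAt_localVariation h4 (hF.smooth _ h3 _) h2
  set N : Euc n → Euc (n + 1) := fun y => chartCoframe q (φ (c.symm y)) (ν (c.symm y)) with hN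
  have hNx : N (c x) = chartCoframe q (φ x) (ν x) := by simp only [hN, hcx]
  have hψx : (ψ ∘ c.symm) (c x) = ψ x := by simp only [Function.comp, hcx]
  have hgram : gramMatrix (chartMetric q) V (c x) 0 = inducedMatrix n φ x := by
    rw [inducedMatrix, ← hφ0]
    exact (gramMatrix_localVariation hy (by rw [← hc, hcx]; exact hF.smooth 0 h0I x)
      (by rw [← hc, hcx, hF0]; exact hqs)).symm
  have hnormal : ∀ᶠ y in 𝓝 (c x), (∀ w, chartMetric q (V (0, y))
      (fderiv ℝ (fun y => V (0, y)) y w) (N y) = 0) ∧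
      chartMetric q (V (0, y)) (N y) (N y) = 1 := by
    filter_upwards [hev] with y h
    have h1 := (isUnitNormal_iff (p := x) (q := q) (c.map_target h.1) (hmd _) h.2 _).1
      (hν (c.symm y))
    have h2 : chartAt (Euc n) x ((chartAt (Euc n) x).symm y) = y := c.right_inv h.1
    rw [h2] at h1
    rw [hVloc, show V (0, y) = localMap (n := n) (m := n + 1) x q φ y from congrFun hVloc y]
    exact h1
  -- The charts at `x` and `φ x` are kept fixed, and the data of the variation are read in them at
  -- all points near `x`. This is possible because the 2-jet of a normal variation is prescribed in
  -- every chart.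
  have key := second_variation_density (f := f ∘ (chartAt (Euc (n + 1)) q).symm)
    (ψ := ψ ∘ c.symm) (N := N) (y₀ := c x) (finrank_euc (n + 1)) (isMetricConnection_chart q)
    hFs (by rw [hV0]; exact (chartAt (Euc (n + 1)) q).map_source hqs) ?_ ?_
    ((contDiffAt_comp_chart_symm hψ x hy).differentiableAt (by simp))
    ((hνs x q (c x) hy (by rw [← hc, hcx]; exact hqs)).differentiableAt (by simp))
    (contDiffAt_comp_chart_symm hf q (by rw [hV0]; exact (chartAt (Euc (n + 1)) q).map_source hqs))
    (hnormal.mono fun y h => h.1) (hnormal.mono fun y h => h.2) (h := inducedMatrix n φ x)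
    hgram.symm hpos (B := shapeMatrix n φ ν x) ?_ rfl rfl
  · rw [hψx, hNx, hV0] at key
    have hk : (fun t => areaDensity n (n + 1) f F (t, x)) =ᶠ[𝓝 0] fun t =>
        Real.exp (-(f ∘ (chartAt (Euc (n + 1)) q).symm) (V (t, c x))) *
        Real.sqrt ((gramMatrix (chartMetric q) V (c x) t).det /
          (gramMatrix (chartMetric q) V (c x) 0).det) := by
      have h1 : ContinuousAt (fun t => F t x) 0 :=
        ContinuousAt.comp (g := fun z : ℝ × S => F z.1 z.2) (f := fun t : ℝ => (t, x))
          (hF.smooth 0 h0I x).continuousAt (by fun_prop)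
      filter_upwards [h1.eventually ((chartAt (Euc (n + 1)) q).open_source.mem_nhds
        (by show F 0 x ∈ _; rw [hF0]; exact hqs)), isOpen_Ioo.mem_nhds h0I] with t h2 h3
      rw [areaDensity, hgram]
      dsimp only
      have h4 : V (t, c x) = chartAt (Euc (n + 1)) q (F t x) := by
        simp only [hV, localVariation, ← hc, hcx]
      rw [h4, Function.comp, (chartAt (Euc (n + 1)) q).left_inv h2, hφ0]
      congr 3
      rw [inducedDet, gramMatrix_localVariation (q := q) hy
        (by rw [← hc, hcx]; exact hF.smooth t h3 x) (by rw [← hc, hcx]; exact h2)]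
    have he : (f ∘ (chartAt (Euc (n + 1)) q).symm) (chartAt (Euc (n + 1)) q (φ x)) = f (φ x) := by
      rw [Function.comp, (chartAt (Euc (n + 1)) q).left_inv hqs]
    rw [he] at key
    refine ⟨?_, fun h => ?_⟩
    · rw [hk.deriv_eq, key.1]
      rfl
    · rw [hk.deriv.deriv_eq, key.2 h, stabilityPotential, bakryEmeryRicci_eq hf,
        ← add_assoc]
      rfl
  · filter_upwards [hev] with y h
    have h1 := (hF.jet (c.symm y) q h.2).1
    rw [map_smul] at h1
    exact h1
  · filter_upwards [hev] with y h
    have h1 := (hF.jet (c.symm y) q h.2).2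
    rw [map_smul] at h1
    rw [show V (0, y) = localMap (n := n) (m := n + 1) x q φ y from congrFun hVloc y]
    exact h1
  · intro i j
    rw [hVloc, hNx, hV0]
    rfl

end Stability

/-! ### First and second variation of the weighted area. -/

section StabilityInequality

variable {n : ℕ} {S : Type*} [TopologicalSpace S] [ChartedSpace (Euc n) S]
  {M : Type*} [TopologicalSpace M] [ChartedSpace (Euc (n + 1)) M]
  [IsManifold (𝓡 n) ∞ S] [IsManifold (𝓡 (n + 1)) ∞ M]
  [RiemannianBundle (fun x : M => TangentSpace (𝓡 (n + 1)) x)]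
  [IsContMDiffRiemannianBundle (𝓡 (n + 1)) ∞ (Euc (n + 1))
    (fun x : M => TangentSpace (𝓡 (n + 1)) x)]

lemma IsNormalVariation.isVariation {φ : S → M} {ν : S → Euc (n + 1)} {K : Set S} {ψ : S → ℝ}
    {ε : ℝ} {F : ℝ → S → M} (hF : IsNormalVariation (n := n) φ ν K ψ ε F) (hK : IsCompact K) :
    IsVariation (n := n) (m := n + 1) φ K ε F where
  pos := hF.pos
  compact := hK
  smooth z hz := (hF.smooth z.1 hz.1 z.2).contMDiffWithinAt
  initial := hF.initial
  fixed := hF.fixed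

lemma IsNormalVariation.isNormal_variationField {φ : S → M} {ν : S → Euc (n + 1)} {K : Set S}
    {ψ : S → ℝ} {ε : ℝ} {F : ℝ → S → M} (hF : IsNormalVariation (n := n) φ ν K ψ ε F)
    (hν : ∀ x, IsUnitNormal n φ x (ν x)) (x : S) :
    IsNormal (n := n) (m := n + 1) (F 0) x (variationField F x) := by
  have hφ := hF.initial
  subst hφ
  have : IsManifold (𝓡 (n + 1)) 1 M := IsManifold.of_le (n := ∞) (by simp)
  have h0I : (0 : ℝ) ∈ Ioo (-ε) ε := ⟨by linarith [hF.pos], hF.pos⟩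
  have hq : F 0 x ∈ (chartAt (Euc (n + 1)) (F 0 x)).source := mem_chart_source _ _
  have h1 : MDifferentiableAt 𝓘(ℝ, ℝ) (𝓡 (n + 1)) (fun t => F t x) 0 := by
    have h2 : ContMDiffAt 𝓘(ℝ, ℝ) (𝓡 (n + 1)) ∞ (fun t => F t x) 0 :=
      ContMDiffAt.comp (0 : ℝ) (g := fun z : ℝ × S => F z.1 z.2) (f := fun t : ℝ => (t, x))
        (hF.smooth 0 h0I x) (contMDiffAt_id.prodMk contMDiffAt_const)
    exact h2.mdifferentiableAt (by simp)
  have h2 := (mdifferentiable_chart (I := 𝓡 (n + 1)) (F 0 x)).mdifferentiableAt hq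
  have h3 := mfderiv_comp (0 : ℝ) h2 h1
  have h4 : mfderiv 𝓘(ℝ, ℝ) (𝓡 (n + 1)) (chartAt (Euc (n + 1)) (F 0 x) ∘ fun t => F t x) 0 =
    fderiv ℝ (fun t => chartAt (Euc (n + 1)) (F 0 x) (F t x)) 0 := mfderiv_eq_fderiv
  rw [h4] at h3
  have h5 : fderiv ℝ (fun t => chartAt (Euc (n + 1)) (F 0 x) (F t x)) 0 (1 : ℝ) =
      chartCoframe (F 0 x) (F 0 x) (variationField F x) :=
    congrArg (fun L : ℝ →L[ℝ] Euc (n + 1) => L 1) h3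
  rw [fderiv_apply_one_eq_deriv, (hF.jet x (F 0 x) hq).1] at h5
  have h6 : ψ x • ν x = variationField F x := by
    have h7 := congrArg (chartFrame (F 0 x) (chartAt (Euc (n + 1)) (F 0 x) (F 0 x))) h5
    rw [chartFrame_chartCoframe _ hq] at h7
    refine h7.trans ?_
    exact chartFrame_chartCoframe _ hq _
  intro v
  rw [← h6]
  refine (real_inner_smul_right _ _ _).trans ?_
  rw [show inner ℝ (mfderiv (𝓡 n) (𝓡 (n + 1)) (F 0) x v) (ν x : TangentSpace (𝓡 (n + 1)) (F 0 x)) =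
      0
    from (hν x).1 v, mul_zero]

variable [T2Space S] [SecondCountableTopology S] [MeasurableSpace S] [BorelSpace S]
  [RiemannianBundle (fun x : S => TangentSpace (𝓡 n) x)]
  [IsContMDiffRiemannianBundle (𝓡 n) ∞ (Euc n) (fun x : S => TangentSpace (𝓡 n) x)]

lemma pullbackMetric_eq_metricTensor {φ : S → M}
    (hφ : IsIsometricImmersion (n := n) (m := n + 1) φ) :
    pullbackMetric (n := n) (m := n + 1) φ = metricTensor (m := n) := by
  funext x v w
  exact hφ.isometric x v w

lemma inducedMatrix_eq {φ : S → M} (hφ : IsIsometricImmersion (n := n) (m := n + 1) φ) (x : S) :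
    inducedMatrix n φ x = metricCoeff x (chartAt (Euc n) x x) := by
  rw [inducedMatrix, pullbackMetric_eq_metricTensor hφ]
  rfl

lemma injective_tangentOf {φ : S → M} (hφ : IsIsometricImmersion (n := n) (m := n + 1) φ) (x : S) :
    Function.Injective (tangentOf n (n + 1) φ x) := by
  refine (injective_iff_map_eq_zero _).2 fun v hv => ?_
  by_contra hne
  have h1 := metricTensor_self_pos (m := n) (x := x) hne
  rw [← pullbackMetric_eq_metricTensor hφ, pullbackMetric_eq (φ x) (mem_chart_source _ _), hv] at h1
  simp at h1

lemma tensorVolume_metric_isLocallyFinite :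
    IsLocallyFiniteMeasure (tensorVolume (metricTensor (m := n) (M := S))) :=
  tensorVolume_isLocallyFinite isFormField_metricTensor

lemma tensorVolume_metric_isOpenPos :
    (tensorVolume (metricTensor (m := n) (M := S))).IsOpenPosMeasure where
  open_pos U hU := by
    rintro ⟨x, hx⟩
    exact (tensorVolume_pos isFormField_metricTensor
      (fun p y hy => (metricCoeff_posDef p hy).det_pos) hU hx).ne'

/-- The first and second variation of the weighted area. -/
lemma variation_weightedArea {f : M → ℝ} (hf : ContMDiff (𝓡 (n + 1)) 𝓘(ℝ, ℝ) ∞ f) {φ : S → M}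
    (hφ : IsIsometricImmersion (n := n) (m := n + 1) φ) {ν : S → Euc (n + 1)} {ψ : S → ℝ}
    (hc : HasCompactSupport ψ) {ε : ℝ} {F : ℝ → S → M}
    (hF : IsNormalVariation (n := n) φ ν (tsupport ψ) ψ ε F) :
    (∀ x, IsFiberSmoothAt n (areaDensity n (n + 1) f F) (0, x)) ∧
    deriv (fun t => weightedArea (n := n) (m := n + 1) f (tsupport ψ) (F t)) 0 =
      ∫ x in tsupport ψ, deriv (fun t => areaDensity n (n + 1) f F (t, x)) 0
        ∂(tensorVolume (metricTensor (m := n))) ∧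
    iteratedDeriv 2 (fun t => weightedArea (n := n) (m := n + 1) f (tsupport ψ) (F t)) 0 =
      ∫ x in tsupport ψ, deriv (deriv fun t => areaDensity n (n + 1) f F (t, x)) 0
        ∂(tensorVolume (metricTensor (m := n))) := by
  have hg : pullbackMetric (n := n) (m := n + 1) (F 0) = metricTensor (m := n) := by
    rw [hF.initial]; exact pullbackMetric_eq_metricTensor hφ
  have hpos : ∀ x, ∀ y ∈ (chartAt (Euc n) x).target, 0 < inducedDet n (n + 1) (F 0) x y := by
    intro x y hy
    rw [inducedDet, hg]
    exact (metricCoeff_posDef x hy).det_pos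
  obtain ⟨W, hWo, hW0, hW⟩ := isFiberSmoothAt_areaDensity hf hF.smooth hpos
  have hlf : IsLocallyFiniteMeasure (tensorVolume (metricTensor (m := n) (M := S))) :=
    tensorVolume_metric_isLocallyFinite
  refine ⟨fun x => hW _ (hW0 x hF.pos), ?_⟩
  refine second_deriv_setIntegral (n := n) hc.isCompact hc.isCompact.measurableSet
    hc.isCompact.measure_ne_top hWo ?_ hW ⟨ε, hF.pos, fun t ht => ?_⟩
  · rintro ⟨t, x⟩ ⟨ht, -⟩
    obtain rfl : t = 0 := ht
    exact hW0 x hF.pos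
  · rw [weightedArea_eq hF.smooth hf hpos ht hc.isCompact, hg]

/-- The weighted mean curvature of an `f`-minimal hypersurface vanishes, and the second variation
is nonnegative on a stable one. -/
theorem stability_inequality {f : M → ℝ} (hf : ContMDiff (𝓡 (n + 1)) 𝓘(ℝ, ℝ) ∞ f) {φ : S → M}
    (hφ : IsIsometricImmersion (n := n) (m := n + 1) φ)
    (hstable : IsStableFMinimal (n := n) (m := n + 1) f φ) {ν : S → Euc (n + 1)}
    (hν : ∀ x, IsUnitNormal n φ x (ν x)) (hνs : IsSmoothField n (n + 1) φ ν) :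
    Continuous (fun x => Real.exp (-f (φ x)) * stabilityPotential n f φ ν x) ∧
    ∀ ψ : S → ℝ, ContMDiff (𝓡 n) 𝓘(ℝ, ℝ) ∞ ψ → HasCompactSupport ψ →
      Continuous (fun x => Real.exp (-f (φ x)) * gradSq n φ ψ x) ∧
      0 ≤ ∫ x in tsupport ψ,
        Real.exp (-f (φ x)) * (gradSq n φ ψ x - ψ x ^ 2 * stabilityPotential n f φ ν x)
        ∂(tensorVolume (metricTensor (m := n))) := by
  have hlf : IsLocallyFiniteMeasure (tensorVolume (metricTensor (m := n) (M := S))) :=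
    tensorVolume_metric_isLocallyFinite
  have hop : (tensorVolume (metricTensor (m := n) (M := S))).IsOpenPosMeasure :=
    tensorVolume_metric_isOpenPos
  have hlc : LocallyCompactSpace S := ChartedSpace.locallyCompactSpace (Euc n) S
  have hdet : ∀ x, 0 < (inducedMatrix n φ x).det := fun x => by
    rw [inducedMatrix_eq hφ]
    exact (metricCoeff_posDef x (mem_chart_target _ x)).det_pos
  let η := weightedMeanCurvature n f φ ν
  let Q := stabilityPotential n f φ ν
  let w : S → ℝ := fun x => Real.exp (-f (φ x))
  have hw : Continuous w := (hf.continuous.comp hφ.smooth.continuous).neg.rexp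
  have hwpos : ∀ x, 0 < w x := fun x => Real.exp_pos _
  -- the first variation
  have hfirst : ∀ ψ : S → ℝ, ContMDiff (𝓡 n) 𝓘(ℝ, ℝ) ∞ ψ → HasCompactSupport ψ →
      Continuous (fun x => w x * (ψ x * η x)) ∧
      ∫ x, w x * (ψ x * η x) ∂(tensorVolume (metricTensor (m := n))) = 0 := by
    intro ψ hψ hc
    obtain ⟨ε, F, hF⟩ := exists_isNormalVariation hφ.smooth hνs hψ hc
    obtain ⟨h1, h2, -⟩ := variation_weightedArea hf hφ hc hF
    have h3 : ∀ x, deriv (fun t => areaDensity n (n + 1) f F (t, x)) 0 = w x * (ψ x * η x) :=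
      fun x => (deriv_areaDensity hf hφ.smooth hν hνs hψ hF x (hdet x)).1
    simp only [h3] at h2
    constructor
    · rw [continuous_iff_continuousAt]
      intro x
      have h4 := ContinuousAt.comp
        (g := fun z : ℝ × S => deriv (fun t => areaDensity n (n + 1) f F (t, z.2)) z.1)
        (f := fun x : S => ((0 : ℝ), x)) (x := x) (h1 x).deriv.continuousAt (by fun_prop)
      exact h4.congr (Eventually.of_forall fun y => h3 y)
    · rw [← setIntegral_eq_integral_of_forall_compl_eq_zero (s := tsupport ψ), ← h2]
      · exact (hstable.1 _ _ _ (hF.isVariation hc.isCompact)).deriv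
      · intro x hx
        rw [image_eq_zero_of_notMem_tsupport hx, zero_mul, mul_zero]
  -- The fundamental lemma of the calculus of variations, tested with bump functions.
  have hη : ∀ x, η x = 0 := by
    intro x₀
    by_contra hne
    -- Continuity of `η` is not available directly. The integrand of the first variation is
    -- continuous for every test function, and a bump equal to `1` near `x₀` transfers this to the
    -- sign of `η` near `x₀`. A second bump supported where `η` keeps its sign then makes the first
    -- variation nonzero.
    obtain ⟨b₀⟩ := (inferInstance : Nonempty (SmoothBumpFunction (𝓡 n) x₀))
    have hc1 := (hfirst b₀ b₀.contMDiff b₀.hasCompactSupport).1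
    have hev : ∀ᶠ x in 𝓝 x₀, 0 < w x * (b₀ x * η x) * η x₀ := by
      refine (hc1.mul continuous_const).continuousAt.eventually (lt_mem_nhds ?_)
      show 0 < w x₀ * (b₀ x₀ * η x₀) * η x₀
      rw [b₀.eq_one, one_mul, mul_assoc]
      exact mul_pos (hwpos x₀) (mul_self_pos.2 hne)
    have hev2 : {x | 0 < η x * η x₀} ∈ 𝓝 x₀ := by
      filter_upwards [hev, b₀.eventuallyEq_one] with x h1 h2
      rw [h2, Pi.one_apply, one_mul, mul_assoc] at h1
      exact (pos_iff_pos_of_mul_pos h1).1 (hwpos x)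
    obtain ⟨b, -, hb⟩ := (SmoothBumpFunction.nhds_basis_tsupport (I := 𝓡 n) x₀).mem_iff.1 hev2
    obtain ⟨h1, h2⟩ := hfirst b b.contMDiff b.hasCompactSupport
    have h3 : 0 < ∫ x, w x * (b x * η x) * η x₀ ∂(tensorVolume (metricTensor (m := n))) := by
      refine Continuous.integral_pos_of_hasCompactSupport_nonneg_nonzero (x := x₀)
        (h1.mul continuous_const) ?_ ?_ ?_
      · have h4 : HasCompactSupport fun x => b x * (w x * η x * η x₀) :=
          b.hasCompactSupport.mul_right
        have h5 : (fun x => w x * (b x * η x) * η x₀) = fun x => b x * (w x * η x * η x₀) := by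
          ext x; ring
        show HasCompactSupport fun x => w x * (b x * η x) * η x₀
        rw [h5]
        exact h4
      · intro x
        by_cases hx : x ∈ tsupport b
        · have h4 : 0 < η x * η x₀ := hb hx
          have h5 := b.nonneg (x := x)
          have h6 := hwpos x
          change 0 ≤ w x * (b x * η x) * η x₀
          have : w x * (b x * η x) * η x₀ = (w x * b x) * (η x * η x₀) := by ring
          rw [this]
          positivity
        · change 0 ≤ w x * (b x * η x) * η x₀
          rw [image_eq_zero_of_notMem_tsupport hx]
          simp
      · rw [b.eq_one, one_mul, mul_assoc]
        exact (mul_pos (hwpos x₀) (mul_self_pos.2 hne)).ne'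
    rw [integral_mul_const, h2, zero_mul] at h3
    exact lt_irrefl _ h3
  -- the second variation
  have hsecond : ∀ ψ : S → ℝ, ContMDiff (𝓡 n) 𝓘(ℝ, ℝ) ∞ ψ → HasCompactSupport ψ →
      Continuous (fun x => w x * (gradSq n φ ψ x - ψ x ^ 2 * Q x)) ∧
      0 ≤ ∫ x in tsupport ψ, w x * (gradSq n φ ψ x - ψ x ^ 2 * Q x)
        ∂(tensorVolume (metricTensor (m := n))) := by
    intro ψ hψ hc
    obtain ⟨ε, F, hF⟩ := exists_isNormalVariation hφ.smooth hνs hψ hc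
    obtain ⟨h1, -, h2⟩ := variation_weightedArea hf hφ hc hF
    have h3 : ∀ x, deriv (deriv fun t => areaDensity n (n + 1) f F (t, x)) 0 =
        w x * (gradSq n φ ψ x - ψ x ^ 2 * Q x) := fun x =>
      (deriv_areaDensity hf hφ.smooth hν hνs hψ hF x (hdet x)).2
        (by rw [show weightedMeanCurvature n f φ ν x = 0 from hη x, mul_zero])
    simp only [h3] at h2
    constructor
    · rw [continuous_iff_continuousAt]
      intro x
      have h4 := ContinuousAt.comp (g := fun z : ℝ × S =>
          deriv (fun s => deriv (fun t => areaDensity n (n + 1) f F (t, z.2)) s) z.1)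
        (f := fun x : S => ((0 : ℝ), x)) (x := x) (h1 x).deriv.deriv.continuousAt (by fun_prop)
      exact h4.congr (Eventually.of_forall fun y => h3 y)
    · rw [← h2]
      exact hstable.2 _ _ _ (hF.isVariation hc.isCompact) (hF.isNormal_variationField hν)
  have hgrad0 : ∀ (ψ : S → ℝ) (x : S), ψ =ᶠ[𝓝 x] 1 → gradSq n φ ψ x = 0 := by
    intro ψ x h
    have h1 : ψ ∘ (chartAt (Euc n) x).symm =ᶠ[𝓝 (chartAt (Euc n) x x)] fun _ => (1 : ℝ) := by
      have h2 : Tendsto (chartAt (Euc n) x).symm (𝓝 (chartAt (Euc n) x x)) (𝓝 x) := by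
        have := (chartAt (Euc n) x).continuousAt_symm (mem_chart_target (Euc n) x)
        rwa [ContinuousAt, (chartAt (Euc n) x).left_inv (mem_chart_source _ x)] at this
      exact h2.eventually h
    simp [gradSq, h1.fderiv_eq]
  -- Where a bump function is locally `1` its gradient vanishes, and the continuous integrand of the
  -- second variation reduces to `-w Q`.
  have hQ : Continuous fun x => w x * Q x := by
    rw [continuous_iff_continuousAt]
    intro x₀
    obtain ⟨b₀⟩ := (inferInstance : Nonempty (SmoothBumpFunction (𝓡 n) x₀))
    have h1 := (hsecond b₀ b₀.contMDiff b₀.hasCompactSupport).1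
    refine h1.neg.continuousAt.congr ?_
    filter_upwards [b₀.eventuallyEq_one.eventually_nhds] with x hx
    have h2 : b₀ x = 1 := hx.self_of_nhds
    show -(w x * (gradSq n φ b₀ x - b₀ x ^ 2 * Q x)) = w x * Q x
    rw [hgrad0 _ x hx, h2]
    ring
  refine ⟨hQ, fun ψ hψ hc => ⟨?_, (hsecond ψ hψ hc).2⟩⟩
  refine ((hsecond ψ hψ hc).1.add ((hψ.continuous.pow 2).mul hQ)).congr fun x => ?_
  change w x * (gradSq n φ ψ x - ψ x ^ 2 * Q x) + ψ x ^ 2 * (w x * Q x) = w x * gradSq n φ ψ x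
  ring

end StabilityInequality

/-! ### Compactness of closed balls -/

section HopfRinow

/-- A Riemannian manifold is a length space: points at distance less than `r + δ` from `p` are at
distance less than `δ` from the closed ball of radius `r`. -/
lemma exists_edist_le_edist_lt (n : ℕ) {S : Type*} [EMetricSpace S] [ChartedSpace (Euc n) S]
    [IsManifold (𝓡 n) ∞ S] [RiemannianBundle (fun x : S => TangentSpace (𝓡 n) x)]
    [IsRiemannianManifold (𝓡 n) S] {p x : S} {r δ : ℝ≥0∞} (hδ : 0 < δ)
    (h : edist p x < r + δ) : ∃ y, edist p y ≤ r ∧ edist y x < δ := by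
  rcases le_or_gt (edist p x) r with h1 | h1
  · exact ⟨x, h1, by simpa using hδ⟩
  rw [IsRiemannianManifold.out (I := 𝓡 n) p x] at h
  obtain ⟨γ, h0, h2, hγ, hl⟩ := Manifold.exists_lt_of_riemannianEDist_lt h
  have hc : ContinuousOn (fun t => edist p (γ t)) (Icc 0 1) :=
    Continuous.comp_continuousOn (g := fun z => edist p z) (continuous_const.edist continuous_id)
        hγ.continuousOn
  have h3 : r ∈ Icc (edist p (γ 0)) (edist p (γ 1)) := by
    rw [h0, h2, edist_self]
    exact ⟨zero_le, h1.le⟩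
  -- A path of length below `r + δ` crosses the sphere of radius `r`. The part before the crossing
  -- has length at least `r`, so the rest is shorter than `δ`.
  obtain ⟨t, ht, hrt⟩ := intermediate_value_Icc zero_le_one hc h3
  have hrt' : edist p (γ t) = r := hrt
  refine ⟨γ t, hrt'.le, ?_⟩
  have h4 : edist p (γ t) ≤ Manifold.pathELength (𝓡 n) γ 0 t := by
    rw [IsRiemannianManifold.out (I := 𝓡 n)]
    exact Manifold.riemannianEDist_le_pathELength (hγ.mono (Icc_subset_Icc_right ht.2)) h0 rfl ht.1
  have h5 : edist (γ t) x ≤ Manifold.pathELength (𝓡 n) γ t 1 := by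
    rw [IsRiemannianManifold.out (I := 𝓡 n)]
    exact Manifold.riemannianEDist_le_pathELength (hγ.mono (Icc_subset_Icc_left ht.1)) rfl h2 ht.2
  rw [← Manifold.pathELength_add ht.1 ht.2] at hl
  refine h5.trans_lt (lt_of_add_lt_add_left (a := r) ?_)
  refine lt_of_le_of_lt (add_le_add_left ?_ _) hl
  rw [← hrt']
  exact h4

/-- The compactness half of the Hopf-Rinow theorem. -/
theorem isCompact_closedEBall (n : ℕ) {S : Type*} [EMetricSpace S] [ChartedSpace (Euc n) S]
    [IsManifold (𝓡 n) ∞ S] [RiemannianBundle (fun x : S => TangentSpace (𝓡 n) x)]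
    [IsRiemannianManifold (𝓡 n) S] [CompleteSpace S] (p : S) (R : NNReal) :
    IsCompact {x : S | edist p x ≤ R} := by
  have hlc : LocallyCompactSpace S := ChartedSpace.locallyCompactSpace (Euc n) S
  have hclosed : ∀ r : NNReal, IsClosed {x : S | edist p x ≤ r} := fun r =>
    isClosed_le (continuous_const.edist continuous_id) continuous_const
  -- Continuity method in the radius: this set contains `0`, passes to limits from below by
  -- completeness, and can always be extended a little to the right by local compactness.
  let A : Set ℝ := {r | IsCompact {x : S | edist p x ≤ ENNReal.ofReal r}}
  have hA : ∀ r, 0 ≤ r → (∀ s ∈ Ico 0 r, s ∈ A) → r ∈ A := by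
    intro r hr hs
    rcases hr.eq_or_lt with rfl | hr
    · have : {x : S | edist p x ≤ ENNReal.ofReal 0} = {p} := by
        ext x; simp [eq_comm]
      show IsCompact _
      rw [this]
      exact isCompact_singleton
    refine isCompact_iff_totallyBounded_isComplete.2
      ⟨EMetric.totallyBounded_iff.2 fun ε hε => ?_, (hclosed _).isComplete⟩
    obtain ⟨δ, hδ, hδε⟩ : ∃ δ : ℝ, 0 < δ ∧ ENNReal.ofReal δ < ε / 2 := by
      obtain ⟨δ, h1, h2⟩ := ENNReal.lt_iff_exists_nnreal_btwn.1 (ENNReal.half_pos hε.ne')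
      exact ⟨δ, by exact_mod_cast h1, by simpa using h2⟩
    -- Here `s < r < s + δ`, so every point of the ball of radius `r` is within `δ < ε / 2` of the
    -- compact ball of radius `s`, and an `ε / 2`-net of the smaller ball is an `ε`-net of the
    -- larger one.
    let s := max 0 (r - δ / 2)
    have hsA : s ∈ A := hs s ⟨le_max_left _ _, max_lt hr (by linarith)⟩
    obtain ⟨T, hT, hTs⟩ := EMetric.totallyBounded_iff.1
      (isCompact_iff_totallyBounded_isComplete.1 hsA).1 (ε / 2) (ENNReal.half_pos hε.ne')
    refine ⟨T, hT, fun x hx => ?_⟩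
    have hx' : edist p x ≤ ENNReal.ofReal r := hx
    obtain ⟨y, hy, hyx⟩ := exists_edist_le_edist_lt n (p := p) (x := x)
      (r := ENNReal.ofReal s) (δ := ENNReal.ofReal δ) (by simpa using hδ) (by
        refine hx'.trans_lt ?_
        rw [← ENNReal.ofReal_add (le_max_left _ _) hδ.le]
        refine (ENNReal.ofReal_lt_ofReal_iff (by positivity)).2 ?_
        have := le_max_right 0 (r - δ / 2)
        linarith)
    obtain ⟨z, hz, hyz⟩ := mem_iUnion₂.1 (hTs hy)
    refine mem_iUnion₂.2 ⟨z, hz, ?_⟩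
    have hyz' : edist y z < ε / 2 := hyz
    calc edist x z ≤ edist x y + edist y z := edist_triangle _ _ _
      _ < ε / 2 + ε / 2 := ENNReal.add_lt_add (by rw [edist_comm]; exact hyx.trans hδε) hyz'
      _ = ε := ENNReal.add_halves _
  -- A compact ball has a compact neighbourhood, which contains a uniform thickening of the ball; in
  -- a length space the thickening contains a slightly larger ball.
  have hA' : ∀ r, 0 ≤ r → r ∈ A → ∃ δ > 0, r + δ ∈ A := by
    intro r hr hrA
    obtain ⟨K, hK, hrK⟩ := exists_compact_superset (show IsCompact _ from hrA)
    obtain ⟨δ, hδ, hδK⟩ := (show IsCompact {x : S | edist p x ≤ ENNReal.ofReal r} from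
      hrA).exists_thickening_subset_open isOpen_interior hrK
    refine ⟨δ / 2, by positivity, ?_⟩
    refine hK.of_isClosed_subset (hclosed _) fun x hx => interior_subset (hδK ?_)
    have hx' : edist p x ≤ ENNReal.ofReal (r + δ / 2) := hx
    obtain ⟨y, hy, hyx⟩ := exists_edist_le_edist_lt n (p := p) (x := x)
      (r := ENNReal.ofReal r) (δ := ENNReal.ofReal δ) (by simpa using hδ) (by
        refine hx'.trans_lt ?_
        rw [← ENNReal.ofReal_add hr hδ.le]
        exact (ENNReal.ofReal_lt_ofReal_iff (by positivity)).2 (by linarith))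
    refine (Metric.mem_thickening_iff_exists_edist_lt _ _).2 ⟨y, hy, ?_⟩
    rwa [edist_comm]
  have hmono : ∀ r s, s ≤ r → r ∈ A → s ∈ A := fun r s hsr hr =>
    (show IsCompact _ from hr).of_isClosed_subset (hclosed _) fun x hx =>
      le_trans (show edist p x ≤ _ from hx) (ENNReal.ofReal_le_ofReal hsr)
  have hall : ∀ r : ℝ, 0 ≤ r → r ∈ A := by
    by_contra! hcon
    obtain ⟨r, hr, hrA⟩ := hcon
    have h0 : (0 : ℝ) ∈ A := hA 0 le_rfl fun s hs => absurd hs (by simp)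
    have hbdd : BddAbove A := ⟨r, fun s hs => by
      by_contra! hlt
      exact hrA (hmono s r hlt.le hs)⟩
    have hs0 : 0 ≤ sSup A := le_csSup hbdd h0
    have hsA : sSup A ∈ A := hA _ hs0 fun s hs => by
      obtain ⟨t, ht, hst⟩ := exists_lt_of_lt_csSup ⟨0, h0⟩ hs.2
      exact hmono t s hst.le ht
    obtain ⟨δ, hδ, hδA⟩ := hA' _ hs0 hsA
    have := le_csSup hbdd hδA
    linarith
  have := hall R R.2
  simpa [A] using this

/-- On a connected Riemannian manifold distances are finite. -/
theorem edist_ne_top_of_connected {S : Type*} [EMetricSpace S] [ConnectedSpace S] (p x : S) :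
    edist p x ≠ ⊤ := by
  -- The set of points at finite distance from `p` is closed as well as open, since a point at
  -- distance below `1` from one of its members also belongs to it.
  have h : IsClopen (Metric.eball p ⊤) := by
    refine ⟨?_, Metric.isOpen_eball⟩
    rw [← isOpen_compl_iff, EMetric.isOpen_iff]
    intro y hy
    refine ⟨1, one_pos, fun z hz hzp => hy ?_⟩
    have h1 : edist z y < 1 := hz
    have h2 : edist z p < ⊤ := hzp
    show edist y p < ⊤
    refine (edist_triangle y z p).trans_lt (ENNReal.add_lt_top.2 ⟨?_, h2⟩)
    rw [edist_comm]
    exact h1.trans ENNReal.one_lt_top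
  have h2 := h.eq_univ ⟨p, Metric.mem_eball_self (by simp)⟩
  have h3 : x ∈ Metric.eball p ⊤ := h2 ▸ mem_univ x
  have h4 : edist x p < ⊤ := h3
  rw [edist_comm]
  exact h4.ne

end HopfRinow

/-! ### Smoothing Lipschitz functions -/

/-- Mollification preserves the modulus of continuity of a function. -/
lemma exists_contDiff_approx {n : ℕ} {u : Euc n → ℝ} {y₀ : Euc n} {r : ℝ} (hr : 0 < r)
    {N : Euc n → ℝ} (hN : Continuous N) (hNs : ∀ (t : ℝ) h, N (t • h) = |t| * N h)
    (hu : ContinuousOn u (Metric.ball y₀ r))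
    (huN : ∀ a ∈ Metric.ball y₀ r, ∀ b ∈ Metric.ball y₀ r, |u b - u a| ≤ N (b - a))
    {ε : ℝ} (hε : 0 < ε) :
    ∃ v : Euc n → ℝ, ContDiff ℝ ∞ v ∧ ∀ y ∈ Metric.ball y₀ (r / 2), |v y - u y| ≤ ε ∧
      ∀ h, |fderiv ℝ v y h| ≤ N h := by
  have hN0 : N 0 = 0 := by simpa using hNs 0 0
  have hNnn : ∀ h, 0 ≤ N h := by
    intro h
    by_contra! hneg
    rcases eq_or_ne h 0 with rfl | -
    · linarith
    have h1 : ∀ᶠ t : ℝ in 𝓝[>] 0, y₀ + t • h ∈ Metric.ball y₀ r := by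
      have h2 : Continuous fun t : ℝ => y₀ + t • h := by fun_prop
      refine nhdsWithin_le_nhds (h2.continuousAt.preimage_mem_nhds ?_)
      simpa using Metric.ball_mem_nhds y₀ hr
    obtain ⟨t, ht, ht0⟩ := (h1.and self_mem_nhdsWithin).exists
    have h3 := huN y₀ (Metric.mem_ball_self hr) _ ht
    rw [add_sub_cancel_left, hNs] at h3
    have ht0' : 0 < t := ht0
    have h4 : |t| * N h < 0 := mul_neg_of_pos_of_neg (abs_pos.2 ht0'.ne') hneg
    linarith [abs_nonneg (u (y₀ + t • h) - u y₀)]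
  obtain ⟨δ, hδ, hδN⟩ : ∃ δ > 0, ∀ z ∈ Metric.ball (0 : Euc n) δ, N z < ε := by
    have h1 : {z | N z < ε} ∈ 𝓝 (0 : Euc n) :=
      hN.continuousAt.eventually (gt_mem_nhds (by rwa [hN0]))
    obtain ⟨δ, hδ, h2⟩ := Metric.mem_nhds_iff.1 h1
    exact ⟨δ, hδ, fun z hz => h2 hz⟩
  -- The radii `r/2`, `5r/8`, `7r/8` leave room first for a small translation along `t • h` and then
  -- for a kernel of radius at most `r/8`. Truncating `u` to `B` makes it integrable without
  -- changing the values that are used.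
  let B : Set (Euc n) := Metric.closedBall y₀ (7 / 8 * r)
  have hBr : B ⊆ Metric.ball y₀ r := Metric.closedBall_subset_ball (by linarith)
  let g : Euc n → ℝ := B.indicator u
  have hBm : MeasurableSet B := Metric.isClosed_closedBall.measurableSet
  have hg : Integrable g volume := (integrable_indicator_iff hBm).2
    ((hu.mono hBr).integrableOn_compact (isCompact_closedBall _ _))
  have hgu : ∀ y ∈ B, g y = u y := fun y hy => indicator_of_mem hy _
  let s := min δ (r / 8)
  have hs : 0 < s := lt_min hδ (by linarith)
  let ρ : ContDiffBump (0 : Euc n) := ⟨s / 2, s, by linarith, by linarith⟩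
  let v : Euc n → ℝ := convolution (ρ.normed volume) g (ContinuousLinearMap.lsmul ℝ ℝ) volume
  have hv : ContDiff ℝ ∞ v := ρ.hasCompactSupport_normed.contDiff_convolution_left _
    ρ.contDiff_normed hg.locallyIntegrable
  have hmem : ∀ y ∈ Metric.ball y₀ (5 / 8 * r), ∀ x ∈ Metric.ball y s, x ∈ B := by
    intro y hy x hx
    have h1 : dist x y < r / 8 := (Metric.mem_ball.1 hx).trans_le (min_le_right _ _)
    have h2 : dist y y₀ < 5 / 8 * r := hy
    have h3 := dist_triangle x y y₀
    refine Metric.mem_closedBall.2 ?_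
    linarith
  refine ⟨v, hv, fun y hy => ⟨?_, fun h => ?_⟩⟩
  · have hy' : y ∈ Metric.ball y₀ (5 / 8 * r) :=
      Metric.ball_subset_ball (by linarith) hy
    have hyB : y ∈ B := hmem y hy' y (Metric.mem_ball_self hs)
    have h1 : dist (v y) (g y) ≤ ε := by
      refine ρ.dist_normed_convolution_le hg.aestronglyMeasurable fun x hx => ?_
      have hxB := hmem y hy' x hx
      rw [hgu x hxB, hgu y hyB, Real.dist_eq]
      refine (huN y (hBr hyB) x (hBr hxB)).trans (hδN _ ?_).le
      rw [Metric.mem_ball, dist_zero_right, ← dist_eq_norm]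
      exact (Metric.mem_ball.1 hx).trans_le (min_le_left _ _)
    rwa [hgu y hyB, Real.dist_eq] at h1
  · have hcont : Continuous fun t : ℝ => y + t • h := by fun_prop
    have hball : ∀ᶠ t : ℝ in 𝓝 0, y + t • h ∈ Metric.ball y₀ (5 / 8 * r) ∧
        t • h ∈ Metric.ball (0 : Euc n) (r / 8) := by
      refine (hcont.continuousAt.eventually (Metric.isOpen_ball.mem_nhds ?_)).and
        ((show Continuous fun t : ℝ => t • h by fun_prop).continuousAt.eventually
          (Metric.isOpen_ball.mem_nhds ?_))
      · show y + (0 : ℝ) • h ∈ _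
        rw [zero_smul, add_zero]
        exact Metric.ball_subset_ball (by linarith) hy
      · show (0 : ℝ) • h ∈ _
        rw [zero_smul]
        exact Metric.mem_ball_self (by linarith)
    have hy' : y ∈ Metric.ball y₀ (5 / 8 * r) := Metric.ball_subset_ball (by linarith) hy
    -- A difference of the mollified function at two points is the mollification of the difference
    -- of translates. The kernel is a probability density, so the bound by `N` survives averaging
    -- with the same constant.
    have hlip : ∀ᶠ t : ℝ in 𝓝 0, ‖v (y + t • h) - v (y + (0 : ℝ) • h)‖ ≤ N h * ‖t - 0‖ := by
      filter_upwards [hball] with t ht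
      rw [zero_smul, add_zero, sub_zero]
      let k : Euc n → ℝ := fun x => g (x + t • h) - g x
      have hk : Integrable k volume := (hg.comp_add_right (t • h)).sub hg
      have hconv : v (y + t • h) - v y =
          convolution (ρ.normed volume) k (ContinuousLinearMap.lsmul ℝ ℝ) volume y := by
        have e1 : ∀ z, ConvolutionExistsAt (ρ.normed volume) g z
            (ContinuousLinearMap.lsmul ℝ ℝ) volume := fun z =>
          ρ.hasCompactSupport_normed.convolutionExists_left _ ρ.continuous_normed
            hg.locallyIntegrable z
        have e2 := integral_sub (e1 (y + t • h)) (e1 y)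
        refine e2.symm.trans (integral_congr_ae (Eventually.of_forall fun x => ?_))
        simp only [k, ContinuousLinearMap.lsmul_apply, smul_eq_mul]
        rw [show y + t • h - x = y - x + t • h by abel]
        ring
      have h1 : dist (convolution (ρ.normed volume) k (ContinuousLinearMap.lsmul ℝ ℝ) volume y) 0
          ≤ |t| * N h := by
        refine dist_convolution_le (mul_nonneg (abs_nonneg _) (hNnn h))
          ρ.support_normed_eq.subset ρ.nonneg_normed ρ.integral_normed hk.aestronglyMeasurable
          fun x hx => ?_
        have hxB := hmem y hy' x hx
        have hxB' : x + t • h ∈ B := by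
          refine hmem (y + t • h) ht.1 _ ?_
          rw [Metric.mem_ball, dist_add_right]
          exact hx
        rw [dist_zero_right, Real.norm_eq_abs]
        simp only [k]
        rw [hgu _ hxB', hgu _ hxB, ← hNs]
        have := huN x (hBr hxB) (x + t • h) (hBr hxB')
        rwa [add_sub_cancel_left] at this
      rw [dist_zero_right, ← hconv] at h1
      rw [mul_comm]
      exact h1
    have hd : HasDerivAt (fun t : ℝ => v (y + t • h)) (fderiv ℝ v y h) 0 := by
      have h1 : HasFDerivAt v (fderiv ℝ v y) (y + (0 : ℝ) • h) := by
        rw [zero_smul, add_zero]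
        exact (hv.differentiable (by simp) y).hasFDerivAt
      have h2 : HasDerivAt (fun t : ℝ => y + t • h) h 0 := by
        simpa using ((hasDerivAt_id (0 : ℝ)).smul_const h).const_add y
      exact h1.comp_hasDerivAt 0 h2
    exact hd.le_of_lip' (hNnn h) hlip

/-! ### Gradient bounds expressed through the metric in charts. -/

section Slope

variable {n : ℕ} {S : Type*} [TopologicalSpace S] [ChartedSpace (Euc n) S]
  [RiemannianBundle (fun x : S => TangentSpace (𝓡 n) x)]

/-- The length of a vector with respect to the metric in the chart at `p`. -/
def chartNorm (p : S) (y h : Euc n) : ℝ := Real.sqrt (chartMetric p y h h)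

/-- The gradient of `ψ` at `x` has length at most `a`. -/
def HasSlopeLE (n : ℕ) [ChartedSpace (Euc n) S]
    [RiemannianBundle (fun x : S => TangentSpace (𝓡 n) x)] (ψ : S → ℝ) (x : S) (a : ℝ) : Prop :=
  ∀ h : Euc n, |fderiv ℝ (ψ ∘ (chartAt (Euc n) x).symm) (chartAt (Euc n) x x) h| ≤
    a * chartNorm x (chartAt (Euc n) x x) h

lemma chartNorm_nonneg (p : S) (y h : Euc n) : 0 ≤ chartNorm p y h := Real.sqrt_nonneg _

lemma HasSlopeLE.mono {ψ : S → ℝ} {x : S} {a b : ℝ} (h : HasSlopeLE n ψ x a) (hab : a ≤ b) :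
    HasSlopeLE n ψ x b := fun w =>
  (h w).trans (mul_le_mul_of_nonneg_right hab (chartNorm_nonneg _ _ _))

lemma chartNorm_smul (p : S) (y : Euc n) (t : ℝ) (h : Euc n) :
    chartNorm p y (t • h) = |t| * chartNorm p y h := by
  rw [chartNorm, map_smul, map_smul, smul_apply, smul_eq_mul, smul_eq_mul,
    ← mul_assoc, Real.sqrt_mul (mul_self_nonneg t), Real.sqrt_mul_self_eq_abs, chartNorm]

lemma continuous_chartNorm (p : S) (y : Euc n) : Continuous (chartNorm p y) := by
  refine Real.continuous_sqrt.comp ?_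
  exact (chartMetric p y).continuous.clm_apply continuous_id

variable [IsManifold (𝓡 n) ∞ S]

/-- The slope can be computed in any chart. -/
lemma hasSlopeLE_of_chart {ψ : S → ℝ} {p x : S} {a : ℝ} {v : Euc n → ℝ}
    (hx : x ∈ (chartAt (Euc n) p).source) (hv : DifferentiableAt ℝ v (chartAt (Euc n) p x))
    (hψ : ψ =ᶠ[𝓝 x] v ∘ chartAt (Euc n) p)
    (h : ∀ w, |fderiv ℝ v (chartAt (Euc n) p x) w| ≤ a * chartNorm p (chartAt (Euc n) p x) w) :
    HasSlopeLE n ψ x a := by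
  intro w
  have hxo : chartAt (Euc n) x x ∈ overlap (m := n) x p := mem_overlap (mem_chart_source _ x) hx
  have htr : transition x p (chartAt (Euc n) x x) = chartAt (Euc n) p x :=
    transition_chart (mem_chart_source _ x)
  have ht : Tendsto (chartAt (Euc n) x).symm (𝓝 (chartAt (Euc n) x x)) (𝓝 x) := by
    have := (chartAt (Euc n) x).continuousAt_symm (mem_chart_target (Euc n) x)
    rwa [ContinuousAt, (chartAt (Euc n) x).left_inv (mem_chart_source _ x)] at this
  have he : ψ ∘ (chartAt (Euc n) x).symm =ᶠ[𝓝 (chartAt (Euc n) x x)] v ∘ transition x p :=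
    ht.eventually hψ
  rw [← htr] at hv h
  rw [he.fderiv_eq, fderiv_comp _ hv (differentiableAt_transition hxo)]
  refine (h (fderiv ℝ (transition x p) (chartAt (Euc n) x x) w)).trans_eq ?_
  exact congrArg (fun z => a * Real.sqrt z) (chartMetric_transition hxo w w)

variable [IsContMDiffRiemannianBundle (𝓡 n) ∞ (Euc n) (fun x : S => TangentSpace (𝓡 n) x)]

/-- The metric in a chart is uniformly definite at each point. -/
lemma exists_norm_le_chartNorm (p : S) {y₀ : Euc n} (hy : y₀ ∈ (chartAt (Euc n) p).target) :
    ∃ c > 0, ∀ h, c * ‖h‖ ^ 2 ≤ chartMetric p y₀ h h := by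
  have hc : Continuous fun h => chartMetric p y₀ h h :=
    (chartMetric p y₀).continuous.clm_apply continuous_id
  rcases (Metric.sphere (0 : Euc n) 1).eq_empty_or_nonempty with he | hne
  · refine ⟨1, one_pos, fun h => ?_⟩
    have h0 : h = 0 := by
      by_contra hne
      have : (‖h‖⁻¹ • h) ∈ Metric.sphere (0 : Euc n) 1 := by
        rw [mem_sphere_zero_iff_norm, norm_smul, norm_inv, norm_norm,
          inv_mul_cancel₀ (norm_ne_zero_iff.2 hne)]
      rw [he] at this
      exact this
    simp [h0]
  · obtain ⟨h₀, hh₀, hmin⟩ := (isCompact_sphere (0 : Euc n) 1).exists_isMinOn hne hc.continuousOn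
    have hh₀' : ‖h₀‖ = 1 := mem_sphere_zero_iff_norm.1 hh₀
    refine ⟨chartMetric p y₀ h₀ h₀, chartMetric_pos p hy fun h0 => ?_, fun h => ?_⟩
    · rw [h0, norm_zero] at hh₀'; exact zero_ne_one hh₀'
    · rcases eq_or_ne h 0 with rfl | hne
      · simp
      have h1 : (‖h‖⁻¹ • h) ∈ Metric.sphere (0 : Euc n) 1 := by
        rw [mem_sphere_zero_iff_norm, norm_smul, norm_inv, norm_norm,
          inv_mul_cancel₀ (norm_ne_zero_iff.2 hne)]
      have h2 : chartMetric p y₀ h₀ h₀ ≤ chartMetric p y₀ (‖h‖⁻¹ • h) (‖h‖⁻¹ • h) := hmin h1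
      rw [map_smul, map_smul, smul_apply, smul_eq_mul, smul_eq_mul] at h2
      have h3 : 0 < ‖h‖ := norm_pos_iff.2 hne
      calc chartMetric p y₀ h₀ h₀ * ‖h‖ ^ 2
          ≤ (‖h‖⁻¹ * (‖h‖⁻¹ * chartMetric p y₀ h h)) * ‖h‖ ^ 2 := by gcongr
        _ = chartMetric p y₀ h h := by field_simp

/-- Nearby metrics are comparable. -/
lemma exists_chartNorm_comparable (p : S) {y₀ : Euc n} (hy : y₀ ∈ (chartAt (Euc n) p).target) :
    ∃ r > 0, Metric.ball y₀ r ⊆ (chartAt (Euc n) p).target ∧ ∀ y ∈ Metric.ball y₀ r, ∀ h,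
      chartNorm p y h ≤ 2 * chartNorm p y₀ h ∧ chartNorm p y₀ h ≤ 2 * chartNorm p y h := by
  obtain ⟨c, hc, hcy⟩ := exists_norm_le_chartNorm p hy
  have h1 : ∀ᶠ y in 𝓝 y₀, ‖chartMetric p y - chartMetric p y₀‖ < c / 2 := by
    have h2 : ContinuousAt (fun y => ‖chartMetric p y - chartMetric p y₀‖) y₀ :=
      ((contDiffAt_chartMetric p hy).continuousAt.sub continuousAt_const).norm
    refine h2.eventually (gt_mem_nhds ?_)
    show ‖chartMetric p y₀ - chartMetric p y₀‖ < c / 2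
    rw [sub_self, norm_zero]
    exact half_pos hc
  obtain ⟨r, hr, hsub⟩ := Metric.mem_nhds_iff.1
    (h1.and ((chartAt (Euc n) p).open_target.mem_nhds hy))
  refine ⟨r, hr, fun y hy => (hsub hy).2, fun y hyr h => ?_⟩
  have h3 : ‖chartMetric p y - chartMetric p y₀‖ < c / 2 := (hsub hyr).1
  -- The metrics differ by less than half the lower bound `c` of the metric at `y₀`, so the relative
  -- error is at most one half, well within the factor `4` allowed for squared lengths.
  have h4 : |chartMetric p y h h - chartMetric p y₀ h h| ≤ chartMetric p y₀ h h / 2 := by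
    have h5 := (chartMetric p y - chartMetric p y₀).le_opNorm₂ h h
    rw [sub_apply, sub_apply, Real.norm_eq_abs] at h5
    refine h5.trans ?_
    have h6 : ‖chartMetric p y - chartMetric p y₀‖ * ‖h‖ * ‖h‖ ≤ c / 2 * ‖h‖ * ‖h‖ := by gcongr
    nlinarith [hcy h]
  have h5 := abs_le.1 h4
  have h0 : 0 ≤ chartMetric p y₀ h h := (by positivity : 0 ≤ c * ‖h‖ ^ 2).trans (hcy h)
  have key : ∀ a b : ℝ, a ≤ 4 * b → Real.sqrt a ≤ 2 * Real.sqrt b := by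
    intro a b hab
    refine (Real.sqrt_le_sqrt hab).trans_eq ?_
    rw [show (4 : ℝ) = 2 ^ 2 by norm_num, Real.sqrt_mul (by positivity),
      Real.sqrt_sq (by norm_num)]
  exact ⟨key _ _ (by linarith), key _ _ (by linarith)⟩

/-- The slope of a smooth function is locally bounded. -/
lemma exists_hasSlopeLE_nhds {ψ : S → ℝ} (hψ : ContMDiff (𝓡 n) 𝓘(ℝ, ℝ) ∞ ψ) (p : S) :
    ∃ D, ∀ᶠ x in 𝓝 p, HasSlopeLE n ψ x D := by
  have hy := mem_chart_target (Euc n) p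
  obtain ⟨c, hc, hcy⟩ := exists_norm_le_chartNorm p hy
  obtain ⟨r, hr, hrt, hcmp⟩ := exists_chartNorm_comparable p hy
  let v := ψ ∘ (chartAt (Euc n) p).symm
  have hv := contDiffAt_comp_chart_symm hψ p hy
  let C := ‖fderiv ℝ v (chartAt (Euc n) p p)‖ + 1
  have h1 : ∀ᶠ y in 𝓝 (chartAt (Euc n) p p), ‖fderiv ℝ v y‖ < C :=
    (hv.fderiv_right (m := 0) (by simp)).continuousAt.norm.eventually
      (gt_mem_nhds (lt_add_one _))
  have hcont : ContinuousAt (chartAt (Euc n) p) p :=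
    (chartAt (Euc n) p).continuousAt (mem_chart_source _ p)
  have hsc : 0 < Real.sqrt c := Real.sqrt_pos.2 hc
  refine ⟨C * (2 / Real.sqrt c), ?_⟩
  filter_upwards [hcont.eventually (h1.and (Metric.ball_mem_nhds _ hr)),
    (chartAt (Euc n) p).open_source.mem_nhds (mem_chart_source _ p)] with x hx hxs
  refine hasSlopeLE_of_chart (v := v) hxs
    ((contDiffAt_comp_chart_symm hψ p ((chartAt (Euc n) p).map_source hxs)).differentiableAt
      (by simp)) ?_ fun w => ?_
  · filter_upwards [(chartAt (Euc n) p).open_source.mem_nhds hxs] with z hz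
    simp only [v, Function.comp, (chartAt (Euc n) p).left_inv hz]
  · have h2 : ‖fderiv ℝ v (chartAt (Euc n) p x) w‖ ≤ C * ‖w‖ :=
      ((fderiv ℝ v _).le_opNorm w).trans (mul_le_mul_of_nonneg_right hx.1.le (norm_nonneg _))
    have h3 : Real.sqrt c * ‖w‖ ≤ chartNorm p (chartAt (Euc n) p p) w := by
      have := Real.sqrt_le_sqrt (hcy w)
      rwa [Real.sqrt_mul hc.le, Real.sqrt_sq (norm_nonneg _)] at this
    have h4 : ‖w‖ ≤ 2 / Real.sqrt c * chartNorm p (chartAt (Euc n) p x) w := by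
      rw [div_mul_eq_mul_div, le_div_iff₀ hsc, mul_comm]
      exact h3.trans (hcmp _ hx.2 w).2
    rw [Real.norm_eq_abs] at h2
    refine h2.trans ?_
    rw [mul_assoc]
    exact mul_le_mul_of_nonneg_left h4 (by positivity)

/-- The slope of a smooth function is bounded on compact sets. -/
lemma exists_hasSlopeLE_of_isCompact {ψ : S → ℝ} (hψ : ContMDiff (𝓡 n) 𝓘(ℝ, ℝ) ∞ ψ) {K : Set S}
    (hK : IsCompact K) : ∃ D, 0 ≤ D ∧ ∀ x ∈ K, HasSlopeLE n ψ x D := by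
  refine hK.induction_on (p := fun K => ∃ D, 0 ≤ D ∧ ∀ x ∈ K, HasSlopeLE n ψ x D)
    ⟨0, le_rfl, fun x hx => hx.elim⟩ ?_ ?_ ?_
  · rintro s t hst ⟨D, h0, hD⟩
    exact ⟨D, h0, fun x hx => hD x (hst hx)⟩
  · rintro s t ⟨D, h0, hD⟩ ⟨D', -, hD'⟩
    refine ⟨max D D', le_max_of_le_left h0, ?_⟩
    rintro x (hx | hx)
    · exact (hD x hx).mono (le_max_left _ _)
    · exact (hD' x hx).mono (le_max_right _ _)
  · intro x _
    obtain ⟨D, hD⟩ := exists_hasSlopeLE_nhds hψ x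
    exact ⟨_, nhdsWithin_le_nhds hD, max D 0, le_max_right _ _,
      fun y hy => HasSlopeLE.mono hy (le_max_left _ _)⟩

end Slope

/-! ### Smooth approximation of Lipschitz functions on the manifold. -/

section SmoothApproximation

variable {n : ℕ} {S : Type*} [EMetricSpace S] [ChartedSpace (Euc n) S] [IsManifold (𝓡 n) ∞ S]
  [RiemannianBundle (fun x : S => TangentSpace (𝓡 n) x)]
  [IsContMDiffRiemannianBundle (𝓡 n) ∞ (Euc n) (fun x : S => TangentSpace (𝓡 n) x)]
  [IsRiemannianManifold (𝓡 n) S]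

lemma enorm_tangentSpace (x : S) (v : TangentSpace (𝓡 n) x) :
    ‖v‖ₑ = ENNReal.ofReal (Real.sqrt (metricTensor x v v)) := by
  rw [← ofReal_norm, norm_eq_sqrt_real_inner v]
  rfl

/-- The distance of nearby points is controlled by the metric of a chart at a fixed point. -/
lemma edist_chart_symm_le {p : S} {y₀ : Euc n} {r : ℝ}
    (hr : Metric.ball y₀ r ⊆ (chartAt (Euc n) p).target)
    (hN : ∀ y ∈ Metric.ball y₀ r, ∀ h, chartNorm p y h ≤ 2 * chartNorm p y₀ h)
    {a b : Euc n} (ha : a ∈ Metric.ball y₀ r) (hb : b ∈ Metric.ball y₀ r) :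
    edist ((chartAt (Euc n) p).symm a) ((chartAt (Euc n) p).symm b) ≤
      ENNReal.ofReal (2 * chartNorm p y₀ (b - a)) := by
  -- The straight segment in the chart is a competitor for the distance, and its speed is controlled
  -- by the metric at `y₀`.
  let η : ℝ → Euc n := fun t => a + t • (b - a)
  have hη : ∀ t ∈ Icc (0 : ℝ) 1, η t ∈ Metric.ball y₀ r := fun t ht => by
    have := (convex_ball y₀ r).add_smul_sub_mem ha hb ht
    exact this
  have hηs : ContDiff ℝ 1 η := by fun_prop
  have hηm : ContMDiff 𝓘(ℝ, ℝ) (𝓡 n) 1 η := hηs.contMDiff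
  have hsymm : ContMDiffOn (𝓡 n) (𝓡 n) 1 (chartAt (Euc n) p).symm (chartAt (Euc n) p).target :=
    (contMDiffOn_chart_symm (I := 𝓡 n) (n := ∞)).of_le (by simp)
  have hγ : ContMDiffOn 𝓘(ℝ, ℝ) (𝓡 n) 1 ((chartAt (Euc n) p).symm ∘ η) (Icc 0 1) :=
    hsymm.comp hηm.contMDiffOn fun t ht => hr (hη t ht)
  rw [IsRiemannianManifold.out (I := 𝓡 n)]
  refine (Manifold.riemannianEDist_le_pathELength hγ (by simp [η]) (by simp [η])
    zero_le_one).trans ?_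
  rw [Manifold.pathELength_eq_lintegral_mfderiv_Ioo]
  have hbound : ∀ t ∈ Ioo (0 : ℝ) 1,
      ‖(mfderiv 𝓘(ℝ, ℝ) (𝓡 n) ((chartAt (Euc n) p).symm ∘ η) t (1 : ℝ) :
        TangentSpace (𝓡 n) (((chartAt (Euc n) p).symm ∘ η) t))‖ₑ ≤
        ENNReal.ofReal (2 * chartNorm p y₀ (b - a)) := by
    intro t ht
    have hηt := hη t (Ioo_subset_Icc_self ht)
    have h1 : MDifferentiableAt (𝓡 n) (𝓡 n) (chartAt (Euc n) p).symm (η t) :=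
      mdifferentiableAt_atlas_symm (chart_mem_atlas _ _) (hr hηt)
    have h2 : HasMFDerivAt 𝓘(ℝ, ℝ) (𝓡 n) η t (ContinuousLinearMap.toSpanSingleton ℝ (b - a)) := by
      have h3 : HasDerivAt η (b - a) t := by
        have := ((hasDerivAt_id t).smul_const (b - a)).const_add a
        rwa [one_smul] at this
      exact h3.hasFDerivAt.hasMFDerivAt
    have h3 : mfderiv 𝓘(ℝ, ℝ) (𝓡 n) ((chartAt (Euc n) p).symm ∘ η) t (1 : ℝ) =
        chartFrame p (η t) (b - a) := by
      rw [(h1.hasMFDerivAt.comp t h2).mfderiv]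
      show chartFrame p (η t) ((1 : ℝ) • (b - a)) = _
      rw [one_smul]
    rw [enorm_tangentSpace, h3]
    refine ENNReal.ofReal_le_ofReal (le_trans (le_of_eq ?_) (hN _ hηt _))
    rw [chartNorm, chartMetric_apply]
    rfl
  refine (setLIntegral_mono' measurableSet_Ioo hbound).trans ?_
  simp

/-- Locally, a function of Lipschitz constant `1` is a limit of smooth functions of
slope at most `4`. -/
lemma exists_local_approx {d : S → ℝ} (hdc : Continuous d)
    (hd : ∀ x y, edist x y ≠ ⊤ → |d x - d y| ≤ (edist x y).toReal) (p : S) :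
    ∃ U : Set S, IsOpen U ∧ p ∈ U ∧ ∀ ε > 0, ∃ v : S → ℝ, ContMDiffOn (𝓡 n) 𝓘(ℝ, ℝ) ∞ v U ∧
      ∀ x ∈ U, |v x - d x| ≤ ε ∧ HasSlopeLE n v x 4 := by
  obtain ⟨r, hr, hrt, hcmp⟩ := exists_chartNorm_comparable p (mem_chart_target (Euc n) p)
  set y₀ := chartAt (Euc n) p p with hy₀
  -- One factor `2` compares distances with the metric at `y₀`; a second one returns from `y₀` to
  -- the metric at the moving point. Together they give the slope `4`.
  let N : Euc n → ℝ := fun h => 2 * chartNorm p y₀ h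
  have hN : Continuous N := continuous_const.mul (continuous_chartNorm p y₀)
  have hNs : ∀ (t : ℝ) h, N (t • h) = |t| * N h := fun t h => by
    simp only [N, chartNorm_smul]; ring
  let u := d ∘ (chartAt (Euc n) p).symm
  have hu : ContinuousOn u (Metric.ball y₀ r) :=
    hdc.comp_continuousOn ((chartAt (Euc n) p).continuousOn_symm.mono hrt)
  have huN : ∀ a ∈ Metric.ball y₀ r, ∀ b ∈ Metric.ball y₀ r, |u b - u a| ≤ N (b - a) := by
    intro a ha b hb
    have h1 := edist_chart_symm_le hrt (fun y hy h => (hcmp y hy h).1) ha hb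
    have h2 := hd _ _ (ne_top_of_le_ne_top ENNReal.ofReal_ne_top h1)
    rw [abs_sub_comm]
    refine h2.trans ((ENNReal.toReal_mono ENNReal.ofReal_ne_top h1).trans_eq ?_)
    exact ENNReal.toReal_ofReal (mul_nonneg zero_le_two (chartNorm_nonneg _ _ _))
  refine ⟨(chartAt (Euc n) p).source ∩ chartAt (Euc n) p ⁻¹' Metric.ball y₀ (r / 2),
    (chartAt (Euc n) p).isOpen_inter_preimage Metric.isOpen_ball,
    ⟨mem_chart_source _ p, Metric.mem_ball_self (half_pos hr)⟩, fun ε hε => ?_⟩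
  obtain ⟨v, hv, hvu⟩ := exists_contDiff_approx hr hN hNs hu huN hε
  refine ⟨v ∘ chartAt (Euc n) p, ?_, fun x hx => ⟨?_, ?_⟩⟩
  · exact hv.contMDiff.comp_contMDiffOn (contMDiffOn_chart.mono inter_subset_left)
  · have h1 := (hvu _ hx.2).1
    simp only [u, Function.comp, (chartAt (Euc n) p).left_inv hx.1] at h1
    exact h1
  · refine hasSlopeLE_of_chart hx.1 (hv.differentiable (by simp) _) (EventuallyEq.refl _ _)
      fun w => ?_
    have h1 := (hvu _ hx.2).2 w
    have h2 := (hcmp _ (Metric.ball_subset_ball (by linarith) hx.2) w).2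
    simp only [N] at h1
    linarith

lemma differentiableAt_comp_chart_symm {v : S → ℝ} {U : Set S} (hU : IsOpen U)
    (hv : ContMDiffOn (𝓡 n) 𝓘(ℝ, ℝ) ∞ v U) {x : S} (hx : x ∈ U) :
    DifferentiableAt ℝ (v ∘ (chartAt (Euc n) x).symm) (chartAt (Euc n) x x) := by
  have h1 : ContMDiffAt (𝓡 n) 𝓘(ℝ, ℝ) ∞ v
      ((chartAt (Euc n) x).symm (chartAt (Euc n) x x)) := by
    rw [(chartAt (Euc n) x).left_inv (mem_chart_source _ x)]
    exact hv.contMDiffAt (hU.mem_nhds hx)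
  have h2 : ContMDiffAt (𝓡 n) (𝓡 n) ∞ (chartAt (Euc n) x).symm (chartAt (Euc n) x x) :=
    contMDiffOn_chart_symm.contMDiffAt
      ((chartAt (Euc n) x).open_target.mem_nhds (mem_chart_target _ x))
  exact (contMDiffAt_iff_contDiffAt.1 (h1.comp _ h2)).differentiableAt (by simp)

/-- On a compact set, a function of Lipschitz constant `1` is close to a smooth function of
slope at most `5`. -/
theorem exists_smooth_approx [SecondCountableTopology S] {d : S → ℝ} (hdc : Continuous d)
    (hd : ∀ x y, edist x y ≠ ⊤ → |d x - d y| ≤ (edist x y).toReal) {K : Set S}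
    (hK : IsCompact K) :
    ∃ β : S → ℝ, ContMDiff (𝓡 n) 𝓘(ℝ, ℝ) ∞ β ∧
      ∀ x ∈ interior K, |β x - d x| ≤ 1 ∧ HasSlopeLE n β x 5 := by
  have hlc : LocallyCompactSpace S := ChartedSpace.locallyCompactSpace (Euc n) S
  choose U hUo hpU hU using exists_local_approx (n := n) hdc hd
  obtain ⟨t, ht⟩ := hK.elim_nhds_subcover U fun x _ => (hUo x).mem_nhds (hpU x)
  obtain ⟨ρ, hρ⟩ := SmoothPartitionOfUnity.exists_isSubordinate (𝓡 n) hK.isClosed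
    (fun i : t => U i) (fun i => hUo i) fun x hx => by
      obtain ⟨y, hy, hxy⟩ := mem_iUnion₂.1 (ht.2 hx)
      exact mem_iUnion.2 ⟨⟨y, hy⟩, hxy⟩
  choose D hD0 hD using fun i : t => exists_hasSlopeLE_of_isCompact (n := n) (ρ i).contMDiff hK
  -- When local approximations are glued, the derivatives of the partition functions, bounded by `D
  -- i`, are multiplied by the approximation error. With this `ε` they add at most `1` to the slope
  -- `4`.
  let ε : ℝ := 1 / (1 + ∑ i, D i)
  have hsum : 0 ≤ ∑ i, D i := Finset.sum_nonneg fun i _ => hD0 i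
  have hε : 0 < ε := by positivity
  have hε1 : ε ≤ 1 := by
    rw [div_le_one (by positivity)]
    linarith
  have hεD : ε * ∑ i, D i ≤ 1 := by
    rw [div_mul_eq_mul_div, one_mul, div_le_one (by positivity)]
    linarith
  choose v hv hvd using fun i : t => hU i ε hε
  refine ⟨fun x => ∑ i, ρ i x * v i x, ?_, fun x hx => ?_⟩
  · refine contMDiff_finsetSum fun i _ => ?_
    refine contMDiff_of_tsupport fun x hx => ?_
    have hx' : x ∈ U i := hρ i (tsupport_mul_subset_left hx)
    exact (ρ i).contMDiff.contMDiffAt.mul ((hv i).contMDiffAt ((hUo i).mem_nhds hx'))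
  have hsum1 : ∀ z ∈ K, ∑ i, ρ i z = 1 := fun z hz => by
    rw [← finsum_eq_sum_of_fintype]
    exact ρ.sum_eq_one hz
  have hxK := interior_subset hx
  have hρle : ∀ i, ρ i x * |v i x - d x| ≤ ρ i x * ε := fun i => by
    by_cases hxi : x ∈ U i
    · exact mul_le_mul_of_nonneg_left (hvd i x hxi).1 (ρ.nonneg i x)
    · have : ρ i x = 0 := image_eq_zero_of_notMem_tsupport fun h => hxi (hρ i h)
      simp [this]
  constructor
  · calc |∑ i, ρ i x * v i x - d x| = |∑ i, ρ i x * (v i x - d x)| := by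
          congr 1
          simp only [mul_sub, Finset.sum_sub_distrib]
          rw [← Finset.sum_mul, hsum1 x hxK, one_mul]
      _ ≤ ∑ i, |ρ i x * (v i x - d x)| := Finset.abs_sum_le_sum_abs _ _
      _ ≤ ∑ i, ρ i x * ε := Finset.sum_le_sum fun i _ => by
          rw [abs_mul, abs_of_nonneg (ρ.nonneg i x)]
          exact hρle i
      _ ≤ 1 := by rw [← Finset.sum_mul, hsum1 x hxK, one_mul]; exact hε1
  · intro h
    set e := (chartAt (Euc n) x).symm
    set y := chartAt (Euc n) x x
    set Nh := chartNorm x y h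
    have hNh : 0 ≤ Nh := chartNorm_nonneg _ _ _
    have hey : e y = x := (chartAt (Euc n) x).left_inv (mem_chart_source _ x)
    have he : Tendsto e (𝓝 y) (𝓝 x) := by
      have := (chartAt (Euc n) x).continuousAt_symm (mem_chart_target (Euc n) x)
      rwa [ContinuousAt, hey] at this
    have hρd : ∀ i, DifferentiableAt ℝ (fun z => ρ i (e z)) y := fun i =>
      differentiableAt_comp_chart_symm isOpen_univ (ρ i).contMDiff.contMDiffOn (mem_univ x)
    have hterm : ∀ i, DifferentiableAt ℝ (fun z => ρ i (e z) * (v i (e z) - d x)) y ∧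
        |fderiv ℝ (fun z => ρ i (e z) * (v i (e z) - d x)) y h| ≤
          (ρ i x * 4 + ε * D i) * Nh := by
      intro i
      by_cases hxi : x ∈ U i
      · have h1 : DifferentiableAt ℝ (fun z => v i (e z)) y :=
          differentiableAt_comp_chart_symm (hUo i) (hv i) hxi
        have h2 := (hρd i).hasFDerivAt.mul (h1.sub_const (d x)).hasFDerivAt
        refine ⟨h2.differentiableAt, ?_⟩
        have h3 : fderiv ℝ (fun z => ρ i (e z) * (v i (e z) - d x)) y h =
            ρ i x * fderiv ℝ (fun z => v i (e z)) y h +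
            (v i x - d x) * fderiv ℝ (fun z => ρ i (e z)) y h := by
          have h4 := congrArg (fun L => L h) h2.fderiv
          rw [fderiv_sub_const] at h4
          simp only [add_apply, smul_apply, smul_eq_mul, hey] at h4
          exact h4
        have h4 : |fderiv ℝ (fun z => v i (e z)) y h| ≤ 4 * Nh := (hvd i x hxi).2 h
        have h5 : |fderiv ℝ (fun z => ρ i (e z)) y h| ≤ D i * Nh := hD i x hxK h
        have h6 := (hvd i x hxi).1
        rw [h3]
        refine (abs_add_le _ _).trans ?_
        rw [abs_mul, abs_mul, abs_of_nonneg (ρ.nonneg i x), add_mul, mul_assoc, mul_assoc]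
        exact add_le_add (mul_le_mul_of_nonneg_left h4 (ρ.nonneg i x))
          (mul_le_mul h6 h5 (abs_nonneg _) hε.le)
      · have hz : ∀ᶠ z in 𝓝 x, ρ i z = 0 := by
          filter_upwards [(isClosed_tsupport (ρ i)).isOpen_compl.mem_nhds
            (fun h => hxi (hρ i h))] with z hz
          exact image_eq_zero_of_notMem_tsupport hz
        have h1 : (fun z => ρ i (e z) * (v i (e z) - d x)) =ᶠ[𝓝 y] fun _ => (0 : ℝ) := by
          filter_upwards [he.eventually hz] with z hz
          rw [hz, zero_mul]
        refine ⟨(h1.differentiableAt_iff).2 (differentiableAt_const _), ?_⟩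
        rw [h1.fderiv_eq]
        have := ρ.nonneg i x
        have := hD0 i
        simpa using (by positivity : 0 ≤ (ρ i x * 4 + ε * D i) * Nh)
    -- Subtracting the constant `d x` inside the sum makes the factors next to the derivatives of
    -- the `ρ i` small. It needs the `ρ i` to sum to `1` in a neighbourhood of `x`, hence the
    -- restriction to the interior of `K`.
    have hβ : ((fun x => ∑ i, ρ i x * v i x) ∘ e) =ᶠ[𝓝 y]
        fun z => (∑ i, ρ i (e z) * (v i (e z) - d x)) + d x := by
      filter_upwards [he.eventually (isOpen_interior.mem_nhds hx)] with z hz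
      have h1 := hsum1 (e z) (interior_subset hz)
      simp only [Function.comp, mul_sub, Finset.sum_sub_distrib]
      rw [← Finset.sum_mul, h1]
      ring
    rw [hβ.fderiv_eq, fderiv_add_const, fderiv_fun_sum fun i _ => (hterm i).1, sum_apply]
    refine (Finset.abs_sum_le_sum_abs _ _).trans
      ((Finset.sum_le_sum fun i _ => (hterm i).2).trans ?_)
    rw [← Finset.sum_mul, Finset.sum_add_distrib, ← Finset.sum_mul, hsum1 x hxK, ← Finset.mul_sum]
    exact mul_le_mul_of_nonneg_right (by linarith) hNh

end SmoothApproximation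

/-! ### Logarithmic cut-off functions -/

/-- A smooth decreasing step, equal to `1` on `(-∞, 1]` and to `0` on `[2, ∞)`. -/
def smoothStep (t : ℝ) : ℝ := Real.smoothTransition (2 - t)

lemma contDiff_smoothStep : ContDiff ℝ ∞ smoothStep :=
  Real.smoothTransition.contDiff.comp (contDiff_const.sub contDiff_id)

lemma smoothStep_of_le {t : ℝ} (ht : t ≤ 1) : smoothStep t = 1 :=
  Real.smoothTransition.one_of_one_le (by linarith)

lemma smoothStep_of_ge {t : ℝ} (ht : 2 ≤ t) : smoothStep t = 0 :=
  Real.smoothTransition.zero_of_nonpos (by linarith)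

lemma deriv_smoothStep_eq_zero {t : ℝ} (ht : t ∉ Icc (1 : ℝ) 2) : deriv smoothStep t = 0 := by
  rcases lt_or_ge t 1 with h | h
  · have : smoothStep =ᶠ[𝓝 t] fun _ => 1 := by
      filter_upwards [Iio_mem_nhds h] with s hs
      exact smoothStep_of_le (le_of_lt hs)
    rw [this.deriv_eq, deriv_const]
  · have h2 : 2 < t := by
      by_contra! h2
      exact ht ⟨h, h2⟩
    have : smoothStep =ᶠ[𝓝 t] fun _ => 0 := by
      filter_upwards [Ioi_mem_nhds h2] with s hs
      exact smoothStep_of_ge (le_of_lt hs)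
    rw [this.deriv_eq, deriv_const]

lemma exists_deriv_smoothStep_le : ∃ C, 0 ≤ C ∧ ∀ t, |deriv smoothStep t| ≤ C := by
  have hc : Continuous (deriv smoothStep) := contDiff_smoothStep.continuous_deriv (by simp)
  obtain ⟨C, hC⟩ := isCompact_Icc.exists_bound_of_continuousOn (s := Icc (1 : ℝ) 2) hc.continuousOn
  refine ⟨max C 0, le_max_right _ _, fun t => ?_⟩
  by_cases ht : t ∈ Icc (1 : ℝ) 2
  · exact (hC t ht).trans (le_max_left _ _)
  · rw [deriv_smoothStep_eq_zero ht, abs_zero]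
    exact le_max_right _ _

section Cutoff

variable {n : ℕ} {S : Type*} [EMetricSpace S] [ChartedSpace (Euc n) S] [IsManifold (𝓡 n) ∞ S]
  [RiemannianBundle (fun x : S => TangentSpace (𝓡 n) x)]
  [IsContMDiffRiemannianBundle (𝓡 n) ∞ (Euc n) (fun x : S => TangentSpace (𝓡 n) x)]
  [IsRiemannianManifold (𝓡 n) S]

/-- The chain rule for slopes. -/
lemma HasSlopeLE.comp_left {β : S → ℝ} (hβ : ContMDiff (𝓡 n) 𝓘(ℝ, ℝ) ∞ β) {x : S} {a c : ℝ}
    (h : HasSlopeLE n β x a) {Θ : ℝ → ℝ} {Θ' : ℝ} (hΘ : HasDerivAt Θ Θ' (β x)) (hc : |Θ'| * a ≤ c)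
    {ψ : S → ℝ} (hψ : ψ =ᶠ[𝓝 x] Θ ∘ β) : HasSlopeLE n ψ x c := by
  intro w
  set e := (chartAt (Euc n) x).symm
  set y := chartAt (Euc n) x x
  have hey : e y = x := (chartAt (Euc n) x).left_inv (mem_chart_source _ x)
  have he : Tendsto e (𝓝 y) (𝓝 x) := by
    have := (chartAt (Euc n) x).continuousAt_symm (mem_chart_target (Euc n) x)
    rwa [ContinuousAt, hey] at this
  have h1 : ψ ∘ e =ᶠ[𝓝 y] Θ ∘ (β ∘ e) := he.eventually hψ
  have h2 : DifferentiableAt ℝ (β ∘ e) y :=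
    differentiableAt_comp_chart_symm isOpen_univ hβ.contMDiffOn (mem_univ x)
  have h3 : HasDerivAt Θ Θ' ((β ∘ e) y) := by rwa [Function.comp, hey]
  have h4 := (h3.comp_hasFDerivAt y h2.hasFDerivAt).fderiv
  rw [h1.fderiv_eq, h4, smul_apply, smul_eq_mul, abs_mul]
  refine (mul_le_mul_of_nonneg_left (h w) (abs_nonneg _)).trans ?_
  rw [← mul_assoc]
  exact mul_le_mul_of_nonneg_right hc (chartNorm_nonneg _ _ _)

lemma abs_toReal_edist_sub_le {S : Type*} [EMetricSpace S] [ConnectedSpace S] (p x y : S) :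
    |(edist p x).toReal - (edist p y).toReal| ≤ (edist x y).toReal := by
  have h := edist_ne_top_of_connected (S := S)
  have key : ∀ a b : S, (edist p a).toReal ≤ (edist p b).toReal + (edist a b).toReal := by
    intro a b
    rw [← ENNReal.toReal_add (h _ _) (h _ _)]
    refine ENNReal.toReal_mono (ENNReal.add_ne_top.2 ⟨h _ _, h _ _⟩) ?_
    rw [edist_comm a b]
    exact edist_triangle _ _ _
  rw [abs_le]
  have h1 := key x y
  have h2 := key y x
  rw [edist_comm y x] at h2
  constructor <;> linarith

/-- Logarithmic cut-off functions on a complete Riemannian manifold. -/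
theorem exists_log_cutoff [CompleteSpace S] [ConnectedSpace S] [SecondCountableTopology S] (p : S) :
    ∃ A : ℝ, 0 ≤ A ∧ ∀ L : ℕ, 1 ≤ L → ∃ ψ : S → ℝ, ContMDiff (𝓡 n) 𝓘(ℝ, ℝ) ∞ ψ ∧
      HasCompactSupport ψ ∧ (∀ x, (edist p x).toReal ≤ Real.exp L - 3 → ψ x = 1) ∧
      ∀ x, HasSlopeLE n ψ x 0 ∨ ∃ k ∈ Finset.Icc L (2 * L),
        (edist p x).toReal < Real.exp (k + 1) ∧ HasSlopeLE n ψ x (A / (L * Real.exp k)) := by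
  obtain ⟨C, hC0, hC⟩ := exists_deriv_smoothStep_le
  refine ⟨C * 5, by positivity, fun L hL => ?_⟩
  have hL0 : (0 : ℝ) < L := by exact_mod_cast hL
  let d : S → ℝ := fun x => (edist p x).toReal
  have hfin := edist_ne_top_of_connected p
  have hdl : ∀ x y : S, |d x - d y| ≤ (edist x y).toReal := abs_toReal_edist_sub_le p
  have hdc : Continuous d := by
    rw [continuous_iff_continuousAt]
    intro x
    exact (ENNReal.tendsto_toReal (hfin x)).comp
      (continuous_const.edist continuous_id).continuousAt
  -- The approximation `β` is controlled where `d < R`. The cut-off already vanishes for `d ≥ exp (2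
  -- L) - 1`, so its extension by zero beyond `R` is smooth.
  let R : ℝ := Real.exp (2 * L) + 1
  have hR : 0 ≤ R := by positivity
  have hK : IsCompact {x : S | edist p x ≤ (R.toNNReal : ℝ≥0∞)} :=
    isCompact_closedEBall n p R.toNNReal
  have hdK : ∀ x, d x ≤ R → x ∈ {x : S | edist p x ≤ (R.toNNReal : ℝ≥0∞)} := fun x hx =>
    (ENNReal.le_ofReal_iff_toReal_le (hfin x) hR).2 hx
  obtain ⟨β, hβ, hβd⟩ := exists_smooth_approx (n := n) hdc (fun x y _ => hdl x y) hK
  have hRo : IsOpen {x | d x < R} := isOpen_lt hdc continuous_const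
  have hint : ∀ x, d x < R → x ∈ interior {x : S | edist p x ≤ (R.toNNReal : ℝ≥0∞)} := fun x hx =>
    interior_maximal (fun z hz => hdK z (le_of_lt hz)) hRo hx
  -- Since `β` is within `1` of `d ≥ 0`, the shift by `2` keeps the argument of the logarithm at
  -- least `1` and places it between `d + 1` and `d + 3`; the latter is the origin of the `3` in the
  -- radius where `ψ = 1`.
  let Θ : ℝ → ℝ := fun s => smoothStep (Real.log (s + 2) / L)
  let ψ : S → ℝ := {x | d x < R}.indicator (Θ ∘ β)
  have hd0 : ∀ x, 0 ≤ d x := fun x => ENNReal.toReal_nonneg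
  have hβ1 : ∀ x, d x < R → d x + 1 ≤ β x + 2 ∧ β x + 2 ≤ d x + 3 := fun x hx => by
    have := abs_le.1 (hβd x (hint x hx)).1
    constructor <;> linarith
  have hψin : ∀ x, d x < R → ψ =ᶠ[𝓝 x] Θ ∘ β := fun x hx => by
    filter_upwards [hRo.mem_nhds hx] with z hz
    exact indicator_of_mem (s := {x | d x < R}) hz _
  have hψ0 : ∀ x, Real.exp (2 * L) - 1 ≤ d x → ψ x = 0 := fun x hx => by
    by_cases hxR : d x < R
    · rw [(hψin x hxR).self_of_nhds]
      refine smoothStep_of_ge ?_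
      have h1 := (hβ1 x hxR).1
      rw [le_div_iff₀ hL0, Real.le_log_iff_exp_le (by linarith [hd0 x])]
      linarith
    · exact indicator_of_notMem (s := {x | d x < R}) hxR _
  have hψout : ∀ x, R ≤ d x → ψ =ᶠ[𝓝 x] fun _ => 0 := fun x hx => by
    have : {z | Real.exp (2 * L) - 1 < d z} ∈ 𝓝 x :=
      (isOpen_lt continuous_const hdc).mem_nhds (show _ < d x by simp only [R] at hx; linarith)
    filter_upwards [this] with z hz
    exact hψ0 z (le_of_lt hz)
  have hΘ : ∀ x, d x < R → ContDiffAt ℝ ∞ Θ (β x) := fun x hx => by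
    have h1 := (hβ1 x hx).1
    have h2 : β x + 2 ≠ 0 := by linarith [hd0 x]
    refine contDiff_smoothStep.contDiffAt.comp _ (ContDiffAt.div_const ?_ _)
    exact (Real.contDiffAt_log.2 h2).comp (β x) (contDiffAt_id.add contDiffAt_const)
  refine ⟨ψ, fun x => ?_, ?_, fun x hx => ?_, fun x => ?_⟩
  · rcases lt_or_ge (d x) R with hx | hx
    · exact ((hΘ x hx).contMDiffAt.comp x (hβ x)).congr_of_eventuallyEq (hψin x hx)
    · exact contMDiffAt_const.congr_of_eventuallyEq (hψout x hx)
  · refine HasCompactSupport.intro hK fun x hx =>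
      indicator_of_notMem (s := {x | d x < R}) (fun h => hx ?_) _
    exact hdK x (le_of_lt h)
  · have hx' : d x ≤ Real.exp L - 3 := hx
    have hle : Real.exp L ≤ Real.exp (2 * L) := Real.exp_le_exp.2 (by linarith)
    have hxR : d x < R := by simp only [R]; linarith
    rw [(hψin x hxR).self_of_nhds]
    refine smoothStep_of_le ?_
    have h1 := hβ1 x hxR
    rw [div_le_one hL0, Real.log_le_iff_le_exp (by linarith [hd0 x])]
    linarith
  · rcases lt_or_ge (d x) R with hx | hx
    · set s := β x + 2 with hs
      have h1 := hβ1 x hx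
      have hs0 : 0 < s := by linarith [hd0 x]
      have hder : HasDerivAt Θ (deriv smoothStep (Real.log s / L) * (1 / s / L)) (β x) := by
        have h2 : HasDerivAt (fun r : ℝ => Real.log (r + 2) / L) (1 / s / L) (β x) :=
          (((hasDerivAt_id (β x)).add_const 2).log hs0.ne').div_const _
        exact (contDiff_smoothStep.differentiable (by simp) _).hasDerivAt.comp (β x) h2
      have hsl : HasSlopeLE n β x 5 := (hβd x (hint x hx)).2
      by_cases hlog : Real.log s / L ∈ Icc (1 : ℝ) 2
      · right
        have hl1 : (L : ℝ) ≤ Real.log s := by simpa using (le_div_iff₀ hL0).1 hlog.1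
        have hl2 : Real.log s ≤ 2 * L := (div_le_iff₀ hL0).1 hlog.2
        have hl0 : 0 ≤ Real.log s := hL0.le.trans hl1
        have hk1 := Nat.floor_le hl0
        have hk2 := Nat.lt_floor_add_one (Real.log s)
        -- The shell index `k` is the integer part of `log s`. Then `d < s < exp (k + 1)`, while
        -- `exp k ≤ s` bounds the derivative `1 / (L s)` of the logarithm.
        refine ⟨⌊Real.log s⌋₊, Finset.mem_Icc.2 ⟨Nat.le_floor hl1, ?_⟩, ?_, ?_⟩
        · exact_mod_cast hk1.trans hl2
        · have := (Real.log_lt_iff_lt_exp hs0).1 hk2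
          show d x < _
          linarith
        · refine hsl.comp_left hβ hder ?_ (hψin x hx)
          have h3 := (Real.le_log_iff_exp_le hs0).1 hk1
          have h4 : 1 / s / L ≤ 1 / (L * Real.exp ⌊Real.log s⌋₊) := by
            rw [div_div, mul_comm]
            exact one_div_le_one_div_of_le (by positivity) (by gcongr)
          rw [abs_mul, abs_of_pos (by positivity : 0 < 1 / s / (L : ℝ))]
          calc |deriv smoothStep (Real.log s / L)| * (1 / s / L) * 5
              ≤ C * (1 / (L * Real.exp ⌊Real.log s⌋₊)) * 5 := by
                gcongr
                exact hC _
            _ = _ := by ring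
      · left
        refine hsl.comp_left hβ hder ?_ (hψin x hx)
        rw [deriv_smoothStep_eq_zero hlog]
        simp
    · left
      intro w
      have he : Tendsto (chartAt (Euc n) x).symm (𝓝 (chartAt (Euc n) x x)) (𝓝 x) := by
        have := (chartAt (Euc n) x).continuousAt_symm (mem_chart_target (Euc n) x)
        rwa [ContinuousAt, (chartAt (Euc n) x).left_inv (mem_chart_source _ x)] at this
      have h1 : ψ ∘ (chartAt (Euc n) x).symm =ᶠ[𝓝 (chartAt (Euc n) x x)] fun _ => (0 : ℝ) :=
        he.eventually (hψout x hx)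
      rw [h1.fderiv_eq]
      simp

end Cutoff

/-! ### The energy density of a function of bounded slope. -/

section GradientBound

variable {n : ℕ} {S : Type*} [TopologicalSpace S] [T2Space S] [SecondCountableTopology S]
  [MeasurableSpace S] [BorelSpace S] [ChartedSpace (Euc n) S] [IsManifold (𝓡 n) ∞ S]
  [RiemannianBundle (fun x : S => TangentSpace (𝓡 n) x)]
  [IsContMDiffRiemannianBundle (𝓡 n) ∞ (Euc n) (fun x : S => TangentSpace (𝓡 n) x)]
  {M : Type*} [TopologicalSpace M] [ChartedSpace (Euc (n + 1)) M] [IsManifold (𝓡 (n + 1)) ∞ M]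
  [RiemannianBundle (fun x : M => TangentSpace (𝓡 (n + 1)) x)]
  [IsContMDiffRiemannianBundle (𝓡 (n + 1)) ∞ (Euc (n + 1))
    (fun x : M => TangentSpace (𝓡 (n + 1)) x)]

/-- The squared gradient is the inverse metric applied to the differential, that is, the square of
its dual norm, and a slope bound is a bound of this dual norm. -/
lemma gradSq_le {φ : S → M} (hφ : IsIsometricImmersion (n := n) (m := n + 1) φ) {ψ : S → ℝ} {x : S}
    {a : ℝ} (h : HasSlopeLE n ψ x a) : gradSq n φ ψ x ≤ a ^ 2 := by
  have hpd := metricCoeff_posDef x (mem_chart_target (Euc n) x)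
  rw [gradSq, inducedMatrix_eq hφ]
  refine dual_form_le hpd fun w => ?_
  rw [metricCoeff_sum]
  have h1 : ∑ i, fderiv ℝ (ψ ∘ (chartAt (Euc n) x).symm) (chartAt (Euc n) x x)
      (EuclideanSpace.single i (1 : ℝ)) * w i =
      fderiv ℝ (ψ ∘ (chartAt (Euc n) x).symm) (chartAt (Euc n) x x) (WithLp.toLp 2 w) := by
    conv_rhs => rw [euc_sum (WithLp.toLp 2 w)]
    rw [map_sum]
    refine Finset.sum_congr rfl fun i _ => ?_
    rw [map_smul, smul_eq_mul, mul_comm]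
  have hnn : 0 ≤ chartMetric x (chartAt (Euc n) x x) (WithLp.toLp 2 w) (WithLp.toLp 2 w) := by
    rcases eq_or_ne (WithLp.toLp 2 w : Euc n) 0 with h0 | h0
    · rw [h0]; simp
    · exact (chartMetric_pos x (mem_chart_target _ x) h0).le
  have h2 := pow_le_pow_left₀ (abs_nonneg _) (h (WithLp.toLp 2 w)) 2
  rw [sq_abs, mul_pow, chartNorm, Real.sq_sqrt hnn] at h2
  rw [h1]
  exact h2

end GradientBound

/-! ### Vanishing of the stability potential -/

section Vanishing

variable {n : ℕ} {M : Type*} [TopologicalSpace M] [ChartedSpace (Euc (n + 1)) M]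
  [IsManifold (𝓡 (n + 1)) ∞ M] [RiemannianBundle (fun x : M => TangentSpace (𝓡 (n + 1)) x)]
  [IsContMDiffRiemannianBundle (𝓡 (n + 1)) ∞ (Euc (n + 1))
    (fun x : M => TangentSpace (𝓡 (n + 1)) x)]

lemma covHessian_symm {S : Type*} [TopologicalSpace S] [ChartedSpace (Euc n) S]
    [IsManifold (𝓡 n) ∞ S] {φ : S → M} (hφ : ContMDiff (𝓡 n) (𝓡 (n + 1)) ∞ φ) (x : S)
    (i j : Fin n) : covHessian (m := n + 1) φ x i j = covHessian φ x j i := by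
  have hu : ContDiffAt ℝ ∞ (localMap (n := n) (m := n + 1) x (φ x) φ) (chartAt (Euc n) x x) :=
    contDiffAt_localMap (mem_chart_target _ x) (hφ _) (by
      rw [(chartAt (Euc n) x).left_inv (mem_chart_source _ x)]
      exact mem_chart_source _ _)
  have hd : DifferentiableAt ℝ (fderiv ℝ (localMap (n := n) (m := n + 1) x (φ x) φ))
      (chartAt (Euc n) x x) := (hu.fderiv_right (m := ∞) (by simp)).differentiableAt (by simp)
  have hs := (hu.isSymmSndFDerivAt (by simpa using ENat.LEInfty.out)).eq
    (EuclideanSpace.single i (1 : ℝ)) (EuclideanSpace.single j (1 : ℝ))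
  have h1 : ∀ a b : Euc n, fderiv ℝ (fun y => fderiv ℝ (localMap (n := n) (m := n + 1) x (φ x) φ)
      y a) (chartAt (Euc n) x x) b = fderiv ℝ (fderiv ℝ (localMap (n := n) (m := n + 1) x (φ x) φ))
        (chartAt (Euc n) x x) b a := fun a b => by
    rw [fderiv_clm_eval hd (differentiableAt_const a), fderiv_const_eval, map_zero, add_zero]
  rw [covHessian, covHessian, h1, h1, hs, chartGamma_symm]

/-- Where the stability potential vanishes, so do its two summands. -/
lemma eq_zero_of_stabilityPotential_eq_zero {S : Type*} [TopologicalSpace S] [T2Space S]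
    [SecondCountableTopology S] [MeasurableSpace S] [BorelSpace S] [ChartedSpace (Euc n) S]
    [IsManifold (𝓡 n) ∞ S] [RiemannianBundle (fun x : S => TangentSpace (𝓡 n) x)]
    [IsContMDiffRiemannianBundle (𝓡 n) ∞ (Euc n) (fun x : S => TangentSpace (𝓡 n) x)]
    {f : M → ℝ} {φ : S → M} (hφ : IsIsometricImmersion (n := n) (m := n + 1) φ)
    {ν : S → Euc (n + 1)} {x : S} (hRic : 0 ≤ bakryEmeryRicci (m := n + 1) f (φ x) (ν x) (ν x)) :
    0 ≤ stabilityPotential n f φ ν x ∧ (stabilityPotential n f φ ν x = 0 →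
      shapeMatrix n φ ν x = 0 ∧ bakryEmeryRicci (m := n + 1) f (φ x) (ν x) (ν x) = 0) := by
  have hpd : (inducedMatrix n φ x).PosDef := by
    rw [inducedMatrix_eq hφ]
    exact metricCoeff_posDef x (mem_chart_target (Euc n) x)
  have hsymm : (shapeMatrix n φ ν x).transpose = shapeMatrix n φ ν x := by
    ext i j
    simp only [shapeMatrix, Matrix.transpose_apply, Matrix.of_apply]
    rw [covHessian_symm hφ.smooth]
  obtain ⟨h1, h2⟩ := trace_conj_square_nonneg hpd hsymm
  refine ⟨add_nonneg h1 hRic, fun h => ?_⟩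
  have h3 := (add_eq_zero_iff_of_nonneg h1 hRic).1 h
  exact ⟨h2 h3.1, h3.2⟩

variable {S : Type*} [EMetricSpace S] [ChartedSpace (Euc n) S] [IsManifold (𝓡 n) ∞ S]
  [RiemannianBundle (fun x : S => TangentSpace (𝓡 n) x)]
  [IsContMDiffRiemannianBundle (𝓡 n) ∞ (Euc n) (fun x : S => TangentSpace (𝓡 n) x)]
  [IsRiemannianManifold (𝓡 n) S] [CompleteSpace S] [SecondCountableTopology S] [ConnectedSpace S]
  [MeasurableSpace S] [BorelSpace S]

/-- Passage from the extended nonnegative integral of the volume bound to a real integral. The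
maximum with `0` appears because `ENNReal.ofReal` truncates negative numbers. -/
lemma integrableOn_of_weightedVolume_le {f : M → ℝ} (hf : Continuous f) {φ : S → M}
    (hφ : Continuous φ) {B : Set S} {V : ℝ}
    (h : weightedVolume (n := n) f φ B ≤ ENNReal.ofReal V) :
    IntegrableOn (fun x => Real.exp (-f (φ x))) B (tensorVolume (metricTensor (m := n))) ∧
      ∫ x in B, Real.exp (-f (φ x)) ∂(tensorVolume (metricTensor (m := n))) ≤ max V 0 := by
  have hw : Continuous fun x => Real.exp (-f (φ x)) := (hf.comp hφ).neg.rexp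
  have hnn : 0 ≤ᵐ[(tensorVolume (metricTensor (m := n))).restrict B]
    fun x => Real.exp (-f (φ x)) := Eventually.of_forall fun x => (Real.exp_pos _).le
  have hm : AEStronglyMeasurable (fun x => Real.exp (-f (φ x)))
    ((tensorVolume (metricTensor (m := n))).restrict B) := hw.aestronglyMeasurable
  refine ⟨(lintegral_ofReal_ne_top_iff_integrable hm hnn).1
    (ne_top_of_le_ne_top ENNReal.ofReal_ne_top h), ?_⟩
  rw [integral_eq_lintegral_of_nonneg_ae hnn hm]
  refine (ENNReal.toReal_mono ENNReal.ofReal_ne_top h).trans_eq ?_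
  exact ENNReal.toReal_ofReal'

/-- Quadratic weighted volume growth yields cut-off functions of small energy. -/
theorem exists_cutoff_energy_le {f : M → ℝ} (hf : Continuous f) {φ : S → M}
    (hφ : IsIsometricImmersion (n := n) (m := n + 1) φ)
    (hgrad : ∀ ψ : S → ℝ, ContMDiff (𝓡 n) 𝓘(ℝ, ℝ) ∞ ψ → HasCompactSupport ψ →
      Continuous (fun x => Real.exp (-f (φ x)) * gradSq n φ ψ x))
    {p : S} {C r₀ : ℝ}
    (hvol : ∀ r : ℝ, r₀ ≤ r →
      weightedVolume (n := n) f φ {x : S | edist x p < ENNReal.ofReal r}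
        ≤ ENNReal.ofReal (C * r ^ 2)) :
    ∃ D : ℝ, ∀ L : ℕ, 1 ≤ L → r₀ ≤ Real.exp L → ∃ ψ : S → ℝ,
      ContMDiff (𝓡 n) 𝓘(ℝ, ℝ) ∞ ψ ∧ HasCompactSupport ψ ∧
      (∀ x, (edist p x).toReal ≤ Real.exp L - 3 → ψ x = 1) ∧
      ∫ x in tsupport ψ, Real.exp (-f (φ x)) * gradSq n φ ψ x
        ∂(tensorVolume (metricTensor (m := n))) ≤ D / L := by
  obtain ⟨A, hA, hcut⟩ := exists_log_cutoff (n := n) p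
  have hlf : IsLocallyFiniteMeasure (tensorVolume (metricTensor (m := n) (M := S))) :=
    tensorVolume_metric_isLocallyFinite
  set μ := tensorVolume (metricTensor (m := n) (M := S)) with hμ
  -- The shell of index `k` contributes at most `(A / (L exp k))² |C| exp (k + 1)² = A² |C| exp 2 /
  -- L²`, and there are `L + 1 ≤ 2 L` shells.
  refine ⟨2 * (A ^ 2 * (|C| * Real.exp 2)), fun L hL hr => ?_⟩
  have hL0 : (0 : ℝ) < L := by exact_mod_cast hL
  obtain ⟨ψ, hψ, hc, hψ1, hslope⟩ := hcut L hL
  refine ⟨ψ, hψ, hc, hψ1, ?_⟩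
  let w : S → ℝ := fun x => Real.exp (-f (φ x))
  have hw0 : ∀ x, 0 ≤ w x := fun x => (Real.exp_pos _).le
  let B : ℕ → Set S := fun k => {x | edist x p < ENNReal.ofReal (Real.exp (k + 1))}
  have hBm : ∀ k, MeasurableSet (B k) := fun k =>
    (isOpen_lt (continuous_id.edist continuous_const) continuous_const).measurableSet
  have hB : ∀ k ∈ Finset.Icc L (2 * L), IntegrableOn w (B k) μ ∧
      ∫ x in B k, w x ∂μ ≤ |C| * Real.exp (k + 1) ^ 2 := fun k hk => by
    have hk1 : (L : ℝ) ≤ k + 1 := by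
      have : (L : ℝ) ≤ k := by exact_mod_cast (Finset.mem_Icc.1 hk).1
      linarith
    obtain ⟨h1, h2⟩ := integrableOn_of_weightedVolume_le hf hφ.smooth.continuous
      (hvol (Real.exp (k + 1)) (hr.trans (Real.exp_le_exp.2 hk1)))
    refine ⟨h1, h2.trans (max_le ?_ (by positivity))⟩
    exact mul_le_mul_of_nonneg_right (le_abs_self C) (by positivity)
  let c : ℕ → ℝ := fun k => (A / (L * Real.exp k)) ^ 2
  have hint : ∀ k ∈ Finset.Icc L (2 * L), Integrable (fun x => c k * (B k).indicator w x) μ :=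
    fun k hk => ((integrable_indicator_iff (hBm k)).2 (hB k hk).1).const_mul _
  have hterm0 : ∀ k x, 0 ≤ c k * (B k).indicator w x := fun k x =>
    mul_nonneg (sq_nonneg _) (indicator_nonneg (fun y _ => hw0 y) x)
  -- Each point is charged to one shell that bounds its gradient. The shells are enlarged to full
  -- balls, where the volume hypothesis applies; the geometric growth of the balls makes this loss
  -- harmless.
  have hpt : ∀ x, w x * gradSq n φ ψ x ≤
      ∑ k ∈ Finset.Icc L (2 * L), c k * (B k).indicator w x := by
    intro x
    rcases hslope x with h | ⟨k, hk, hkx, h⟩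
    · have h1 := gradSq_le hφ h
      refine le_trans ?_ (Finset.sum_nonneg fun k _ => hterm0 k x)
      exact mul_nonpos_of_nonneg_of_nonpos (hw0 x) (by simpa using h1)
    · have hxB : x ∈ B k := by
        show edist x p < _
        rw [edist_comm]
        exact (ENNReal.lt_ofReal_iff_toReal_lt (edist_ne_top_of_connected p x)).2 hkx
      refine le_trans ?_ (Finset.single_le_sum (fun k _ => hterm0 k x) hk)
      rw [indicator_of_mem hxB, mul_comm]
      exact mul_le_mul_of_nonneg_right (gradSq_le hφ h) (hw0 x)
  have hsum := integrable_finsetSum (Finset.Icc L (2 * L)) hint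
  calc ∫ x in tsupport ψ, w x * gradSq n φ ψ x ∂μ
      ≤ ∫ x in tsupport ψ, ∑ k ∈ Finset.Icc L (2 * L), c k * (B k).indicator w x ∂μ :=
        setIntegral_mono ((hgrad ψ hψ hc).continuousOn.integrableOn_compact hc.isCompact)
          hsum.integrableOn hpt
    _ ≤ ∫ x, ∑ k ∈ Finset.Icc L (2 * L), c k * (B k).indicator w x ∂μ :=
        setIntegral_le_integral hsum
          (Eventually.of_forall fun x => Finset.sum_nonneg fun k _ => hterm0 k x)
    _ = ∑ k ∈ Finset.Icc L (2 * L), c k * ∫ x in B k, w x ∂μ := by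
        rw [integral_finsetSum _ hint]
        refine Finset.sum_congr rfl fun k _ => ?_
        rw [integral_const_mul, integral_indicator (hBm k)]
    _ ≤ ∑ k ∈ Finset.Icc L (2 * L), A ^ 2 * (|C| * Real.exp 2) / (L : ℝ) ^ 2 := by
        refine Finset.sum_le_sum fun k hk => ?_
        refine (mul_le_mul_of_nonneg_left (hB k hk).2 (sq_nonneg _)).trans_eq ?_
        have h1 : Real.exp ((k : ℝ) + 1) ^ 2 = Real.exp k ^ 2 * Real.exp 2 := by
          rw [Real.exp_add, mul_pow, ← Real.exp_nat_mul 1]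
          norm_num
        have h2 := Real.exp_pos (k : ℝ)
        rw [h1]
        field_simp
    _ = (L + 1) * (A ^ 2 * (|C| * Real.exp 2)) / (L : ℝ) ^ 2 := by
        rw [Finset.sum_const, Nat.card_Icc, nsmul_eq_mul,
          show 2 * L + 1 - L = L + 1 by omega]
        push_cast
        ring
    _ ≤ 2 * (A ^ 2 * (|C| * Real.exp 2)) / L := by
        rw [div_le_div_iff₀ (by positivity) hL0]
        have h1 : (1 : ℝ) ≤ L := by exact_mod_cast hL
        have h2 : 0 ≤ A ^ 2 * (|C| * Real.exp 2) := by positivity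
        have h3 : ((L : ℝ) + 1) * L ≤ 2 * (L : ℝ) ^ 2 := by nlinarith
        calc (L + 1) * (A ^ 2 * (|C| * Real.exp 2)) * L
            = (A ^ 2 * (|C| * Real.exp 2)) * ((L + 1) * L) := by ring
          _ ≤ (A ^ 2 * (|C| * Real.exp 2)) * (2 * (L : ℝ) ^ 2) :=
              mul_le_mul_of_nonneg_left h3 h2
          _ = _ := by ring

/-- The stability potential of a stable hypersurface of quadratic weighted volume growth
vanishes. -/
theorem stabilityPotential_eq_zero {f : M → ℝ} (hf : ContMDiff (𝓡 (n + 1)) 𝓘(ℝ, ℝ) ∞ f) {φ : S → M}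
    (hφ : IsIsometricImmersion (n := n) (m := n + 1) φ)
    (hstable : IsStableFMinimal (n := n) (m := n + 1) f φ) {ν : S → Euc (n + 1)}
    (hν : ∀ x, IsUnitNormal n φ x (ν x)) (hνs : IsSmoothField n (n + 1) φ ν)
    (hQ0 : ∀ x, 0 ≤ stabilityPotential n f φ ν x) {p : S} {C r₀ : ℝ}
    (hvol : ∀ r : ℝ, r₀ ≤ r →
      weightedVolume (n := n) f φ {x : S | edist x p < ENNReal.ofReal r}
        ≤ ENNReal.ofReal (C * r ^ 2)) (x₀ : S) :
    stabilityPotential n f φ ν x₀ = 0 := by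
  have hlf : IsLocallyFiniteMeasure (tensorVolume (metricTensor (m := n) (M := S))) :=
    tensorVolume_metric_isLocallyFinite
  have hop : (tensorVolume (metricTensor (m := n) (M := S))).IsOpenPosMeasure :=
    tensorVolume_metric_isOpenPos
  have hlc : LocallyCompactSpace S := ChartedSpace.locallyCompactSpace (Euc n) S
  set μ := tensorVolume (metricTensor (m := n) (M := S)) with hμ
  obtain ⟨hwQ, hineq⟩ := stability_inequality hf hφ hstable hν hνs
  let q : S → ℝ := fun x => Real.exp (-f (φ x)) * stabilityPotential n f φ ν x
  have hq0 : ∀ x, 0 ≤ q x := fun x => mul_nonneg (Real.exp_pos _).le (hQ0 x)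
  have hq : Continuous q := hwQ
  by_contra hne
  have hqx : q x₀ ≠ 0 := mul_ne_zero (Real.exp_pos _).ne' hne
  obtain ⟨b⟩ := (inferInstance : Nonempty (SmoothBumpFunction (𝓡 n) x₀))
  have hbq : Continuous fun x => b x * q x := b.contMDiff.continuous.mul hq
  have hbc : HasCompactSupport fun x => b x * q x := b.hasCompactSupport.mul_right
  have hpos : 0 < ∫ x, b x * q x ∂μ := by
    -- A nonzero value of the potential at `x₀` gives a fixed positive integral, against which the
    -- energies `D / L` are compared.
    refine Continuous.integral_pos_of_hasCompactSupport_nonneg_nonzero (x := x₀) hbq hbc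
      (fun x => mul_nonneg b.nonneg (hq0 x)) ?_
    show b x₀ * q x₀ ≠ 0
    rw [b.eq_one, one_mul]
    exact hqx
  have hfin := edist_ne_top_of_connected p
  have hdc : Continuous fun x => (edist p x).toReal := by
    rw [continuous_iff_continuousAt]
    intro x
    exact (ENNReal.tendsto_toReal (hfin x)).comp
      (continuous_const.edist continuous_id).continuousAt
  obtain ⟨ρ, hρ⟩ := b.hasCompactSupport.isCompact.bddAbove_image hdc.continuousOn
  obtain ⟨D, hD⟩ := exists_cutoff_energy_le hf.continuous hφ (fun ψ hψ hc => (hineq ψ hψ hc).1) hvol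
  have hbound : ∀ L : ℕ, 1 ≤ L → r₀ ≤ Real.exp L → ρ ≤ Real.exp L - 3 →
      ∫ x, b x * q x ∂μ ≤ D / L := by
    intro L hL hr hρL
    obtain ⟨ψ, hψ, hc, hψ1, hE⟩ := hD L hL hr
    obtain ⟨h1, h2⟩ := hineq ψ hψ hc
    have hψq : Continuous fun x => ψ x ^ 2 * q x := (hψ.continuous.pow 2).mul hq
    have hψqc : HasCompactSupport fun x => ψ x ^ 2 * q x := by
      refine HasCompactSupport.mul_right (f := fun x => ψ x ^ 2) ?_
      exact hc.comp_left (g := fun t : ℝ => t ^ 2) (by simp)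
    have h3 : ∫ x in tsupport ψ, Real.exp (-f (φ x)) *
          (gradSq n φ ψ x - ψ x ^ 2 * stabilityPotential n f φ ν x) ∂μ =
        ∫ x in tsupport ψ, Real.exp (-f (φ x)) * gradSq n φ ψ x ∂μ - ∫ x, ψ x ^ 2 * q x ∂μ := by
      rw [← setIntegral_eq_integral_of_forall_compl_eq_zero (s := tsupport ψ)
        (f := fun x => ψ x ^ 2 * q x), ← integral_sub]
      · refine integral_congr_ae (Eventually.of_forall fun x => ?_)
        simp only [q]
        ring
      · exact h1.continuousOn.integrableOn_compact hc.isCompact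
      · exact hψq.continuousOn.integrableOn_compact hc.isCompact
      · intro x hx
        rw [image_eq_zero_of_notMem_tsupport hx]
        ring
    -- For large `L` the cut-off is `1` on the support of the bump function, so its square dominates
    -- the bump.
    have h4 : ∫ x, b x * q x ∂μ ≤ ∫ x, ψ x ^ 2 * q x ∂μ := by
      refine integral_mono (hbq.integrable_of_hasCompactSupport hbc)
        (hψq.integrable_of_hasCompactSupport hψqc) fun x => ?_
      refine mul_le_mul_of_nonneg_right ?_ (hq0 x)
      by_cases hx : x ∈ tsupport b
      · rw [hψ1 x ((hρ (mem_image_of_mem _ hx)).trans hρL), one_pow]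
        exact b.le_one
      · rw [image_eq_zero_of_notMem_tsupport hx]
        positivity
    rw [h3] at h2
    linarith
  obtain ⟨L, hL⟩ := exists_nat_gt (max (max 1 r₀) (max (ρ + 3) (D / ∫ x, b x * q x ∂μ)))
  have hL1 : (1 : ℝ) < L := (le_max_left _ _).trans_lt ((le_max_left _ _).trans_lt hL)
  have hL2 : r₀ < L := (le_max_right _ _).trans_lt ((le_max_left _ _).trans_lt hL)
  have hL3 : ρ + 3 < L := (le_max_left _ _).trans_lt ((le_max_right _ _).trans_lt hL)
  have hL4 : D / ∫ x, b x * q x ∂μ < L := (le_max_right _ _).trans_lt ((le_max_right _ _).trans_lt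
      hL)
  have hexp : (L : ℝ) ≤ Real.exp L := by linarith [Real.add_one_le_exp (L : ℝ)]
  have h1 := hbound L (by exact_mod_cast hL1.le) (by linarith) (by linarith)
  rw [le_div_iff₀ (by linarith)] at h1
  rw [div_lt_iff₀ hpos] at hL4
  linarith

end Vanishing

/-! ### Arbitrary normal vectors as multiples of the chosen unit normal. -/

section NormalVectors

variable {n : ℕ} {M : Type*} [TopologicalSpace M] [ChartedSpace (Euc (n + 1)) M]
  [IsManifold (𝓡 (n + 1)) ∞ M] [RiemannianBundle (fun x : M => TangentSpace (𝓡 (n + 1)) x)]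
  {S : Type*} [TopologicalSpace S] [ChartedSpace (Euc n) S] [IsManifold (𝓡 n) ∞ S]

/-- The normal vectors of a hypersurface are the multiples of its unit normal. -/
lemma exists_smul_of_isNormal {φ : S → M} {x : S}
    (hinj : Function.Injective (tangentOf n (n + 1) φ x)) {N w : Euc (n + 1)}
    (hN : IsUnitNormal n φ x N) (hw : IsNormal (n := n) (m := n + 1) φ x w) :
    ∃ c : ℝ, w = c • N ∧ metricTensor (m := n + 1) (φ x) w w = c ^ 2 := by
  -- The inner product of the tangent space, written through the chart so as to be a continuous
  -- bilinear form on the model space.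
  let g : Euc (n + 1) →L[ℝ] Euc (n + 1) →L[ℝ] ℝ :=
    (ContinuousLinearMap.compL ℝ (Euc (n + 1)) (Euc (n + 1)) ℝ).flip
      (chartCoframe (φ x) (φ x)) ∘L
      (chartMetric (φ x) (chartAt (Euc (n + 1)) (φ x) (φ x))) ∘L (chartCoframe (φ x) (φ x))
  have hg : ∀ v w, g v w = metricTensor (m := n + 1) (φ x) v w := fun v w =>
    chartMetric_coframe (φ x) (mem_chart_source _ _) v w
  have h1 := unit_normal_unique (g := g) (fun v w => by rw [hg, hg]; exact real_inner_comm _ _)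
    (fun v hv => by rw [hg]; exact metricTensor_self_pos hv) hinj (N := N) (w := w)
    (fun v => by rw [hg]; exact hN.1 v) (by rw [hg]; exact hN.2) (fun v => by rw [hg]; exact hw v)
  refine ⟨g w N, h1, ?_⟩
  have h2 : g N N = 1 := by rw [hg]; exact hN.2
  rw [← hg]
  generalize g w N = c at h1
  rw [h1, map_smul, map_smul, smul_apply, h2]
  simp [sq]

lemma bakryEmeryRicci_smul (f : M → ℝ) (x : M) (c : ℝ) (v : Euc (n + 1)) :
    bakryEmeryRicci (m := n + 1) f x (c • v : Euc (n + 1)) (c • v : Euc (n + 1)) =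
      c ^ 2 * bakryEmeryRicci (m := n + 1) f x v v := by
  have h : ∀ i, tangentCoord x (c • v : Euc (n + 1)) i = c * tangentCoord x v i := fun i => by
    rw [tangentCoord_eq, tangentCoord_eq, map_smul]
    rfl
  unfold bakryEmeryRicci ricci hessian
  simp only [h, mul_add, Finset.mul_sum]
  congr 1 <;> exact Finset.sum_congr rfl fun i _ => Finset.sum_congr rfl fun j _ => by ring

end NormalVectors

/-- Stable hypersurfaces of quadratic weighted volume growth are totally geodesic. -/
theorem isTotallyGeodesic_of_isStableFMinimal {n : ℕ}
    {M : Type*} [EMetricSpace M] [ChartedSpace (EuclideanSpace ℝ (Fin (n + 1))) M]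
    [IsManifold (𝓡 (n + 1)) ∞ M]
    [RiemannianBundle (fun x : M => TangentSpace (𝓡 (n + 1)) x)]
    [IsContMDiffRiemannianBundle (𝓡 (n + 1)) ∞ (EuclideanSpace ℝ (Fin (n + 1)))
      (fun x : M => TangentSpace (𝓡 (n + 1)) x)]
    [IsRiemannianManifold (𝓡 (n + 1)) M] [CompleteSpace M]
    {S : Type*} [EMetricSpace S] [ChartedSpace (EuclideanSpace ℝ (Fin n)) S]
    [IsManifold (𝓡 n) ∞ S]
    [RiemannianBundle (fun x : S => TangentSpace (𝓡 n) x)]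
    [IsContMDiffRiemannianBundle (𝓡 n) ∞ (EuclideanSpace ℝ (Fin n))
      (fun x : S => TangentSpace (𝓡 n) x)]
    [IsRiemannianManifold (𝓡 n) S] [CompleteSpace S]
    [SecondCountableTopology S] [ConnectedSpace S] [NoncompactSpace S]
    [MeasurableSpace S] [BorelSpace S]
    (hM : IsOrientable (n + 1) M) (hS : IsOrientable n S)
    (f : M → ℝ) (hf : ContMDiff (𝓡 (n + 1)) 𝓘(ℝ, ℝ) ∞ f)
    (φ : S → M) (hφ : IsIsometricImmersion (n := n) (m := n + 1) φ)
    (hstable : IsStableFMinimal (n := n) (m := n + 1) f φ)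
    (hRic : ∀ (x : S) (v : TangentSpace (𝓡 (n + 1)) (φ x)), 0 ≤ bakryEmeryRicci f (φ x) v v)
    (p : S) (C r₀ : ℝ)
    (hvol : ∀ r : ℝ, r₀ ≤ r →
      weightedVolume (n := n) f φ {x : S | edist x p < ENNReal.ofReal r}
        ≤ ENNReal.ofReal (C * r ^ 2)) :
    IsTotallyGeodesic (n := n) (m := n + 1) φ ∧
    ∀ (x : S) (ν : TangentSpace (𝓡 (n + 1)) (φ x)),
      IsNormal (n := n) φ x ν → ‖ν‖ = 1 → bakryEmeryRicci f (φ x) ν ν = 0 := by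
  obtain ⟨N, hN, hNs⟩ := exists_unit_normal_field hS hM hφ.smooth (injective_tangentOf hφ)
  -- Nonnegativity of the potential feeds the cut-off argument, and its vanishing then splits into
  -- the two conclusions. The rest only passes from the chosen normal `N` to arbitrary normal
  -- vectors.
  have hzero : ∀ x, shapeMatrix n φ N x = 0 ∧
      bakryEmeryRicci (m := n + 1) f (φ x) (N x) (N x) = 0 := fun x =>
    (eq_zero_of_stabilityPotential_eq_zero hφ (hRic x (N x))).2
      (stabilityPotential_eq_zero hf hφ hstable hN hNs
        (fun z => (eq_zero_of_stabilityPotential_eq_zero hφ (hRic z (N z))).1) hvol x)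
  constructor
  · intro x ν hν v w
    obtain ⟨c, hc, -⟩ := exists_smul_of_isNormal (injective_tangentOf hφ x) (hN x) hν
    refine (secondFundamentalForm_eq hφ.smooth x ν v w).trans ?_
    refine Finset.sum_eq_zero fun i _ => Finset.sum_eq_zero fun j _ => ?_
    have h1 : -chartMetric (φ x) (chartAt (Euc (n + 1)) (φ x) (φ x))
        (chartCoframe (φ x) (φ x) (N x)) (covHessian φ x i j) = 0 :=
      congrFun (congrFun (hzero x).1 i) j
    have h2 : chartCoframe (φ x) (φ x) ν = c • chartCoframe (φ x) (φ x) (N x) := by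
      refine Eq.trans ?_ (map_smul (chartCoframe (φ x) (φ x)) c (N x))
      exact congrArg (chartCoframe (φ x) (φ x)) hc
    rw [h2, map_smul, chartMetric_symm, neg_eq_zero.1 h1, smul_zero, mul_zero]
  · intro x ν hν _
    obtain ⟨c, hc, -⟩ := exists_smul_of_isNormal (injective_tangentOf hφ x) (hN x) hν
    have h3 := bakryEmeryRicci_smul f (φ x) c (N x)
    rw [(hzero x).2, mul_zero, ← hc] at h3
    exact h3

end WeightedHypersurface

end

theorem proposition2 {n : ℕ}
    {M : Type*} [EMetricSpace M] [ChartedSpace (EuclideanSpace ℝ (Fin (n + 1))) M]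
    [IsManifold (𝓡 (n + 1)) ∞ M]
    [RiemannianBundle (fun x : M => TangentSpace (𝓡 (n + 1)) x)]
    [IsContMDiffRiemannianBundle (𝓡 (n + 1)) ∞ (EuclideanSpace ℝ (Fin (n + 1)))
      (fun x : M => TangentSpace (𝓡 (n + 1)) x)]
    [IsRiemannianManifold (𝓡 (n + 1)) M] [CompleteSpace M]
    {S : Type*} [EMetricSpace S] [ChartedSpace (EuclideanSpace ℝ (Fin n)) S]
    [IsManifold (𝓡 n) ∞ S]
    [RiemannianBundle (fun x : S => TangentSpace (𝓡 n) x)]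
    [IsContMDiffRiemannianBundle (𝓡 n) ∞ (EuclideanSpace ℝ (Fin n))
      (fun x : S => TangentSpace (𝓡 n) x)]
    [IsRiemannianManifold (𝓡 n) S] [CompleteSpace S]
    [SecondCountableTopology S] [ConnectedSpace S] [NoncompactSpace S]
    [MeasurableSpace S] [BorelSpace S]
    (hM : IsOrientable (n + 1) M) (hS : IsOrientable n S)
    (f : M → ℝ) (hf : ContMDiff (𝓡 (n + 1)) 𝓘(ℝ, ℝ) ∞ f)
    (φ : S → M) (hφ : IsIsometricImmersion (n := n) (m := n + 1) φ)
    (hstable : IsStableFMinimal (n := n) (m := n + 1) f φ)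
    (hRic : ∀ (x : S) (v : TangentSpace (𝓡 (n + 1)) (φ x)), 0 ≤ bakryEmeryRicci f (φ x) v v)
    (p : S) (C r₀ : ℝ)
    (hvol : ∀ r : ℝ, r₀ ≤ r →
      weightedVolume (n := n) f φ {x : S | edist x p < ENNReal.ofReal r}
        ≤ ENNReal.ofReal (C * r ^ 2)) :
    IsTotallyGeodesic (n := n) (m := n + 1) φ ∧
    ∀ (x : S) (ν : TangentSpace (𝓡 (n + 1)) (φ x)),
      IsNormal (n := n) φ x ν → ‖ν‖ = 1 → bakryEmeryRicci f (φ x) ν ν = 0 :=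
  isTotallyGeodesic_of_isStableFMinimal hM hS f hf φ hφ hstable hRic p C r₀ hvol
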